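/- **Conventions.** A tree with lifetimes is a plane rooted tree in which every individual has finitely many (ordered) children and carries a lifetime in $(0,\infty)$; trees may be infinite. A bush is a finite sequence of trees. Offspring distributions $q$ on $\{0,1,2,\dots\}$ are assumed to satisfy $q(0)>0$ and $q(1)=0$; lifetime distributions $\kappa$ are probability measures on $(0,\infty)$. A $\mathrm{GW}(q,\kappa)$-tree has independent numbers of children with law $q$ and independent lifetimes with law $\kappa$; a $\mathrm{GW}(q,\kappa,\beta)$-bush is a sequence of $N\sim\mathrm{Poi}(\beta)$ independent $\mathrm{GW}(q,\kappa)$-trees, $\beta\in[0,\infty)$. For $p\in[0,1]$, colour the leaves of a tree $T$ independently red with probability $p$ and black with probability $1-p$; call an individual black if the subtree above it contains a black leaf or is infinite, and red otherwise (for $p<1$ and $q(0)>0$ an infinite Galton–Watson subtree has black leaves almost surely; for $p=1$ the black individuals are those with an infinite line of descent). If the root is black, the $p$-reduced tree $T^{p\text{-rdc}}$ is obtained by deleting all red individuals and then merging every individual that has exactly one remaining child with this child, adding up lifetimes. The $p$-reduced bush $B^{p\text{-rdc}}$ is the sequence of the $p$-reduced trees of those trees in $B$ that have a black root. $(q',\kappa')$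 is the $p$-reduced pair associated with $(q,\kappa)$ if, for a $\mathrm{GW}(q,\kappa)$-tree $T$, the conditional law of $T^{p\text{-rdc}}$ given that the root is black is that of a $\mathrm{GW}(q',\kappa')$-tree (no condition if the root is red almost surely, which can only happen for $p=1$). $(q',\kappa',\beta')$ is the $p$-reduced triplet associated with $(q,\kappa,\beta)$ if $B^{p\text{-rdc}}$ is a $\mathrm{GW}(q',\kappa',\beta')$-bush for a $\mathrm{GW}(q,\kappa,\beta)$-bush $B$. In families indexed by $\lambda\in[0,\infty)$, $q_0$ may be any probability distribution on $\{0,1,2,\dots\}$. **Theorem.** For a pair $(q,\kappa)$ of offspring and lifetime distributions, the following are equivalent. (i) There are families $(q_\lambda,\kappa_\lambda)_{\lambda\ge0}$ with $q_1=q$, $\kappa_1=\kappa$ such that $(q_\mu,\kappa_\mu)$ is the $(1-\mu/\lambda)$-reduced pair associated with $(q_\lambda,\kappa_\lambda)$ for all $0\le\mu<\lambda<\infty$. (ii) There are $\tilde b\in\mathbb R$, $\tilde a\ge0$ and a measure $\tilde\Pi$ on $(0,\infty)$ with $\int(1\wedge x^2)\,\tilde\Pi(dx)<\infty$ such that, with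 $$\tilde\psi(r)=\tilde b r+\tilde a r^2+\int_{(0,\infty)}\bigl(e^{-rx}-1+rx\mathbf 1_{\{x<1\}}\bigr)\tilde\Pi(dx),\qquad r\ge0,$$ we have $\varphi_q(s)=\sum_{i\ge0}s^iq(i)=s+\tilde\psi(1-s)$ for $0\le s\le1$; moreover, with $\tilde\psi'(\infty)=\lim_{r\to\infty}\tilde\psi'(r)\in(0,\infty]$, the law $\kappa$ is geometrically divisible with parameter $\alpha$ for all $\alpha\in(0,1]$ with $\alpha>1/\tilde\psi'(\infty)$ if $\tilde\psi'(\infty)<\infty$, and for all $\alpha\in(0,1]$ if $\tilde\psi'(\infty)=\infty$. Here $\kappa$ is geometrically divisible with parameter $\alpha$ if there are independent identically distributed $X^{(1)},X^{(2)},\dots$ and an independent $G$ with $\mathbb P(G=k)=\alpha(1-\alpha)^{k-1}$, $k\ge1$, such that $X^{(1)}+\dots+X^{(G)}\sim\kappa$. In this case, for all families $(q_\lambda,\kappa_\lambda)_{\lambda\ge0}$ as in (i) and every $\beta\in(0,\infty)$ there are $(\beta_\lambda)_{\lambda\ge0}$ in $[0,\infty)$ with $\beta_1=\beta$ and, on one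 probability space, $\mathrm{GW}(q_\lambda,\kappa_\lambda,\beta_\lambda)$-bushes $B_\lambda$, $\lambda\ge0$, with $(B_\mu,B_\lambda)\overset{(d)}{=}(B_\lambda^{(1-\mu/\lambda)\text{-rdc}},B_\lambda)$ for all $0\le\mu<\lambda<\infty$. The parameter families are unique, with the following dependence. Let $(q_\lambda,\kappa_\lambda,\beta_\lambda)_{\lambda\ge0}$ and $(q'_\lambda,\kappa'_\lambda,\beta'_\lambda)_{\lambda\ge0}$ be two families in each of which the triplet at $\mu$ is the $(1-\mu/\lambda)$-reduced triplet associated with the triplet at $\lambda$ for all $0\le\mu<\lambda<\infty$, with $q_1=q'_1=q$, $\kappa_1=\kappa$ and $\beta_1,\beta'_1\in(0,\infty)$. Then $q_\lambda=q'_\lambda$ for all $\lambda>0$ (so $(q_\lambda)$ does not depend on $(\kappa,\beta)$); if $\kappa'_1=\kappa$, then $\kappa_\lambda=\kappa'_\lambda$ for all $\lambda>0$ (so $(\kappa_\lambda)$ does not depend on $\beta$); if $\beta_1=\beta'_1$, then $\beta_\lambda=\beta'_\lambda$ for all $\lambda\ge0$ (so $(\beta_\lambda)$ does not depend on $\kappa$).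 The first two statements also hold for $\lambda=0$ if $\beta_0>0$; if $\beta_0=0$, the bush at $\lambda=0$ is empty and $(q_0,\kappa_0)$ is not determined. -/

import Mathlib

open MeasureTheory ProbabilityTheory Filter Topology
open scoped NNReal ENNReal

/-! ### Trees with lifetimes

Individuals are words of natural numbers; the children of `u` are `u0, u1, …` (numbered from `0`).
A word `u` belongs to the tree `t` iff `t.mark u = some z`, and then `z` is the lifetime of `u`. -/

structure MarkedTree where
  mark : List ℕ → Option ℝ
  root_mem : (mark []).isSome
  parent_mem : ∀ (u : List ℕ) (j : ℕ), (mark (u ++ [j])).isSome → (mark u).isSome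
  children : ∀ u : List ℕ, (mark u).isSome →
    ∃ n : ℕ, ∀ j : ℕ, (mark (u ++ [j])).isSome ↔ j < n

/-- The σ-algebra generated by the events that `u` is an individual with lifetime in `A`. -/
instance : MeasurableSpace MarkedTree :=
  MeasurableSpace.generateFrom
    {s | ∃ (u : List ℕ) (A : Set ℝ), MeasurableSet A ∧
      s = {t : MarkedTree | ∃ z ∈ A, t.mark u = some z}}

/-- `u` is an individual of the tree in which the individual `v` has `ν v` children. -/
def IsIndividual (ν : List ℕ → ℕ) (u : List ℕ) : Prop :=
  ∀ (k : ℕ) (h : k < u.length), u[k] < ν (u.take k)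

theorem isIndividual_append (ν : List ℕ → ℕ) (u : List ℕ) (j : ℕ) :
    IsIndividual ν (u ++ [j]) ↔ IsIndividual ν u ∧ j < ν u := by
  constructor
  · intro h
    refine ⟨fun k hk => ?_, ?_⟩
    · have := h k (by simp; omega)
      rwa [List.getElem_append_left hk, List.take_append_of_le_length hk.le] at this
    · have := h u.length (by simp)
      simpa using this
  · rintro ⟨h, hj⟩ k hk
    rcases lt_or_ge k u.length with hk' | hk'
    · rw [List.getElem_append_left hk', List.take_append_of_le_length hk'.le]
      exact h k hk'
    · have : k = u.length := by simp at hk; omega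
      subst this
      simpa using hj

namespace MarkedTree

open Classical in
/-- The tree in which the individual `u` has `ν u` children and lifetime `ζ u`. The values at words
which are not individuals of the tree are irrelevant. -/
noncomputable def ofData (ν : List ℕ → ℕ) (ζ : List ℕ → ℝ) : MarkedTree where
  mark u := if IsIndividual ν u then some (ζ u) else none
  root_mem := by simp [IsIndividual]
  parent_mem u j := by
    simp only [Option.isSome_ite, isIndividual_append]
    exact fun h => h.1
  children u := by
    simp only [Option.isSome_ite, isIndividual_append]
    exact fun h => ⟨ν u, fun j => by simp [h]⟩

theorem measurable_ofData {α : Type*} [MeasurableSpace α] (ν : α → List ℕ → ℕ)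
    (ζ : α → List ℕ → ℝ) (hν : ∀ u, Measurable fun a => ν a u)
    (hζ : ∀ u, Measurable fun a => ζ a u) :
    Measurable fun a => ofData (ν a) (ζ a) := by
  refine measurable_generateFrom ?_
  rintro _ ⟨u, A, hA, rfl⟩
  have h1 : MeasurableSet {a | IsIndividual (ν a) u} := by
    simp only [IsIndividual, Set.ofPred_forall]
    exact MeasurableSet.iInter fun k => MeasurableSet.iInter fun h =>
      measurableSet_lt measurable_const (hν _)
  convert h1.inter (hζ u hA) using 1
  ext a
  by_cases h : IsIndividual (ν a) u <;> simp [ofData, h]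

instance : Membership (List ℕ) MarkedTree := ⟨fun t u => (t.mark u).isSome⟩

/-- The lifetime of the individual `u` (and `0` if `u` is not in `t`). -/
def lifetime (t : MarkedTree) (u : List ℕ) : ℝ := (t.mark u).getD 0

def IsLeaf (t : MarkedTree) (u : List ℕ) : Prop := u ∈ t ∧ ∀ j : ℕ, u ++ [j] ∉ t

/-! ### Reduction of a tree with coloured leaves

A colouring is a map `γ` on words, of which only the values at leaves are used; `true` is black and
`false` is red. -/

/-- `u` is black: the subtree above `u` contains a black leaf or is infinite. (If leaves are black
with positive probability, an infinite Galton-Watson subtree has black leaves almost surely. If all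
leaves are red, the black individuals are those with an infinite line of descent.) -/
def IsBlack (t : MarkedTree) (γ : List ℕ → Bool) (u : List ℕ) : Prop :=
  u ∈ t ∧ ({v : List ℕ | u ++ v ∈ t}.Infinite ∨
    ∃ v : List ℕ, t.IsLeaf (u ++ v) ∧ γ (u ++ v) = true)

/-- The number of black children of `u`. -/
noncomputable def numBlack (t : MarkedTree) (γ : List ℕ → Bool) (u : List ℕ) : ℕ :=
  {j : ℕ | t.IsBlack γ (u ++ [j])}.ncard

open Classical in
/-- The `i`-th black child of `u` (counted from `0`, for `i < numBlack t γ u`). -/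
noncomputable def blackChild (t : MarkedTree) (γ : List ℕ → Bool) (u : List ℕ) (i : ℕ) : List ℕ :=
  u ++ [Nat.nth (fun j => t.IsBlack γ (u ++ [j])) i]

/-- Starting at `u` and moving on to the only black child as long as there is exactly one black
child, the number of moves that are made. -/
noncomputable def chainLength (t : MarkedTree) (γ : List ℕ → Bool) (u : List ℕ) : ℕ :=
  sInf {n : ℕ | t.numBlack γ ((fun v => t.blackChild γ v 0)^[n] u) ≠ 1}

/-- The first individual on this chain that does not have exactly one black child. -/
noncomputable def chainEnd (t : MarkedTree) (γ : List ℕ → Bool) (u : List ℕ) : List ℕ :=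
  (fun v => t.blackChild γ v 0)^[t.chainLength γ u] u

/-- The sum of the lifetimes of the individuals on the chain from `u` to `chainEnd t γ u`. -/
noncomputable def chainLifetime (t : MarkedTree) (γ : List ℕ → Bool) (u : List ℕ) : ℝ :=
  ∑ n ∈ Finset.range (t.chainLength γ u + 1), t.lifetime ((fun v => t.blackChild γ v 0)^[n] u)

/-- The individual of `t` at which the chain starts that becomes the individual `w` of the reduced
tree: the root for the empty word, and for `w` followed by `i` the `i`-th black child of the end of
the chain of `w`. -/
noncomputable def chainStart (t : MarkedTree) (γ : List ℕ → Bool) (w : List ℕ) : List ℕ :=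
  w.foldl (fun v i => t.blackChild γ (t.chainEnd γ v) i) []

/-- The reduced tree (meaningful if the root is black): red individuals are removed and each chain
of single-child individuals in the remaining tree is merged with the individual at its end, adding
up the lifetimes; the order of the children is kept. -/
noncomputable def reduce (t : MarkedTree) (γ : List ℕ → Bool) : MarkedTree :=
  ofData (fun w => t.numBlack γ (t.chainEnd γ (t.chainStart γ w)))
    (fun w => t.chainLifetime γ (t.chainStart γ w))

end MarkedTree

/-! ### Bushes -/

/-- A bush is a finite sequence of trees. -/
abbrev Bush := List MarkedTree

/-- The σ-algebra on bushes, from the identification of `Bush` with the disjoint union over `n` of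
the product spaces `MarkedTree ^ n`. -/
instance : MeasurableSpace Bush :=
  MeasurableSpace.comap
    (fun b : Bush => (⟨b.length, b.get⟩ : Σ n : ℕ, (Fin n → MarkedTree))) inferInstance

open Classical in
/-- The reduced bush: the sequence of the reduced trees of those trees that have a black root. The
`i`-th tree is coloured by `γ i`. -/
noncomputable def reduceBush (b : Bush) (γ : ℕ → List ℕ → Bool) : Bush :=
  b.zipIdx.filterMap fun x =>
    if x.1.IsBlack (γ x.2) [] then some (x.1.reduce (γ x.2)) else none

/-! ### Laws -/

/-- An offspring distribution `q` with `q(0) > 0` and `q(1) = 0`. -/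
def IsOffspringLaw (q : PMF ℕ) : Prop := 0 < q 0 ∧ q 1 = 0

/-- A probability distribution on `(0, ∞)`. -/
def IsLifetimeLaw (κ : ProbabilityMeasure ℝ) : Prop := (κ : Measure ℝ) (Set.Iic 0) = 0

/-- The law of the `GW(q, κ)`-tree: independent numbers of children with law `q` and independent
lifetimes with law `κ`. -/
noncomputable def gwTree (q : PMF ℕ) (κ : ProbabilityMeasure ℝ) : Measure MarkedTree :=
  (Measure.infinitePi fun _ : List ℕ => q.toMeasure.prod (κ : Measure ℝ)).map
    fun ω => MarkedTree.ofData (fun u => (ω u).1) (fun u => (ω u).2)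

instance (q : PMF ℕ) (κ : ProbabilityMeasure ℝ) : IsProbabilityMeasure (gwTree q κ) :=
  Measure.isProbabilityMeasure_map (MarkedTree.measurable_ofData _ _
    (fun u => (measurable_pi_apply u).fst) (fun u => (measurable_pi_apply u).snd)).aemeasurable

/-- The law of the `GW(q, κ, β)`-bush: a Poisson number with parameter `β` of independent
`GW(q, κ)`-trees. -/
noncomputable def gwBush (q : PMF ℕ) (κ : ProbabilityMeasure ℝ) (β : ℝ≥0) : Measure Bush :=
  ((poissonMeasure β).prod (Measure.infinitePi fun _ : ℕ => gwTree q κ)).map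
    fun x => List.ofFn fun i : Fin x.1 => x.2 i

/-- Independent colours: red (`false`) with probability `p`, black (`true`) with probability
`1 - p`. -/
noncomputable def colourLaw (p : unitInterval) : Measure (List ℕ → Bool) :=
  Measure.infinitePi fun _ : List ℕ => bernoulliMeasure false true p

/-- `(q', κ')` is the `p`-reduced pair associated with `(q, κ)`: given that the root is black, the
`p`-reduced tree of a `GW(q, κ)`-tree is a `GW(q', κ')`-tree. (No condition if the root is red almost
surely, which for `q(0) > 0` can only happen for `p = 1`.) -/
def IsReducedPair (p : unitInterval) (q : PMF ℕ) (κ : ProbabilityMeasure ℝ)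
    (q' : PMF ℕ) (κ' : ProbabilityMeasure ℝ) : Prop :=
  let ν := (gwTree q κ).prod (colourLaw p)
  let E := {x : MarkedTree × (List ℕ → Bool) | x.1.IsBlack x.2 []}
  ν E ≠ 0 → (ProbabilityTheory.cond ν E).map (fun x => x.1.reduce x.2) = gwTree q' κ'

/-- The joint law of `(B^{p-rdc}, B)` for a `GW(q, κ, β)`-bush `B` with independent colours. -/
noncomputable def reductionLaw (p : unitInterval) (q : PMF ℕ) (κ : ProbabilityMeasure ℝ)
    (β : ℝ≥0) : Measure (Bush × Bush) :=
  ((gwBush q κ β).prod (Measure.infinitePi fun _ : ℕ => colourLaw p)).map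
    fun x => (reduceBush x.1 x.2, x.1)

/-- `(q', κ', β')` is the `p`-reduced triplet associated with `(q, κ, β)`. -/
def IsReducedTriplet (p : unitInterval) (q : PMF ℕ) (κ : ProbabilityMeasure ℝ) (β : ℝ≥0)
    (q' : PMF ℕ) (κ' : ProbabilityMeasure ℝ) (β' : ℝ≥0) : Prop :=
  (reductionLaw p q κ β).map Prod.fst = gwBush q' κ' β'

/-! ### Consistent families, indexed by `[0, ∞)` -/

/-- The probability `1 - μ / l` of the colour red. -/
noncomputable def redProb (μ l : ℝ≥0) (h : μ < l) : unitInterval :=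
  ⟨1 - (μ : ℝ) / l, by
    have hl : (0 : ℝ) < l := by exact_mod_cast pos_of_gt h
    have h' : (μ : ℝ) ≤ l := by exact_mod_cast h.le
    have h1 : (μ : ℝ) / l ≤ 1 := (div_le_one hl).2 h'
    have h2 : 0 ≤ (μ : ℝ) / l := by positivity
    constructor <;> linarith⟩

/-- For `l > 0` the offspring law satisfies `q(0) > 0` and `q(1) = 0`; all lifetimes are positive. -/
def IsParameterFamily (Q : ℝ≥0 → PMF ℕ) (K : ℝ≥0 → ProbabilityMeasure ℝ) : Prop :=
  (∀ l, 0 < l → IsOffspringLaw (Q l)) ∧ ∀ l, IsLifetimeLaw (K l)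

def ConsistentPairs (Q : ℝ≥0 → PMF ℕ) (K : ℝ≥0 → ProbabilityMeasure ℝ) : Prop :=
  IsParameterFamily Q K ∧
    ∀ (μ l : ℝ≥0) (h : μ < l), IsReducedPair (redProb μ l h) (Q l) (K l) (Q μ) (K μ)

def ConsistentTriplets (Q : ℝ≥0 → PMF ℕ) (K : ℝ≥0 → ProbabilityMeasure ℝ) (b : ℝ≥0 → ℝ≥0) :
    Prop :=
  IsParameterFamily Q K ∧
    ∀ (μ l : ℝ≥0) (h : μ < l),
      IsReducedTriplet (redProb μ l h) (Q l) (K l) (b l) (Q μ) (K μ) (b μ)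

/-- There are `GW(Q l, K l, b l)`-bushes `B l`, `l ≥ 0`, on one probability space such that
`(B μ, B l)` has the law of `((B l)^{(1 - μ / l)-rdc}, B l)` for all `μ < l`. -/
def ExistConsistentBushes (Q : ℝ≥0 → PMF ℕ) (K : ℝ≥0 → ProbabilityMeasure ℝ)
    (b : ℝ≥0 → ℝ≥0) : Prop :=
  ∃ (Ω : Type) (_ : MeasurableSpace Ω) (P : Measure Ω) (B : ℝ≥0 → Ω → Bush),
    IsProbabilityMeasure P ∧ (∀ l, Measurable (B l)) ∧
    (∀ l, P.map (B l) = gwBush (Q l) (K l) (b l)) ∧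
    ∀ (μ l : ℝ≥0) (h : μ < l),
      P.map (fun ω => (B μ ω, B l ω)) = reductionLaw (redProb μ l h) (Q l) (K l) (b l)

/-! ### Branching mechanisms and geometric divisibility -/

noncomputable def genFun (q : PMF ℕ) (s : ℝ) : ℝ := ∑' i : ℕ, s ^ i * (q i).toReal

/-- A measure on `(0, ∞)` with `∫ (1 ∧ x²) Π(dx) < ∞`. -/
def IsLevyMeasure (Pi : Measure ℝ) : Prop :=
  Pi (Set.Iic 0) = 0 ∧ ∫⁻ x, ENNReal.ofReal (min 1 (x ^ 2)) ∂Pi < ∞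

/-- `ψ(r) = b r + a r² + ∫ (e^{-rx} - 1 + r x 1_{x < 1}) Π(dx)`. -/
noncomputable def branchingMechanism (b a : ℝ) (Pi : Measure ℝ) (r : ℝ) : ℝ :=
  b * r + a * r ^ 2 +
    ∫ x, (Real.exp (-(r * x)) - 1 + (if x < 1 then r * x else 0)) ∂Pi

/-- `κ` is the law of `X₁ + ⋯ + X_G` with `X₁, X₂, …` independent and identically distributed and
`G` independent of them with `P(G = k) = α (1 - α)^(k-1)`, `k ≥ 1`. (`X j` below is `X_{j+1}`.) -/
def IsGeometricallyDivisible (κ : ProbabilityMeasure ℝ) (α : ℝ) : Prop :=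
  ∃ (Ω : Type) (_ : MeasurableSpace Ω) (P : Measure Ω) (X : ℕ → Ω → ℝ) (G : Ω → ℕ),
    IsProbabilityMeasure P ∧ (∀ j, Measurable (X j)) ∧ Measurable G ∧
    iIndepFun X P ∧ (∀ j, IdentDistrib (X j) (X 0) P P) ∧
    IndepFun (fun ω j => X j ω) G P ∧
    (∀ k : ℕ, 1 ≤ k → P (G ⁻¹' {k}) = ENNReal.ofReal (α * (1 - α) ^ (k - 1))) ∧
    P.map (fun ω => ∑ j ∈ Finset.range (G ω), X j ω) = (κ : Measure ℝ)

/-! ### Decorated trees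

A decorated tree assigns to each word a number of children, a lifetime and a mark. A leaf is black at
level `s` if its mark is less than `s`. The values at words which are not individuals are
irrelevant. -/

/-! Every individual gets an independent uniform mark in `[0, 1)`, and a leaf is black at level `s`
if its mark is below `s`; colouring red with probability `p` is the level `s = 1 - p`. The mark of a
black leaf, divided by `s`, is uniform again. So reduction becomes a deterministic map `red s` on
decorated trees, and `red s'` after `red s` is `red (s * s')` as soon as the chains involved are
finite (`red_red`), which holds almost surely (`ae_good`).

One reduction is understood through the branching property. Thinning the children of the root shows
that the reduced tree again has independent subtrees with its own law, and this property
characterises Galton-Watson trees (`eq_prunedLaw_of_eq_graftLaw`). The lifetime of a merged chain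
satisfies a renewal equation (`lifeMeasure_eq`), so it is a geometric sum, independent of what lies
above the chain. With `mech q y = φ(1 - y) - (1 - y)`, the probability `w` of a black root solves
`mech q w = s q(0)`. If `w ≠ 0` and `α` is the slope of `mech q` at `w`, then reduction turns `mech
q` into `y ↦ mech q (w y) / (w α)` and the lifetime law into that of a geometric sum with parameter
`α` (`isReducedPair_iff`).

From (ii) to (i): for `θ ≥ 1` the function `y ↦ ψ(θ y) / (θ ψ'(θ))` is `mech Q` for an offspring law
`Q`, because the relevant Taylor coefficients of `ψ` at `θ` are nonnegative. If `ψ(θ) = q(0) / s`,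
then its `s`-reduction is `q`, with `w = 1 / θ` and `α = 1 / ψ'(θ)`; divisibility of `κ` supplies
the lifetime law (`exists_preimage_pair`). Preimages are unique by analyticity
(`eq_of_rescaled_mech_eq`), hence they fit together into a consistent family
(`exists_consistentPairs`).

From (i) to (ii): the functions `mech (Q l)`, rescaled to agree with `mech (Q 1)` on `[0, 1]`,
extend one another to a function `Ψ` on `[0, ∞)`, since `1 / w` tends to infinity with `l`
(`le_inv_rootProb`). For arbitrarily large `θ`, `Ψ''` is a power series in `1 - x / θ` with
nonnegative coefficients. A compactness argument shows that such a function is a Laplace transform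
(`exists_laplace`), and integrating twice gives the Lévy-Khintchine form. Divisibility by `α` is
read off at the level `l` where the slope is `α`.

For bushes, Poisson thinning multiplies `β` by `w`. Bushes at integer levels come from an inverse
limit, and all others are reductions of these. Uniqueness of parameters is uniqueness of reductions
below level `1` and of preimages above it. -/

abbrev TreeData := List ℕ → ℕ × ℝ × ℝ

namespace TreeData

def sub (x : TreeData) (j : ℕ) : TreeData := fun u => x (j :: u)

def shift (x : TreeData) (u : List ℕ) : TreeData := fun v => x (u ++ v)

@[simp] theorem shift_nil (x : TreeData) : x.shift [] = x := rfl

theorem shift_cons (x : TreeData) (j : ℕ) (u : List ℕ) : x.shift (j :: u) = (x.sub j).shift u := rfl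

theorem shift_append (x : TreeData) (u v : List ℕ) : x.shift (u ++ v) = (x.shift u).shift v := by
  funext w; simp [shift]

theorem shift_singleton (x : TreeData) (j : ℕ) : x.shift [j] = x.sub j := rfl

def childList (x : TreeData) : List TreeData := (List.range (x []).1).map x.sub

theorem mem_childList {x y : TreeData} : y ∈ x.childList ↔ ∃ j < (x []).1, x.sub j = y := by
  simp [childList]

@[simp] theorem length_childList (x : TreeData) : x.childList.length = (x []).1 := by
  simp [childList]

theorem getElem_childList (x : TreeData) (i : ℕ) (h : i < x.childList.length) :
    x.childList[i] = x.sub i :=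
  List.getElem_eq_iff h |>.2 (by
    rw [childList, List.getElem?_map, List.getElem?_range (by simpa using h)]; rfl)

/-- All leaves are red at level `s` and the height is less than `n`. -/
def RedWithin (s : ℝ) : ℕ → TreeData → Prop
  | 0, _ => False
  | n + 1, x => ((x []).1 = 0 → s ≤ (x []).2.2) ∧ ∀ j < (x []).1, RedWithin s n (x.sub j)

/-- The tree is finite and all of its leaves are red at level `s`. -/
def IsRed (s : ℝ) (x : TreeData) : Prop := ∃ n, RedWithin s n x

theorem RedWithin.succ {s : ℝ} {n : ℕ} {x : TreeData} (h : RedWithin s n x) :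
    RedWithin s (n + 1) x := by
  induction n generalizing x with
  | zero => exact h.elim
  | succ n ih => exact ⟨h.1, fun j hj => ih (h.2 j hj)⟩

theorem RedWithin.mono {s : ℝ} {m n : ℕ} (hmn : m ≤ n) {x : TreeData} (h : RedWithin s m x) :
    RedWithin s n x := by
  induction hmn with
  | refl => exact h
  | step _ ih => exact ih.succ

theorem isRed_iff {s : ℝ} {x : TreeData} :
    IsRed s x ↔ ((x []).1 = 0 → s ≤ (x []).2.2) ∧ ∀ y ∈ x.childList, IsRed s y := by
  constructor
  · rintro ⟨n, hn⟩
    cases n with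
    | zero => exact hn.elim
    | succ n =>
      refine ⟨hn.1, fun y hy => ?_⟩
      obtain ⟨j, hj, rfl⟩ := mem_childList.1 hy
      exact ⟨n, hn.2 j hj⟩
  · rintro ⟨h0, h⟩
    have h' : ∀ j : Fin (x []).1, ∃ n, RedWithin s n (x.sub j) := fun j =>
      h _ (mem_childList.2 ⟨j, j.2, rfl⟩)
    choose n hn using h'
    exact ⟨Finset.univ.sup n + 1, h0, fun j hj =>
      (hn ⟨j, hj⟩).mono (Finset.le_sup (Finset.mem_univ _))⟩

/-- Redness is witnessed by a bound on the height, so it supports induction over the subtrees above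
the children, as an inductive predicate would. -/
theorem IsRed.induction {s : ℝ} {P : TreeData → Prop}
    (h : ∀ x, ((x []).1 = 0 → s ≤ (x []).2.2) → (∀ y ∈ x.childList, IsRed s y) →
      (∀ y ∈ x.childList, P y) → P x) {x : TreeData} (hx : IsRed s x) : P x := by
  obtain ⟨n, hn⟩ := hx
  induction n generalizing x with
  | zero => exact hn.elim
  | succ n ih =>
    refine h x hn.1 ?_ ?_
    · intro y hy
      obtain ⟨j, hj, rfl⟩ := mem_childList.1 hy
      exact ⟨n, hn.2 j hj⟩
    · intro y hy
      obtain ⟨j, hj, rfl⟩ := mem_childList.1 hy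
      exact ih (hn.2 j hj)

theorem IsRed.anti {s s' : ℝ} (h : s' ≤ s) {x : TreeData} (hx : IsRed s x) : IsRed s' x := by
  refine IsRed.induction (P := IsRed s') ?_ hx
  intro x h0 _ h2
  exact isRed_iff.2 ⟨fun h' => h.trans (h0 h'), h2⟩

open Classical in
/-- The subtrees above the black children of the root. -/
noncomputable def kids (s : ℝ) (x : TreeData) : List TreeData :=
  x.childList.filter fun y => ¬ IsRed s y

theorem mem_kids {s : ℝ} {x y : TreeData} : y ∈ kids s x ↔ y ∈ x.childList ∧ ¬ IsRed s y := by
  simp [kids]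

/-- An individual that has children, all of them red, is red itself; so a black root without black
children has no children at all. -/
theorem kids_eq_nil_iff_of_not_isRed {s : ℝ} {x : TreeData} (hx : ¬ IsRed s x) :
    kids s x = [] ↔ (x []).1 = 0 := by
  constructor
  · intro h
    by_contra h0
    refine hx (isRed_iff.2 ⟨fun h' => absurd h' h0, fun y hy => ?_⟩)
    by_contra hy'
    have := mem_kids.2 ⟨hy, hy'⟩
    simp [h] at this
  · intro h
    simp [kids, childList, h]

theorem mark_lt_of_not_isRed {s : ℝ} {x : TreeData} (hx : ¬ IsRed s x) (h0 : (x []).1 = 0) :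
    (x []).2.2 < s := by
  by_contra h
  refine hx (isRed_iff.2 ⟨fun _ => not_lt.1 h, fun y hy => ?_⟩)
  obtain ⟨j, hj, -⟩ := mem_childList.1 hy
  omega

/-- The first black child, if there is one. -/
noncomputable def step (s : ℝ) (x : TreeData) : TreeData := (kids s x).headD x

/-- On an infinite chain the set is empty and the value is `0`, as for `chainLength`. Almost surely
this does not happen in trees with a black root (`ae_finChain`). -/
noncomputable def chainLen (s : ℝ) (x : TreeData) : ℕ :=
  sInf {n : ℕ | (kids s ((step s)^[n] x)).length ≠ 1}

noncomputable def chainTop (s : ℝ) (x : TreeData) : TreeData := (step s)^[chainLen s x] x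

noncomputable def chainLife (s : ℝ) (x : TreeData) : ℝ :=
  ∑ n ∈ Finset.range (chainLen s x + 1), ((step s)^[n] x []).2.1

/-- The mark of an individual in the reduced tree. -/
noncomputable def newMark (s : ℝ) (x : TreeData) : ℝ :=
  -- The mark of a black leaf is uniform on `[0, s)`; division by `s` makes it uniform on `[0, 1)`
  -- and makes levels multiply under composition. At an inner individual the mark plays no role and
  -- is kept.
  if (x []).1 = 0 then (x []).2.2 / s else (x []).2.2

/-- The tree whose root has the lifetime `z`, the mark `m`, and the subtrees `l` above it. -/
def mkNode (z m : ℝ) (l : List TreeData) : TreeData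
  | [] => (l.length, z, m)
  | i :: w => (l[i]?).elim default (fun y => y w)

@[simp] theorem mkNode_nil (z m : ℝ) (l : List TreeData) : mkNode z m l [] = (l.length, z, m) := rfl

theorem mkNode_cons (z m : ℝ) (l : List TreeData) (i : ℕ) (w : List ℕ) :
    mkNode z m l (i :: w) = (l[i]?).elim default (fun y => y w) := rfl

@[simp] theorem childList_mkNode (z m : ℝ) (l : List TreeData) : (mkNode z m l).childList = l := by
  refine List.ext_getElem (by simp) fun i h1 h2 => ?_
  rw [getElem_childList]
  funext w
  change (l[i]?).elim default (fun y => y w) = l[i] w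
  rw [List.getElem?_eq_getElem h2]
  rfl

/-- The reduced decorated tree. -/
noncomputable def red (s : ℝ) : TreeData → TreeData := fun x w =>
  match w with
  | [] => ((kids s (chainTop s x)).length, chainLife s x, newMark s (chainTop s x))
  | i :: w => ((kids s (chainTop s x))[i]?).elim default (fun y => red s y w)

theorem red_eq_mkNode (s : ℝ) (x : TreeData) :
    red s x = mkNode (chainLife s x) (newMark s (chainTop s x))
      ((kids s (chainTop s x)).map (red s)) := by
  funext w
  cases w with
  | nil => simp [red]
  | cons i w =>
    simp only [red, mkNode, List.getElem?_map]
    cases (kids s (chainTop s x))[i]? <;> rfl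

/-- The chain of single black children which starts at the root is finite. -/
def FinChain (s : ℝ) (x : TreeData) : Prop := ∃ n, (kids s ((step s)^[n] x)).length ≠ 1

theorem step_of_kids_eq {s : ℝ} {x y : TreeData} (h : kids s x = [y]) : step s x = y := by
  simp [step, h]

theorem finChain_of_length_ne {s : ℝ} {x : TreeData} (h : (kids s x).length ≠ 1) : FinChain s x :=
  ⟨0, h⟩

theorem finChain_iff_of_kids_eq {s : ℝ} {x y : TreeData} (h : kids s x = [y]) :
    FinChain s x ↔ FinChain s y := by
  constructor
  · rintro ⟨n, hn⟩
    cases n with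
    | zero => simp [h] at hn
    | succ n => exact ⟨n, by rwa [Function.iterate_succ_apply, step_of_kids_eq h] at hn⟩
  · rintro ⟨n, hn⟩
    exact ⟨n + 1, by rwa [Function.iterate_succ_apply, step_of_kids_eq h]⟩

theorem FinChain.induction {s : ℝ} {P : TreeData → Prop}
    (h0 : ∀ x, (kids s x).length ≠ 1 → P x)
    (h1 : ∀ x y, kids s x = [y] → FinChain s y → P y → P x) {x : TreeData} (hx : FinChain s x) :
    P x := by
  obtain ⟨n, hn⟩ := hx
  induction n generalizing x with
  | zero => exact h0 x hn
  | succ n ih =>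
    by_cases hk : (kids s x).length = 1
    · obtain ⟨y, hy⟩ := List.length_eq_one_iff.1 hk
      rw [Function.iterate_succ_apply, step_of_kids_eq hy] at hn
      exact h1 x y hy ⟨n, hn⟩ (ih hn)
    · exact h0 x hk

theorem chainLen_of_length_ne {s : ℝ} {x : TreeData} (h : (kids s x).length ≠ 1) :
    chainLen s x = 0 :=
  Nat.sInf_eq_zero.2 (Or.inl h)

theorem chainLen_of_kids_eq {s : ℝ} {x y : TreeData} (h : kids s x = [y]) (hy : FinChain s y) :
    chainLen s x = chainLen s y + 1 := by
  have hx := (finChain_iff_of_kids_eq h).2 hy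
  have key : ∀ n, (kids s ((step s)^[n + 1] x)) = kids s ((step s)^[n] y) := fun n => by
    rw [Function.iterate_succ_apply, step_of_kids_eq h]
  refine le_antisymm (Nat.sInf_le ?_) ?_
  · have := Nat.sInf_mem hy
    change (kids s _).length ≠ 1
    rw [key]
    exact this
  · have h1 : (kids s ((step s)^[chainLen s x] x)).length ≠ 1 := Nat.sInf_mem hx
    cases hc : chainLen s x with
    | zero => rw [hc] at h1; simp [h] at h1
    | succ n =>
      rw [hc, key] at h1
      exact Nat.succ_le_succ (Nat.sInf_le h1)

/-- Adds `z` to the lifetime of the root. -/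
def prolong (z : ℝ) (x : TreeData) : TreeData
  | [] => ((x []).1, z + (x []).2.1, (x []).2.2)
  | i :: w => x (i :: w)

theorem prolong_cons (z : ℝ) (x : TreeData) (i : ℕ) (w : List ℕ) :
    prolong z x (i :: w) = x (i :: w) := rfl

theorem prolong_mkNode (z z' m : ℝ) (l : List TreeData) :
    prolong z (mkNode z' m l) = mkNode (z + z') m l := by
  funext w; cases w <;> rfl

theorem red_of_length_ne {s : ℝ} {x : TreeData} (h : (kids s x).length ≠ 1) :
    red s x = mkNode (x []).2.1 (newMark s x) ((kids s x).map (red s)) := by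
  rw [red_eq_mkNode, chainLife, chainTop, chainLen_of_length_ne h]
  simp

theorem chainTop_of_length_ne {s : ℝ} {x : TreeData} (h : (kids s x).length ≠ 1) :
    chainTop s x = x := by
  simp [chainTop, chainLen_of_length_ne h]

theorem chainLife_of_length_ne {s : ℝ} {x : TreeData} (h : (kids s x).length ≠ 1) :
    chainLife s x = (x []).2.1 := by
  simp [chainLife, chainLen_of_length_ne h]

theorem chainTop_of_kids_eq {s : ℝ} {x y : TreeData} (h : kids s x = [y]) (hy : FinChain s y) :
    chainTop s x = chainTop s y := by
  rw [chainTop, chainTop, chainLen_of_kids_eq h hy, Function.iterate_succ_apply, step_of_kids_eq h]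

theorem chainLife_of_kids_eq {s : ℝ} {x y : TreeData} (h : kids s x = [y]) (hy : FinChain s y) :
    chainLife s x = (x []).2.1 + chainLife s y := by
  rw [chainLife, chainLife, chainLen_of_kids_eq h hy, Finset.sum_range_succ']
  simp only [Function.iterate_succ_apply, step_of_kids_eq h, Function.iterate_zero, id_eq]
  ring

/-- With `red_of_length_ne` this unfolds `red` one individual at a time along a finite chain, in the
form used by the inductions below. -/
theorem red_of_kids_eq {s : ℝ} {x y : TreeData} (h : kids s x = [y]) (hy : FinChain s y) :
    red s x = prolong (x []).2.1 (red s y) := by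
  rw [red_eq_mkNode, red_eq_mkNode s y, prolong_mkNode, chainTop_of_kids_eq h hy,
    chainLife_of_kids_eq h hy]

theorem isRed_prolong {s z : ℝ} {x : TreeData} : IsRed s (prolong z x) ↔ IsRed s x := by
  rw [isRed_iff, isRed_iff (x := x)]
  rfl

theorem kids_prolong (s z : ℝ) (x : TreeData) : kids s (prolong z x) = kids s x := rfl

theorem red_prolong {s z : ℝ} {x : TreeData} (hx : FinChain s x) :
    red s (prolong z x) = prolong z (red s x) := by
  by_cases h : (kids s x).length = 1
  · obtain ⟨y, hy⟩ := List.length_eq_one_iff.1 h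
    have hy' := (finChain_iff_of_kids_eq hy).1 hx
    rw [red_of_kids_eq hy hy', red_of_kids_eq (x := prolong z x) hy hy']
    funext w; cases w
    · simp [prolong, add_assoc]
    · rfl
  · rw [red_of_length_ne h, red_of_length_ne (x := prolong z x) h]
    funext w; cases w <;> rfl

/-! ### Successive reductions -/

/-- The chains at the levels `s` and `s * s'` in `x`, and at the level `s'` in the tree which
is reduced at level `s`, are finite, for all trees above individuals of `x`. -/
def Good (s s' : ℝ) (x : TreeData) : Prop :=
  ∀ u, (¬ IsRed s (x.shift u) → FinChain s (x.shift u)) ∧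
    (¬ IsRed (s * s') (x.shift u) → FinChain (s * s') (x.shift u)) ∧
    (¬ IsRed (s * s') (x.shift u) → FinChain s' (red s (x.shift u)))

theorem Good.self {s s' : ℝ} {x : TreeData} (hx : Good s s' x) :
    (¬ IsRed s x → FinChain s x) ∧ (¬ IsRed (s * s') x → FinChain (s * s') x) ∧
      (¬ IsRed (s * s') x → FinChain s' (red s x)) := by
  have := hx []
  rwa [shift_nil] at this

theorem Good.child {s s' : ℝ} {x y : TreeData} (hx : Good s s' x) (hy : y ∈ x.childList) :
    Good s s' y := by
  obtain ⟨j, -, rfl⟩ := mem_childList.1 hy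
  exact fun u => hx (j :: u)

theorem child_of_kids_eq {s : ℝ} {x y : TreeData} (h : kids s x = [y]) :
    y ∈ x.childList ∧ ¬ IsRed s y := mem_kids.1 (by simp [h])

/-- Induction over the red tree: merging a chain does not change colours, and at a leaf `s * s' ≤ u`
is the same as `s' ≤ u / s`. -/
theorem isRed_red_of_isRed {s s' : ℝ} (hs : 0 < s) {x : TreeData}
    (hx : IsRed (s * s') x) (hg : Good s s' x) (hb : ¬ IsRed s x) : IsRed s' (red s x) := by
  revert hg hb
  refine IsRed.induction (P := fun x => Good s s' x → ¬ IsRed s x → IsRed s' (red s x)) ?_ hx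
  intro x h0 h1 ih hg hb
  by_cases hk : (kids s x).length = 1
  · obtain ⟨y, hy⟩ := List.length_eq_one_iff.1 hk
    obtain ⟨hyc, hyb⟩ := child_of_kids_eq hy
    rw [red_of_kids_eq hy ((hg.child hyc).self.1 hyb), isRed_prolong]
    exact ih y hyc (hg.child hyc) hyb
  · rw [red_of_length_ne hk, isRed_iff]
    simp only [mkNode_nil, List.length_map, childList_mkNode, List.mem_map, List.length_eq_zero_iff]
    refine ⟨fun hnil => ?_, ?_⟩
    · have hν := (kids_eq_nil_iff_of_not_isRed hb).1 hnil
      rw [newMark, if_pos hν, le_div_iff₀ hs, mul_comm]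
      exact h0 hν
    · rintro _ ⟨y, hy, rfl⟩
      obtain ⟨hyc, hyb⟩ := mem_kids.1 hy
      exact ih y hyc (hg.child hyc) hyb

theorem isRed_of_forall_kids {s t : ℝ} (hts : t ≤ s) {x : TreeData} (h0 : (x []).1 = 0 → t ≤ (x []).2.2)
    (h : ∀ y ∈ kids s x, IsRed t y) : IsRed t x := by
  refine isRed_iff.2 ⟨h0, fun y hy => ?_⟩
  by_cases hyb : IsRed s y
  · exact hyb.anti hts
  · exact h y (mem_kids.2 ⟨hy, hyb⟩)

/-- The height of the reduced tree does not drop along a merged chain, so the induction on the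
height contains an inner induction along the chain. -/
theorem isRed_of_isRed_red {s s' : ℝ} (hs : 0 < s) (hs' : s' ≤ 1) {x : TreeData}
    (hg : Good s s' x) (hb : ¬ IsRed s x) (hx : IsRed s' (red s x)) : IsRed (s * s') x := by
  have hle : s * s' ≤ s := by nlinarith
  obtain ⟨n, hn⟩ := hx
  induction n generalizing x with
  | zero => exact hn.elim
  | succ n ih =>
    have hfin : FinChain s x := hg.self.1 hb
    revert hg hb hn
    refine FinChain.induction (P := fun x => Good s s' x → ¬ IsRed s x →
      RedWithin s' (n + 1) (red s x) → IsRed (s * s') x) ?_ ?_ hfin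
    · intro x hk hg hb hn
      rw [red_of_length_ne hk] at hn
      obtain ⟨h0, h1⟩ := hn
      simp only [mkNode_nil, List.length_map, List.length_eq_zero_iff] at h0
      refine isRed_of_forall_kids hle (fun hν => ?_) (fun y hy => ?_)
      · have := h0 ((kids_eq_nil_iff_of_not_isRed hb).2 hν)
        rwa [newMark, if_pos hν, le_div_iff₀ hs, mul_comm] at this
      · obtain ⟨hyc, hyb⟩ := mem_kids.1 hy
        obtain ⟨i, hi, rfl⟩ := List.getElem_of_mem hy
        refine ih (hg.child hyc) hyb ?_
        have h2 := h1 i (by simpa using hi)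
        convert h2 using 1
        funext w
        simp [sub, mkNode, hi]
    · intro x y hy hfy ih2 hg hb hn
      obtain ⟨hyc, hyb⟩ := child_of_kids_eq hy
      rw [red_of_kids_eq hy hfy] at hn
      have h3 : RedWithin s' (n + 1) (red s y) := hn
      refine isRed_of_forall_kids hle (fun hν => ?_) (fun y' hy' => ?_)
      · obtain ⟨j, hj, -⟩ := mem_childList.1 hyc
        omega
      · rw [hy, List.mem_singleton] at hy'
        subst hy'
        exact ih2 (hg.child hyc) hyb h3

theorem isRed_mul_iff {s s' : ℝ} (hs : 0 < s) (hs' : s' ≤ 1) {x : TreeData}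
    (hg : Good s s' x) : IsRed (s * s') x ↔ (¬ IsRed s x → IsRed s' (red s x)) := by
  constructor
  · exact fun h hb => isRed_red_of_isRed hs h hg hb
  · intro h
    by_cases hb : IsRed s x
    · exact hb.anti (by nlinarith)
    · exact isRed_of_isRed_red hs hs' hg hb (h hb)

theorem kids_mul {s s' : ℝ} (hs : 0 < s) (hs' : s' ≤ 1) {x : TreeData} (hg : Good s s' x) :
    (kids (s * s') x).map (red s) =
      ((kids s x).map (red s)).filter (by classical exact fun y => decide (¬ IsRed s' y)) := by
  classical
  rw [List.filter_map, kids, kids, List.filter_filter]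
  congr 1
  refine List.filter_congr fun y hy => ?_
  have := isRed_mul_iff hs hs' (hg.child hy)
  simp only [Function.comp, decide_eq_decide, ← Bool.decide_and, this]
  tauto

theorem kids_red_of_length_ne {s s' : ℝ} (hs : 0 < s) (hs' : s' ≤ 1) {x : TreeData}
    (hg : Good s s' x) (hk : (kids s x).length ≠ 1) :
    kids s' (red s x) = (kids (s * s') x).map (red s) := by
  rw [kids_mul hs hs' hg, red_of_length_ne hk, kids, childList_mkNode]

theorem kids_eq_filter_kids {s t : ℝ} (h : t ≤ s) (x : TreeData) :
    kids t x = (kids s x).filter (by classical exact fun y => decide (¬ IsRed t y)) := by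
  classical
  rw [kids, kids, List.filter_filter]
  refine List.filter_congr fun y _ => ?_
  have : IsRed s y → IsRed t y := IsRed.anti h
  simp only [← Bool.decide_and, decide_eq_decide]
  tauto

theorem newMark_red {s s' : ℝ} {x : TreeData} (hb : ¬ IsRed s x) (hk : (kids s x).length ≠ 1) :
    newMark s' (red s x) = newMark (s * s') x := by
  rw [red_of_length_ne hk]
  simp only [newMark, mkNode_nil, List.length_map, List.length_eq_zero_iff,
    kids_eq_nil_iff_of_not_isRed hb]
  split_ifs
  · rw [div_div]
  · rfl

theorem red_red_of_length_ne {s s' : ℝ} (hs : 0 < s) (hs' : s' ≤ 1) {x : TreeData}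
    (hg : Good s s' x) (hb : ¬ IsRed s x) (hk : (kids s x).length ≠ 1)
    (hk' : (kids (s * s') x).length ≠ 1) :
    red s' (red s x) = mkNode (x []).2.1 (newMark (s * s') x)
      ((kids (s * s') x).map fun y => red s' (red s y)) := by
  have hkids := kids_red_of_length_ne hs hs' hg hk
  have hl : (kids s' (red s x)).length ≠ 1 := by rwa [hkids, List.length_map]
  have hz : (red s x []).2.1 = (x []).2.1 := by rw [red_of_length_ne hk, mkNode_nil]
  rw [red_of_length_ne hl, newMark_red hb hk, hkids, hz, List.map_map]
  rfl

/-- The outer induction is on the word at which the trees are compared, the inner one along the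
chain at level `s * s'`. An individual with exactly one black child at level `s * s'` is merged by
the first reduction if it has one black child at level `s` too; otherwise it survives the first
reduction and is merged by the second. -/
theorem red_red {s s' : ℝ} (hs : 0 < s) (hs' : s' ≤ 1) {x : TreeData}
    (hg : Good s s' x) (hb : ¬ IsRed (s * s') x) : red s' (red s x) = red (s * s') x := by
  have hle : s * s' ≤ s := by nlinarith
  have key : ∀ (w : List ℕ), (∀ i w', w = i :: w' → ∀ x, Good s s' x → ¬ IsRed (s * s') x →
      red s' (red s x) w' = red (s * s') x w') → ∀ x, FinChain (s * s') x → Good s s' x →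
      ¬ IsRed (s * s') x → red s' (red s x) w = red (s * s') x w := by
    intro w ih x hfin
    refine FinChain.induction (P := fun x => Good s s' x →
      ¬ IsRed (s * s') x → red s' (red s x) w = red (s * s') x w) ?_ ?_ hfin
    · intro x hk hg hb
      have hb' : ¬ IsRed s x := fun h => hb (h.anti hle)
      -- A single black child at level `s` would either stay the only one at level `s * s'`, or turn
      -- red and leave a black individual with children but without black ones.
      have hk' : (kids s x).length ≠ 1 := by
        intro h
        obtain ⟨y, hy⟩ := List.length_eq_one_iff.1 h
        have hnil : kids (s * s') x = [] := by
          have h1 := kids_eq_filter_kids hle x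
          rw [hy, List.filter_singleton] at h1
          cases hd : (by classical exact decide (¬ IsRed (s * s') y) : Bool) with
          | true => rw [hd] at h1; rw [h1] at hk; simp at hk
          | false => rw [hd] at h1; simpa using h1
        have h0 := (kids_eq_nil_iff_of_not_isRed hb).1 hnil
        obtain ⟨j, hj, -⟩ := mem_childList.1 (child_of_kids_eq hy).1
        omega
      rw [red_red_of_length_ne hs hs' hg hb' hk' hk, red_of_length_ne hk]
      cases w with
      | nil => rw [mkNode_nil, mkNode_nil, List.length_map, List.length_map]
      | cons i w =>
        rw [mkNode_cons, mkNode_cons, List.getElem?_map, List.getElem?_map]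
        cases hy : (kids (s * s') x)[i]? with
        | none => rw [Option.map_none, Option.map_none, Option.elim_none]
        | some y =>
          obtain ⟨hyc, hyb⟩ := mem_kids.1 (List.mem_of_getElem? hy)
          rw [Option.map_some, Option.map_some, Option.elim_some, Option.elim_some]
          exact ih i w rfl y (hg.child hyc) hyb
    · intro x y hy hfy ihy hg hb
      obtain ⟨hyc, hyb⟩ := child_of_kids_eq hy
      have hgy := hg.child hyc
      have hy' : red s' (red s x) = prolong (x []).2.1 (red s' (red s y)) := by
        by_cases hk : (kids s x).length = 1
        · obtain ⟨y', hy'⟩ := List.length_eq_one_iff.1 hk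
          have : y = y' := by
            have h1 : y ∈ kids s x := mem_kids.2 ⟨hyc, fun h => hyb (h.anti hle)⟩
            rwa [hy', List.mem_singleton] at h1
          subst this
          have hfin' : FinChain s' (red s y) := hgy.self.2.2 hyb
          rw [red_of_kids_eq hy' (hgy.self.1 (child_of_kids_eq hy').2), red_prolong hfin']
        · have hkids := kids_red_of_length_ne hs hs' hg hk
          rw [hy, List.map_singleton] at hkids
          have hz : (red s x []).2.1 = (x []).2.1 := by rw [red_of_length_ne hk, mkNode_nil]
          rw [red_of_kids_eq hkids (hgy.self.2.2 hyb), hz]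
      rw [hy', red_of_kids_eq hy hfy]
      have := ihy hgy hyb
      cases w with
      | nil => simp only [prolong, this]
      | cons i w => rw [prolong_cons, prolong_cons, this]
  funext w
  induction w generalizing x with
  | nil => exact key [] (by simp) x (hg.self.2.1 hb) hg hb
  | cons i w ih =>
    refine key (i :: w) ?_ x (hg.self.2.1 hb) hg hb
    rintro i' w' h x hg hb
    obtain ⟨-, rfl⟩ := List.cons.inj h
    exact ih hg hb

/-! ### Pruning -/

/-- Replaces the values at words which are not individuals by the default value. -/
def prune : TreeData → TreeData := fun x w =>
  match w with
  | [] => x []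
  | i :: w => if i < (x []).1 then prune (x.sub i) w else default

theorem prune_eq_mkNode (x : TreeData) :
    prune x = mkNode (x []).2.1 (x []).2.2 (x.childList.map prune) := by
  funext w
  cases w with
  | nil => simp [prune]
  | cons i w =>
    simp only [prune, mkNode, childList, List.map_map, List.getElem?_map]
    split_ifs with h
    · simp [List.getElem?_range h]
    · rw [List.getElem?_eq_none (by simpa using h)]; rfl

theorem childList_prune (x : TreeData) : (prune x).childList = x.childList.map prune := by
  rw [prune_eq_mkNode, childList_mkNode]

@[simp] theorem prune_nil (x : TreeData) : prune x [] = x [] := rfl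

theorem redWithin_prune {s : ℝ} {n : ℕ} {x : TreeData} :
    RedWithin s n (prune x) ↔ RedWithin s n x := by
  induction n generalizing x with
  | zero => rfl
  | succ n ih =>
    simp only [RedWithin, prune_nil]
    refine and_congr_right fun _ => forall₂_congr fun j hj => ?_
    have : (prune x).sub j = prune (x.sub j) := by
      funext w; simp [sub, prune, hj]
    rw [this, ih]

theorem isRed_prune {s : ℝ} {x : TreeData} : IsRed s (prune x) ↔ IsRed s x :=
  exists_congr fun _ => redWithin_prune

theorem kids_prune (s : ℝ) (x : TreeData) : kids s (prune x) = (kids s x).map prune := by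
  rw [kids, childList_prune, List.filter_map, kids]
  congr 1
  refine List.filter_congr fun y _ => ?_
  simp [isRed_prune]

theorem step_prune (s : ℝ) (x : TreeData) : step s (prune x) = prune (step s x) := by
  rw [step, step, kids_prune]
  cases kids s x <;> rfl

theorem iterate_step_prune (s : ℝ) (n : ℕ) (x : TreeData) :
    (step s)^[n] (prune x) = prune ((step s)^[n] x) := by
  induction n generalizing x with
  | zero => rfl
  | succ n ih => rw [Function.iterate_succ_apply, Function.iterate_succ_apply, step_prune, ih]

theorem chainLen_prune (s : ℝ) (x : TreeData) : chainLen s (prune x) = chainLen s x := by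
  simp only [chainLen, iterate_step_prune, kids_prune, List.length_map]

theorem newMark_prune (s : ℝ) (x : TreeData) : newMark s (prune x) = newMark s x := rfl

theorem red_prune (s : ℝ) (x : TreeData) : red s (prune x) = red s x := by
  funext w
  induction w generalizing x with
  | nil =>
    simp only [red, chainTop, chainLife, chainLen_prune, iterate_step_prune, kids_prune,
      newMark_prune, List.length_map, prune_nil]
  | cons i w ih =>
    simp only [red, chainTop, chainLen_prune, iterate_step_prune, kids_prune, List.getElem?_map]
    cases (kids s ((step s)^[chainLen s x] x))[i]? with
    | none => rfl
    | some y => exact ih y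

end TreeData

/-! ### Decorated trees as trees with lifetimes and coloured leaves -/

theorem isIndividual_nil (ν : List ℕ → ℕ) : IsIndividual ν [] := by simp [IsIndividual]

theorem isIndividual_cons (ν : List ℕ → ℕ) (j : ℕ) (u : List ℕ) :
    IsIndividual ν (j :: u) ↔ j < ν [] ∧ IsIndividual (fun v => ν (j :: v)) u := by
  constructor
  · refine fun h => ⟨h 0 (by simp), fun k hk => ?_⟩
    exact h (k + 1) (by simpa using hk)
  · rintro ⟨h0, h⟩ k hk
    cases k with
    | zero => simpa using h0
    | succ k => exact h k (by simpa using hk)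

theorem isIndividual_congr {ν ν' : List ℕ → ℕ} (h : ∀ u, IsIndividual ν' u → ν u = ν' u)
    (u : List ℕ) : IsIndividual ν u ↔ IsIndividual ν' u := by
  induction u using List.reverseRecOn with
  | nil => simp [isIndividual_nil]
  | append_singleton u j ih =>
    rw [isIndividual_append, isIndividual_append, ih]
    exact and_congr_right fun hu => by rw [h u hu]

namespace MarkedTree

theorem ext_mark {t t' : MarkedTree} (h : ∀ u, t.mark u = t'.mark u) : t = t' := by
  cases t; cases t'
  simp only [mk.injEq]
  exact funext h

theorem ofData_congr {ν ν' : List ℕ → ℕ} {ζ ζ' : List ℕ → ℝ}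
    (h : ∀ u, IsIndividual ν' u → ν u = ν' u ∧ ζ u = ζ' u) : ofData ν ζ = ofData ν' ζ' := by
  refine ext_mark fun u => ?_
  have hu := isIndividual_congr (fun u hu => (h u hu).1) u
  by_cases h' : IsIndividual ν' u
  · simp [ofData, h', hu.2 h', (h u h').2]
  · simp [ofData, h', mt hu.1 h']

theorem mem_ofData {ν : List ℕ → ℕ} {ζ : List ℕ → ℝ} {u : List ℕ} :
    u ∈ ofData ν ζ ↔ IsIndividual ν u := by
  change ((ofData ν ζ).mark u).isSome ↔ _
  simp [ofData]

theorem lifetime_ofData {ν : List ℕ → ℕ} {ζ : List ℕ → ℝ} {u : List ℕ} (hu : IsIndividual ν u) :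
    (ofData ν ζ).lifetime u = ζ u := by
  simp [lifetime, ofData, hu]

theorem isLeaf_ofData {ν : List ℕ → ℕ} {ζ : List ℕ → ℝ} {u : List ℕ} :
    (ofData ν ζ).IsLeaf u ↔ IsIndividual ν u ∧ ν u = 0 := by
  simp only [IsLeaf, mem_ofData, isIndividual_append]
  refine and_congr_right fun hu => ⟨fun h => ?_, fun h j => by simp [h]⟩
  by_contra h0
  exact h 0 ⟨hu, Nat.pos_of_ne_zero h0⟩

end MarkedTree

/-- Links the `Nat.nth` in the definition of `blackChild` with the filtered list of children behind
`kids`. -/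
theorem nth_eq_getD_filter_range {p : ℕ → Prop} [DecidablePred p] {n : ℕ} (hp : ∀ j, p j → j < n)
    (i : ℕ) : Nat.nth p i = ((List.range n).filter p).getD i 0 := by
  have hfin : (Set.ofPred p).Finite := (Set.finite_lt_nat n).subset fun j hj => hp j hj
  rw [Nat.nth_eq_getD_sort hfin]
  congr 1
  have h1 : hfin.toFinset = ((List.range n).filter p).toFinset := by
    ext j
    simp only [Set.Finite.mem_toFinset, List.mem_toFinset, List.mem_filter, List.mem_range,
      decide_eq_true_eq]
    exact ⟨fun h => ⟨hp j h, h⟩, fun h => h.2⟩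
  rw [h1]
  refine (List.toFinset_sort _ (List.nodup_range.filter _)).2 ?_
  exact (List.pairwise_le_range).filter _

namespace TreeData

/-- The individuals of `x`. -/
def Ind (x : TreeData) (u : List ℕ) : Prop := IsIndividual (fun v => (x v).1) u

noncomputable def tree (x : TreeData) : MarkedTree :=
  MarkedTree.ofData (fun u => (x u).1) (fun u => (x u).2.1)

noncomputable def colour (s : ℝ) (x : TreeData) (u : List ℕ) : Bool := decide ((x u).2.2 < s)

theorem ind_cons {x : TreeData} {j : ℕ} {u : List ℕ} :
    Ind x (j :: u) ↔ j < (x []).1 ∧ Ind (x.sub j) u := isIndividual_cons _ _ _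

theorem ind_append {x : TreeData} {u v : List ℕ} (hu : Ind x u) :
    Ind x (u ++ v) ↔ Ind (x.shift u) v := by
  induction u generalizing x with
  | nil => rfl
  | cons j u ih =>
    obtain ⟨hj, hu⟩ := ind_cons.1 hu
    rw [List.cons_append, ind_cons, ih hu, shift_cons]
    exact and_iff_right hj

theorem ind_concat {x : TreeData} {u : List ℕ} {j : ℕ} :
    Ind x (u ++ [j]) ↔ Ind x u ∧ j < (x u).1 := isIndividual_append _ _ _

theorem ind_finite_and_of_isRed {s : ℝ} {x : TreeData} (hx : IsRed s x) :
    {v | Ind x v}.Finite ∧ ∀ v, Ind x v → (x v).1 = 0 → s ≤ (x v).2.2 := by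
  refine IsRed.induction (P := fun x => {v | Ind x v}.Finite ∧
    ∀ v, Ind x v → (x v).1 = 0 → s ≤ (x v).2.2) ?_ hx
  intro x h0 _ ih
  have ih' : ∀ j < (x []).1, _ := fun j hj => ih (x.sub j) (mem_childList.2 ⟨j, hj, rfl⟩)
  constructor
  · refine ((Set.finite_singleton ([] : List ℕ)).union
      (Set.Finite.biUnion (Set.finite_lt_nat (x []).1)
        fun j hj => ((ih' j hj).1.image (List.cons j)))).subset ?_
    intro v hv
    cases v with
    | nil => simp
    | cons j v =>
      obtain ⟨hj, hv⟩ := ind_cons.1 hv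
      exact Or.inr (Set.mem_biUnion (show j ∈ {i | i < (x []).1} from hj) ⟨v, hv, rfl⟩)
  · intro v hv hv0
    cases v with
    | nil => exact h0 hv0
    | cons j v =>
      obtain ⟨hj, hv⟩ := ind_cons.1 hv
      exact (ih' j hj).2 v hv hv0

/-- Strong induction on the number of individuals: the subtree above a child misses the root and is
strictly smaller. -/
theorem isRed_of_finite {s : ℝ} {x : TreeData} (hfin : {v | Ind x v}.Finite)
    (hx : ∀ v, Ind x v → (x v).1 = 0 → s ≤ (x v).2.2) : IsRed s x := by
  induction hn : {v | Ind x v}.ncard using Nat.strong_induction_on generalizing x with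
  | _ n ih =>
    refine isRed_iff.2 ⟨hx [] (isIndividual_nil _), fun y hy => ?_⟩
    obtain ⟨j, hj, rfl⟩ := mem_childList.1 hy
    have hinj : Set.InjOn (List.cons j) {v | Ind (x.sub j) v} := fun _ _ _ _ h => (List.cons.inj h).2
    have hsub : List.cons j '' {v | Ind (x.sub j) v} ⊂ {v | Ind x v} := by
      refine ⟨?_, fun h => ?_⟩
      · rintro _ ⟨v, hv, rfl⟩
        exact ind_cons.2 ⟨hj, hv⟩
      · obtain ⟨v, -, hv⟩ := h (show Ind x [] from isIndividual_nil _)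
        simp at hv
    refine ih _ ?_ (Set.Finite.of_finite_image (hfin.subset hsub.1) hinj)
      (fun v hv => hx (j :: v) (ind_cons.2 ⟨hj, hv⟩)) rfl
    rw [← hn, ← hinj.ncard_image]
    exact Set.ncard_lt_ncard hsub hfin

theorem isBlack_tree {s : ℝ} {x : TreeData} {u : List ℕ} :
    (tree x).IsBlack (colour s x) u ↔ Ind x u ∧ ¬ IsRed s (x.shift u) := by
  simp only [MarkedTree.IsBlack, tree, MarkedTree.mem_ofData, MarkedTree.isLeaf_ofData]
  refine and_congr_right fun hu => ?_
  have h2 : ∀ v, IsIndividual (fun u => (x u).1) (u ++ v) ↔ Ind (x.shift u) v :=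
    fun v => ind_append hu
  simp only [h2, colour, decide_eq_true_eq]
  constructor
  · rintro (h | ⟨v, ⟨hv, hv0⟩, hv'⟩) hr
    · exact h (ind_finite_and_of_isRed hr).1
    · exact absurd ((ind_finite_and_of_isRed hr).2 v hv hv0) (not_le.2 hv')
  · intro h
    by_contra hcon
    simp only [not_or, Set.not_infinite, not_exists, not_and, not_lt] at hcon
    exact h (isRed_of_finite hcon.1 fun v hv hv0 => hcon.2 v ⟨hv, hv0⟩)

open Classical in
theorem kids_eq_map (s : ℝ) (x : TreeData) :
    kids s x = ((List.range (x []).1).filter fun j => ¬ IsRed s (x.sub j)).map x.sub := by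
  rw [kids, childList, List.filter_map]
  rfl

theorem isBlack_concat {s : ℝ} {x : TreeData} {u : List ℕ} (hu : Ind x u) (j : ℕ) :
    (tree x).IsBlack (colour s x) (u ++ [j]) ↔
      j < (x.shift u []).1 ∧ ¬ IsRed s ((x.shift u).sub j) := by
  rw [isBlack_tree, ind_concat, shift_append, shift_singleton, and_iff_right hu]
  simp [shift]

theorem numBlack_tree {s : ℝ} {x : TreeData} {u : List ℕ} (hu : Ind x u) :
    (tree x).numBlack (colour s x) u = (kids s (x.shift u)).length := by
  classical
  rw [MarkedTree.numBlack, kids_eq_map, List.length_map]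
  have : {j | (tree x).IsBlack (colour s x) (u ++ [j])} =
      ((List.range (x.shift u []).1).filter fun j => ¬ IsRed s ((x.shift u).sub j)).toFinset := by
    ext j
    simp [isBlack_concat hu]
  rw [this, Set.ncard_coe_finset, List.toFinset_card_of_nodup (List.nodup_range.filter _)]

theorem blackChild_tree {s : ℝ} {x : TreeData} {u : List ℕ} (hu : Ind x u) {i : ℕ}
    (hi : i < (kids s (x.shift u)).length) :
    Ind x ((tree x).blackChild (colour s x) u i) ∧
      x.shift ((tree x).blackChild (colour s x) u i) = (kids s (x.shift u))[i] := by
  classical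
  have h1 : ∀ j, (tree x).IsBlack (colour s x) (u ++ [j]) → j < (x.shift u []).1 :=
    fun j hj => ((isBlack_concat hu j).1 hj).1
  have h2 : (List.range (x.shift u []).1).filter
        (fun j => decide ((tree x).IsBlack (colour s x) (u ++ [j]))) =
      (List.range (x.shift u []).1).filter fun j => ¬ IsRed s ((x.shift u).sub j) := by
    refine List.filter_congr fun j hj => ?_
    have := isBlack_concat (s := s) hu j
    rw [List.mem_range] at hj
    simp [this, hj]
  have hk := kids_eq_map s (x.shift u)
  set l := (List.range (x.shift u []).1).filter fun j => ¬ IsRed s ((x.shift u).sub j) with hl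
  have hi' : i < l.length := by rw [hk, List.length_map] at hi; exact hi
  have h3 : (tree x).blackChild (colour s x) u i = u ++ [l[i]] := by
    rw [MarkedTree.blackChild]
    congr 2
    rw [nth_eq_getD_filter_range h1, h2]
    simp [hi']
  have h4 : l[i] < (x.shift u []).1 := by
    have := List.mem_of_mem_filter (List.getElem_mem hi')
    simpa using this
  rw [h3]
  refine ⟨ind_concat.2 ⟨hu, by simpa [shift] using h4⟩, ?_⟩
  rw [shift_append, shift_singleton]
  simp [hk]

theorem iterate_blackChild {s : ℝ} {x : TreeData} {u : List ℕ} (hu : Ind x u) (n : ℕ)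
    (hn : ∀ m < n, (kids s ((step s)^[m] (x.shift u))).length = 1) :
    Ind x ((fun v => (tree x).blackChild (colour s x) v 0)^[n] u) ∧
      x.shift ((fun v => (tree x).blackChild (colour s x) v 0)^[n] u) =
        (step s)^[n] (x.shift u) := by
  induction n with
  | zero => exact ⟨hu, rfl⟩
  | succ n ih =>
    obtain ⟨h1, h2⟩ := ih fun m hm => hn m (by omega)
    rw [Function.iterate_succ_apply', Function.iterate_succ_apply']
    have h3 := hn n (by omega)
    have h4 := blackChild_tree (s := s) h1 (i := 0) (by rw [h2, h3]; exact one_pos)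
    refine ⟨h4.1, h4.2.trans ?_⟩
    obtain ⟨y, hy⟩ := List.length_eq_one_iff.1 h3
    rw [step_of_kids_eq hy]
    simp [h2, hy]

theorem lt_chainLen {s : ℝ} {x : TreeData} {m : ℕ} (hm : m < chainLen s x) :
    (kids s ((step s)^[m] x)).length = 1 := by
  by_contra h
  exact Nat.notMem_of_lt_sInf hm h

theorem chainLength_tree {s : ℝ} {x : TreeData} {u : List ℕ} (hu : Ind x u) :
    (tree x).chainLength (colour s x) u = chainLen s (x.shift u) := by
  have key : ∀ n, (∀ m < n, (kids s ((step s)^[m] (x.shift u))).length = 1) →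
      (tree x).numBlack (colour s x) ((fun v => (tree x).blackChild (colour s x) v 0)^[n] u) =
        (kids s ((step s)^[n] (x.shift u))).length := fun n hn => by
    obtain ⟨h1, h2⟩ := iterate_blackChild (s := s) hu n hn
    rw [numBlack_tree h1, h2]
  by_cases hfin : FinChain s (x.shift u)
  · refine le_antisymm (Nat.sInf_le ?_) (le_of_not_gt fun hlt => ?_)
    · change _ ≠ 1
      rw [key _ fun m hm => lt_chainLen hm]
      exact Nat.sInf_mem hfin
    · have hne : {n | (tree x).numBlack (colour s x)
          ((fun v => (tree x).blackChild (colour s x) v 0)^[n] u) ≠ 1}.Nonempty := by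
        refine ⟨chainLen s (x.shift u), ?_⟩
        change _ ≠ 1
        rw [key _ fun m hm => lt_chainLen hm]
        exact Nat.sInf_mem hfin
      have := Nat.sInf_mem hne
      change (tree x).numBlack (colour s x) ((fun v => (tree x).blackChild (colour s x) v 0)^[
        (tree x).chainLength (colour s x) u] u) ≠ 1 at this
      rw [key _ fun m hm => lt_chainLen (hm.trans hlt)] at this
      exact this (lt_chainLen hlt)
  -- On an infinite chain both lengths are infima of the empty set and agree by default.
  · have hall : ∀ n, (kids s ((step s)^[n] (x.shift u))).length = 1 := by
      simpa [FinChain] using hfin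
    have e1 : {n | (tree x).numBlack (colour s x)
        ((fun v => (tree x).blackChild (colour s x) v 0)^[n] u) ≠ 1} = ∅ := by
      ext n
      simp [key n fun m _ => hall m, hall]
    rw [MarkedTree.chainLength, e1, chainLen]
    simp [hall]

theorem chainEnd_tree {s : ℝ} {x : TreeData} {u : List ℕ} (hu : Ind x u) :
    Ind x ((tree x).chainEnd (colour s x) u) ∧
      x.shift ((tree x).chainEnd (colour s x) u) = chainTop s (x.shift u) := by
  rw [MarkedTree.chainEnd, chainLength_tree hu]
  exact iterate_blackChild hu _ fun m hm => lt_chainLen hm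

theorem chainLifetime_tree {s : ℝ} {x : TreeData} {u : List ℕ} (hu : Ind x u) :
    (tree x).chainLifetime (colour s x) u = chainLife s (x.shift u) := by
  rw [MarkedTree.chainLifetime, chainLength_tree hu, chainLife]
  refine Finset.sum_congr rfl fun n hn => ?_
  obtain ⟨h1, h2⟩ := iterate_blackChild (s := s) hu n
    fun m hm => lt_chainLen (lt_of_lt_of_le hm (Nat.lt_succ_iff.1 (Finset.mem_range.1 hn)))
  refine (MarkedTree.lifetime_ofData h1).trans ?_
  rw [← h2]
  simp [shift]

theorem chainStart_tree {s : ℝ} {x : TreeData} {w : List ℕ} (hw : Ind (red s x) w) :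
    Ind x ((tree x).chainStart (colour s x) w) ∧
      (red s x).shift w = red s (x.shift ((tree x).chainStart (colour s x) w)) := by
  induction w using List.reverseRecOn with
  | nil => exact ⟨isIndividual_nil _, rfl⟩
  | append_singleton w i ih =>
    obtain ⟨hw, hi⟩ := ind_concat.1 hw
    obtain ⟨h1, h2⟩ := ih hw
    obtain ⟨h3, h4⟩ := chainEnd_tree (s := s) h1
    have hi' : i < (kids s (chainTop s (x.shift ((tree x).chainStart (colour s x) w)))).length := by
      have : (red s x w).1 = ((red s x).shift w []).1 := by simp [shift]
      rw [this, h2] at hi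
      exact hi
    have h5 := blackChild_tree (s := s) h3 (i := i) (by rwa [h4])
    have h6 : (tree x).chainStart (colour s x) (w ++ [i]) = (tree x).blackChild (colour s x)
        ((tree x).chainEnd (colour s x) ((tree x).chainStart (colour s x) w)) i := by
      simp [MarkedTree.chainStart]
    rw [h6]
    refine ⟨h5.1, ?_⟩
    rw [shift_append, h2, h5.2, shift_singleton]
    funext v
    simp only [sub, red, h4]
    rw [List.getElem?_eq_getElem hi', Option.elim_some]

/-- The bridge between the two descriptions. It holds for every tree, without a condition on chains,
because the default values on both sides match. -/
theorem reduce_tree (s : ℝ) (x : TreeData) :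
    (tree x).reduce (colour s x) = tree (red s x) := by
  refine MarkedTree.ofData_congr fun w hw => ?_
  obtain ⟨h1, h2⟩ := chainStart_tree (s := s) (x := x) hw
  obtain ⟨h3, h4⟩ := chainEnd_tree (s := s) h1
  have h5 : red s x w = (red s x).shift w [] := by simp [shift]
  rw [h5, h2, numBlack_tree h3, h4, chainLifetime_tree h1]
  exact ⟨rfl, rfl⟩

theorem tree_prune (x : TreeData) : tree (prune x) = tree x := by
  refine MarkedTree.ofData_congr fun u hu => ?_
  suffices h : prune x u = x u by simp [h]
  change Ind x u at hu
  induction u generalizing x with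
  | nil => rfl
  | cons j u ih =>
    obtain ⟨hj, hu⟩ := ind_cons.1 hu
    simp only [prune, hj, if_true]
    exact ih _ hu

end TreeData

/-! ### Product measures -/

/-- One coordinate of an infinite product is split off. The inverse map rebuilds the family, and
cylinder sets pull back to rectangles. Used for the first entry of a sequence and for the root of a
tree. -/
theorem infinitePi_map_option {ι J X : Type*} [MeasurableSpace X] (a : Measure X)
    [IsProbabilityMeasure a] (e : Option ι ≃ J) :
    (Measure.infinitePi fun _ : J => a).map (fun x => (x (e none), fun i => x (e (some i)))) =
      a.prod (Measure.infinitePi fun _ : ι => a) := by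
  classical
  have hg : Measurable fun (p : X × (ι → X)) (j : J) => (e.symm j).elim p.1 p.2 := by
    refine measurable_pi_lambda _ fun j => ?_
    cases e.symm j with
    | none => exact measurable_fst
    | some i => exact (measurable_pi_apply i).comp measurable_snd
  have hinv : (a.prod (Measure.infinitePi fun _ : ι => a)).map
      (fun (p : X × (ι → X)) (j : J) => (e.symm j).elim p.1 p.2) =
      Measure.infinitePi fun _ : J => a := by
    refine Measure.eq_infinitePi _ fun s t ht => ?_
    rw [Measure.map_apply hg (MeasurableSet.pi s.countable_toSet fun j _ => ht j)]
    set s' : Finset (Option ι) := s.map e.symm.toEmbedding with hs'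
    have hpre : (fun (p : X × (ι → X)) (j : J) => (e.symm j).elim p.1 p.2) ⁻¹'
        ((s : Set J).pi t) = (if none ∈ s' then t (e none) else Set.univ) ×ˢ
          ((Finset.eraseNone s' : Finset ι) : Set ι).pi (fun i => t (e (some i))) := by
      ext ⟨z, c⟩
      simp only [Set.mem_preimage, Set.mem_pi, Finset.mem_coe, Set.mem_prod, Finset.mem_eraseNone]
      have hm : ∀ o, o ∈ s' ↔ e o ∈ s := fun o => by
        simp only [hs', Finset.mem_map, Equiv.coe_toEmbedding]
        exact ⟨by rintro ⟨j, hj, rfl⟩; simpa using hj, fun h => ⟨e o, h, by simp⟩⟩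
      constructor
      · refine fun h => ⟨?_, fun i hi => by simpa using h _ ((hm _).1 hi)⟩
        split_ifs with h0
        · simpa using h _ ((hm _).1 h0)
        · trivial
      · rintro ⟨h1, h2⟩ j hj
        obtain ⟨o, rfl⟩ := e.surjective j
        have ho := (hm o).2 hj
        cases o with
        | none => simpa [ho] using h1
        | some i => simpa using h2 i ho
    rw [hpre, Measure.prod_prod, Measure.infinitePi_pi _ (fun i _ => ht _)]
    have h3 : ∏ j ∈ s, a (t j) = ∏ o ∈ s', a (t (e o)) := by simp [hs']
    rw [h3]
    by_cases h0 : none ∈ s'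
    · rw [if_pos h0, ← Finset.prod_insertNone (fun o => a (t (e o))),
        Finset.insertNone_eraseNone, Finset.insert_eq_of_mem h0]
    · rw [if_neg h0, measure_univ, one_mul]
      conv_rhs => rw [← Finset.erase_eq_of_notMem h0, ← Finset.map_some_eraseNone]
      rw [Finset.prod_map]; rfl
  rw [← hinv, Measure.map_map (by fun_prop) hg]
  convert Measure.map_id
  ext p <;> simp

def optionEquivNat : Option ℕ ≃ ℕ where
  toFun o := o.elim 0 Nat.succ
  invFun n := Nat.casesOn n none some
  left_inv o := by cases o <;> rfl
  right_inv n := by cases n <;> rfl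

theorem infinitePi_map_head_tail {X : Type*} [MeasurableSpace X] (a : Measure X)
    [IsProbabilityMeasure a] :
    (Measure.infinitePi fun _ : ℕ => a).map (fun x => (x 0, fun i => x (i + 1))) =
      a.prod (Measure.infinitePi fun _ : ℕ => a) :=
  infinitePi_map_option a optionEquivNat

def optionEquivList : Option (ℕ × List ℕ) ≃ List ℕ where
  toFun o := o.elim [] fun p => p.1 :: p.2
  invFun u := List.casesOn u none fun j u => some (j, u)
  left_inv o := by cases o <;> rfl
  right_inv n := by cases n <;> rfl

/-- The branching property: the subtrees above the children are independent of the root and of each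
other, with the law of the whole tree. -/
theorem infinitePi_map_root_sub {X : Type*} [MeasurableSpace X] (a : Measure X)
    [IsProbabilityMeasure a] :
    (Measure.infinitePi fun _ : List ℕ => a).map (fun x => (x [], fun j u => x (j :: u))) =
      a.prod (Measure.infinitePi fun _ : ℕ => Measure.infinitePi fun _ : List ℕ => a) := by
  have h1 := infinitePi_map_option a optionEquivList
  have h2 := Measure.infinitePi_map_curry (fun (_ : ℕ) (_ : List ℕ) => a)
  have h3 : (fun x : List ℕ → X => (x [], fun (j : ℕ) (u : List ℕ) => x (j :: u))) =
      Prod.map id (MeasurableEquiv.curry ℕ (List ℕ) X) ∘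
        fun x => (x (optionEquivList none), fun i => x (optionEquivList (some i))) := rfl
  rw [h3, ← Measure.map_map (by fun_prop) (by fun_prop), h1,
    ← Measure.map_prod_map _ _ measurable_id (MeasurableEquiv.measurable _), Measure.map_id, h2]

/-! ### Lists, encoded by their lengths and their entries -/

section Encoding

variable {Z W : Type*}

/-- Random lists are handled as a length and a padded sequence, so that they live in a product space
and measurability can be checked for each length. -/
def enc [Inhabited Z] (l : List Z) : ℕ × (ℕ → Z) := (l.length, fun i => l.getD i default)

def consEnc (z : Z) (e : ℕ × (ℕ → Z)) : ℕ × (ℕ → Z) :=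
  (e.1 + 1, fun i => Nat.casesOn i z e.2)

theorem enc_cons [Inhabited Z] (z : Z) (l : List Z) : enc (z :: l) = consEnc z (enc l) := by
  refine Prod.ext rfl ?_
  funext i
  cases i <;> rfl

/-- The list with the given encoding. -/
def decList (e : ℕ × (ℕ → Z)) : List Z := (List.range e.1).map e.2

@[simp] theorem length_decList (e : ℕ × (ℕ → Z)) : (decList e).length = e.1 := by simp [decList]

@[simp] theorem decList_enc [Inhabited Z] (l : List Z) : decList (enc l) = l := by
  refine List.ext_getElem (by simp [decList, enc]) fun i h1 h2 => ?_
  simp [decList, enc, h2]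

theorem decList_succ (n : ℕ) (c : ℕ → Z) : decList (n + 1, c) = c 0 :: decList (n, fun i => c (i + 1)) := by
  simp [decList, List.range_succ_eq_map, Function.comp_def]

variable [MeasurableSpace Z] [MeasurableSpace W]

theorem measurable_consEnc : Measurable fun p : Z × (ℕ × (ℕ → Z)) => consEnc p.1 p.2 := by
  refine Measurable.prodMk (by fun_prop) (measurable_pi_lambda _ fun i => ?_)
  cases i with
  | zero => exact measurable_fst
  | succ i => exact (measurable_pi_apply i).comp (measurable_snd.comp measurable_snd)

theorem measurable_enc_map_decList [Inhabited W] {g : Z → W} (hg : Measurable g) :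
    Measurable fun e : ℕ × (ℕ → Z) => enc ((decList e).map g) := by
  refine measurable_from_prod_countable_right fun n => ?_
  refine Measurable.prodMk (by simp) (measurable_pi_lambda _ fun i => ?_)
  by_cases h : i < n
  · simp only [List.getD_eq_getElem?_getD, List.getElem?_map, decList, List.map_map]
    simp only [List.getElem?_range h, Option.map_some, Option.getD_some, Function.comp]
    exact hg.comp (measurable_pi_apply i)
  · simp [decList, h]

open Classical in
theorem measurable_enc_filter_decList [Inhabited Z] {B : Set Z} (hB : MeasurableSet B) :
    Measurable fun e : ℕ × (ℕ → Z) => enc ((decList e).filter (· ∈ B)) := by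
  refine measurable_from_prod_countable_right fun n => ?_
  induction n with
  | zero =>
    have : (fun c : ℕ → Z => enc ((decList (0, c)).filter (· ∈ B))) = fun _ => enc [] := by
      funext c; simp [decList]
    rw [this]
    exact measurable_const
  | succ n ih =>
    have : (fun c : ℕ → Z => enc ((decList (n + 1, c)).filter (· ∈ B))) = fun c =>
        if c 0 ∈ B then consEnc (c 0) (enc ((decList (n, fun i => c (i + 1))).filter (· ∈ B)))
        else enc ((decList (n, fun i => c (i + 1))).filter (· ∈ B)) := by
      funext c
      rw [decList_succ, List.filter_cons]
      split_ifs with h1 h2 h2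
      · rw [enc_cons]
      · simp_all
      · simp_all
      · rfl
    rw [this]
    have h1 : Measurable fun c : ℕ → Z => enc ((decList (n, fun i => c (i + 1))).filter (· ∈ B)) :=
      ih.comp (by fun_prop)
    refine Measurable.ite (measurable_pi_apply 0 hB) ?_ h1
    exact measurable_consEnc.comp ((measurable_pi_apply 0).prodMk h1)

end Encoding

/-! ### Measurability of the reduction -/

namespace TreeData

/-- The tree whose root has the lifetime `z`, the mark `m` and the subtrees encoded by `e`. -/
def nodeEnc (p : (ℕ × (ℕ → TreeData)) × ℝ × ℝ) : TreeData
  | [] => (p.1.1, p.2.1, p.2.2)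
  | i :: w => if i < p.1.1 then p.1.2 i w else default

theorem nodeEnc_enc (l : List TreeData) (z m : ℝ) : nodeEnc (enc l, z, m) = mkNode z m l := by
  funext w
  cases w with
  | nil => rfl
  | cons i w =>
    by_cases h : i < l.length
    · simp [nodeEnc, mkNode, enc, h]
    · simp [nodeEnc, mkNode, enc, h]

theorem nodeEnc_congr {n : ℕ} {c c' : ℕ → TreeData} (h : ∀ i < n, c i = c' i) (z m : ℝ) :
    nodeEnc ((n, c), z, m) = nodeEnc ((n, c'), z, m) := by
  funext w
  cases w with
  | nil => rfl
  | cons i w => by_cases hi : i < n <;> simp [nodeEnc, hi, h]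

theorem measurable_nodeEnc : Measurable nodeEnc := by
  refine measurable_pi_lambda _ fun w => ?_
  cases w with
  | nil => exact (by fun_prop : Measurable fun p : (ℕ × (ℕ → TreeData)) × ℝ × ℝ =>
      (p.1.1, p.2.1, p.2.2))
  | cons i w =>
    refine Measurable.ite ?_ ?_ measurable_const
    · exact measurableSet_lt measurable_const (by fun_prop)
    · fun_prop

theorem measurable_sub (j : ℕ) : Measurable fun x : TreeData => x.sub j :=
  measurable_pi_lambda _ fun u => measurable_pi_apply (j :: u)

theorem measurable_shift (u : List ℕ) : Measurable fun x : TreeData => x.shift u :=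
  measurable_pi_lambda _ fun v => measurable_pi_apply (u ++ v)

theorem measurableSet_redWithin (s : ℝ) (n : ℕ) : MeasurableSet {x | RedWithin s n x} := by
  induction n with
  | zero => simp [RedWithin]
  | succ n ih =>
    have h1 : MeasurableSet {x : TreeData | (x []).1 = 0 → s ≤ (x []).2.2} := by
      have h2 : MeasurableSet {x : TreeData | (x []).1 = 0} :=
        measurableSet_eq_fun (by fun_prop) measurable_const
      have h3 : MeasurableSet {x : TreeData | s ≤ (x []).2.2} :=
        measurableSet_le measurable_const (by fun_prop)
      simp only [imp_iff_not_or]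
      exact h2.compl.union h3
    have h4 : MeasurableSet {x : TreeData | ∀ j < (x []).1, RedWithin s n (x.sub j)} := by
      simp only [imp_iff_not_or, Set.ofPred_forall]
      refine MeasurableSet.iInter fun j => MeasurableSet.union ?_ (measurable_sub j ih)
      exact (measurableSet_lt measurable_const
        (by fun_prop : Measurable fun x : TreeData => (x []).1)).compl
    exact h1.inter h4

theorem measurableSet_isRed (s : ℝ) : MeasurableSet {x | IsRed s x} := by
  simp only [IsRed, Set.ofPred_exists]
  exact MeasurableSet.iUnion fun n => measurableSet_redWithin s n

theorem measurable_children : Measurable fun x : TreeData => ((x []).1, x.sub) :=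
  Measurable.prodMk (by fun_prop) (measurable_pi_lambda _ measurable_sub)

theorem decList_children (x : TreeData) : decList ((x []).1, x.sub) = x.childList := rfl

theorem measurable_enc_kids (s : ℝ) : Measurable fun x => enc (kids s x) := by
  have := (measurable_enc_filter_decList (measurableSet_isRed s).compl).comp measurable_children
  convert this using 2 with x
  rw [Function.comp, decList_children, kids]
  exact congrArg enc (List.filter_congr fun y _ => decide_eq_decide.2 Iff.rfl)

theorem measurable_length_kids (s : ℝ) : Measurable fun x => (kids s x).length :=
  (measurable_enc_kids s).fst

theorem measurable_step (s : ℝ) : Measurable (step s) := by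
  have : step s = fun x => if (kids s x).length = 0 then x else (enc (kids s x)).2 0 := by
    funext x
    rw [step]
    cases h : kids s x <;> simp [enc]
  rw [this]
  refine Measurable.ite (measurable_length_kids s (measurableSet_singleton 0)) measurable_id ?_
  exact (measurable_pi_apply 0).comp (measurable_enc_kids s).snd

theorem measurable_sInf_nat {α : Type*} [MeasurableSpace α] {p : ℕ → α → Prop}
    (hp : ∀ n, MeasurableSet {x | p n x}) : Measurable fun x => sInf {n | p n x} := by
  refine measurable_to_countable' fun n => ?_
  have h1 : MeasurableSet {x | p n x ∧ ∀ m < n, ¬ p m x} := by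
    simp only [Set.ofPred_and, Set.ofPred_forall]
    exact (hp n).inter (MeasurableSet.iInter fun m => MeasurableSet.iInter fun _ => (hp m).compl)
  -- The value `0` is also taken where the set is empty.
  have h2 : MeasurableSet {x | n = 0 ∧ ∀ m, ¬ p m x} := by
    simp only [Set.ofPred_and, Set.ofPred_forall]
    exact (MeasurableSet.const _).inter (MeasurableSet.iInter fun m => (hp m).compl)
  convert h1.union h2 using 1
  ext x
  simp only [Set.mem_preimage, Set.mem_singleton_iff, Set.mem_union, Set.mem_ofPred]
  constructor
  · rintro rfl
    by_cases hne : {n | p n x}.Nonempty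
    · exact Or.inl ⟨Nat.sInf_mem hne, fun m hm => Nat.notMem_of_lt_sInf hm⟩
    · have hall : ∀ m, ¬ p m x := fun m hm => hne ⟨m, hm⟩
      exact Or.inr ⟨by simp [hall], hall⟩
  · rintro (⟨h, h'⟩ | ⟨rfl, h⟩)
    · exact le_antisymm (Nat.sInf_le h) (le_of_not_gt fun hlt => h' _ hlt
        (Nat.sInf_mem (s := {n | p n x}) ⟨n, h⟩))
    · simp [h]

theorem measurable_iterate_step (s : ℝ) (n : ℕ) : Measurable ((step s)^[n]) :=
  (measurable_step s).iterate n

theorem measurableSet_length_kids_iterate (s : ℝ) (n : ℕ) :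
    MeasurableSet {x | (kids s ((step s)^[n] x)).length ≠ 1} :=
  ((measurable_length_kids s).comp (measurable_iterate_step s n)
    (measurableSet_singleton 1)).compl

theorem measurableSet_finChain (s : ℝ) : MeasurableSet {x | FinChain s x} := by
  simp only [FinChain, Set.ofPred_exists]
  exact MeasurableSet.iUnion (measurableSet_length_kids_iterate s)

theorem measurable_chainLen (s : ℝ) : Measurable (chainLen s) :=
  measurable_sInf_nat (measurableSet_length_kids_iterate s)

theorem measurable_chainTop (s : ℝ) : Measurable (chainTop s) := by
  have h : Measurable fun p : ℕ × TreeData => (step s)^[p.1] p.2 :=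
    measurable_from_prod_countable_right fun n => measurable_iterate_step s n
  exact h.comp ((measurable_chainLen s).prodMk measurable_id)

theorem measurable_chainLife (s : ℝ) : Measurable (chainLife s) := by
  have h : Measurable fun p : ℕ × TreeData =>
      ∑ n ∈ Finset.range (p.1 + 1), ((step s)^[n] p.2 []).2.1 :=
    measurable_from_prod_countable_right fun n => Finset.measurable_sum (Finset.range (n + 1))
      fun m _ => ((measurable_pi_apply []).comp (measurable_iterate_step s m)).snd.fst
  exact h.comp ((measurable_chainLen s).prodMk measurable_id)

theorem measurable_newMark (s : ℝ) : Measurable (newMark s) := by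
  refine Measurable.ite ?_ (by fun_prop) (by fun_prop)
  exact measurableSet_eq_fun (by fun_prop) measurable_const

theorem measurable_red (s : ℝ) : Measurable (red s) := by
  refine measurable_pi_lambda _ fun w => ?_
  induction w with
  | nil =>
    exact ((measurable_length_kids s).comp (measurable_chainTop s)).prodMk
      ((measurable_chainLife s).prodMk ((measurable_newMark s).comp (measurable_chainTop s)))
  | cons i w ih =>
    have : (fun x => red s x (i :: w)) = fun x => if i < (kids s (chainTop s x)).length then
        red s ((enc (kids s (chainTop s x))).2 i) w else default := by
      funext x
      by_cases h : i < (kids s (chainTop s x)).length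
      · simp [red, enc, h]
      · simp [red, h]
    rw [this]
    refine Measurable.ite ?_ ?_ measurable_const
    · exact measurableSet_lt measurable_const
        ((measurable_length_kids s).comp (measurable_chainTop s))
    · exact ih.comp ((measurable_pi_apply i).comp
        ((measurable_enc_kids s).comp (measurable_chainTop s)).snd)

theorem measurable_prune : Measurable prune := by
  refine measurable_pi_lambda _ fun w => ?_
  induction w with
  | nil => exact measurable_pi_apply []
  | cons i w ih =>
    refine Measurable.ite ?_ (ih.comp (measurable_sub i)) measurable_const
    exact measurableSet_lt measurable_const (by fun_prop)

theorem measurable_tree : Measurable tree :=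
  MarkedTree.measurable_ofData _ _ (fun u => (measurable_pi_apply u).fst)
    (fun u => (measurable_pi_apply u).snd.fst)

theorem measurable_colour (s : ℝ) : Measurable (colour s) := by
  refine measurable_pi_lambda _ fun u => ?_
  refine measurable_to_bool ?_
  have : (fun x : TreeData => colour s x u) ⁻¹' {true} = {x | (x u).2.2 < s} := by
    ext x; simp [colour]
  rw [this]
  exact measurableSet_lt (by fun_prop) measurable_const

end TreeData

/-! ### Thinning of a random number of independent objects -/

section Thinning

variable {Z W : Type*} [Inhabited Z] [Inhabited W] [MeasurableSpace Z] [MeasurableSpace W]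

/-- The law of a list of `k` independent objects with law `ρ`. -/
noncomputable def listLaw (ρ : Measure Z) [IsProbabilityMeasure ρ] (k : ℕ) :
    Measure (ℕ × (ℕ → Z)) :=
  (Measure.infinitePi fun _ : ℕ => ρ).map fun c => enc (decList (k, c))

theorem measurable_enc_decList : Measurable fun e : ℕ × (ℕ → Z) => enc (decList e) := by
  simpa using measurable_enc_map_decList (Z := Z) (W := Z) measurable_id

theorem measurable_enc_decList_mk (k : ℕ) : Measurable fun c : ℕ → Z => enc (decList (k, c)) :=
  measurable_enc_decList.comp (by fun_prop : Measurable fun c : ℕ → Z => (k, c))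

instance (ρ : Measure Z) [IsProbabilityMeasure ρ] (k : ℕ) : IsProbabilityMeasure (listLaw ρ k) :=
  Measure.isProbabilityMeasure_map (measurable_enc_decList_mk k).aemeasurable

theorem listLaw_fst_eq (ρ : Measure Z) [IsProbabilityMeasure ρ] (k : ℕ) :
    ∀ᵐ e ∂listLaw ρ k, e.1 = k := by
  rw [listLaw, ae_map_iff (measurable_enc_decList_mk k).aemeasurable
    (measurableSet_eq_fun measurable_fst measurable_const)]
  exact ae_of_all _ fun c => by simp [enc]

theorem listLaw_zero (ρ : Measure Z) [IsProbabilityMeasure ρ] :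
    listLaw ρ 0 = Measure.dirac (enc []) := by
  rw [listLaw]
  have : (fun c : ℕ → Z => enc (decList (0, c))) = fun _ => enc [] := by
    funext c; simp [decList]
  rw [this, Measure.map_const, measure_univ, one_smul]

theorem listLaw_succ (ρ : Measure Z) [IsProbabilityMeasure ρ] (k : ℕ) :
    listLaw ρ (k + 1) = (ρ.prod (listLaw ρ k)).map fun p => consEnc p.1 p.2 := by
  have h1 : (fun c : ℕ → Z => enc (decList (k + 1, c))) = (fun p : Z × (ℕ × (ℕ → Z)) =>
      consEnc p.1 p.2) ∘ Prod.map id (fun c => enc (decList (k, c))) ∘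
        fun c => (c 0, fun i => c (i + 1)) := by
    funext c; simp [decList_succ, enc_cons]
  have hm := measurable_enc_decList_mk (Z := Z) k
  rw [listLaw, h1, ← Measure.map_map measurable_consEnc (by fun_prop),
    ← Measure.map_map (by fun_prop) (by fun_prop), infinitePi_map_head_tail,
    ← Measure.map_prod_map _ _ measurable_id hm, Measure.map_id, listLaw]

theorem listLaw_map (ρ : Measure Z) [IsProbabilityMeasure ρ] {g : Z → W} (hg : Measurable g) (k : ℕ)
    [IsProbabilityMeasure (ρ.map g)] :
    (listLaw ρ k).map (fun e => enc ((decList e).map g)) = listLaw (ρ.map g) k := by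
  rw [listLaw, listLaw, Measure.map_map (measurable_enc_map_decList hg) (measurable_enc_decList_mk k)]
  have h1 := Measure.infinitePi_map_pi (fun _ : ℕ => ρ) (f := fun _ => g) (fun _ => hg)
  have hg' : Measurable fun (x : ℕ → Z) i => g (x i) :=
    measurable_pi_lambda _ fun i => hg.comp (measurable_pi_apply i)
  rw [← h1, Measure.map_map (measurable_enc_decList_mk k) hg']
  congr 1
  funext c
  have h2 : decList (k, fun i => g (c i)) = (decList (k, c)).map g := by simp [decList]
  rw [Function.comp, Function.comp, decList_enc, h2]

-- Each of the `n` objects is kept independently, so the number kept is binomial, and the kept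
-- objects are independent with the conditional law `ρ`. The induction looks at the first object;
-- Pascal's rule combines the cases in which it is kept and deleted.
open Classical in
theorem map_filter_decList (μ : Measure Z) [IsProbabilityMeasure μ] {B : Set Z}
    (hB : MeasurableSet B) (ρ : Measure Z) [IsProbabilityMeasure ρ]
    (hρ : μ.restrict B = μ B • ρ) (n : ℕ) {A : Set (ℕ × (ℕ → Z))} (hA : MeasurableSet A) :
    (Measure.infinitePi fun _ : ℕ => μ)
        ((fun c => enc ((decList (n, c)).filter (· ∈ B))) ⁻¹' A) =
      ∑ ij ∈ Finset.HasAntidiagonal.antidiagonal n,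
        (n.choose ij.1 : ℝ≥0∞) * (μ B ^ ij.1 * μ Bᶜ ^ ij.2 * listLaw ρ ij.1 A) := by
  have hm : ∀ n, Measurable fun c : ℕ → Z => enc ((decList (n, c)).filter (· ∈ B)) := fun n =>
    (measurable_enc_filter_decList hB).comp (by fun_prop : Measurable fun c : ℕ → Z => (n, c))
  induction n generalizing A with
  | zero =>
    have : (fun c : ℕ → Z => enc ((decList (0, c)).filter (· ∈ B))) = fun _ => enc [] := by
      funext c; simp [decList]
    rw [this]
    simp only [Finset.HasAntidiagonal.antidiagonal_zero, Finset.sum_singleton, Nat.choose_self, Nat.cast_one,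
      pow_zero, one_mul, listLaw_zero, Measure.dirac_apply' _ hA]
    by_cases h : enc [] ∈ A <;> simp [h]
  | succ n ih =>
    rw [Finset.sum_antidiagonal_choose_succ_mul
      (fun i j => μ B ^ i * μ Bᶜ ^ j * listLaw ρ i A)]
    set P := Measure.infinitePi fun _ : ℕ => μ with hP
    set F : ℕ → (ℕ → Z) → ℕ × (ℕ → Z) := fun n c => enc ((decList (n, c)).filter (· ∈ B)) with hF
    have hFs : ∀ c, F (n + 1) c = if c 0 ∈ B then consEnc (c 0) (F n fun i => c (i + 1))
        else F n fun i => c (i + 1) := by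
      intro c
      simp only [hF]
      rw [decList_succ, List.filter_cons]
      by_cases h : c 0 ∈ B
      · simp [h, enc_cons]
      · simp [h]
    have hcons : MeasurableSet {p : Z × (ℕ × (ℕ → Z)) | consEnc p.1 p.2 ∈ A} :=
      measurable_consEnc hA
    have hsplit : F (n + 1) ⁻¹' A = (fun c => (c 0, fun i => c (i + 1))) ⁻¹'
        ((B ×ˢ Set.univ) ∩ {p | consEnc p.1 (F n p.2) ∈ A} ∪ Bᶜ ×ˢ (F n ⁻¹' A)) := by
      ext c
      rw [Set.mem_preimage, hFs]
      by_cases h : c 0 ∈ B <;> simp [h]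
    have hmF := hm n
    have hS1 : MeasurableSet {p : Z × (ℕ → Z) | consEnc p.1 (F n p.2) ∈ A} :=
      (measurable_consEnc.comp (by fun_prop : Measurable fun p : Z × (ℕ → Z) => (p.1, F n p.2))) hA
    have hS2 : MeasurableSet (Bᶜ ×ˢ (F n ⁻¹' A)) := hB.compl.prod (hmF hA)
    have hdisj : Disjoint ((B ×ˢ Set.univ) ∩ {p : Z × (ℕ → Z) | consEnc p.1 (F n p.2) ∈ A})
        (Bᶜ ×ˢ (F n ⁻¹' A)) := by
      rw [Set.disjoint_left]
      rintro ⟨z, c⟩ ⟨⟨h1, -⟩, -⟩ ⟨h2, -⟩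
      exact h2 h1
    rw [hsplit, ← Measure.map_apply (by fun_prop)
      (((hB.prod MeasurableSet.univ).inter hS1).union hS2), hP, infinitePi_map_head_tail, ← hP,
      measure_union hdisj hS2, Measure.prod_prod, ih hA]
    have h1 : (μ.prod P) ((B ×ˢ Set.univ) ∩ {p | consEnc p.1 (F n p.2) ∈ A}) =
        μ B * ∫⁻ z, P (F n ⁻¹' {e | consEnc z e ∈ A}) ∂ρ := by
      rw [Set.inter_comm, ← Measure.restrict_apply hS1, ← Measure.restrict_univ (μ := P),
        ← Measure.prod_restrict, Measure.restrict_univ, hρ, Measure.prod_apply hS1,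
        lintegral_smul_measure]
      rfl
    have h2 : ∀ i, ∫⁻ z, listLaw ρ i {e | consEnc z e ∈ A} ∂ρ = listLaw ρ (i + 1) A := by
      intro i
      rw [listLaw_succ, Measure.map_apply measurable_consEnc hA,
        Measure.prod_apply (measurable_consEnc hA)]
      rfl
    have h3 : ∀ z, MeasurableSet {e : ℕ × (ℕ → Z) | consEnc z e ∈ A} := fun z =>
      measurable_prodMk_left hcons
    rw [h1]
    have h4 : ∀ z, P (F n ⁻¹' {e | consEnc z e ∈ A}) = _ := fun z => ih (h3 z)
    simp_rw [h4]
    have hmeas : ∀ i, Measurable fun z => listLaw ρ i {e | consEnc z e ∈ A} := fun i =>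
      measurable_measure_prodMk_left hcons
    rw [lintegral_finsetSum _ (fun ij _ => ((hmeas ij.1).const_mul _).const_mul _)]
    have h5 : ∀ ij : ℕ × ℕ, ∫⁻ z, (n.choose ij.1 : ℝ≥0∞) * (μ B ^ ij.1 * μ Bᶜ ^ ij.2 *
        listLaw ρ ij.1 {e | consEnc z e ∈ A}) ∂ρ = (n.choose ij.1 : ℝ≥0∞) *
        (μ B ^ ij.1 * μ Bᶜ ^ ij.2 * listLaw ρ (ij.1 + 1) A) := fun ij => by
      rw [lintegral_const_mul _ ((hmeas _).const_mul _), lintegral_const_mul _ (hmeas _), h2]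
    simp_rw [h5]
    rw [add_comm, Finset.mul_sum, Finset.mul_sum]
    congr 1
    · exact Finset.sum_congr rfl fun ij _ => by rw [pow_succ]; ring
    · refine Finset.sum_congr rfl fun ij hij => ?_
      rw [Finset.HasAntidiagonal.mem_antidiagonal] at hij
      rw [← hij, ← Nat.choose_symm_add, pow_succ]; ring

/-- The law of the number of objects which remain if each of a random number with law `a` of
objects is kept with probability `w` and deleted with probability `r`. -/
noncomputable def thin (a : Measure ℕ) (w r : ℝ≥0∞) (k : ℕ) : ℝ≥0∞ :=
  ∑' j : ℕ, a {k + j} * ((k + j).choose k * (w ^ k * r ^ j))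

open Classical in
theorem prod_filter_decList (a : Measure ℕ) [SFinite a] (μ : Measure Z) [IsProbabilityMeasure μ]
    {B : Set Z} (hB : MeasurableSet B) (ρ : Measure Z) [IsProbabilityMeasure ρ]
    (hρ : μ.restrict B = μ B • ρ) {A : Set (ℕ × (ℕ → Z))} (hA : MeasurableSet A) :
    (a.prod (Measure.infinitePi fun _ : ℕ => μ)).map
        (fun e => enc ((decList e).filter (· ∈ B))) A =
      ∑' k, thin a (μ B) (μ Bᶜ) k * listLaw ρ k A := by
  rw [Measure.map_apply (measurable_enc_filter_decList hB) hA,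
    Measure.prod_apply (measurable_enc_filter_decList hB hA), lintegral_countable']
  have h1 : ∀ n : ℕ, (Measure.infinitePi fun _ : ℕ => μ) (Prod.mk n ⁻¹'
      ((fun e => enc ((decList e).filter (· ∈ B))) ⁻¹' A)) = ∑ ij ∈ Finset.HasAntidiagonal.antidiagonal n,
        (n.choose ij.1 : ℝ≥0∞) * (μ B ^ ij.1 * μ Bᶜ ^ ij.2 * listLaw ρ ij.1 A) := fun n =>
    map_filter_decList μ hB ρ hρ n hA
  simp_rw [h1, thin, ← ENNReal.tsum_mul_right, Finset.sum_mul]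
  -- Both sides are sums over pairs of kept and deleted objects, on one side grouped by their total
  -- number.
  rw [← ENNReal.tsum_prod (f := fun k j => a {k + j} * ((k + j).choose k * (μ B ^ k * μ Bᶜ ^ j)) *
    listLaw ρ k A), ← Finset.HasAntidiagonal.sigmaAntidiagonalEquivProd.tsum_eq, ENNReal.tsum_sigma']
  refine tsum_congr fun n => ?_
  rw [tsum_fintype, Finset.univ_eq_attach, ← Finset.sum_attach]
  refine Finset.sum_congr rfl fun ij _ => ?_
  have := Finset.HasAntidiagonal.mem_antidiagonal.1 ij.2
  simp only [Finset.HasAntidiagonal.sigmaAntidiagonalEquivProd_apply, this]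
  ring

end Thinning

/-! ### The law of the decorated Galton-Watson tree -/

noncomputable def unifLaw : Measure ℝ := volume.restrict (Set.Ico 0 1)

instance : IsProbabilityMeasure unifLaw := ⟨by simp [unifLaw]⟩

noncomputable def rootLaw (q : PMF ℕ) (κ : ProbabilityMeasure ℝ) : Measure (ℕ × ℝ × ℝ) :=
  q.toMeasure.prod ((κ : Measure ℝ).prod unifLaw)

instance (q : PMF ℕ) (κ : ProbabilityMeasure ℝ) : IsProbabilityMeasure (rootLaw q κ) := by
  unfold rootLaw; infer_instance

noncomputable def dataLaw (q : PMF ℕ) (κ : ProbabilityMeasure ℝ) : Measure TreeData :=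
  Measure.infinitePi fun _ => rootLaw q κ

instance (q : PMF ℕ) (κ : ProbabilityMeasure ℝ) : IsProbabilityMeasure (dataLaw q κ) := by
  unfold dataLaw; infer_instance

/-- A reduced tree takes the default value off its individuals, so its law as a decorated tree is to
be compared with that of a pruned tree. -/
noncomputable def prunedLaw (q : PMF ℕ) (κ : ProbabilityMeasure ℝ) : Measure TreeData :=
  (dataLaw q κ).map TreeData.prune

instance (q : PMF ℕ) (κ : ProbabilityMeasure ℝ) : IsProbabilityMeasure (prunedLaw q κ) :=
  Measure.isProbabilityMeasure_map TreeData.measurable_prune.aemeasurable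

namespace TreeData

variable (q : PMF ℕ) (κ : ProbabilityMeasure ℝ)

theorem dataLaw_map_root_sub :
    (dataLaw q κ).map (fun x => (x [], x.sub)) =
      (rootLaw q κ).prod (Measure.infinitePi fun _ : ℕ => dataLaw q κ) :=
  infinitePi_map_root_sub (rootLaw q κ)

theorem measurable_root_sub : Measurable fun x : TreeData => (x [], x.sub) :=
  (measurable_pi_apply []).prodMk (measurable_pi_lambda _ measurable_sub)

theorem dataLaw_map_children :
    (dataLaw q κ).map (fun x => (((x []).1, x.sub), (x []).2)) =
      (q.toMeasure.prod (Measure.infinitePi fun _ : ℕ => dataLaw q κ)).prod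
        ((κ : Measure ℝ).prod unifLaw) := by
  set P := Measure.infinitePi fun _ : ℕ => dataLaw q κ
  set m := (κ : Measure ℝ).prod unifLaw
  have h1 : MeasurePreserving (MeasurableEquiv.prodAssoc : (ℕ × (ℝ × ℝ)) × (ℕ → TreeData) ≃ᵐ _)
      ((q.toMeasure.prod m).prod P) (q.toMeasure.prod (m.prod P)) := measurePreserving_prodAssoc _ _ _
  have h2 : MeasurePreserving (Prod.map id Prod.swap) (q.toMeasure.prod (m.prod P))
      (q.toMeasure.prod (P.prod m)) :=
    (MeasurePreserving.id _).prod Measure.measurePreserving_swap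
  have h3 : MeasurePreserving (MeasurableEquiv.prodAssoc.symm :
      ℕ × (ℕ → TreeData) × (ℝ × ℝ) ≃ᵐ (ℕ × (ℕ → TreeData)) × (ℝ × ℝ))
      (q.toMeasure.prod (P.prod m)) ((q.toMeasure.prod P).prod m) :=
    (measurePreserving_prodAssoc _ _ _).symm _
  have h4 : MeasurePreserving (fun x : TreeData => (x [], x.sub)) (dataLaw q κ)
      ((q.toMeasure.prod m).prod P) := ⟨measurable_root_sub, dataLaw_map_root_sub q κ⟩
  exact (h3.comp (h2.comp (h1.comp h4))).map_eq

/-- The law of the tree with independent subtrees above the children of the root, with law `ρ`. -/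
noncomputable def graftLaw (ρ : Measure TreeData) [IsProbabilityMeasure ρ] : Measure TreeData :=
  ((q.toMeasure.prod (Measure.infinitePi fun _ : ℕ => ρ)).prod
    ((κ : Measure ℝ).prod unifLaw)).map nodeEnc

theorem prune_eq_nodeEnc (x : TreeData) :
    prune x = nodeEnc (((x []).1, fun i => prune (x.sub i)), (x []).2) := by
  funext w
  cases w <;> rfl

theorem prunedLaw_eq_graftLaw : prunedLaw q κ = graftLaw q κ (prunedLaw q κ) := by
  have h1 := Measure.infinitePi_map_pi (fun _ : ℕ => dataLaw q κ) (f := fun _ => prune)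
    (fun _ => measurable_prune)
  have hp : Measurable fun (c : ℕ → TreeData) i => prune (c i) :=
    measurable_pi_lambda _ fun i => measurable_prune.comp (measurable_pi_apply i)
  have h2 : prune = nodeEnc ∘ Prod.map (Prod.map id fun (c : ℕ → TreeData) i => prune (c i)) id ∘
      fun x : TreeData => (((x []).1, x.sub), (x []).2) := by
    funext x; exact prune_eq_nodeEnc x
  have h3 : Measurable fun x : TreeData => (((x []).1, x.sub), (x []).2) :=
    measurable_children.prodMk (by fun_prop)
  conv_lhs => rw [prunedLaw, h2]
  have hp1 := (measurable_id : Measurable (id : ℕ → ℕ)).prodMap hp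
  have hp2 := hp1.prodMap (measurable_id : Measurable (id : ℝ × ℝ → ℝ × ℝ))
  rw [← Measure.map_map measurable_nodeEnc (hp2.comp h3), ← Measure.map_map hp2 h3,
    dataLaw_map_children, ← Measure.map_prod_map _ _ hp1 measurable_id,
    ← Measure.map_prod_map _ _ measurable_id hp, h1, Measure.map_id, Measure.map_id]
  rfl

/-- Forgets what happens in the generations from `n` on. -/
def trunc (n : ℕ) (x : TreeData) : TreeData := fun w => if w.length < n then x w else default

theorem measurable_trunc (n : ℕ) : Measurable (trunc n) := by
  refine measurable_pi_lambda _ fun w => ?_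
  by_cases h : w.length < n
  · simpa [trunc, h] using measurable_pi_apply w
  · simp [trunc, h]

theorem trunc_nodeEnc (n : ℕ) (p : (ℕ × (ℕ → TreeData)) × ℝ × ℝ) :
    trunc (n + 1) (nodeEnc p) =
      trunc (n + 1) (nodeEnc ((p.1.1, fun i => trunc n (p.1.2 i)), p.2)) := by
  funext w
  cases w with
  | nil => rfl
  | cons i w => by_cases h : w.length < n <;> simp [trunc, nodeEnc, h]

/-- The first `n + 1` generations of a grafted tree involve only the first `n` generations of the
grafted subtrees. -/
theorem map_trunc_graftLaw (ρ : Measure TreeData) [IsProbabilityMeasure ρ] (n : ℕ)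
    [IsProbabilityMeasure (ρ.map (trunc n))] :
    (graftLaw q κ ρ).map (trunc (n + 1)) = (graftLaw q κ (ρ.map (trunc n))).map (trunc (n + 1)) := by
  have h1 := Measure.infinitePi_map_pi (fun _ : ℕ => ρ) (f := fun _ => trunc n)
    (fun _ => measurable_trunc n)
  have hp : Measurable fun (c : ℕ → TreeData) i => trunc n (c i) :=
    measurable_pi_lambda _ fun i => (measurable_trunc n).comp (measurable_pi_apply i)
  have h2 : trunc (n + 1) ∘ nodeEnc = (trunc (n + 1) ∘ nodeEnc) ∘
      Prod.map (Prod.map id fun (c : ℕ → TreeData) i => trunc n (c i)) id := by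
    funext p; exact trunc_nodeEnc n p
  have hm := (measurable_trunc (n + 1)).comp measurable_nodeEnc
  have hp1 := (measurable_id : Measurable (id : ℕ → ℕ)).prodMap hp
  have hp2 := hp1.prodMap (measurable_id : Measurable (id : ℝ × ℝ → ℝ × ℝ))
  rw [graftLaw, graftLaw, Measure.map_map (measurable_trunc _) measurable_nodeEnc, h2,
    ← Measure.map_map hm hp2, ← Measure.map_prod_map _ _ hp1 measurable_id,
    ← Measure.map_prod_map _ _ measurable_id hp, h1, Measure.map_id, Measure.map_id,
    Measure.map_map (measurable_trunc _) measurable_nodeEnc]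

/-- Finite-dimensional marginals involve only finitely many generations. -/
theorem eq_of_map_trunc {ρ ρ' : Measure TreeData} [IsProbabilityMeasure ρ] [IsProbabilityMeasure ρ']
    (h : ∀ n, ρ.map (trunc n) = ρ'.map (trunc n)) : ρ = ρ' := by
  refine IsProjectiveLimit.unique (P := fun I : Finset (List ℕ) => ρ'.map I.restrict) ?_
    (fun I => rfl)
  intro I
  obtain ⟨n, hn⟩ : ∃ n, ∀ w ∈ I, w.length < n :=
    ⟨I.sup List.length + 1, fun w hw => Nat.lt_succ_of_le (Finset.le_sup (f := List.length) hw)⟩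
  have h1 : (I.restrict : TreeData → _) = I.restrict ∘ trunc n := by
    funext x w
    simp [trunc, hn w.1 w.2]
  simp only
  rw [h1, ← Measure.map_map (Finset.measurable_restrict I) (measurable_trunc n), h,
    Measure.map_map (Finset.measurable_restrict I) (measurable_trunc n)]

/-- The branching property fixes the law of the first `n` generations, by induction on `n`. This is
the criterion by which the reduced tree is recognised as a Galton-Watson tree. -/
theorem eq_prunedLaw_of_eq_graftLaw {ρ : Measure TreeData} [IsProbabilityMeasure ρ]
    (h : ρ = graftLaw q κ ρ) : ρ = prunedLaw q κ := by
  refine eq_of_map_trunc fun n => ?_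
  have hp : ∀ (n : ℕ) (ρ : Measure TreeData) [IsProbabilityMeasure ρ],
      IsProbabilityMeasure (ρ.map (trunc n)) := fun n ρ _ =>
    Measure.isProbabilityMeasure_map (measurable_trunc n).aemeasurable
  induction n with
  | zero =>
    have : trunc 0 = fun _ => default := by funext x w; simp [trunc]
    rw [this]
    simp
  | succ n ih =>
    have := hp n ρ
    have := hp n (prunedLaw q κ)
    conv_lhs => rw [h]
    conv_rhs => rw [prunedLaw_eq_graftLaw]
    rw [map_trunc_graftLaw q κ ρ, map_trunc_graftLaw q κ (prunedLaw q κ)]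
    simp only [ih]

/-- The lifetime of the root is independent of everything else. -/
theorem dataLaw_map_prodMk_lifetime {Y : Type*} [MeasurableSpace Y] {f : TreeData → Y}
    (hf : Measurable f) (hinv : ∀ z x, f (prolong z x) = f x) :
    (dataLaw q κ).map (fun x => (f x, (x []).2.1)) = ((dataLaw q κ).map f).prod (κ : Measure ℝ) := by
  set P := Measure.infinitePi fun _ : ℕ => dataLaw q κ
  set a := q.toMeasure.prod P
  -- Rebuilds the tree with root lifetime `0`; by invariance `f` factors through `g`, whose argument
  -- does not contain the lifetime of the root.
  let g : (ℕ × (ℕ → TreeData)) × ℝ → TreeData := fun p w =>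
    match w with
    | [] => (p.1.1, 0, p.2)
    | i :: w => p.1.2 i w
  have hg : Measurable g := by
    refine measurable_pi_lambda _ fun w => ?_
    cases w with
    | nil => exact (by fun_prop : Measurable fun p : (ℕ × (ℕ → TreeData)) × ℝ =>
        (p.1.1, (0 : ℝ), p.2))
    | cons i w => exact (by fun_prop : Measurable fun p : (ℕ × (ℕ → TreeData)) × ℝ => p.1.2 i w)
  have h1 : MeasurePreserving (Prod.map id Prod.swap) (a.prod ((κ : Measure ℝ).prod unifLaw))
      (a.prod (unifLaw.prod (κ : Measure ℝ))) :=
    (MeasurePreserving.id _).prod Measure.measurePreserving_swap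
  have h2 : MeasurePreserving (MeasurableEquiv.prodAssoc.symm :
      (ℕ × (ℕ → TreeData)) × (ℝ × ℝ) ≃ᵐ ((ℕ × (ℕ → TreeData)) × ℝ) × ℝ)
      (a.prod (unifLaw.prod (κ : Measure ℝ))) ((a.prod unifLaw).prod (κ : Measure ℝ)) :=
    (measurePreserving_prodAssoc _ _ _).symm _
  have h3 : MeasurePreserving (fun x : TreeData => (((x []).1, x.sub), (x []).2)) (dataLaw q κ)
      (a.prod ((κ : Measure ℝ).prod unifLaw)) :=
    ⟨measurable_children.prodMk (by fun_prop), dataLaw_map_children q κ⟩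
  have h4 := h2.comp (h1.comp h3)
  have h5 : ∀ x : TreeData, f x = f (g (((x []).1, x.sub), (x []).2.2)) := by
    intro x
    rw [← hinv (-(x []).2.1) x]
    congr 1
    funext w
    cases w with
    | nil => simp [prolong, g]
    | cons i w => rfl
  have h6 : (dataLaw q κ).map f = (a.prod unifLaw).map (f ∘ g) := by
    have : f = (f ∘ g) ∘ Prod.fst ∘ (MeasurableEquiv.prodAssoc.symm ∘ Prod.map id Prod.swap ∘
        fun x : TreeData => (((x []).1, x.sub), (x []).2)) := by
      funext x; exact h5 x
    conv_lhs => rw [this]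
    rw [← Measure.map_map (hf.comp hg) (measurable_fst.comp h4.measurable),
      ← Measure.map_map measurable_fst h4.measurable, h4.map_eq]
    congr 1
    exact Measure.fst_prod
  have h7 : (fun x : TreeData => (f x, (x []).2.1)) = Prod.map (f ∘ g) id ∘
      (MeasurableEquiv.prodAssoc.symm ∘ Prod.map id Prod.swap ∘
        fun x : TreeData => (((x []).1, x.sub), (x []).2)) := by
    funext x
    exact Prod.ext (h5 x) rfl
  rw [h6, h7, ← Measure.map_map ((hf.comp hg).prodMap measurable_id) h4.measurable, h4.map_eq,
    ← Measure.map_prod_map _ _ (hf.comp hg) measurable_id, Measure.map_id]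

end TreeData

/-! ### The law of the black children of the root -/

namespace TreeData

/-- The trees with a black root. -/
def blk (s : ℝ) : Set TreeData := {x | ¬ IsRed s x}

theorem measurableSet_blk (s : ℝ) : MeasurableSet (blk s) := (measurableSet_isRed s).compl

theorem compl_blk (s : ℝ) : (blk s)ᶜ = {x | IsRed s x} := by ext; simp [blk]

/-- The conditional law given `B`, in a form that also makes sense for null sets `B`, where any `ρ`
serves. -/
theorem exists_restrict_eq_smul {Z : Type*} [Inhabited Z] [MeasurableSpace Z] (μ : Measure Z)
    [IsFiniteMeasure μ] (B : Set Z) :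
    ∃ ρ : Measure Z, IsProbabilityMeasure ρ ∧ μ.restrict B = μ B • ρ := by
  by_cases h : μ B = 0
  · exact ⟨Measure.dirac default, inferInstance, by simp [h]⟩
  · refine ⟨(μ B)⁻¹ • μ.restrict B, ⟨?_⟩, ?_⟩
    · simp [ENNReal.inv_mul_cancel h (measure_ne_top _ _)]
    · rw [smul_smul, ENNReal.mul_inv_cancel h (measure_ne_top _ _), one_smul]

variable (q : PMF ℕ) (κ : ProbabilityMeasure ℝ) (s : ℝ)

theorem toMeasure_singleton_nat (n : ℕ) : q.toMeasure {n} = q n := by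
  rw [PMF.toMeasure_apply_singleton _ _ (measurableSet_singleton n)]

theorem kids_eq_filter_blk (x : TreeData) : kids s x =
    (decList ((x []).1, x.sub)).filter (by classical exact fun y => decide (y ∈ blk s)) := by
  rw [decList_children, kids]
  exact List.filter_congr fun y _ => decide_eq_decide.2 Iff.rfl

theorem dataLaw_map_kids :
    (dataLaw q κ).map (fun x => (enc (kids s x), (x []).2)) =
      ((dataLaw q κ).map fun x => enc (kids s x)).prod ((κ : Measure ℝ).prod unifLaw) := by
  classical
  set F : ℕ × (ℕ → TreeData) → ℕ × (ℕ → TreeData) :=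
    fun e => enc ((decList e).filter (· ∈ blk s))
  have hF : Measurable F := measurable_enc_filter_decList (measurableSet_blk s)
  have h3 : Measurable fun x : TreeData => (((x []).1, x.sub), (x []).2) :=
    measurable_children.prodMk (by fun_prop)
  have h4 : ∀ x : TreeData, enc (kids s x) = F ((x []).1, x.sub) := fun x => by
    rw [kids_eq_filter_blk]
  have e1 : (fun x : TreeData => (enc (kids s x), (x []).2)) =
      Prod.map F id ∘ fun x : TreeData => (((x []).1, x.sub), (x []).2) := by
    funext x; exact Prod.ext (h4 x) rfl
  have e2 : (fun x : TreeData => enc (kids s x)) =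
      F ∘ Prod.fst ∘ fun x : TreeData => (((x []).1, x.sub), (x []).2) := by
    funext x; exact h4 x
  rw [e1, e2, ← Measure.map_map (by fun_prop) h3, ← Measure.map_map hF (measurable_fst.comp h3),
    ← Measure.map_map measurable_fst h3, dataLaw_map_children, ← Measure.map_prod_map _ _ hF
    measurable_id, Measure.map_id]
  congr 2
  exact (Measure.fst_prod).symm

theorem dataLaw_enc_kids (ρ : Measure TreeData) [IsProbabilityMeasure ρ]
    (hρ : (dataLaw q κ).restrict (blk s) = dataLaw q κ (blk s) • ρ)
    {A : Set (ℕ × (ℕ → TreeData))} (hA : MeasurableSet A) :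
    (dataLaw q κ).map (fun x => enc (kids s x)) A =
      ∑' k, thin q.toMeasure (dataLaw q κ (blk s)) (dataLaw q κ (blk s)ᶜ) k * listLaw ρ k A := by
  classical
  rw [← prod_filter_decList q.toMeasure (dataLaw q κ) (measurableSet_blk s) ρ hρ hA]
  have h3 : Measurable fun x : TreeData => (((x []).1, x.sub), (x []).2) :=
    measurable_children.prodMk (by fun_prop)
  have h := congrArg (Measure.map Prod.fst) (dataLaw_map_children q κ)
  rw [Measure.map_map measurable_fst h3] at h
  have h' : (dataLaw q κ).map (fun x => ((x []).1, x.sub)) =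
      q.toMeasure.prod (Measure.infinitePi fun _ : ℕ => dataLaw q κ) := h.trans Measure.fst_prod
  rw [← h', Measure.map_map (measurable_enc_filter_decList (measurableSet_blk s))
    measurable_children]
  congr 2
  funext x
  rw [kids_eq_filter_blk]
  rfl

theorem dataLaw_map_root : (dataLaw q κ).map (fun x => x []) = rootLaw q κ :=
  Measure.infinitePi_map_eval (fun _ : List ℕ => rootLaw q κ) []

theorem measurableSet_length_kids (S : Set ℕ) : MeasurableSet {x | (kids s x).length ∈ S} :=
  measurable_length_kids s (MeasurableSet.of_discrete)

theorem dataLaw_length_kids (k : ℕ) :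
    dataLaw q κ {x | (kids s x).length = k} =
      thin q.toMeasure (dataLaw q κ (blk s)) (dataLaw q κ (blk s)ᶜ) k := by
  obtain ⟨ρ, hρ, h⟩ := exists_restrict_eq_smul (dataLaw q κ) (blk s)
  have hA : MeasurableSet {e : ℕ × (ℕ → TreeData) | e.1 = k} :=
    measurableSet_eq_fun measurable_fst measurable_const
  have h1 := dataLaw_enc_kids q κ s ρ h hA
  rw [Measure.map_apply (measurable_enc_kids s) hA] at h1
  refine h1.trans ?_
  have h2 : ∀ j, listLaw ρ j {e : ℕ × (ℕ → TreeData) | e.1 = k} = if j = k then 1 else 0 := by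
    intro j
    split_ifs with hj
    · subst hj
      exact (prob_compl_eq_zero_iff hA).1 (listLaw_fst_eq ρ j)
    · rw [measure_eq_zero_iff_ae_notMem]
      filter_upwards [listLaw_fst_eq ρ j] with e he
      simpa [he] using hj
  simp_rw [h2]
  simp

theorem isRed_iff_kids {x : TreeData} :
    IsRed s x ↔ kids s x = [] ∧ ¬ ((x []).1 = 0 ∧ (x []).2.2 < s) := by
  constructor
  · intro h
    obtain ⟨h0, h1⟩ := isRed_iff.1 h
    refine ⟨?_, fun h' => absurd (h0 h'.1) (not_le.2 h'.2)⟩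
    rw [kids, List.filter_eq_nil_iff]
    intro y hy
    simpa using h1 y hy
  · rintro ⟨h, h'⟩
    refine isRed_iff.2 ⟨fun h0 => not_lt.1 fun h2 => h' ⟨h0, h2⟩, fun y hy => ?_⟩
    by_contra hb
    have := mem_kids.2 ⟨hy, hb⟩
    simp [h] at this

theorem kids_eq_nil_of_leaf {x : TreeData} (h : (x []).1 = 0) : kids s x = [] := by
  simp [kids, childList, h]

variable {s}

/-- Scaling of Lebesgue measure: this is why rescaled marks are uniform again. For `s = 0` both
sides vanish, marks being nonnegative. -/
theorem unifLaw_black_leaf (h0 : 0 ≤ s) (h1 : s ≤ 1) {C : Set ℝ} (hC : MeasurableSet C) :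
    unifLaw {u | u < s ∧ u / s ∈ C} = ENNReal.ofReal s * unifLaw C := by
  have hm : MeasurableSet {u : ℝ | u < s ∧ u / s ∈ C} :=
    (measurableSet_lt measurable_id measurable_const).inter
      ((measurable_id.div_const s) hC)
  rcases h0.eq_or_lt with rfl | hs
  · rw [ENNReal.ofReal_zero, zero_mul, unifLaw, Measure.restrict_apply hm]
    convert measure_empty (μ := volume)
    ext u
    simp only [Set.mem_inter_iff, Set.mem_ofPred, Set.mem_Ico, Set.mem_empty_iff_false, iff_false]
    intro h
    linarith [h.1.1, h.2.1]
  · rw [unifLaw, Measure.restrict_apply hm, Measure.restrict_apply hC]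
    have : {u | u < s ∧ u / s ∈ C} ∩ Set.Ico 0 1 = (s⁻¹ * ·) ⁻¹' (C ∩ Set.Ico 0 1) := by
      ext u
      simp only [Set.mem_inter_iff, Set.mem_ofPred, Set.mem_Ico, Set.mem_preimage, div_eq_inv_mul]
      have e1 : s⁻¹ * u < 1 ↔ u < s := by rw [inv_mul_lt_iff₀ hs, mul_one]
      have e2 : 0 ≤ s⁻¹ * u ↔ 0 ≤ u := by
        rw [mul_nonneg_iff_of_pos_left (inv_pos.2 hs)]
      rw [e1, e2]
      constructor
      · rintro ⟨⟨a, b⟩, c, d⟩; exact ⟨b, c, a⟩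
      · rintro ⟨b, c, a⟩; exact ⟨⟨a, b⟩, c, a.trans_le h1⟩
    rw [this, Real.volume_preimage_mul_left (inv_pos.2 hs).ne', inv_inv, abs_of_pos hs]

theorem dataLaw_black_leaf (h0 : 0 ≤ s) (h1 : s ≤ 1) {C : Set ℝ} (hC : MeasurableSet C) :
    dataLaw q κ {x | (x []).1 = 0 ∧ (x []).2.2 < s ∧ (x []).2.2 / s ∈ C} =
      q 0 * ENNReal.ofReal s * unifLaw C := by
  have hm : MeasurableSet {u : ℝ | u < s ∧ u / s ∈ C} :=
    (measurableSet_lt measurable_id measurable_const).inter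
      ((measurable_id.div_const s) hC)
  have h2 : {x : TreeData | (x []).1 = 0 ∧ (x []).2.2 < s ∧ (x []).2.2 / s ∈ C} =
      (fun x => x []) ⁻¹' ({0} ×ˢ (Set.univ ×ˢ {u | u < s ∧ u / s ∈ C})) := by
    ext x; simp
  rw [h2, ← Measure.map_apply (measurable_pi_apply []) ((measurableSet_singleton 0).prod
    (MeasurableSet.univ.prod hm)), dataLaw_map_root, rootLaw, Measure.prod_prod, Measure.prod_prod,
    toMeasure_singleton_nat, measure_univ, one_mul, unifLaw_black_leaf h0 h1 hC, mul_assoc]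

theorem dataLaw_black_leaf_univ (h0 : 0 ≤ s) (h1 : s ≤ 1) :
    dataLaw q κ {x | (x []).1 = 0 ∧ (x []).2.2 < s} = q 0 * ENNReal.ofReal s := by
  simpa using dataLaw_black_leaf q κ h0 h1 MeasurableSet.univ

/-- The equation for the probability that the root is red. -/
theorem tsum_red_prob (h0 : 0 ≤ s) (h1 : s ≤ 1) :
    ∑' j, q j * dataLaw q κ (blk s)ᶜ ^ j = dataLaw q κ (blk s)ᶜ + q 0 * ENNReal.ofReal s := by
  have h2 := dataLaw_length_kids q κ s 0
  have h3 : {x | (kids s x).length = 0} = (blk s)ᶜ ∪ {x | (x []).1 = 0 ∧ (x []).2.2 < s} := by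
    ext x
    rw [compl_blk]
    simp only [List.length_eq_zero_iff, Set.mem_ofPred, Set.mem_union, isRed_iff_kids]
    constructor
    · intro h; by_cases h' : (x []).1 = 0 ∧ (x []).2.2 < s
      · exact Or.inr h'
      · exact Or.inl ⟨h, h'⟩
    · rintro (h | h)
      · exact h.1
      · exact kids_eq_nil_of_leaf s h.1
  have hm : MeasurableSet {x : TreeData | (x []).1 = 0 ∧ (x []).2.2 < s} :=
    (measurableSet_eq_fun (by fun_prop : Measurable fun x : TreeData => (x []).1)
      measurable_const).inter
      (measurableSet_lt (by fun_prop : Measurable fun x : TreeData => (x []).2.2) measurable_const)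
  rw [h3, measure_union _ hm, dataLaw_black_leaf_univ q κ h0 h1] at h2
  · rw [h2, thin]
    simp [toMeasure_singleton_nat]
  · rw [Set.disjoint_left]
    intro x hx hx'
    rw [compl_blk] at hx
    exact ((isRed_iff_kids s).1 hx).2 hx'

/-- The conditional probability, given that the root is black, that it has exactly one black
child. -/
noncomputable def singleProb (q : PMF ℕ) (r : ℝ≥0∞) : ℝ≥0∞ :=
  ∑' j : ℕ, q (j + 1) * ((j + 1 : ℕ) * r ^ j)

theorem thin_one (w r : ℝ≥0∞) : thin q.toMeasure w r 1 = w * singleProb q r := by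
  rw [thin, singleProb, ← ENNReal.tsum_mul_left]
  refine tsum_congr fun j => ?_
  rw [toMeasure_singleton_nat, Nat.choose_one_right, add_comm 1 j]
  ring

-- The only black child carries a tree with the conditional law of a black tree; the probability of
-- exactly one black child is `w * singleProb`, and the factor `w` cancels the normalisation of that
-- conditional law.
variable (s) in
theorem dataLaw_single {V : Set TreeData} (hV : MeasurableSet V) :
    dataLaw q κ {x | (kids s x).length = 1 ∧ (enc (kids s x)).2 0 ∈ V} =
      singleProb q (dataLaw q κ (blk s)ᶜ) * dataLaw q κ (V ∩ blk s) := by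
  obtain ⟨ρ, hρ, h⟩ := exists_restrict_eq_smul (dataLaw q κ) (blk s)
  have hA : MeasurableSet {e : ℕ × (ℕ → TreeData) | e.1 = 1 ∧ e.2 0 ∈ V} :=
    (measurableSet_eq_fun measurable_fst measurable_const).inter
      (((measurable_pi_apply 0).comp measurable_snd) hV)
  have h1 := dataLaw_enc_kids q κ s ρ h hA
  rw [Measure.map_apply (measurable_enc_kids s) hA] at h1
  refine h1.trans ?_
  rw [tsum_eq_single 1]
  · have h2 : listLaw ρ 1 {e : ℕ × (ℕ → TreeData) | e.1 = 1 ∧ e.2 0 ∈ V} = ρ V := by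
      have hV' : ρ V = (Measure.infinitePi fun _ : ℕ => ρ) ((fun c => c 0) ⁻¹' V) := by
        rw [← Measure.map_apply (measurable_pi_apply 0) hV]
        exact (DFunLike.congr_fun (Measure.infinitePi_map_eval (fun _ : ℕ => ρ) 0) V).symm
      rw [listLaw, Measure.map_apply (measurable_enc_decList_mk 1) hA, hV']
      congr 1
      ext c
      have : decList (1, c) = [c 0] := by simp [decList]
      rw [Set.mem_preimage, this]
      simp [enc]
    rw [h2, thin_one, mul_comm (dataLaw q κ (blk s)), mul_assoc, ← smul_eq_mul (a := dataLaw q κ _),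
      ← Measure.smul_apply, ← h, Measure.restrict_apply hV]
  · intro j hj
    rw [mul_eq_zero]
    right
    rw [measure_eq_zero_iff_ae_notMem]
    filter_upwards [listLaw_fst_eq ρ j] with e he h'
    exact hj (he.symm.trans h'.1)

theorem not_isRed_of_length {x : TreeData} (h : (kids s x).length ≠ 0) : ¬ IsRed s x := fun hr =>
  h (by rw [((isRed_iff_kids s).1 hr).1]; rfl)

/-- The trees with a black root which does not have exactly one black child. -/
def blkNe (s : ℝ) : Set TreeData := blk s ∩ {x | (kids s x).length ≠ 1}

theorem measurableSet_blkNe (s : ℝ) : MeasurableSet (blkNe s) :=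
  (measurableSet_blk s).inter (measurableSet_length_kids s {1}ᶜ)

variable (s) in
theorem dataLaw_blk_eq :
    dataLaw q κ (blk s) = dataLaw q κ (blkNe s) +
      singleProb q (dataLaw q κ (blk s)ᶜ) * dataLaw q κ (blk s) := by
  have h1 := dataLaw_single q κ s MeasurableSet.univ
  simp only [Set.mem_univ, and_true, Set.univ_inter] at h1
  rw [← h1, ← measure_inter_add_sdiff (blk s) (measurableSet_length_kids s {1}ᶜ)]
  congr 2
  ext x
  simp only [Set.mem_sdiff, Set.mem_ofPred, Set.mem_compl_iff, Set.mem_singleton_iff, not_not]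
  exact ⟨fun h => h.2, fun h => ⟨not_isRed_of_length (by omega), h⟩⟩

/-- For `s > 0` the root may be a black leaf. For `s = 0` some number `n ≥ 2` of children has
positive probability, since otherwise `q 0 = 1` and no tree is black; then all `n` children may be
black. -/
theorem dataLaw_blkNe_pos (hq : IsOffspringLaw q) (h0 : 0 ≤ s) (h1 : s ≤ 1)
    (hw : dataLaw q κ (blk s) ≠ 0) : dataLaw q κ (blkNe s) ≠ 0 := by
  rcases h0.eq_or_lt with hs | hs
  · obtain ⟨n, hn2, hn⟩ : ∃ n, 2 ≤ n ∧ q n ≠ 0 := by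
      by_contra! hcon
      have hq0 : q 0 = 1 := by
        have := q.tsum_coe
        rw [tsum_eq_single 0] at this
        · exact this
        · intro n hn
          rcases Nat.lt_or_ge n 2 with h | h
          · have : n = 1 := by omega
            rw [this]; exact hq.2
          · exact hcon n h
      have := tsum_red_prob q κ h0 h1
      rw [tsum_eq_single 0, hq0, ← hs] at this
      · simp only [pow_zero, mul_one, ENNReal.ofReal_zero, mul_zero, add_zero] at this
        rw [← hs] at hw
        rw [prob_compl_eq_one_sub (measurableSet_blk 0)] at this
        have hle : dataLaw q κ (blk 0) ≤ 1 := prob_le_one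
        have h5 := tsub_add_cancel_of_le hle
        rw [← this] at h5
        exact hw ((ENNReal.add_right_inj ENNReal.one_ne_top).1 (h5.trans (add_zero 1).symm))
      · intro n hn
        have : q n = 0 := by
          rcases Nat.lt_or_ge n 2 with h | h
          · have : n = 1 := by omega
            rw [this]; exact hq.2
          · exact hcon n h
        rw [this, zero_mul]
    have h3 := dataLaw_length_kids q κ s n
    have h4 : {x | (kids s x).length = n} ⊆ blkNe s := fun x hx => by
      have hx' : (kids s x).length = n := hx
      refine ⟨not_isRed_of_length (by omega), ?_⟩
      change _ ≠ 1
      omega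
    refine (lt_of_lt_of_le ?_ (measure_mono h4)).ne'
    rw [h3, thin]
    refine lt_of_lt_of_le ?_ (ENNReal.le_tsum 0)
    rw [pos_iff_ne_zero]
    simp [toMeasure_singleton_nat, hn, hw]
  · have h4 : {x | (x []).1 = 0 ∧ (x []).2.2 < s} ⊆ blkNe s := fun x hx => by
      have hk := kids_eq_nil_of_leaf s hx.1
      refine ⟨fun hr => ((isRed_iff_kids s).1 hr).2 hx, ?_⟩
      change _ ≠ 1
      simp [hk]
    refine (lt_of_lt_of_le ?_ (measure_mono h4)).ne'
    rw [dataLaw_black_leaf_univ q κ h0 h1, pos_iff_ne_zero]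
    simp [hq.1.ne', hs]

theorem singleProb_lt_one (hq : IsOffspringLaw q) (h0 : 0 ≤ s) (h1 : s ≤ 1)
    (hw : dataLaw q κ (blk s) ≠ 0) : singleProb q (dataLaw q κ (blk s)ᶜ) < 1 := by
  by_contra! h
  have h2 := dataLaw_blk_eq q κ s
  have h3 : dataLaw q κ (blkNe s) + dataLaw q κ (blk s) ≤ 0 + dataLaw q κ (blk s) := by
    rw [zero_add]
    conv_rhs => rw [h2]
    gcongr
    exact le_mul_of_one_le_left' h
  exact dataLaw_blkNe_pos q κ hq h0 h1 hw
    (le_antisymm ((ENNReal.add_le_add_iff_right (measure_ne_top _ _)).1 h3) zero_le)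

/-- A black tree with an infinite chain has a single black child, whose tree is of the same kind.
The probability `P` of such trees thus satisfies `P ≤ singleProb * P` with `singleProb < 1`. -/
theorem ae_finChain (hq : IsOffspringLaw q) (h0 : 0 ≤ s) (h1 : s ≤ 1) :
    ∀ᵐ x ∂dataLaw q κ, ¬ IsRed s x → FinChain s x := by
  by_cases hw : dataLaw q κ (blk s) = 0
  · have : ∀ᵐ x ∂dataLaw q κ, x ∉ blk s := measure_eq_zero_iff_ae_notMem.1 hw
    filter_upwards [this] with x hx h
    exact absurd h hx
  · have hlt := singleProb_lt_one q κ hq h0 h1 hw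
    have hm := (measurableSet_finChain s).compl
    have h2 := dataLaw_single q κ s hm
    have h3 : {x | FinChain s x}ᶜ ∩ blk s ⊆
        {x | (kids s x).length = 1 ∧ (enc (kids s x)).2 0 ∈ {x | FinChain s x}ᶜ} := by
      rintro x ⟨hx, -⟩
      have hk : (kids s x).length = 1 := by
        by_contra hk; exact hx (finChain_of_length_ne hk)
      obtain ⟨y, hy⟩ := List.length_eq_one_iff.1 hk
      refine ⟨hk, fun h => hx ((finChain_iff_of_kids_eq hy).2 ?_)⟩
      simpa [hy, enc] using h
    have h4 := (measure_mono h3).trans h2.le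
    have h5 : dataLaw q κ ({x | FinChain s x}ᶜ ∩ blk s) = 0 := by
      by_contra hne
      have := ENNReal.mul_lt_mul_left hne (measure_ne_top _ _) hlt
      rw [one_mul] at this
      exact absurd h4 (not_le.2 this)
    filter_upwards [measure_eq_zero_iff_ae_notMem.1 h5] with x hx hb
    by_contra hcon
    exact hx ⟨hcon, hb⟩

end TreeData

/-! ### Geometric sums, in terms of characteristic functions -/

theorem charFun_smul_ennreal (μ : Measure ℝ) (c : ℝ≥0∞) (t : ℝ) :
    charFun (c • μ) t = c.toReal * charFun μ t := by
  simp [charFun, integral_smul_measure]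

theorem integrable_charFun_integrand (μ : Measure ℝ) [IsFiniteMeasure μ] (t : ℝ) :
    Integrable (fun x : ℝ => Complex.exp (inner ℝ x t * Complex.I)) μ := by
  refine (integrable_const (1 : ℝ)).mono' (by fun_prop) (ae_of_all _ fun x => ?_)
  rw [Complex.norm_exp_ofReal_mul_I]

theorem charFun_add_measure (μ ν : Measure ℝ) [IsFiniteMeasure μ] [IsFiniteMeasure ν] (t : ℝ) :
    charFun (μ + ν) t = charFun μ t + charFun ν t := by
  simp only [charFun]
  exact integral_add_measure (integrable_charFun_integrand μ t) (integrable_charFun_integrand ν t)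

/-- `κ'` is the law of the sum of a geometric number, with success probability `α`, of independent
random variables with law `κ`. -/
def GeomRel (α : ℝ) (κ κ' : ProbabilityMeasure ℝ) : Prop :=
  ∀ t, charFun (κ' : Measure ℝ) t * (1 - (1 - α) * charFun (κ : Measure ℝ) t) =
    α * charFun (κ : Measure ℝ) t

theorem norm_mul_charFun_lt_one {d : ℝ} (h0 : 0 ≤ d) (h1 : d < 1) (κ : ProbabilityMeasure ℝ)
    (t : ℝ) : (1 : ℂ) - d * charFun (κ : Measure ℝ) t ≠ 0 := by
  intro h
  have h2 : ‖(d : ℂ) * charFun (κ : Measure ℝ) t‖ = 1 := by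
    rw [← sub_eq_zero.1 h, norm_one]
  rw [norm_mul, Complex.norm_real, Real.norm_of_nonneg h0] at h2
  have h3 := norm_charFun_le_one (μ := (κ : Measure ℝ)) t
  nlinarith [norm_nonneg (charFun (κ : Measure ℝ) t)]

/-! ### The law of the reduced tree -/

namespace TreeData

variable (q : PMF ℕ) (κ : ProbabilityMeasure ℝ) {s : ℝ}

/-- The reduced trees above the black children of the root, and the new mark of the root. -/
noncomputable def topData (s : ℝ) (x : TreeData) : (ℕ × (ℕ → TreeData)) × ℝ :=
  (enc ((kids s x).map (red s)), newMark s x)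

theorem measurable_topData (s : ℝ) : Measurable (topData s) := by
  refine Measurable.prodMk ?_ (measurable_newMark s)
  have := (measurable_enc_map_decList (measurable_red s)).comp (measurable_enc_kids s)
  simpa [Function.comp_def] using this

theorem red_eq_nodeEnc (s : ℝ) (x : TreeData) :
    red s x = nodeEnc ((topData s (chainTop s x)).1, chainLife s x, (topData s (chainTop s x)).2) := by
  rw [red_eq_mkNode, topData, nodeEnc_enc]

/-- The law of the lifetime of the root of the reduced tree, on the event that the root is black and
that the other data are in `A`. -/
noncomputable def lifeMeasure (s : ℝ) (A : Set ((ℕ × (ℕ → TreeData)) × ℝ)) : Measure ℝ :=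
  ((dataLaw q κ).restrict (blk s ∩ (fun x => topData s (chainTop s x)) ⁻¹' A)).map (chainLife s)

instance (s : ℝ) (A : Set ((ℕ × (ℕ → TreeData)) × ℝ)) : IsFiniteMeasure (lifeMeasure q κ s A) := by
  unfold lifeMeasure; infer_instance

theorem measurable_topData_chainTop (s : ℝ) : Measurable fun x => topData s (chainTop s x) :=
  (measurable_topData s).comp (measurable_chainTop s)

theorem lifeMeasure_apply {A : Set ((ℕ × (ℕ → TreeData)) × ℝ)} {C : Set ℝ} (hC : MeasurableSet C) :
    lifeMeasure q κ s A C = dataLaw q κ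
      (blk s ∩ (fun x => topData s (chainTop s x)) ⁻¹' A ∩ chainLife s ⁻¹' C) := by
  rw [lifeMeasure, Measure.map_apply (measurable_chainLife s) hC,
    Measure.restrict_apply (measurable_chainLife s hC), Set.inter_comm]

theorem dataLaw_map_kids_lifetime (s : ℝ) :
    (dataLaw q κ).map (fun x => (enc (kids s x), (x []).2.1)) =
      ((dataLaw q κ).map fun x => enc (kids s x)).prod (κ : Measure ℝ) :=
  dataLaw_map_prodMk_lifetime q κ (measurable_enc_kids s) fun _ _ => rfl

/-- A renewal equation. Either the chain ends at the root, whose lifetime has law `κ` independently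
of the rest; or there is a single black child, the data at the end of the chain are those of the
child's chain, and the root adds an independent lifetime. -/
theorem lifeMeasure_eq (hq : IsOffspringLaw q) (h0 : 0 ≤ s) (h1 : s ≤ 1)
    {A : Set ((ℕ × (ℕ → TreeData)) × ℝ)} (hA : MeasurableSet A) :
    lifeMeasure q κ s A = dataLaw q κ (blkNe s ∩ topData s ⁻¹' A) • (κ : Measure ℝ) +
      singleProb q (dataLaw q κ (blk s)ᶜ) • ((κ : Measure ℝ).conv (lifeMeasure q κ s A)) := by
  refine Measure.ext fun C hC => ?_
  have hmT := measurable_topData_chainTop s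
  have hmL := measurable_chainLife s
  rw [lifeMeasure_apply q κ hC, Measure.add_apply, Measure.smul_apply, Measure.smul_apply,
    ← measure_inter_add_sdiff _ (measurableSet_length_kids s {1}ᶜ)]
  congr 1
  · have h2 : blk s ∩ (fun x => topData s (chainTop s x)) ⁻¹' A ∩ chainLife s ⁻¹' C ∩
        {x | (kids s x).length ∈ ({1}ᶜ : Set ℕ)} =
        {x | (x ∈ blkNe s ∧ topData s x ∈ A) ∧ (x []).2.1 ∈ C} := by
      ext x
      simp only [Set.mem_inter_iff, Set.mem_preimage, Set.mem_ofPred, blkNe, Set.mem_compl_iff,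
        Set.mem_singleton_iff]
      constructor
      · rintro ⟨⟨⟨a, b⟩, c⟩, d⟩
        rw [chainTop_of_length_ne d] at b
        rw [chainLife_of_length_ne d] at c
        exact ⟨⟨⟨a, d⟩, b⟩, c⟩
      · rintro ⟨⟨⟨a, d⟩, b⟩, c⟩
        rw [chainTop_of_length_ne d, chainLife_of_length_ne d]
        exact ⟨⟨⟨a, b⟩, c⟩, d⟩
    have hmS : MeasurableSet {x | x ∈ blkNe s ∧ topData s x ∈ A} :=
      (measurableSet_blkNe s).inter (measurable_topData s hA)
    have hf : Measurable fun x => (x ∈ blkNe s ∧ topData s x ∈ A) := measurableSet_setOfPred.1 hmS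
    have h3 := dataLaw_map_prodMk_lifetime q κ hf (fun z x => by
      have e1 : (prolong z x ∈ blkNe s) = (x ∈ blkNe s) := by
        simp only [blkNe, blk, Set.mem_inter_iff, Set.mem_ofPred, isRed_prolong, kids_prolong]
      rw [e1]; rfl)
    have h4 : {x : TreeData | (x ∈ blkNe s ∧ topData s x ∈ A) ∧ (x []).2.1 ∈ C} =
        (fun x => ((x ∈ blkNe s ∧ topData s x ∈ A), (x []).2.1)) ⁻¹' ({True} ×ˢ C) := by
      ext x; simp
    have hmf : Measurable fun x : TreeData => ((x ∈ blkNe s ∧ topData s x ∈ A), (x []).2.1) :=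
      hf.prodMk (by fun_prop)
    rw [h2, h4, ← Measure.map_apply hmf ((measurableSet_singleton True).prod hC), h3,
      Measure.prod_prod, Measure.map_apply hf (measurableSet_singleton True), smul_eq_mul]
    congr 2
    ext x; simp
  · set V := (fun x => topData s (chainTop s x)) ⁻¹' A with hV
    have hmV : MeasurableSet V := hmT hA
    set S : Set ((ℕ × (ℕ → TreeData)) × ℝ) :=
      {p | p.1.1 = 1 ∧ p.1.2 0 ∈ V ∧ p.2 + chainLife s (p.1.2 0) ∈ C} with hS
    have hmS : MeasurableSet S := by
      refine (measurableSet_eq_fun (by fun_prop : Measurable fun p : (ℕ × (ℕ → TreeData)) × ℝ =>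
        p.1.1) measurable_const).inter (MeasurableSet.inter ?_ ?_)
      · exact (by fun_prop : Measurable fun p : (ℕ × (ℕ → TreeData)) × ℝ => p.1.2 0) hmV
      · exact (measurable_snd.add (hmL.comp
          (by fun_prop : Measurable fun p : (ℕ × (ℕ → TreeData)) × ℝ => p.1.2 0))) hC
    have h2 : dataLaw q κ ((blk s ∩ V ∩ chainLife s ⁻¹' C) \
        {x | (kids s x).length ∈ ({1}ᶜ : Set ℕ)}) =
        dataLaw q κ ((fun x => (enc (kids s x), (x []).2.1)) ⁻¹' S) := by
      refine measure_congr ?_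
      -- The recursions for the end and the lifetime of a chain need the chain to be finite, so the
      -- two events agree only up to a null set.
      filter_upwards [ae_finChain q κ hq h0 h1] with x hx
      refine propext ?_
      change (_ ∧ _) ↔ (_ ∧ _)
      simp only [Set.mem_inter_iff, Set.mem_preimage, Set.mem_ofPred, Set.mem_compl_iff,
        Set.mem_singleton_iff, not_not]
      constructor
      · rintro ⟨⟨⟨a, b⟩, c⟩, d⟩
        obtain ⟨y, hy⟩ := List.length_eq_one_iff.1 d
        have hfy := (finChain_iff_of_kids_eq hy).1 (hx a)
        rw [hV, Set.mem_preimage, chainTop_of_kids_eq hy hfy] at b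
        rw [chainLife_of_kids_eq hy hfy] at c
        simp only [enc, hy]
        exact ⟨rfl, b, c⟩
      · rintro ⟨d, b, c⟩
        have d' : (kids s x).length = 1 := d
        have a : ¬ IsRed s x := not_isRed_of_length (by omega)
        obtain ⟨y, hy⟩ := List.length_eq_one_iff.1 d'
        have hfy := (finChain_iff_of_kids_eq hy).1 (hx a)
        simp only [enc, hy] at b c
        refine ⟨⟨⟨a, ?_⟩, ?_⟩, d'⟩
        · rw [hV, Set.mem_preimage, chainTop_of_kids_eq hy hfy]; exact b
        · rw [chainLife_of_kids_eq hy hfy]; exact c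
    have hm2 : Measurable fun x : TreeData => (enc (kids s x), (x []).2.1) :=
      (measurable_enc_kids s).prodMk (by fun_prop)
    rw [h2, ← Measure.map_apply hm2 hmS, dataLaw_map_kids_lifetime, Measure.prod_apply_symm hmS]
    have h5 : ∀ z : ℝ, (dataLaw q κ).map (fun x => enc (kids s x)) ((fun e => (e, z)) ⁻¹' S) =
        singleProb q (dataLaw q κ (blk s)ᶜ) * lifeMeasure q κ s A {l | z + l ∈ C} := by
      intro z
      have hmz : MeasurableSet {l : ℝ | z + l ∈ C} := (measurable_const_add z) hC
      rw [Measure.map_apply (measurable_enc_kids s) (measurable_prodMk_right hmS),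
        lifeMeasure_apply q κ hmz]
      have h6 := dataLaw_single q κ s (hmV.inter (hmL hmz))
      rw [show blk s ∩ V ∩ chainLife s ⁻¹' {l | z + l ∈ C} =
        V ∩ chainLife s ⁻¹' {l | z + l ∈ C} ∩ blk s by ext; simp; tauto, ← h6]
      rfl
    simp_rw [h5]
    rw [lintegral_const_mul, smul_eq_mul, Measure.conv, Measure.map_apply measurable_add hC,
      Measure.prod_apply (measurable_add hC)]
    · rfl
    · exact measurable_measure_prodMk_left (s := {p : ℝ × ℝ | p.1 + p.2 ∈ C}) (measurable_add hC)

end TreeData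

namespace TreeData

variable (q : PMF ℕ) (κ : ProbabilityMeasure ℝ) {s : ℝ}

theorem lifeMeasure_univ_univ (s : ℝ) :
    lifeMeasure q κ s Set.univ Set.univ = dataLaw q κ (blk s) := by
  rw [lifeMeasure_apply q κ MeasurableSet.univ]; simp

theorem charFun_lifeMeasure (hq : IsOffspringLaw q) (h0 : 0 ≤ s) (h1 : s ≤ 1)
    (hw : dataLaw q κ (blk s) ≠ 0) {A : Set ((ℕ × (ℕ → TreeData)) × ℝ)} (hA : MeasurableSet A)
    (t : ℝ) : charFun (lifeMeasure q κ s A) t *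
      (1 - (singleProb q (dataLaw q κ (blk s)ᶜ)).toReal * charFun (κ : Measure ℝ) t) =
      (dataLaw q κ (blkNe s ∩ topData s ⁻¹' A)).toReal * charFun (κ : Measure ℝ) t := by
  have hlt := singleProb_lt_one q κ hq h0 h1 hw
  have hf1 : IsFiniteMeasure (dataLaw q κ (blkNe s ∩ topData s ⁻¹' A) • (κ : Measure ℝ)) :=
    Measure.smul_finite _ (measure_ne_top _ _)
  have hf2 : IsFiniteMeasure (singleProb q (dataLaw q κ (blk s)ᶜ) •
      ((κ : Measure ℝ).conv (lifeMeasure q κ s A))) :=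
    Measure.smul_finite _ (hlt.trans ENNReal.one_lt_top).ne
  have h2 := congrArg (fun m => charFun m t) (lifeMeasure_eq q κ hq h0 h1 hA)
  rw [charFun_add_measure, charFun_smul_ennreal, charFun_smul_ennreal, charFun_conv] at h2
  linear_combination h2

/-- The renewal equation has a unique solution in terms of characteristic functions, and the event
`A` enters only through a constant factor. Hence the lifetime of the chain is independent of the
data at its end. -/
theorem lifeMeasure_proportional (hq : IsOffspringLaw q) (h0 : 0 ≤ s) (h1 : s ≤ 1)
    (hw : dataLaw q κ (blk s) ≠ 0) {A : Set ((ℕ × (ℕ → TreeData)) × ℝ)} (hA : MeasurableSet A) :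
    dataLaw q κ (blkNe s) • lifeMeasure q κ s A =
      dataLaw q κ (blkNe s ∩ topData s ⁻¹' A) • lifeMeasure q κ s Set.univ := by
  have hf1 : IsFiniteMeasure (dataLaw q κ (blkNe s) • lifeMeasure q κ s A) :=
    Measure.smul_finite _ (measure_ne_top _ _)
  have hf2 : IsFiniteMeasure (dataLaw q κ (blkNe s ∩ topData s ⁻¹' A) •
      lifeMeasure q κ s Set.univ) := Measure.smul_finite _ (measure_ne_top _ _)
  refine Measure.ext_of_charFun ?_
  funext t
  rw [charFun_smul_ennreal, charFun_smul_ennreal]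
  have e1 := charFun_lifeMeasure q κ hq h0 h1 hw hA t
  have e2 := charFun_lifeMeasure q κ hq h0 h1 hw MeasurableSet.univ t
  rw [Set.preimage_univ, Set.inter_univ] at e2
  have hlt := singleProb_lt_one q κ hq h0 h1 hw
  have hne := norm_mul_charFun_lt_one (d := (singleProb q (dataLaw q κ (blk s)ᶜ)).toReal)
    ENNReal.toReal_nonneg (by
      rw [← ENNReal.toReal_one]
      exact (ENNReal.toReal_lt_toReal hlt.ne_top ENNReal.one_ne_top).2 hlt) κ t
  refine mul_right_cancel₀ hne ?_
  linear_combination (dataLaw q κ (blkNe s)).toReal * e1 -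
    (dataLaw q κ (blkNe s ∩ topData s ⁻¹' A)).toReal * e2

/-- The weights of the offspring law of the reduced tree. -/
noncomputable def redCoef (q : PMF ℕ) (s : ℝ) (w r : ℝ≥0∞) (k : ℕ) : ℝ≥0∞ :=
  if k = 0 then q 0 * ENNReal.ofReal s else if k = 1 then 0 else thin q.toMeasure w r k

/-- A chain of length zero ends either in a black leaf, whose rescaled mark is uniform, or in an
individual with at least two black children, whose mark is untouched. In both cases the mark is
independent of the list of reduced subtrees, hence the product. -/
theorem dataLaw_blkNe_topData (h0 : 0 ≤ s) (h1 : s ≤ 1) (ρ₀ : Measure TreeData)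
    [IsProbabilityMeasure ρ₀] [IsProbabilityMeasure (ρ₀.map (red s))]
    (hρ : (dataLaw q κ).restrict (blk s) = dataLaw q κ (blk s) • ρ₀)
    {A : Set (ℕ × (ℕ → TreeData))} (hA : MeasurableSet A) {C : Set ℝ} (hC : MeasurableSet C) :
    dataLaw q κ (blkNe s ∩ topData s ⁻¹' (A ×ˢ C)) =
      (∑' k, redCoef q s (dataLaw q κ (blk s)) (dataLaw q κ (blk s)ᶜ) k *
        listLaw (ρ₀.map (red s)) k A) * unifLaw C := by
  have hmap := measurable_enc_map_decList (measurable_red s)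
  set S : Set (ℕ × (ℕ → TreeData)) := {e | 2 ≤ e.1 ∧ enc ((decList e).map (red s)) ∈ A} with hS
  have hmS : MeasurableSet S := (measurableSet_le measurable_const measurable_fst).inter (hmap hA)
  have hsplit : blkNe s ∩ topData s ⁻¹' (A ×ˢ C) =
      {x | enc [] ∈ A ∧ (x []).1 = 0 ∧ (x []).2.2 < s ∧ (x []).2.2 / s ∈ C} ∪
        (fun x => (enc (kids s x), (x []).2)) ⁻¹' (S ×ˢ (Set.univ ×ˢ C)) := by
    ext x
    simp only [Set.mem_inter_iff, blkNe, blk, Set.mem_ofPred, Set.mem_preimage, Set.mem_prod,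
      Set.mem_union, hS, topData, decList_enc, Set.mem_univ, true_and]
    have hlen : (enc (kids s x)).1 = (kids s x).length := rfl
    rw [hlen]
    constructor
    · rintro ⟨⟨hb, hl⟩, ha, hc⟩
      rcases Nat.lt_or_ge (kids s x).length 2 with h | h
      · left
        have hk : kids s x = [] := List.eq_nil_of_length_eq_zero (by omega)
        have hν := (kids_eq_nil_iff_of_not_isRed hb).1 hk
        rw [hk] at ha
        rw [newMark, if_pos hν] at hc
        exact ⟨ha, hν, mark_lt_of_not_isRed hb hν, hc⟩
      · right
        have hν : (x []).1 ≠ 0 := fun hν => by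
          rw [kids_eq_nil_of_leaf s hν] at h; simp at h
        rw [newMark, if_neg hν] at hc
        exact ⟨⟨h, ha⟩, hc⟩
    · rintro (⟨ha, hν, hu, hc⟩ | ⟨⟨h, ha⟩, hc⟩)
      · have hk := kids_eq_nil_of_leaf s hν
        refine ⟨⟨fun hr => ((isRed_iff_kids s).1 hr).2 ⟨hν, hu⟩, by simp [hk]⟩, by simpa [hk] using ha, ?_⟩
        rw [newMark, if_pos hν]; exact hc
      · have hν : (x []).1 ≠ 0 := fun hν => by
          rw [kids_eq_nil_of_leaf s hν] at h; simp at h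
        refine ⟨⟨not_isRed_of_length (by omega), by omega⟩, ha, ?_⟩
        rw [newMark, if_neg hν]; exact hc
  have hm2 : Measurable fun x : TreeData => (enc (kids s x), (x []).2) :=
    (measurable_enc_kids s).prodMk (by fun_prop)
  have hmR : MeasurableSet (S ×ˢ ((Set.univ : Set ℝ) ×ˢ C)) := hmS.prod (MeasurableSet.univ.prod hC)
  have hdisj : Disjoint {x : TreeData | enc [] ∈ A ∧ (x []).1 = 0 ∧ (x []).2.2 < s ∧
      (x []).2.2 / s ∈ C} ((fun x => (enc (kids s x), (x []).2)) ⁻¹' (S ×ˢ (Set.univ ×ˢ C))) := by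
    rw [Set.disjoint_left]
    rintro x ⟨-, hν, -⟩ ⟨⟨h, -⟩, -⟩
    have hk := kids_eq_nil_of_leaf s hν
    simp [hk, enc] at h
  rw [hsplit, measure_union hdisj (hm2 hmR), ← Measure.map_apply hm2 hmR, dataLaw_map_kids,
    Measure.prod_prod, Measure.prod_prod, measure_univ, one_mul,
    dataLaw_enc_kids q κ s ρ₀ hρ hmS]
  have hleaf : dataLaw q κ {x : TreeData | enc [] ∈ A ∧ (x []).1 = 0 ∧ (x []).2.2 < s ∧
      (x []).2.2 / s ∈ C} = q 0 * ENNReal.ofReal s * listLaw (ρ₀.map (red s)) 0 A * unifLaw C := by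
    rw [listLaw_zero, Measure.dirac_apply' _ hA]
    by_cases ha : enc [] ∈ A
    · simp only [ha, true_and, Set.indicator_of_mem, Pi.one_apply, mul_one]
      exact dataLaw_black_leaf q κ h0 h1 hC
    · simp [ha]
  rw [hleaf, ← add_mul]
  congr 1
  have hsplit2 : ∀ f : ℕ → ℝ≥0∞, ∑' k, f k = f 0 + (f (0 + 1) + ∑' k, f (k + 1 + 1)) := fun f => by
    rw [tsum_eq_zero_add' ENNReal.summable, tsum_eq_zero_add' ENNReal.summable]
  rw [hsplit2, hsplit2 fun k => redCoef q s _ _ k * _]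
  have hz : ∀ k < 2, listLaw ρ₀ k S = 0 := fun k hk => by
    rw [measure_eq_zero_iff_ae_notMem]
    filter_upwards [listLaw_fst_eq ρ₀ k] with e he h'
    have := h'.1
    omega
  have hk : ∀ k, listLaw ρ₀ (k + 1 + 1) S = listLaw (ρ₀.map (red s)) (k + 1 + 1) A := fun k => by
    rw [← listLaw_map ρ₀ (measurable_red s), Measure.map_apply hmap hA]
    refine measure_congr ?_
    filter_upwards [listLaw_fst_eq ρ₀ (k + 1 + 1)] with e he
    refine propext ⟨fun h => h.2, fun h => ⟨?_, h⟩⟩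
    omega
  rw [hz 0 (by omega), hz (0 + 1) (by omega)]
  simp only [hk, redCoef]
  simp

/-- The law of the reduced decorated tree. -/
theorem exists_reduced_law (hq : IsOffspringLaw q) (h0 : 0 ≤ s) (h1 : s ≤ 1)
    (hw : dataLaw q κ (blk s) ≠ 0) :
    ∃ (q' : PMF ℕ) (κ' : ProbabilityMeasure ℝ),
      ((dataLaw q κ).restrict (blk s)).map (red s) = dataLaw q κ (blk s) • prunedLaw q' κ' ∧
      (∀ k, q' k = (dataLaw q κ (blkNe s))⁻¹ *
        redCoef q s (dataLaw q κ (blk s)) (dataLaw q κ (blk s)ᶜ) k) ∧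
      GeomRel (1 - (singleProb q (dataLaw q κ (blk s)ᶜ)).toReal) κ κ' ∧
      (IsLifetimeLaw κ → IsLifetimeLaw κ') := by
  set D := dataLaw q κ with hD
  set w := D (blk s) with hwdef
  set r := D (blk s)ᶜ with hr
  set c := D (blkNe s) with hc
  have hwt : w ≠ ∞ := measure_ne_top _ _
  have hc0 : c ≠ 0 := dataLaw_blkNe_pos q κ hq h0 h1 hw
  have hct : c ≠ ∞ := measure_ne_top _ _
  have hlt : singleProb q r < 1 := singleProb_lt_one q κ hq h0 h1 hw
  obtain ⟨ρ₀, hρ₀, hρ⟩ := exists_restrict_eq_smul D (blk s)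
  have hρp : IsProbabilityMeasure (ρ₀.map (red s)) :=
    Measure.isProbabilityMeasure_map (measurable_red s).aemeasurable
  set ρ := ρ₀.map (red s) with hρdef
  have hred : (D.restrict (blk s)).map (red s) = w • ρ := by
    rw [hρ, Measure.map_smul]
  -- the offspring law
  have hsum : ∑' k, redCoef q s w r k = c := by
    have := dataLaw_blkNe_topData q κ h0 h1 ρ₀ hρ MeasurableSet.univ MeasurableSet.univ
    simp only [Set.univ_prod_univ, Set.preimage_univ, Set.inter_univ, measure_univ, mul_one] at this
    exact this.symm
  let q' : PMF ℕ := ⟨fun k => c⁻¹ * redCoef q s w r k, by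
    have h := ENNReal.tsum_mul_left (a := c⁻¹) (f := redCoef q s w r)
    rw [hsum, ENNReal.inv_mul_cancel hc0 hct] at h
    rw [← h]
    exact ENNReal.summable.hasSum⟩
  have hq' : ∀ k, q' k = c⁻¹ * redCoef q s w r k := fun k => rfl
  -- the lifetime law
  set M := lifeMeasure q κ s Set.univ with hM
  have hMw : M Set.univ = w := lifeMeasure_univ_univ q κ s
  have hκp : IsProbabilityMeasure (w⁻¹ • M) := ⟨by
    rw [Measure.smul_apply, hMw, smul_eq_mul, ENNReal.inv_mul_cancel hw hwt]⟩
  let κ' : ProbabilityMeasure ℝ := ⟨w⁻¹ • M, hκp⟩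
  have hκ' : (κ' : Measure ℝ) = w⁻¹ • M := rfl
  refine ⟨q', κ', ?_, hq', ?_, ?_⟩
  · rw [hred]
    congr 1
    refine eq_prunedLaw_of_eq_graftLaw q' κ' ?_
    set T : Measure ((ℕ × (ℕ → TreeData)) × ℝ) := (D.restrict (blkNe s)).map (topData s) with hT
    have hTfin : IsFiniteMeasure (c⁻¹ • T) :=
      Measure.smul_finite _ (ENNReal.inv_ne_top.2 hc0)
    set E : Measure (ℕ × (ℕ → TreeData)) :=
      (q'.toMeasure.prod (Measure.infinitePi fun _ : ℕ => ρ)).map fun e => enc (decList e) with hE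
    have hEp : IsProbabilityMeasure E :=
      Measure.isProbabilityMeasure_map measurable_enc_decList.aemeasurable
    -- `T / c` is the law of the data at the end of a chain: offspring number with law `q'`,
    -- independent subtrees with law `ρ`, independent uniform mark.
    have hTE : E.prod unifLaw = c⁻¹ • T := by
      refine Measure.prod_eq fun A C hA hC => ?_
      have e1 : E A = ∑' k, q' k * listLaw ρ k A := by
        rw [hE, Measure.map_apply measurable_enc_decList hA,
          Measure.prod_apply (measurable_enc_decList hA), lintegral_countable']
        refine tsum_congr fun k => ?_
        rw [toMeasure_singleton_nat, mul_comm, listLaw,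
          Measure.map_apply (measurable_enc_decList_mk k) hA]
        rfl
      rw [Measure.smul_apply, hT, Measure.map_apply (measurable_topData s) (hA.prod hC),
        Measure.restrict_apply (measurable_topData s (hA.prod hC)), Set.inter_comm,
        dataLaw_blkNe_topData q κ h0 h1 ρ₀ hρ hA hC, e1, smul_eq_mul, ← mul_assoc,
        ← ENNReal.tsum_mul_left]
      congr 1
      refine tsum_congr fun k => ?_
      rw [hq', mul_assoc]
    set J : Measure (((ℕ × (ℕ → TreeData)) × ℝ) × ℝ) :=
      (D.restrict (blk s)).map fun x => (topData s (chainTop s x), chainLife s x) with hJ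
    have hmJ : Measurable fun x => (topData s (chainTop s x), chainLife s x) :=
      (measurable_topData_chainTop s).prodMk (measurable_chainLife s)
    -- The chain lifetime is independent of these data, by proportionality; together they make up
    -- the reduced tree.
    have hJE : (c⁻¹ • T).prod (κ' : Measure ℝ) = w⁻¹ • J := by
      refine Measure.prod_eq fun A C hA hC => ?_
      have e1 : J (A ×ˢ C) = lifeMeasure q κ s A C := by
        rw [hJ, Measure.map_apply hmJ (hA.prod hC), Measure.restrict_apply (hmJ (hA.prod hC)),
          lifeMeasure_apply q κ hC]
        congr 1
        ext x
        simp only [Set.mem_inter_iff, Set.mem_preimage, Set.mem_prod]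
        tauto
      have e2 := DFunLike.congr_fun (lifeMeasure_proportional q κ hq h0 h1 hw hA) C
      simp only [Measure.smul_apply, smul_eq_mul] at e2
      have e3 : lifeMeasure q κ s A C = c⁻¹ * D (blkNe s ∩ topData s ⁻¹' A) * M C := by
        rw [mul_assoc, ← e2, ← mul_assoc, ENNReal.inv_mul_cancel hc0 hct, one_mul]
      rw [Measure.smul_apply, Measure.smul_apply, hT, Measure.map_apply (measurable_topData s) hA,
        Measure.restrict_apply (measurable_topData s hA), Set.inter_comm, hκ', Measure.smul_apply,
        smul_eq_mul, smul_eq_mul, smul_eq_mul, e1, e3]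
      ring
    have hρJ : ρ = (w⁻¹ • J).map fun p => nodeEnc (p.1.1, p.2, p.1.2) := by
      have hmn : Measurable fun p : ((ℕ × (ℕ → TreeData)) × ℝ) × ℝ => nodeEnc (p.1.1, p.2, p.1.2) :=
        measurable_nodeEnc.comp (by fun_prop)
      have e1 : J.map (fun p => nodeEnc (p.1.1, p.2, p.1.2)) = w • ρ := by
        rw [hJ, Measure.map_map hmn hmJ, ← hred]
        congr 1
        funext x
        exact (red_eq_nodeEnc s x).symm
      rw [Measure.map_smul, e1, smul_smul, ENNReal.inv_mul_cancel hw hwt, one_smul]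
    rw [← hJE, ← hTE] at hρJ
    have f1 : MeasurePreserving (MeasurableEquiv.prodAssoc : ((ℕ × (ℕ → TreeData)) × ℝ) × ℝ ≃ᵐ _)
        ((E.prod unifLaw).prod (κ' : Measure ℝ)) (E.prod (unifLaw.prod (κ' : Measure ℝ))) :=
      measurePreserving_prodAssoc _ _ _
    have f2 : MeasurePreserving (Prod.map id Prod.swap) (E.prod (unifLaw.prod (κ' : Measure ℝ)))
        (E.prod ((κ' : Measure ℝ).prod unifLaw)) :=
      (MeasurePreserving.id _).prod Measure.measurePreserving_swap
    have f3 := (f2.comp f1).map_eq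
    have f4 : (fun p : ((ℕ × (ℕ → TreeData)) × ℝ) × ℝ => nodeEnc (p.1.1, p.2, p.1.2)) =
        nodeEnc ∘ (Prod.map id Prod.swap ∘ MeasurableEquiv.prodAssoc) := rfl
    rw [f4, ← Measure.map_map measurable_nodeEnc (f2.comp f1).measurable, f3] at hρJ
    have f5 : E.prod ((κ' : Measure ℝ).prod unifLaw) =
        ((q'.toMeasure.prod (Measure.infinitePi fun _ : ℕ => ρ)).prod
          ((κ' : Measure ℝ).prod unifLaw)).map (Prod.map (fun e => enc (decList e)) id) := by
      rw [← Measure.map_prod_map _ _ measurable_enc_decList measurable_id, Measure.map_id]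
    -- Re-encoding changes only entries beyond the length of the list, and `nodeEnc` ignores them.
    have f6 : nodeEnc ∘ Prod.map (fun e => enc (decList e)) id = nodeEnc := by
      funext ⟨⟨n, cc⟩, z, m⟩
      refine (nodeEnc_congr (n := (decList (n, cc)).length) (c' := cc) ?_ z m).trans ?_
      · intro i hi
        have hi' : i < n := by simpa using hi
        simp [decList, hi']
      · simp
    rw [f5, Measure.map_map measurable_nodeEnc
      (measurable_enc_decList.prodMap measurable_id), f6] at hρJ
    exact hρJ
  · intro t
    have e := charFun_lifeMeasure q κ hq h0 h1 hw MeasurableSet.univ t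
    rw [Set.preimage_univ, Set.inter_univ] at e
    have hcw : c.toReal = w.toReal * (1 - (singleProb q r).toReal) := by
      have h := congrArg ENNReal.toReal (dataLaw_blk_eq q κ s)
      rw [ENNReal.toReal_add hct (ENNReal.mul_ne_top hlt.ne_top hwt), ENNReal.toReal_mul] at h
      linarith
    have hw' : w.toReal ≠ 0 := (ENNReal.toReal_ne_zero).2 ⟨hw, hwt⟩
    have hw'' : (w.toReal : ℂ) ≠ 0 := by exact_mod_cast hw'
    rw [hκ', charFun_smul_ennreal, ENNReal.toReal_inv]
    have hcw' : (c.toReal : ℂ) = w.toReal * (1 - (singleProb q r).toReal) := by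
      rw [hcw]; push_cast; ring
    push_cast
    rw [sub_sub_cancel]
    rw [← hc, ← hD, ← hr, hcw', ← hM] at e
    field_simp
    linear_combination e
  · intro hκ
    have e := DFunLike.congr_fun (lifeMeasure_eq q κ hq h0 h1 MeasurableSet.univ) (Set.Iic (0 : ℝ))
    rw [Measure.add_apply, Measure.smul_apply, Measure.smul_apply, hκ, smul_zero, zero_add,
      smul_eq_mul] at e
    -- Adding a positive lifetime can only make a nonpositive total less likely. With the renewal
    -- equation the mass `m` of `(-∞, 0]` satisfies `m ≤ singleProb * m`, so it is `0`.
    have hconv : ((κ : Measure ℝ).conv M) (Set.Iic 0) ≤ M (Set.Iic 0) := by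
      rw [Measure.conv, Measure.map_apply measurable_add measurableSet_Iic,
        Measure.prod_apply (measurable_add measurableSet_Iic)]
      calc _ ≤ ∫⁻ _, M (Set.Iic 0) ∂(κ : Measure ℝ) := by
            have hpos : ∀ᵐ z ∂(κ : Measure ℝ), z ∉ Set.Iic 0 := measure_eq_zero_iff_ae_notMem.1 hκ
            refine lintegral_mono_ae ?_
            filter_upwards [hpos] with z hz
            refine measure_mono fun l hl => ?_
            have hl' : z + l ≤ 0 := hl
            rw [Set.mem_Iic] at hz ⊢
            linarith
        _ = M (Set.Iic 0) := by simp
    have hzero : M (Set.Iic 0) = 0 := by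
      by_contra hne
      have h3 : M (Set.Iic 0) < 1 * M (Set.Iic 0) := by
        calc M (Set.Iic 0) = singleProb q r * ((κ : Measure ℝ).conv M) (Set.Iic 0) := e
          _ ≤ singleProb q r * M (Set.Iic 0) := by gcongr
          _ < 1 * M (Set.Iic 0) := ENNReal.mul_lt_mul_left hne (measure_ne_top _ _) hlt
      rw [one_mul] at h3
      exact lt_irrefl _ h3
    change (w⁻¹ • M) (Set.Iic 0) = 0
    rw [Measure.smul_apply, hzero, smul_zero]

end TreeData

/-! ### Product measures -/

theorem infinitePi_prod {ι X Y : Type*} [MeasurableSpace X] [MeasurableSpace Y] (a : Measure X)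
    (b : Measure Y) [IsProbabilityMeasure a] [IsProbabilityMeasure b] :
    (Measure.infinitePi fun _ : ι => a.prod b).map (fun x => (fun i => (x i).1, fun i => (x i).2)) =
      (Measure.infinitePi fun _ : ι => a).prod (Measure.infinitePi fun _ : ι => b) := by
  classical
  have hm : Measurable fun x : ι → X × Y => ((fun i => (x i).1, fun i => (x i).2) : (ι → X) × (ι → Y)) := by
    fun_prop
  symm
  refine Measure.prod_eq_generateFrom generateFrom_squareCylinders generateFrom_squareCylinders
    (isPiSystem_squareCylinders (fun _ => MeasurableSpace.isPiSystem_measurableSet) (by simp))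
    (isPiSystem_squareCylinders (fun _ => MeasurableSpace.isPiSystem_measurableSet) (by simp))
    ⟨fun _ => Set.univ, fun _ => ⟨∅, fun _ => Set.univ, by simp, by simp⟩,
      fun _ => measure_lt_top _ _, Set.iUnion_const _⟩
    ⟨fun _ => Set.univ, fun _ => ⟨∅, fun _ => Set.univ, by simp, by simp⟩,
      fun _ => measure_lt_top _ _, Set.iUnion_const _⟩ ?_
  rintro _ ⟨s, A, hA, rfl⟩ _ ⟨t, B, hB, rfl⟩
  have hA' : ∀ i, MeasurableSet (A i) := fun i => hA i (Set.mem_univ i)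
  have hB' : ∀ i, MeasurableSet (B i) := fun i => hB i (Set.mem_univ i)
  set A' : ι → Set X := fun i => if i ∈ s then A i else Set.univ with hA'def
  set B' : ι → Set Y := fun i => if i ∈ t then B i else Set.univ with hB'def
  have hmA' : ∀ i, MeasurableSet (A' i) := fun i => by
    by_cases h : i ∈ s <;> simp [A', h, hA']
  have hmB' : ∀ i, MeasurableSet (B' i) := fun i => by
    by_cases h : i ∈ t <;> simp [B', h, hB']
  have e : (fun x : ι → X × Y => ((fun i => (x i).1, fun i => (x i).2) : (ι → X) × (ι → Y))) ⁻¹'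
      ((s : Set ι).pi A ×ˢ (t : Set ι).pi B) = ((s ∪ t : Finset ι) : Set ι).pi fun i => A' i ×ˢ B' i := by
    ext x
    simp only [Set.mem_preimage, Set.mem_prod, Set.mem_pi, Finset.mem_coe, Finset.mem_union]
    constructor
    · rintro ⟨h1, h2⟩ i -
      constructor
      · by_cases h : i ∈ s <;> simp [A', h]
        exact h1 i h
      · by_cases h : i ∈ t <;> simp [B', h]
        exact h2 i h
    · intro h
      refine ⟨fun i hi => ?_, fun i hi => ?_⟩
      · have := (h i (Or.inl hi)).1
        simpa [A', hi] using this
      · have := (h i (Or.inr hi)).2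
        simpa [B', hi] using this
  rw [Measure.map_apply hm ((MeasurableSet.pi s.countable_toSet fun i _ => hA' i).prod
    (MeasurableSet.pi t.countable_toSet fun i _ => hB' i)), e,
    Measure.infinitePi_pi _ fun i _ => (hmA' i).prod (hmB' i), Measure.infinitePi_pi _ fun i _ => hA' i,
    Measure.infinitePi_pi _ fun i _ => hB' i]
  simp only [Measure.prod_prod]
  rw [Finset.prod_mul_distrib]
  congr 1
  · rw [← Finset.prod_subset (Finset.subset_union_left (s₁ := s) (s₂ := t))
      (fun i _ hi => by simp [A', hi])]
    exact Finset.prod_congr rfl fun i hi => by simp [A', hi]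
  · rw [← Finset.prod_subset (Finset.subset_union_right (s₁ := s) (s₂ := t))
      (fun i _ hi => by simp [B', hi])]
    exact Finset.prod_congr rfl fun i hi => by simp [B', hi]

/-! ### Trees with colours and decorated trees -/

theorem unifLaw_map_decide {s : unitInterval} :
    unifLaw.map (fun u => decide (u < (s : ℝ))) = bernoulliMeasure false true (unitInterval.symm s) := by
  have hm : Measurable fun u : ℝ => decide (u < (s : ℝ)) := by
    refine measurable_to_bool ?_
    have : (fun u : ℝ => decide (u < (s : ℝ))) ⁻¹' {true} = Set.Iio (s : ℝ) := by ext; simp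
    rw [this]; exact measurableSet_Iio
  have : IsProbabilityMeasure (unifLaw.map fun u => decide (u < (s : ℝ))) :=
    Measure.isProbabilityMeasure_map hm.aemeasurable
  have h1 : ∀ b : Bool, unifLaw.map (fun u => decide (u < (s : ℝ))) {b} =
      bernoulliMeasure false true (unitInterval.symm s) {b} := by
    have ht : unifLaw.map (fun u => decide (u < (s : ℝ))) {true} =
        bernoulliMeasure false true (unitInterval.symm s) {true} := by
      rw [Measure.map_apply hm (measurableSet_singleton _)]
      have : (fun u : ℝ => decide (u < (s : ℝ))) ⁻¹' {true} = Set.Iio (s : ℝ) := by ext; simp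
      rw [this, unifLaw, Measure.restrict_apply measurableSet_Iio]
      have h2 : Set.Iio (s : ℝ) ∩ Set.Ico 0 1 = Set.Ico 0 (s : ℝ) := by
        ext u
        have := s.2.2
        simp only [Set.mem_inter_iff, Set.mem_Iio, Set.mem_Ico]
        constructor
        · rintro ⟨h, h', -⟩; exact ⟨h', h⟩
        · rintro ⟨h, h'⟩; exact ⟨h', h, by linarith⟩
      rw [h2, Real.volume_Ico, bernoulliMeasure_apply _ (measurableSet_singleton _)]
      simp [unitInterval.toNNReal, ENNReal.ofReal, Real.toNNReal, max_eq_left s.2.1]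
      rfl
    intro b
    cases b with
    | true => exact ht
    | false =>
      have hc : ({false} : Set Bool) = {true}ᶜ := by ext b; cases b <;> simp
      rw [hc, prob_compl_eq_one_sub (measurableSet_singleton _),
        prob_compl_eq_one_sub (measurableSet_singleton _), ht]
  exact Measure.ext_of_singleton h1

instance (p : unitInterval) : IsProbabilityMeasure (colourLaw p) := by
  unfold colourLaw; infer_instance

namespace MarkedTree

theorem measurableSet_mem (u : List ℕ) : MeasurableSet {t : MarkedTree | u ∈ t} := by
  refine MeasurableSpace.measurableSet_generateFrom ⟨u, Set.univ, MeasurableSet.univ, ?_⟩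
  ext t
  change (t.mark u).isSome ↔ _
  simp [Option.isSome_iff_exists]

theorem measurable_lifetime (u : List ℕ) : Measurable fun t : MarkedTree => t.lifetime u := by
  intro A hA
  have h1 : MeasurableSet {t : MarkedTree | ∃ z ∈ A, t.mark u = some z} :=
    MeasurableSpace.measurableSet_generateFrom ⟨u, A, hA, rfl⟩
  have h2 : (fun t : MarkedTree => t.lifetime u) ⁻¹' A = {t | ∃ z ∈ A, t.mark u = some z} ∪
      ({t | u ∈ t}ᶜ ∩ {t | (0 : ℝ) ∈ A}) := by
    ext t
    have hm : u ∈ t ↔ (t.mark u).isSome := Iff.rfl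
    simp only [Set.mem_preimage, Set.mem_union, Set.mem_inter_iff, Set.mem_compl_iff, Set.mem_ofPred,
      hm, lifetime]
    cases t.mark u <;> simp
  rw [h2]
  exact h1.union ((measurableSet_mem u).compl.inter (MeasurableSet.const _))

noncomputable def numChildren (t : MarkedTree) (u : List ℕ) : ℕ := sInf {n | u ++ [n] ∉ t}

theorem measurable_numChildren (u : List ℕ) : Measurable fun t : MarkedTree => t.numChildren u :=
  TreeData.measurable_sInf_nat fun n => (measurableSet_mem (u ++ [n])).compl

theorem lt_numChildren {t : MarkedTree} {u : List ℕ} (hu : u ∈ t) (j : ℕ) :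
    j < t.numChildren u ↔ u ++ [j] ∈ t := by
  obtain ⟨n, hn⟩ := t.children u hu
  have hn' : ∀ j, u ++ [j] ∈ t ↔ j < n := hn
  have : t.numChildren u = n := by
    refine le_antisymm (Nat.sInf_le ?_) ?_
    · simp [hn']
    · refine le_csInf ⟨n, by simp [hn']⟩ fun m hm => ?_
      simpa [hn'] using hm
  rw [this, hn']

theorem ofData_numChildren_lifetime (t : MarkedTree) : ofData t.numChildren t.lifetime = t := by
  have h : ∀ u, IsIndividual t.numChildren u ↔ u ∈ t := fun u => by
    induction u using List.reverseRecOn with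
    | nil => exact iff_of_true (isIndividual_nil _) t.root_mem
    | append_singleton u j ih =>
      rw [isIndividual_append, ih]
      constructor
      · rintro ⟨hu, hj⟩; exact (lt_numChildren hu j).1 hj
      · intro hj
        have hu : u ∈ t := t.parent_mem u j hj
        exact ⟨hu, (lt_numChildren hu j).2 hj⟩
  refine ext_mark fun u => ?_
  by_cases hu : u ∈ t
  · have hs : (t.mark u).isSome := hu
    obtain ⟨z, hz⟩ := Option.isSome_iff_exists.1 hs
    simp [ofData, (h u).2 hu, lifetime, hz]
  · have hn : t.mark u = none := by simpa using (show ¬ (t.mark u).isSome from hu)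
    simp [ofData, mt (h u).1 hu, hn]

theorem numChildren_ofData_nil (ν : List ℕ → ℕ) (ζ : List ℕ → ℝ) :
    (ofData ν ζ).numChildren [] = ν [] := by
  have h : ∀ j, j < (ofData ν ζ).numChildren [] ↔ j < ν [] := fun j => by
    rw [lt_numChildren (mem_ofData.2 (isIndividual_nil _)), mem_ofData, isIndividual_append]
    exact and_iff_right (isIndividual_nil _)
  exact eq_of_forall_lt_iff h

/-- A tree with coloured leaves, as a decorated tree. -/
noncomputable def toData (x : MarkedTree × (List ℕ → Bool)) : TreeData := fun u =>
  (x.1.numChildren u, x.1.lifetime u, bif x.2 u then 0 else 1)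

theorem measurable_toData : Measurable toData := by
  refine measurable_pi_lambda _ fun u => ?_
  refine Measurable.prodMk ((measurable_numChildren u).comp measurable_fst)
    (((measurable_lifetime u).comp measurable_fst).prodMk ?_)
  exact (Measurable.of_discrete : Measurable fun b : Bool => (bif b then (0 : ℝ) else 1)).comp
    ((measurable_pi_apply u).comp measurable_snd)

theorem tree_toData (x : MarkedTree × (List ℕ → Bool)) : TreeData.tree (toData x) = x.1 :=
  ofData_numChildren_lifetime x.1

/-- Black has mark `0` and red has mark `1`, and `1 / 2` separates them. Thereby measurability of
`reduce` and of the black-root event follows from that of `red` and `blk`. -/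
theorem colour_toData (x : MarkedTree × (List ℕ → Bool)) :
    TreeData.colour (1 / 2) (toData x) = x.2 := by
  funext u
  cases h : x.2 u <;> simp [TreeData.colour, toData, h]; norm_num

end MarkedTree

namespace TreeData

theorem isBlack_tree_nil {s : ℝ} {x : TreeData} : (tree x).IsBlack (colour s x) [] ↔ x ∈ blk s := by
  rw [isBlack_tree]
  exact and_iff_right (isIndividual_nil _)

theorem measurableSet_isBlack :
    MeasurableSet {x : MarkedTree × (List ℕ → Bool) | x.1.IsBlack x.2 []} := by
  convert MarkedTree.measurable_toData (measurableSet_blk (1 / 2)) using 1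
  ext x
  rw [Set.mem_preimage, ← isBlack_tree_nil, MarkedTree.tree_toData, MarkedTree.colour_toData]
  rfl

theorem measurable_reduce :
    Measurable fun x : MarkedTree × (List ℕ → Bool) => x.1.reduce x.2 := by
  convert measurable_tree.comp ((measurable_red (1 / 2)).comp MarkedTree.measurable_toData) using 1
  funext x
  rw [Function.comp, Function.comp, ← reduce_tree, MarkedTree.tree_toData, MarkedTree.colour_toData]

variable (q : PMF ℕ) (κ : ProbabilityMeasure ℝ)

theorem measurable_tree_colour (s : ℝ) : Measurable fun x => (tree x, colour s x) :=
  measurable_tree.prodMk (measurable_colour s)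

theorem dataLaw_map_tree_colour (s : unitInterval) :
    (dataLaw q κ).map (fun x => (tree x, colour s x)) =
      (gwTree q κ).prod (colourLaw (unitInterval.symm s)) := by
  set a := q.toMeasure.prod (κ : Measure ℝ) with ha
  set f : ℕ × ℝ × ℝ → (ℕ × ℝ) × Bool := fun p => ((p.1, p.2.1), decide (p.2.2 < (s : ℝ))) with hf
  have hd : Measurable fun u : ℝ => decide (u < (s : ℝ)) := by
    refine measurable_to_bool ?_
    have : (fun u : ℝ => decide (u < (s : ℝ))) ⁻¹' {true} = Set.Iio (s : ℝ) := by ext; simp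
    rw [this]; exact measurableSet_Iio
  have hfm : Measurable f := by
    refine Measurable.prodMk (by fun_prop) (hd.comp (by fun_prop))
  have h1 : (rootLaw q κ).map f = a.prod (bernoulliMeasure false true (unitInterval.symm s)) := by
    have e1 : MeasurePreserving (MeasurableEquiv.prodAssoc.symm : ℕ × ℝ × ℝ ≃ᵐ (ℕ × ℝ) × ℝ)
        (rootLaw q κ) (a.prod unifLaw) := (measurePreserving_prodAssoc _ _ _).symm _
    have e2 : f = Prod.map id (fun u : ℝ => decide (u < (s : ℝ))) ∘ MeasurableEquiv.prodAssoc.symm := rfl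
    rw [e2, ← Measure.map_map (measurable_id.prodMap hd) e1.measurable, e1.map_eq,
      ← Measure.map_prod_map _ _ measurable_id hd, unifLaw_map_decide, Measure.map_id]
  have hp : IsProbabilityMeasure ((rootLaw q κ).map f) :=
    Measure.isProbabilityMeasure_map hfm.aemeasurable
  have h2 := Measure.infinitePi_map_pi (fun _ : List ℕ => rootLaw q κ) (f := fun _ => f)
    (fun _ => hfm)
  have h3 := infinitePi_prod (ι := List ℕ) a (bernoulliMeasure false true (unitInterval.symm s))
  simp only [h1] at h2
  have hfm' : Measurable fun (x : List ℕ → ℕ × ℝ × ℝ) i => f (x i) := by fun_prop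
  rw [← h2, Measure.map_map (by fun_prop) hfm'] at h3
  have ht : Measurable fun ω : List ℕ → ℕ × ℝ =>
      MarkedTree.ofData (fun u => (ω u).1) (fun u => (ω u).2) :=
    MarkedTree.measurable_ofData _ _ (fun u => (measurable_pi_apply u).fst)
      (fun u => (measurable_pi_apply u).snd)
  have h4 := congrArg (Measure.map (Prod.map (fun ω : List ℕ → ℕ × ℝ =>
      MarkedTree.ofData (fun u => (ω u).1) (fun u => (ω u).2)) (id : (List ℕ → Bool) → _))) h3
  rw [← Measure.map_prod_map _ _ ht measurable_id, Measure.map_id,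
    Measure.map_map (ht.prodMap measurable_id) (by fun_prop)] at h4
  exact h4

theorem dataLaw_map_tree : (dataLaw q κ).map tree = gwTree q κ := by
  have h := congrArg (Measure.map Prod.fst) (dataLaw_map_tree_colour q κ 0)
  rw [Measure.map_map measurable_fst (measurable_tree_colour _), Measure.map_fst_prod] at h
  rw [measure_univ, one_smul] at h
  exact h

theorem prunedLaw_map_tree : (prunedLaw q κ).map tree = gwTree q κ := by
  rw [prunedLaw, Measure.map_map measurable_tree measurable_prune, ← dataLaw_map_tree]
  congr 1
  funext x
  exact tree_prune x

variable {q κ}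

/-- Transfers the definition to decorated trees, with the conditional law multiplied by the
probability of the condition. -/
theorem isReducedPair_iff_map {s : unitInterval} {q' : PMF ℕ} {κ' : ProbabilityMeasure ℝ} :
    IsReducedPair (unitInterval.symm s) q κ q' κ' ↔ (dataLaw q κ (blk s) ≠ 0 →
      (((dataLaw q κ).restrict (blk s)).map (red s)).map tree =
        dataLaw q κ (blk s) • gwTree q' κ') := by
  have hpre : (fun x => (tree x, colour s x)) ⁻¹' {x | x.1.IsBlack x.2 []} = blk s := by
    ext x; exact isBlack_tree_nil
  have hm := measurable_tree_colour s
  have hE := measurableSet_isBlack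
  have hw : ((gwTree q κ).prod (colourLaw (unitInterval.symm s)))
      {x : MarkedTree × (List ℕ → Bool) | x.1.IsBlack x.2 []} = dataLaw q κ (blk s) := by
    rw [← dataLaw_map_tree_colour, Measure.map_apply hm hE, hpre]
  simp only [IsReducedPair]
  rw [hw]
  refine imp_congr_right fun h0 => ?_
  have ht : dataLaw q κ (blk s) ≠ ∞ := measure_ne_top _ _
  have h1 : (ProbabilityTheory.cond ((gwTree q κ).prod (colourLaw (unitInterval.symm s)))
      {x : MarkedTree × (List ℕ → Bool) | x.1.IsBlack x.2 []}).map (fun x => x.1.reduce x.2) =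
      (dataLaw q κ (blk s))⁻¹ • (((dataLaw q κ).restrict (blk s)).map (red s)).map tree := by
    rw [ProbabilityTheory.cond, hw, Measure.map_smul, ← dataLaw_map_tree_colour,
      Measure.restrict_map hm hE, hpre, Measure.map_map measurable_reduce hm,
      Measure.map_map measurable_tree (measurable_red s)]
    congr 2
    funext x
    exact reduce_tree _ _
  rw [h1]
  constructor
  · intro h
    rw [← h, smul_smul, ENNReal.mul_inv_cancel h0 ht, one_smul]
  · intro h
    rw [h, smul_smul, ENNReal.inv_mul_cancel h0 ht, one_smul]

end TreeData

/-- The root alone reveals both laws. -/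
theorem gwTree_injective {q q' : PMF ℕ} {κ κ' : ProbabilityMeasure ℝ} (h : gwTree q κ = gwTree q' κ') :
    q = q' ∧ κ = κ' := by
  have h1 : ∀ (q : PMF ℕ) (κ : ProbabilityMeasure ℝ),
      (gwTree q κ).map (fun t => (t.numChildren [], t.lifetime [])) = q.toMeasure.prod (κ : Measure ℝ) := by
    intro q κ
    rw [gwTree, Measure.map_map ((MarkedTree.measurable_numChildren []).prodMk
      (MarkedTree.measurable_lifetime [])) (MarkedTree.measurable_ofData _ _
      (fun u => (measurable_pi_apply u).fst) (fun u => (measurable_pi_apply u).snd))]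
    refine Eq.trans ?_ (Measure.infinitePi_map_eval
      (fun _ : List ℕ => q.toMeasure.prod (κ : Measure ℝ)) [])
    congr 1
    funext ω
    refine Prod.ext (MarkedTree.numChildren_ofData_nil _ _) ?_
    exact MarkedTree.lifetime_ofData (isIndividual_nil _)
  have h2 : q.toMeasure.prod (κ : Measure ℝ) = q'.toMeasure.prod (κ' : Measure ℝ) := by
    rw [← h1, ← h1, h]
  have h3 := congrArg Measure.fst h2
  have h4 := congrArg Measure.snd h2
  rw [Measure.fst_prod, Measure.fst_prod] at h3
  rw [Measure.snd_prod, Measure.snd_prod] at h4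
  refine ⟨?_, Subtype.ext h4⟩
  ext n
  rw [← TreeData.toMeasure_singleton_nat q, ← TreeData.toMeasure_singleton_nat q', h3]

/-! ### Decorated bushes -/

abbrev BushData := ℕ × (ℕ → TreeData)

namespace BushData

open TreeData

noncomputable def trees (e : BushData) : Bush := (decList e).map tree

open Classical in
/-- The reduced bush, in which the black leaves have marks below `s`. -/
noncomputable def red (s : ℝ) (e : BushData) : BushData :=
  enc (((decList e).filter (· ∈ blk s)).map (TreeData.red s))

theorem ofFn_tree (e : BushData) : (List.ofFn fun i : Fin e.1 => tree (e.2 i)) = trees e := by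
  refine List.ext_getElem (by simp [trees]) fun i h1 h2 => ?_
  simp [trees, decList]

theorem reduceBush_trees (s : ℝ) (e : BushData) :
    reduceBush (trees e) (fun i => colour s (e.2 i)) = trees (red s e) := by
  classical
  have h1 : (trees e).zipIdx = (List.range e.1).map fun i => (tree (e.2 i), i) := by
    refine List.ext_getElem (by simp [trees]) fun i h1 h2 => ?_
    simp [trees, decList]
  rw [reduceBush, h1, List.filterMap_map, trees, red, decList_enc, List.map_map, decList]
  induction List.range e.1 with
  | nil => rfl
  | cons i l ih =>
    rw [List.filterMap_cons, ih, List.map_cons]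
    by_cases h : e.2 i ∈ blk s
    · simp [isBlack_tree_nil, h, reduce_tree]
    · simp [isBlack_tree_nil, h]

theorem measurable_red (s : ℝ) : Measurable (red s) := by
  classical
  have := (measurable_enc_map_decList (TreeData.measurable_red s)).comp
    (measurable_enc_filter_decList (measurableSet_blk s))
  convert this using 1
  funext e
  simp only [Function.comp, red, decList_enc]

theorem measurable_trees : Measurable trees := by
  rintro _ ⟨A, hA, rfl⟩
  refine measurable_from_prod_countable_right (f := fun e : BushData =>
    (⟨(trees e).length, (trees e).get⟩ : Σ n : ℕ, (Fin n → MarkedTree))) (fun n => ?_) hA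
  have h : (fun c : ℕ → TreeData => (⟨(trees (n, c)).length, (trees (n, c)).get⟩ :
      Σ n : ℕ, (Fin n → MarkedTree))) = fun c => ⟨n, fun i => tree (c i)⟩ := by
    funext c
    have hl : (trees (n, c)).length = n := by simp [trees]
    refine Sigma.ext hl ?_
    refine (Fin.heq_fun_iff hl).2 fun i => ?_
    change (trees (n, c)).get i = tree (c i)
    rw [List.get_eq_getElem]
    simp [trees, decList]
  rw [h]
  intro B hB
  have hB' : MeasurableSet {f : Fin n → MarkedTree |
      (⟨n, f⟩ : Σ n : ℕ, (Fin n → MarkedTree)) ∈ B} := by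
    have := MeasurableSpace.measurableSet_iInf.1 hB n
    exact this
  exact (measurable_pi_lambda _ fun i : Fin n => measurable_tree.comp
    (measurable_pi_apply (i : ℕ)) : Measurable fun (c : ℕ → TreeData) (i : Fin n) => tree (c i)) hB'

/-- A bush with coloured leaves, as a decorated bush. -/
noncomputable def ofBush (x : Bush × (ℕ → List ℕ → Bool)) : BushData :=
  (x.1.length, fun i => MarkedTree.toData (x.1.getD i (tree default), x.2 i))

theorem measurable_bush_getD (t₀ : MarkedTree) :
    Measurable fun b : Bush => (b.length, fun i => b.getD i t₀) := by
  let g : (Σ n : ℕ, (Fin n → MarkedTree)) → ℕ × (ℕ → MarkedTree) :=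
    fun y => (y.1, fun i => if h : i < y.1 then y.2 ⟨i, h⟩ else t₀)
  have hg : Measurable g := by
    intro A hA
    refine MeasurableSpace.measurableSet_iInf.2 fun n => ?_
    have : Measurable fun f : Fin n → MarkedTree =>
        ((n, fun i => if h : i < n then f ⟨i, h⟩ else t₀) : ℕ × (ℕ → MarkedTree)) := by
      refine Measurable.prodMk measurable_const (measurable_pi_lambda _ fun i => ?_)
      by_cases h : i < n
      · simpa [h] using measurable_pi_apply _
      · simp [h]
    exact this hA
  have h : (fun b : Bush => (b.length, fun i => b.getD i t₀)) =
      g ∘ fun b : Bush => (⟨b.length, b.get⟩ : Σ n : ℕ, (Fin n → MarkedTree)) := by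
    funext b
    refine Prod.ext rfl ?_
    funext i
    by_cases h : i < b.length <;> simp [g, h]
  rw [h]
  exact hg.comp (comap_measurable _)

theorem measurable_ofBush : Measurable ofBush := by
  have h := (measurable_bush_getD (tree default)).comp
    (measurable_fst : Measurable (Prod.fst : Bush × (ℕ → List ℕ → Bool) → Bush))
  refine Measurable.prodMk h.fst (measurable_pi_lambda _ fun i => ?_)
  exact MarkedTree.measurable_toData.comp (((measurable_pi_apply i).comp h.snd).prodMk
    ((measurable_pi_apply i).comp measurable_snd))

theorem trees_ofBush (x : Bush × (ℕ → List ℕ → Bool)) : trees (ofBush x) = x.1 := by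
  refine List.ext_getElem (by simp [trees, ofBush]) fun i h1 h2 => ?_
  simp [trees, decList, ofBush, MarkedTree.tree_toData, h2]

theorem measurable_reduceBush :
    Measurable fun x : Bush × (ℕ → List ℕ → Bool) => reduceBush x.1 x.2 := by
  convert measurable_trees.comp ((measurable_red (1 / 2)).comp measurable_ofBush) using 1
  funext x
  rw [Function.comp, Function.comp, ← reduceBush_trees, trees_ofBush]
  congr 1
  funext i
  exact (MarkedTree.colour_toData (x.1.getD i (tree default), x.2 i)).symm

variable (q : PMF ℕ) (κ : ProbabilityMeasure ℝ) (β : ℝ≥0)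

/-- A Poisson number of independent decorated trees. -/
noncomputable def poissonLaw (ρ : Measure TreeData) (β : ℝ≥0) : Measure BushData :=
  (poissonMeasure β).prod (Measure.infinitePi fun _ : ℕ => ρ)

instance (ρ : Measure TreeData) [IsProbabilityMeasure ρ] (β : ℝ≥0) :
    IsProbabilityMeasure (poissonLaw ρ β) := by unfold poissonLaw; infer_instance

theorem poissonLaw_map_trees_colour (s : unitInterval) :
    (poissonLaw (dataLaw q κ) β).map (fun e => (trees e, fun i => colour s (e.2 i))) =
      (gwBush q κ β).prod (Measure.infinitePi fun _ : ℕ => colourLaw (unitInterval.symm s)) := by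
  set C := colourLaw (unitInterval.symm s) with hC
  have hm := measurable_tree_colour s
  have hp : IsProbabilityMeasure ((dataLaw q κ).map fun x => (tree x, colour s x)) :=
    Measure.isProbabilityMeasure_map hm.aemeasurable
  have h1 := Measure.infinitePi_map_pi (fun _ : ℕ => dataLaw q κ)
    (f := fun _ x => (tree x, colour s x)) (fun _ => hm)
  simp only [dataLaw_map_tree_colour] at h1
  have h2 := infinitePi_prod (ι := ℕ) (gwTree q κ) C
  have hm' : Measurable fun (x : ℕ → TreeData) i => (tree (x i), colour s (x i)) :=
    measurable_pi_lambda _ fun i => hm.comp (measurable_pi_apply i)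
  have hz : Measurable fun x : ℕ → MarkedTree × (List ℕ → Bool) =>
      ((fun i => (x i).1, fun i => (x i).2) : (ℕ → MarkedTree) × (ℕ → List ℕ → Bool)) := by fun_prop
  rw [← h1, Measure.map_map hz hm'] at h2
  have h3 : (poissonLaw (dataLaw q κ) β).map (Prod.map id
      ((fun x : ℕ → MarkedTree × (List ℕ → Bool) =>
      ((fun i => (x i).1, fun i => (x i).2) : (ℕ → MarkedTree) × (ℕ → List ℕ → Bool))) ∘
      fun (x : ℕ → TreeData) i => (tree (x i), colour s (x i)))) =
      (poissonMeasure β).prod ((Measure.infinitePi fun _ : ℕ => gwTree q κ).prod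
        (Measure.infinitePi fun _ : ℕ => C)) := by
    rw [poissonLaw, ← Measure.map_prod_map _ _ measurable_id (hz.comp hm'), h2, Measure.map_id]
  have h4 : MeasurePreserving (MeasurableEquiv.prodAssoc.symm :
      ℕ × ((ℕ → MarkedTree) × (ℕ → List ℕ → Bool)) ≃ᵐ (ℕ × (ℕ → MarkedTree)) × (ℕ → List ℕ → Bool))
      ((poissonMeasure β).prod ((Measure.infinitePi fun _ : ℕ => gwTree q κ).prod
        (Measure.infinitePi fun _ : ℕ => C)))
      (((poissonMeasure β).prod (Measure.infinitePi fun _ : ℕ => gwTree q κ)).prod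
        (Measure.infinitePi fun _ : ℕ => C)) :=
    (measurePreserving_prodAssoc _ _ _).symm _
  have hb : Measurable fun x : ℕ × (ℕ → MarkedTree) => List.ofFn fun i : Fin x.1 => x.2 i := by
    have h := measurable_trees.comp
      ((by
        refine Measurable.prodMk measurable_fst (measurable_pi_lambda _ fun i => ?_)
        exact MarkedTree.measurable_toData.comp (Measurable.prodMk (by fun_prop) measurable_const) :
        Measurable fun x : ℕ × (ℕ → MarkedTree) =>
        ((x.1, fun i => MarkedTree.toData (x.2 i, fun _ => true)) : BushData)))
    convert h using 1
    funext x
    rw [Function.comp, ← ofFn_tree]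
    simp [MarkedTree.tree_toData]
  rw [gwBush]
  have hid : Measure.infinitePi (fun _ : ℕ => C) = (Measure.infinitePi fun _ : ℕ => C).map id :=
    Measure.map_id.symm
  rw [hid, Measure.map_prod_map _ _ hb measurable_id, ← h4.map_eq, ← h3,
    Measure.map_map h4.measurable (measurable_id.prodMap (hz.comp hm')),
    Measure.map_map (hb.prodMap measurable_id) (h4.measurable.comp
      (measurable_id.prodMap (hz.comp hm')))]
  congr 1
  funext e
  exact Prod.ext (ofFn_tree e).symm rfl

theorem measurable_trees_colour (s : ℝ) :
    Measurable fun e : BushData => (trees e, fun i => colour s (e.2 i)) := by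
  refine measurable_trees.prodMk (measurable_pi_lambda _ fun i => ?_)
  exact (measurable_colour s).comp (by fun_prop)

theorem poissonLaw_map_trees : (poissonLaw (dataLaw q κ) β).map trees = gwBush q κ β := by
  have h := congrArg (Measure.map Prod.fst) (poissonLaw_map_trees_colour q κ β 0)
  rw [Measure.map_map measurable_fst (measurable_trees_colour _), Measure.map_fst_prod] at h
  rw [measure_univ, one_smul] at h
  exact h

theorem reductionLaw_eq (s : unitInterval) :
    reductionLaw (unitInterval.symm s) q κ β =
      (poissonLaw (dataLaw q κ) β).map fun e => (trees (red s e), trees e) := by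
  rw [reductionLaw, ← poissonLaw_map_trees_colour, Measure.map_map
    (measurable_reduceBush.prodMk measurable_fst) (measurable_trees_colour _)]
  congr 1
  funext e
  exact Prod.ext (reduceBush_trees _ e) rfl

/-- The law of the decorated Galton-Watson bush, with irrelevant data removed. -/
noncomputable def prunedLaw (q : PMF ℕ) (κ : ProbabilityMeasure ℝ) (β : ℝ≥0) : Measure BushData :=
  (poissonLaw (_root_.prunedLaw q κ) β).map fun e => enc (decList e)

instance : IsProbabilityMeasure (prunedLaw q κ β) :=
  Measure.isProbabilityMeasure_map measurable_enc_decList.aemeasurable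

theorem prunedLaw_eq_map :
    prunedLaw q κ β = (poissonLaw (dataLaw q κ) β).map fun e => enc ((decList e).map prune) := by
  have h1 := Measure.infinitePi_map_pi (fun _ : ℕ => dataLaw q κ) (f := fun _ => prune)
    (fun _ => measurable_prune)
  have hp : Measurable fun (c : ℕ → TreeData) i => prune (c i) :=
    measurable_pi_lambda _ fun i => measurable_prune.comp (measurable_pi_apply i)
  have h2 : poissonLaw (_root_.prunedLaw q κ) β = (poissonLaw (dataLaw q κ) β).map
      (Prod.map id fun (c : ℕ → TreeData) i => prune (c i)) := by
    rw [poissonLaw, poissonLaw, ← Measure.map_prod_map _ _ measurable_id hp, h1, Measure.map_id]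
    rfl
  rw [prunedLaw, h2, Measure.map_map measurable_enc_decList (measurable_id.prodMap hp)]
  congr 1
  funext e
  simp [decList, Function.comp_def]

theorem red_map_prune (s : ℝ) (e : BushData) : red s (enc ((decList e).map prune)) = red s e := by
  classical
  rw [red, red, decList_enc]
  congr 1
  induction decList e with
  | nil => rfl
  | cons x l ih =>
    have : prune x ∈ blk s ↔ x ∈ blk s := not_congr isRed_prune
    by_cases h : x ∈ blk s <;> simp [h, this, ih, red_prune]

theorem trees_map_prune (e : BushData) : trees (enc ((decList e).map prune)) = trees e := by
  rw [trees, trees, decList_enc, List.map_map]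
  exact List.map_congr_left fun x _ => tree_prune x

theorem reductionLaw_eq_prunedLaw (s : unitInterval) :
    reductionLaw (unitInterval.symm s) q κ β =
      (prunedLaw q κ β).map fun e => (trees (red s e), trees e) := by
  have hm : Measurable fun e => (trees (red s e), trees e) :=
    (measurable_trees.comp (measurable_red s)).prodMk measurable_trees
  rw [reductionLaw_eq, prunedLaw_eq_map, Measure.map_map hm
    (measurable_enc_map_decList measurable_prune)]
  congr 1
  funext e
  simp only [Function.comp, red_map_prune, trees_map_prune]

theorem prunedLaw_map_trees : (prunedLaw q κ β).map trees = gwBush q κ β := by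
  rw [prunedLaw_eq_map, ← poissonLaw_map_trees, Measure.map_map measurable_trees
    (measurable_enc_map_decList measurable_prune)]
  congr 1
  funext e
  exact trees_map_prune e

end BushData

/-! ### The probability of a black root -/

/-- Colours do not involve lifetimes, so a fixed lifetime law serves to define the probability of a
black root in terms of `q` alone (`dataLaw_blk`). -/
noncomputable def zeroLife : ProbabilityMeasure ℝ := ⟨Measure.dirac 0, inferInstance⟩

/-- The probability that the root is black if leaves are black with probability `s`. -/
noncomputable def blackProb (q : PMF ℕ) (s : ℝ) : ℝ≥0 :=
  (dataLaw q zeroLife (TreeData.blk s)).toNNReal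

namespace TreeData

theorem redWithin_congr {s : ℝ} {n : ℕ} {x y : TreeData}
    (h : ∀ u, (x u).1 = (y u).1 ∧ (x u).2.2 = (y u).2.2) : RedWithin s n x ↔ RedWithin s n y := by
  induction n generalizing x y with
  | zero => rfl
  | succ n ih =>
    simp only [RedWithin, h []]
    exact and_congr_right fun _ => forall₂_congr fun j _ => ih fun u => h (j :: u)

variable (q : PMF ℕ) (κ : ProbabilityMeasure ℝ)

theorem dataLaw_map_zero :
    (dataLaw q κ).map (fun x u => ((x u).1, (0 : ℝ), (x u).2.2)) =
      dataLaw q zeroLife := by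
  have hm : Measurable fun p : ℕ × ℝ × ℝ => (p.1, (0 : ℝ), p.2.2) := by fun_prop
  have h1 := Measure.infinitePi_map_pi (fun _ : List ℕ => rootLaw q κ)
    (f := fun _ p => (p.1, (0 : ℝ), p.2.2)) (fun _ => hm)
  have h2 : (rootLaw q κ).map (fun p : ℕ × ℝ × ℝ => (p.1, (0 : ℝ), p.2.2)) =
      rootLaw q zeroLife := by
    have e : (fun p : ℕ × ℝ × ℝ => (p.1, (0 : ℝ), p.2.2)) =
        Prod.map id (Prod.map (fun _ => (0 : ℝ)) id) := rfl
    rw [e, rootLaw, ← Measure.map_prod_map _ _ measurable_id (by fun_prop),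
      ← Measure.map_prod_map _ _ measurable_const measurable_id, Measure.map_id, Measure.map_id,
      Measure.map_const, measure_univ, one_smul]
    rfl
  simp only [h2] at h1
  exact h1

theorem dataLaw_blk (s : ℝ) : dataLaw q κ (blk s) = blackProb q s := by
  rw [blackProb, ENNReal.coe_toNNReal (measure_ne_top _ _), ← dataLaw_map_zero q κ, Measure.map_apply
    (measurable_pi_lambda _ fun u => by fun_prop) (measurableSet_blk s)]
  congr 1
  ext x
  refine not_congr (exists_congr fun n => ?_)
  exact redWithin_congr fun u => ⟨rfl, rfl⟩

theorem blackProb_le_one (s : ℝ) : blackProb q s ≤ 1 := by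
  have h := prob_le_one (μ := dataLaw q zeroLife) (s := blk s)
  rw [dataLaw_blk] at h
  exact_mod_cast h

theorem dataLaw_compl_blk (s : ℝ) : dataLaw q κ (blk s)ᶜ = (1 - blackProb q s : ℝ≥0) := by
  rw [prob_compl_eq_one_sub (measurableSet_blk s), dataLaw_blk]
  push_cast
  rfl

end TreeData

/-! ### Thinning of Poisson bushes -/

/-- The sum over the number `j` of deleted objects is an exponential series with sum `exp (β (1 -
w))`. -/
theorem thin_poissonMeasure (β w : ℝ≥0) (hw : w ≤ 1) (k : ℕ) :
    thin (poissonMeasure β) w (1 - w : ℝ≥0) k = poissonMeasure (β * w) {k} := by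
  have hterm : ∀ j : ℕ, poissonMeasure β {k + j} *
      (((k + j).choose k : ℝ≥0∞) * ((w : ℝ≥0∞) ^ k * ((1 - w : ℝ≥0) : ℝ≥0∞) ^ j)) =
      ENNReal.ofReal (Real.exp (-β) * (β * w) ^ k / k.factorial *
        ((β * (1 - w)) ^ j / j.factorial)) := fun j => by
    have h0 : (0 : ℝ) ≤ 1 - w := by have : (w : ℝ) ≤ 1 := by exact_mod_cast hw
                                    linarith
    have e1 : ((1 - w : ℝ≥0) : ℝ≥0∞) = ENNReal.ofReal (1 - w : ℝ) := by
      rw [← ENNReal.ofReal_coe_nnreal, NNReal.coe_sub hw]; simp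
    have e2 : ((k + j).choose k : ℝ≥0∞) = ENNReal.ofReal ((k + j).choose k : ℝ) :=
      (ENNReal.ofReal_natCast _).symm
    rw [poissonMeasure_singleton, e1, e2, ← ENNReal.ofReal_coe_nnreal (p := w),
      ← ENNReal.ofReal_pow w.coe_nonneg, ← ENNReal.ofReal_pow h0, ← ENNReal.ofReal_mul (by positivity),
      ← ENNReal.ofReal_mul (by positivity), ← ENNReal.ofReal_mul (by positivity)]
    congr 1
    have hc : ((k + j).choose k : ℝ) * k.factorial * j.factorial = (k + j).factorial := by
      rw [Nat.choose_symm_add]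
      exact_mod_cast Nat.add_choose_mul_factorial_mul_factorial k j
    have h1 : (k.factorial : ℝ) ≠ 0 := by positivity
    have h2 : (j.factorial : ℝ) ≠ 0 := by positivity
    have h3 : ((k + j).factorial : ℝ) ≠ 0 := by positivity
    rw [mul_pow (β : ℝ) (1 - w) j]
    field_simp
    rw [← hc]
    ring
  have hsum : HasSum (fun j : ℕ => Real.exp (-β) * (β * w) ^ k / k.factorial *
      ((β * (1 - w) : ℝ) ^ j / j.factorial))
      (Real.exp (-β) * (β * w) ^ k / k.factorial * Real.exp (β * (1 - w))) := by
    have := NormedSpace.expSeries_div_hasSum_exp (β * (1 - w) : ℝ)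
    rw [← Real.exp_eq_exp_ℝ] at this
    exact this.mul_left _
  have hw1 : (w : ℝ) ≤ 1 := by exact_mod_cast hw
  have h0 : (0 : ℝ) ≤ 1 - w := by linarith
  rw [thin, tsum_congr hterm, ← ENNReal.ofReal_tsum_of_nonneg (fun j => by positivity) hsum.summable,
    hsum.tsum_eq, poissonMeasure_singleton]
  congr 1
  have : Real.exp (-((β * w : ℝ≥0) : ℝ)) = Real.exp (-β) * Real.exp (β * (1 - w)) := by
    rw [← Real.exp_add]; congr 1; push_cast; ring
  rw [this]
  push_cast
  ring

namespace BushData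

open TreeData

theorem prunedLaw_apply (q : PMF ℕ) (κ : ProbabilityMeasure ℝ) (β : ℝ≥0) {A : Set BushData}
    (hA : MeasurableSet A) :
    prunedLaw q κ β A = ∑' k, poissonMeasure β {k} * listLaw (_root_.prunedLaw q κ) k A := by
  rw [prunedLaw, Measure.map_apply measurable_enc_decList hA, poissonLaw,
    Measure.prod_apply (measurable_enc_decList hA), lintegral_countable']
  refine tsum_congr fun k => ?_
  rw [mul_comm, listLaw, Measure.map_apply (measurable_enc_decList_mk k) hA]
  rfl

theorem prunedLaw_zero (q : PMF ℕ) (κ : ProbabilityMeasure ℝ) :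
    prunedLaw q κ 0 = Measure.dirac (enc []) := by
  ext A hA
  rw [prunedLaw_apply q κ 0 hA, tsum_eq_single 0, listLaw_zero, poissonMeasure_singleton]
  · simp
  · intro k hk
    rw [poissonMeasure_singleton]
    simp [hk]

/-- Poisson thinning: the trees with a black root are Poisson in number with parameter `β w`, and
their reductions are independent. If `w = 0`, the reduced bush is empty and `q'`, `κ'` are
arbitrary. -/
theorem prunedLaw_map_red {q q' : PMF ℕ} {κ κ' : ProbabilityMeasure ℝ} (β : ℝ≥0) {s : ℝ}
    (h : blackProb q s ≠ 0 → ((dataLaw q κ).restrict (blk s)).map (TreeData.red s) =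
      dataLaw q κ (blk s) • _root_.prunedLaw q' κ') :
    (prunedLaw q κ β).map (red s) = prunedLaw q' κ' (β * blackProb q s) := by
  classical
  have h1 : (prunedLaw q κ β).map (red s) = (poissonLaw (dataLaw q κ) β).map (red s) := by
    rw [prunedLaw_eq_map, Measure.map_map (measurable_red s)
      (measurable_enc_map_decList measurable_prune)]
    congr 1
    funext e
    exact red_map_prune s e
  obtain ⟨ρ₀, hρ₀, hρ⟩ := exists_restrict_eq_smul (dataLaw q κ) (blk s)
  have hp : IsProbabilityMeasure (ρ₀.map (TreeData.red s)) :=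
    Measure.isProbabilityMeasure_map (TreeData.measurable_red s).aemeasurable
  have hm1 := measurable_enc_filter_decList (measurableSet_blk s)
  have hm2 := measurable_enc_map_decList (TreeData.measurable_red s)
  have hcomp : red s = (fun e : BushData => enc ((decList e).map (TreeData.red s))) ∘
      fun e => enc ((decList e).filter (· ∈ blk s)) := by
    funext e; simp [red]
  ext A hA
  rw [h1, hcomp, ← Measure.map_map hm2 hm1, Measure.map_apply hm2 hA, poissonLaw,
    prod_filter_decList _ _ (measurableSet_blk s) ρ₀ hρ (hm2 hA), dataLaw_blk, dataLaw_compl_blk]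
  simp only [thin_poissonMeasure β _ (blackProb_le_one q s)]
  by_cases hw : blackProb q s = 0
  · rw [hw, mul_zero, prunedLaw_zero, tsum_eq_single 0, poissonMeasure_singleton, listLaw_zero,
      Measure.dirac_apply' _ (hm2 hA), Measure.dirac_apply' _ hA]
    · by_cases ha : enc [] ∈ A
      · simp [ha]
      · simp [ha]
    · intro k hk
      rw [poissonMeasure_singleton]
      simp [hk]
  · have hρ' : ρ₀.map (TreeData.red s) = _root_.prunedLaw q' κ' := by
      have h2 := h hw
      rw [hρ, Measure.map_smul, dataLaw_blk] at h2
      have h3 := congrArg (fun m : Measure TreeData => ((blackProb q s : ℝ≥0∞))⁻¹ • m) h2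
      simp only [smul_smul] at h3
      rwa [ENNReal.inv_mul_cancel (by exact_mod_cast hw) ENNReal.coe_ne_top, one_smul, one_smul] at h3
    rw [prunedLaw_apply _ _ _ hA]
    refine tsum_congr fun k => ?_
    have h4 := listLaw_map ρ₀ (TreeData.measurable_red s) k
    simp only [hρ'] at h4
    rw [← Measure.map_apply hm2 hA, h4]

end BushData

/-! ### Parameters of bushes -/

theorem measurableSet_length_eq (n : ℕ) : MeasurableSet {b : Bush | b.length = n} :=
  measurableSet_eq_fun (BushData.measurable_bush_getD (TreeData.tree default)).fst measurable_const

theorem gwBush_length (q : PMF ℕ) (κ : ProbabilityMeasure ℝ) (β : ℝ≥0) (n : ℕ) :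
    gwBush q κ β {b | b.length = n} = poissonMeasure β {n} := by
  rw [← BushData.poissonLaw_map_trees, Measure.map_apply BushData.measurable_trees
    (measurableSet_length_eq n)]
  have : BushData.trees ⁻¹' {b : Bush | b.length = n} = {n} ×ˢ Set.univ := by
    ext e; simp [BushData.trees]
  rw [this, BushData.poissonLaw, Measure.prod_prod, measure_univ, mul_one]

theorem gwBush_single (q : PMF ℕ) (κ : ProbabilityMeasure ℝ) (β : ℝ≥0) (t₀ : MarkedTree)
    {A : Set MarkedTree} (hA : MeasurableSet A) :
    gwBush q κ β {b | b.length = 1 ∧ b.getD 0 t₀ ∈ A} = poissonMeasure β {1} * gwTree q κ A := by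
  have hm : MeasurableSet {b : Bush | b.length = 1 ∧ b.getD 0 t₀ ∈ A} :=
    (measurableSet_length_eq 1).inter
      (((measurable_pi_apply 0).comp (BushData.measurable_bush_getD t₀).snd) hA)
  rw [← BushData.poissonLaw_map_trees, Measure.map_apply BushData.measurable_trees hm]
  have : BushData.trees ⁻¹' {b : Bush | b.length = 1 ∧ b.getD 0 t₀ ∈ A} =
      {1} ×ˢ ((fun c : ℕ → TreeData => c 0) ⁻¹' (TreeData.tree ⁻¹' A)) := by
    ext ⟨n, c⟩
    simp only [Set.mem_preimage, Set.mem_ofPred, Set.mem_prod, Set.mem_singleton_iff,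
      BushData.trees, List.length_map, length_decList]
    refine and_congr_right fun hn => ?_
    subst hn
    simp [decList]
  have h2 : MeasurableSet (TreeData.tree ⁻¹' A) := TreeData.measurable_tree hA
  rw [this, BushData.poissonLaw, Measure.prod_prod,
    ← Measure.map_apply (measurable_pi_apply 0) h2, Measure.infinitePi_map_eval,
    ← TreeData.dataLaw_map_tree, Measure.map_apply TreeData.measurable_tree hA]

/-- The probability of the empty bush gives `β`. If `β ≠ 0`, a bush of exactly one tree has positive
probability and shows the law of the tree. -/
theorem gwBush_eq_iff {q q' : PMF ℕ} {κ κ' : ProbabilityMeasure ℝ} {β β' : ℝ≥0} :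
    gwBush q κ β = gwBush q' κ' β' ↔ β = β' ∧ (β ≠ 0 → q = q' ∧ κ = κ') := by
  constructor
  · intro h
    have hβ : β = β' := by
      have h0 := gwBush_length q κ β 0
      rw [h, gwBush_length, poissonMeasure_singleton, poissonMeasure_singleton] at h0
      have h1 := (ENNReal.ofReal_eq_ofReal_iff (by positivity) (by positivity)).1 h0
      simpa using h1.symm
    refine ⟨hβ, fun h0 => gwTree_injective ?_⟩
    ext A hA
    have h1 := gwBush_single q κ β (TreeData.tree default) hA
    rw [h, gwBush_single _ _ _ _ hA, ← hβ] at h1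
    refine ((ENNReal.mul_right_inj ?_ ?_).1 h1).symm
    · rw [poissonMeasure_singleton]
      have : 0 < β := pos_iff_ne_zero.2 h0
      have h2 : (0 : ℝ) < β := by exact_mod_cast this
      refine (ENNReal.ofReal_pos.2 ?_).ne'
      positivity
    · exact measure_ne_top _ _
  · rintro ⟨rfl, h⟩
    by_cases h0 : β = 0
    · subst h0
      rw [← BushData.prunedLaw_map_trees, ← BushData.prunedLaw_map_trees, BushData.prunedLaw_zero,
        BushData.prunedLaw_zero]
    · rw [(h h0).1, (h h0).2]

/-- The reduced pair, in terms of weights and characteristic functions. -/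
theorem isReducedPair_iff_exists {q : PMF ℕ} {κ : ProbabilityMeasure ℝ} (hq : IsOffspringLaw q)
    {s : unitInterval} (hw : blackProb q s ≠ 0) :
    ∃ (q₁ : PMF ℕ) (κ₁ : ProbabilityMeasure ℝ),
      (∀ q' κ', IsReducedPair (unitInterval.symm s) q κ q' κ' ↔ q' = q₁ ∧ κ' = κ₁) ∧
      ((dataLaw q κ).restrict (TreeData.blk s)).map (TreeData.red s) =
        dataLaw q κ (TreeData.blk s) • prunedLaw q₁ κ₁ ∧
      (∀ k, q₁ k = (dataLaw q κ (TreeData.blkNe s))⁻¹ *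
        TreeData.redCoef q s (blackProb q s) (1 - blackProb q s : ℝ≥0) k) ∧
      GeomRel (1 - (TreeData.singleProb q (1 - blackProb q s : ℝ≥0)).toReal) κ κ₁ ∧
      (IsLifetimeLaw κ → IsLifetimeLaw κ₁) := by
  have hw' : dataLaw q κ (TreeData.blk s) ≠ 0 := by
    rw [TreeData.dataLaw_blk]; exact_mod_cast hw
  obtain ⟨q₁, κ₁, h1, h2, h3, h4⟩ := TreeData.exists_reduced_law q κ hq s.2.1 s.2.2 hw'
  rw [TreeData.dataLaw_compl_blk] at h3
  refine ⟨q₁, κ₁, fun q' κ' => ?_, h1, fun k => ?_, h3, h4⟩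
  · rw [TreeData.isReducedPair_iff_map, h1, Measure.map_smul, TreeData.prunedLaw_map_tree]
    constructor
    · intro h
      have h5 := congrArg (fun m : Measure MarkedTree =>
        (dataLaw q κ (TreeData.blk s))⁻¹ • m) (h hw')
      simp only [smul_smul] at h5
      rw [ENNReal.inv_mul_cancel hw' (measure_ne_top _ _), one_smul, one_smul] at h5
      obtain ⟨rfl, rfl⟩ := gwTree_injective h5
      exact ⟨rfl, rfl⟩
    · rintro ⟨rfl, rfl⟩ -
      rfl
  · rw [h2, TreeData.dataLaw_compl_blk, TreeData.dataLaw_blk]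

theorem isReducedPair_of_blackProb_eq_zero {q : PMF ℕ} {κ : ProbabilityMeasure ℝ} {s : unitInterval}
    (hw : blackProb q s = 0) (q' : PMF ℕ) (κ' : ProbabilityMeasure ℝ) :
    IsReducedPair (unitInterval.symm s) q κ q' κ' := by
  rw [TreeData.isReducedPair_iff_map, TreeData.dataLaw_blk, hw]
  simp

/-- The definition speaks of trees without marks, but iterating reductions needs the marks that
remain. The reduced decorated tree is Galton-Watson anyway, with parameters identified by
`gwTree_injective`, so nothing is lost. -/
theorem isReducedPair_iff_prunedLaw {q : PMF ℕ} {κ : ProbabilityMeasure ℝ} (hq : IsOffspringLaw q)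
    {s : unitInterval} {q' : PMF ℕ} {κ' : ProbabilityMeasure ℝ} :
    IsReducedPair (unitInterval.symm s) q κ q' κ' ↔ (blackProb q s ≠ 0 →
      ((dataLaw q κ).restrict (TreeData.blk s)).map (TreeData.red s) =
        dataLaw q κ (TreeData.blk s) • prunedLaw q' κ') := by
  by_cases hw : blackProb q s = 0
  · exact iff_of_true (isReducedPair_of_blackProb_eq_zero hw _ _) fun h => absurd hw h
  · constructor
    · intro h _
      obtain ⟨q₁, κ₁, h1, h2, -⟩ := isReducedPair_iff_exists (κ := κ) hq hw
      obtain ⟨rfl, rfl⟩ := (h1 _ _).1 h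
      exact h2
    · intro h
      rw [TreeData.isReducedPair_iff_map]
      intro _
      rw [h hw, Measure.map_smul, TreeData.prunedLaw_map_tree]

/-- By thinning the reduced bush is a Galton-Watson bush with parameter `β * w`; comparing
parameters by `gwBush_eq_iff` separates the condition on `β'` from that on the pair. -/
theorem isReducedTriplet_iff {q : PMF ℕ} {κ : ProbabilityMeasure ℝ} (hq : IsOffspringLaw q)
    {s : unitInterval} {β : ℝ≥0} {q' : PMF ℕ} {κ' : ProbabilityMeasure ℝ} {β' : ℝ≥0} :
    IsReducedTriplet (unitInterval.symm s) q κ β q' κ' β' ↔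
      β' = β * blackProb q s ∧ (β ≠ 0 → IsReducedPair (unitInterval.symm s) q κ q' κ') := by
  have hm : Measurable fun e => (BushData.trees (BushData.red s e), BushData.trees e) :=
    (BushData.measurable_trees.comp (BushData.measurable_red s)).prodMk BushData.measurable_trees
  have h0 : ∀ q₁ κ₁, (blackProb q s ≠ 0 →
      ((dataLaw q κ).restrict (TreeData.blk s)).map (TreeData.red s) =
        dataLaw q κ (TreeData.blk s) • prunedLaw q₁ κ₁) →
      (reductionLaw (unitInterval.symm s) q κ β).map Prod.fst = gwBush q₁ κ₁ (β * blackProb q s) := by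
    intro q₁ κ₁ h
    rw [BushData.reductionLaw_eq_prunedLaw, Measure.map_map measurable_fst hm,
      ← BushData.prunedLaw_map_trees, ← BushData.prunedLaw_map_red β h,
      Measure.map_map BushData.measurable_trees (BushData.measurable_red s)]
    rfl
  rw [IsReducedTriplet]
  by_cases hw : blackProb q s = 0
  · rw [h0 q κ fun h => absurd hw h, gwBush_eq_iff, hw, mul_zero]
    simp only [isReducedPair_of_blackProb_eq_zero hw, implies_true, and_true, ne_eq, not_true,
      false_implies]
    exact eq_comm
  · obtain ⟨q₁, κ₁, h1, h2, -⟩ := isReducedPair_iff_exists (κ := κ) hq hw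
    rw [h0 q₁ κ₁ fun _ => h2, gwBush_eq_iff, h1]
    simp only [ne_eq, mul_eq_zero, hw, or_false]
    refine and_congr eq_comm (forall_congr' fun _ => and_congr eq_comm eq_comm)

/-! ### Composition of reductions in law -/

namespace TreeData

variable (q : PMF ℕ) (κ : ProbabilityMeasure ℝ)

theorem dataLaw_map_shift (u : List ℕ) : (dataLaw q κ).map (fun x => x.shift u) = dataLaw q κ := by
  induction u with
  | nil => simp
  | cons j u ih =>
    have h1 : (dataLaw q κ).map (fun x => x.sub j) = dataLaw q κ := by
      have h2 := congrArg (Measure.map fun p : (ℕ × ℝ × ℝ) × (ℕ → TreeData) => p.2 j)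
        (dataLaw_map_root_sub q κ)
      rw [Measure.map_map (by fun_prop) measurable_root_sub] at h2
      refine h2.trans ?_
      have h3 : (fun p : (ℕ × ℝ × ℝ) × (ℕ → TreeData) => p.2 j) = (fun c => c j) ∘ Prod.snd := rfl
      rw [h3, ← Measure.map_map (measurable_pi_apply j) measurable_snd, Measure.map_snd_prod,
        measure_univ, one_smul, Measure.infinitePi_map_eval]
    have h4 : (fun x : TreeData => x.shift (j :: u)) = (fun x => x.shift u) ∘ fun x => x.sub j := rfl
    rw [h4, ← Measure.map_map (measurable_shift u) (measurable_sub j), h1, ih]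

theorem finChain_prune {s : ℝ} {x : TreeData} : FinChain s (prune x) ↔ FinChain s x := by
  refine exists_congr fun n => ?_
  rw [iterate_step_prune, kids_prune, List.length_map]

variable {q κ}

theorem finChain_of_isRed {s : ℝ} {x : TreeData} (h : IsRed s x) : FinChain s x :=
  ⟨0, by simp [((isRed_iff_kids s).1 h).1]⟩

theorem ae_finChain_prunedLaw {s : ℝ} (hq : IsOffspringLaw q) (h0 : 0 ≤ s) (h1 : s ≤ 1) :
    ∀ᵐ x ∂prunedLaw q κ, FinChain s x := by
  rw [prunedLaw, ae_map_iff measurable_prune.aemeasurable (measurableSet_finChain s)]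
  filter_upwards [ae_finChain q κ hq h0 h1] with x hx
  rw [finChain_prune]
  by_cases h : IsRed s x
  · exact finChain_of_isRed h
  · exact hx h

end TreeData

open TreeData in
theorem IsReducedPair.isOffspringLaw {q q' : PMF ℕ} {κ κ' : ProbabilityMeasure ℝ}
    (hq : IsOffspringLaw q) {s : unitInterval} (hs : 0 < (s : ℝ)) (hw : blackProb q s ≠ 0)
    (h : IsReducedPair (unitInterval.symm s) q κ q' κ') : IsOffspringLaw q' := by
  obtain ⟨q₁, κ₁, h1, -, h3, -⟩ := isReducedPair_iff_exists (κ := κ) hq hw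
  obtain ⟨rfl, rfl⟩ := (h1 _ _).1 h
  constructor
  · rw [h3, redCoef, if_pos rfl]
    refine ENNReal.mul_pos (ENNReal.inv_ne_zero.2 (measure_ne_top _ _)) ?_
    exact (ENNReal.mul_pos hq.1.ne' (ENNReal.ofReal_pos.2 hs).ne').ne'
  · rw [h3, redCoef, if_neg one_ne_zero, if_pos rfl, mul_zero]

namespace TreeData

variable {q q' q'' : PMF ℕ} {κ κ' κ'' : ProbabilityMeasure ℝ}

/-- Chains at the levels `s` and `s * s'` are finite by `ae_finChain`. So are those at level `s'` in
the reduced tree, which for `s > 0` is Galton-Watson with an admissible offspring law. Every subtree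
has the law of the whole tree, and there are countably many words. -/
theorem ae_good (hq : IsOffspringLaw q) {s : unitInterval} (hs : 0 < (s : ℝ)) {s' : ℝ} (h0 : 0 ≤ s')
    (h1 : s' ≤ 1) : ∀ᵐ x ∂dataLaw q κ, Good s s' x := by
  have hss0 : 0 ≤ s * s' := mul_nonneg hs.le h0
  have hsle : s * s' ≤ (s : ℝ) := mul_le_of_le_one_right hs.le h1
  have key : ∀ᵐ x ∂dataLaw q κ, (¬ IsRed s x → FinChain s x) ∧
      (¬ IsRed (s * s') x → FinChain (s * s') x) ∧
      (¬ IsRed (s * s') x → FinChain s' (red s x)) := by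
    refine (ae_finChain q κ hq hs.le s.2.2).and ((ae_finChain q κ hq hss0
      (hsle.trans s.2.2)).and ?_)
    by_cases hw : blackProb q s = 0
    · have hz : dataLaw q κ (blk s) = 0 := by rw [dataLaw_blk, hw]; rfl
      filter_upwards [measure_eq_zero_iff_ae_notMem.1 hz] with x hx hr
      exact absurd (IsRed.anti hsle (not_not.1 hx)) hr
    · obtain ⟨q₁, κ₁, e1, e2, -⟩ := isReducedPair_iff_exists (κ := κ) hq hw
      have hq₁ := IsReducedPair.isOffspringLaw hq hs hw ((e1 _ _).2 ⟨rfl, rfl⟩)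
      have hae : ∀ᵐ y ∂((dataLaw q κ).restrict (blk s)).map (red s), FinChain s' y := by
        rw [e2]
        exact Measure.ae_smul_measure (ae_finChain_prunedLaw hq₁ h0 h1) _
      rw [ae_map_iff (measurable_red s).aemeasurable (measurableSet_finChain s'),
        ae_restrict_iff' (measurableSet_blk s)] at hae
      filter_upwards [hae] with x hx hr
      exact hx fun h => hr (IsRed.anti hsle h)
  have h2 : ∀ u, ∀ᵐ x ∂dataLaw q κ, (¬ IsRed s (x.shift u) → FinChain s (x.shift u)) ∧
      (¬ IsRed (s * s') (x.shift u) → FinChain (s * s') (x.shift u)) ∧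
      (¬ IsRed (s * s') (x.shift u) → FinChain s' (red s (x.shift u))) := fun u =>
    (⟨measurable_shift u, (dataLaw_map_shift q κ u).le.absolutelyContinuous⟩ :
      Measure.QuasiMeasurePreserving (fun x : TreeData => x.shift u) (dataLaw q κ)
        (dataLaw q κ)).ae key
  exact ae_all_iff.2 h2

/-- The two-step description of colours and trees, valid on good trees, is pushed through the known
law of the first reduction; pruning is invisible to the second. -/
theorem restrict_map_red_mul (hq : IsOffspringLaw q) {s s' : unitInterval} (hs : 0 < (s : ℝ))
    (h : IsReducedPair (unitInterval.symm s) q κ q' κ') :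
    ((dataLaw q κ).restrict (blk (s * s'))).map (red (s * s')) =
      (blackProb q s : ℝ≥0∞) • ((dataLaw q' κ').restrict (blk s')).map (red s') := by
  have hsle : s * s' ≤ (s : ℝ) := mul_le_of_le_one_right hs.le s'.2.2
  have hgood := ae_good (κ := κ) hq hs s'.2.1 s'.2.2
  have hset : (blk (s * s') : Set TreeData) =ᵐ[dataLaw q κ] (blk s ∩ red s ⁻¹' blk s' : Set TreeData) := by
    filter_upwards [hgood] with x hx
    have := isRed_mul_iff hs s'.2.2 hx
    change (¬ IsRed (s * s') x) = (¬ IsRed s x ∧ ¬ IsRed s' (red s x))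
    rw [this]
    simp
  have h1 : ((dataLaw q κ).restrict (blk (s * s'))).map (red (s * s')) =
      ((dataLaw q κ).restrict (blk (s * s'))).map (red s' ∘ red s) := by
    refine Measure.map_congr ?_
    rw [Filter.EventuallyEq, ae_restrict_iff' (measurableSet_blk _)]
    filter_upwards [hgood] with x hx hb
    exact (red_red hs s'.2.2 hx hb).symm
  rw [h1, Measure.restrict_congr_set hset, ← Measure.map_map (measurable_red _) (measurable_red _)]
  have h2 : (dataLaw q κ).restrict (blk s ∩ red s ⁻¹' blk s') =
      ((dataLaw q κ).restrict (blk s)).restrict (red s ⁻¹' blk s') := by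
    rw [Measure.restrict_restrict (measurable_red _ (measurableSet_blk _)), Set.inter_comm]
  rw [h2, ← Measure.restrict_map (measurable_red s) (measurableSet_blk s')]
  by_cases hw : blackProb q s = 0
  · have hz : (dataLaw q κ).restrict (blk s) = 0 := by
      rw [Measure.restrict_eq_zero, dataLaw_blk, hw]; rfl
    simp [hz, hw]
  · rw [(isReducedPair_iff_prunedLaw hq).1 h hw, Measure.restrict_smul, Measure.map_smul, dataLaw_blk,
      prunedLaw, Measure.restrict_map measurable_prune (measurableSet_blk _),
      Measure.map_map (measurable_red _) measurable_prune]
    have h3 : prune ⁻¹' blk s' = blk s' := by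
      ext x; exact not_congr isRed_prune
    have h4 : red s' ∘ prune = red s' := by funext x; exact red_prune _ _
    rw [h3, h4]

end TreeData

open TreeData

variable {q q' q'' : PMF ℕ} {κ κ' κ'' : ProbabilityMeasure ℝ}

/-- Total masses in `restrict_map_red_mul`. -/
theorem blackProb_mul (hq : IsOffspringLaw q) {s : unitInterval} (hs : 0 < (s : ℝ))
    (h : IsReducedPair (unitInterval.symm s) q κ q' κ') (s' : unitInterval) :
    blackProb q (s * s') = blackProb q s * blackProb q' s' := by
  have h1 := DFunLike.congr_fun (restrict_map_red_mul (s' := s') hq hs h) Set.univ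
  rw [Measure.smul_apply, Measure.map_apply (measurable_red _) MeasurableSet.univ,
    Measure.map_apply (measurable_red _) MeasurableSet.univ, Set.preimage_univ, Set.preimage_univ,
    Measure.restrict_apply_univ, Measure.restrict_apply_univ, dataLaw_blk, dataLaw_blk,
    smul_eq_mul] at h1
  exact_mod_cast h1

theorem IsReducedPair.trans (hq : IsOffspringLaw q) (hq' : IsOffspringLaw q') {s s' : unitInterval}
    (hs : 0 < (s : ℝ))
    (h : IsReducedPair (unitInterval.symm s) q κ q' κ')
    (h' : IsReducedPair (unitInterval.symm s') q' κ' q'' κ'') :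
    IsReducedPair (unitInterval.symm (s * s')) q κ q'' κ'' := by
  rw [isReducedPair_iff_prunedLaw hq]
  intro hw
  have hm := blackProb_mul hq hs h s'
  have hcoe : ((s * s' : unitInterval) : ℝ) = s * s' := rfl
  rw [hcoe] at hw ⊢
  have hw' : blackProb q' s' ≠ 0 := fun h0 => hw (by rw [hm, h0, mul_zero])
  rw [restrict_map_red_mul hq hs h, (isReducedPair_iff_prunedLaw hq').1 h' hw', smul_smul,
    dataLaw_blk, dataLaw_blk, hm]
  push_cast
  rfl

namespace BushData

theorem red_red_of_good {s s' : ℝ} (hs : 0 < s) (hs' : s' ≤ 1) {e : BushData}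
    (he : ∀ x ∈ decList e, Good s s' x) : red s' (red s e) = red (s * s') e := by
  classical
  have hsle : s * s' ≤ s := by nlinarith
  simp only [red, decList_enc]
  congr 1
  revert he
  induction decList e with
  | nil => intro _; rfl
  | cons x l ih =>
    intro he
    have hx := he x (by simp)
    have ih' := ih fun y hy => he y (by simp [hy])
    have hiff := isRed_mul_iff hs hs' hx
    by_cases h1 : IsRed s x
    · have h2 : IsRed (s * s') x := h1.anti hsle
      have b1 : x ∉ blk s := fun h => h h1
      have b2 : x ∉ blk (s * s') := fun h => h h2
      simpa [b1, b2] using ih'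
    · have b1 : x ∈ blk s := h1
      by_cases h2 : IsRed (s * s') x
      · have b2 : x ∉ blk (s * s') := fun h => h h2
        have b3 : TreeData.red s x ∉ blk s' := fun h => h (hiff.1 h2 h1)
        simpa [b1, b2, b3] using ih'
      · have b2 : x ∈ blk (s * s') := h2
        have b3 : TreeData.red s x ∈ blk s' := fun h => h2 (hiff.2 fun _ => h)
        simpa [b1, b2, b3, red_red hs hs' hx h2] using ih'

/-- Standard Borel structure is needed for conditional laws in the inverse limit and for the
measurability of sets `{f = g}`. -/
instance : StandardBorelSpace (ℕ × ℝ × ℝ) := inferInstance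

instance : StandardBorelSpace TreeData :=
  inferInstanceAs (StandardBorelSpace (List ℕ → ℕ × ℝ × ℝ))

instance : StandardBorelSpace (ℕ → TreeData) := inferInstance

instance : StandardBorelSpace BushData := inferInstanceAs (StandardBorelSpace (ℕ × (ℕ → TreeData)))

theorem ae_red_red (hq : IsOffspringLaw q) (κ : ProbabilityMeasure ℝ) (β : ℝ≥0) {s : unitInterval}
    (hs : 0 < (s : ℝ)) (s' : unitInterval) :
    ∀ᵐ e ∂prunedLaw q κ β, red s' (red s e) = red (s * s') e := by
  have hm : MeasurableSet {e : BushData | red s' (red s e) = red (s * s') e} :=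
    measurableSet_eq_fun ((measurable_red s').comp (measurable_red s)) (measurable_red _)
  rw [prunedLaw_eq_map, ae_map_iff (measurable_enc_map_decList measurable_prune).aemeasurable hm]
  have h1 : ∀ i, ∀ᵐ e ∂poissonLaw (dataLaw q κ) β, Good s s' (e.2 i) := fun i => by
    have hmp : Measure.QuasiMeasurePreserving (fun e : BushData => e.2 i)
        (poissonLaw (dataLaw q κ) β) (dataLaw q κ) :=
      (measurePreserving_eval_infinitePi (fun _ : ℕ => dataLaw q κ) i).quasiMeasurePreserving.comp
        Measure.quasiMeasurePreserving_snd
    exact hmp.ae (ae_good hq hs s'.2.1 s'.2.2)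
  filter_upwards [ae_all_iff.2 h1] with e he
  rw [red_map_prune, red_map_prune]
  refine red_red_of_good hs s'.2.2 fun x hx => ?_
  obtain ⟨i, -, rfl⟩ := List.mem_map.1 hx
  exact he i

end BushData

/-! ### Inverse limits -/

/-- The conditional law of `y` given `f y`, realised as a function of `f y` and an independent
uniform variable. -/
theorem exists_measurable_disintegration {X : Type*} [MeasurableSpace X] [StandardBorelSpace X]
    [Nonempty X] (M M' : Measure X) [IsProbabilityMeasure M] [IsProbabilityMeasure M'] {f : X → X}
    (h : M'.map f = M) :
    ∃ g : X × unitInterval → X, Measurable g ∧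
      (M.prod volume).map (fun p => (p.1, g p)) = M'.map fun y => (f y, y) := by
  obtain ⟨g, hg, hgκ⟩ := Kernel.exists_measurable_map_eq_unitInterval (condDistrib id f M')
  refine ⟨Function.uncurry g, hg, ?_⟩
  have h1 := compProd_map_condDistrib (X := f) (μ := M') (Y := id)
    (mβ := inferInstance) aemeasurable_id
  rw [h] at h1
  refine Eq.trans ?_ h1
  ext A hA
  have hm : Measurable fun p : X × unitInterval => (p.1, Function.uncurry g p) := measurable_fst.prodMk hg
  rw [Measure.map_apply hm hA, Measure.prod_apply (hm hA), Measure.compProd_apply hA]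
  refine lintegral_congr fun a => ?_
  have hga : Measurable (g a) := hg.comp measurable_prodMk_left
  rw [← hgκ a, Measure.map_apply hga (measurable_prodMk_left hA)]
  rfl

/-- A Markov chain started from `M 0`: given the point at stage `n`, the next one is sampled among
its preimages under `f n` with a fresh uniform variable. -/
theorem exists_inverse_limit {X : Type} [MeasurableSpace X] [StandardBorelSpace X] [Nonempty X]
    (M : ℕ → Measure X) [∀ n, IsProbabilityMeasure (M n)] {f : ℕ → X → X}
    (hf : ∀ n, Measurable (f n)) (h : ∀ n, (M (n + 1)).map (f n) = M n) :
    ∃ (Ω : Type) (_ : MeasurableSpace Ω) (P : Measure Ω) (x : ℕ → Ω → X),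
      IsProbabilityMeasure P ∧ (∀ n, Measurable (x n)) ∧ (∀ n, P.map (x n) = M n) ∧
      ∀ n, ∀ᵐ ω ∂P, f n (x (n + 1) ω) = x n ω := by
  choose g hg hgM using fun n => exists_measurable_disintegration (M n) (M (n + 1)) (h n)
  set U : Measure (ℕ → unitInterval) := Measure.infinitePi fun _ => volume with hU
  -- The state carries the uniform variables not yet used; a step consumes the first and shifts the
  -- others.
  let T : ℕ → X × (ℕ → unitInterval) → X × (ℕ → unitInterval) :=
    fun n p => (g n (p.1, p.2 0), fun i => p.2 (i + 1))
  let S : ℕ → X × (ℕ → unitInterval) → X × (ℕ → unitInterval) := fun n => Nat.rec id (fun n Sn => T n ∘ Sn) n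
  have hT : ∀ n, Measurable (T n) := fun n =>
    ((hg n).comp (by fun_prop)).prodMk (by fun_prop)
  have hS : ∀ n, Measurable (S n) := fun n => by
    induction n with
    | zero => exact measurable_id
    | succ n ih => exact (hT n).comp ih
  have hsplit : ∀ n, ((M n).prod U).map (fun p => ((p.1, g n (p.1, p.2 0)), fun i => p.2 (i + 1))) =
      ((M (n + 1)).map fun y => (f n y, y)).prod U := fun n => by
    have e1 := infinitePi_map_head_tail (volume : Measure unitInterval)
    rw [← hU] at e1
    have hm1 : Measurable fun u : ℕ → unitInterval => (u 0, fun i => u (i + 1)) := by fun_prop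
    have e2 : MeasurePreserving (MeasurableEquiv.prodAssoc.symm :
        X × (unitInterval × (ℕ → unitInterval)) ≃ᵐ (X × unitInterval) × (ℕ → unitInterval))
        ((M n).prod (volume.prod U)) (((M n).prod volume).prod U) :=
      (measurePreserving_prodAssoc _ _ _).symm _
    have hm2 : Measurable fun p : X × unitInterval => (p.1, g n p) := measurable_fst.prodMk (hg n)
    have e3 : (fun p : X × (ℕ → unitInterval) => ((p.1, g n (p.1, p.2 0)), fun i => p.2 (i + 1))) =
        Prod.map (fun p : X × unitInterval => (p.1, g n p)) id ∘ MeasurableEquiv.prodAssoc.symm ∘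
          Prod.map id (fun u : ℕ → unitInterval => (u 0, fun i => u (i + 1))) := rfl
    rw [e3, ← Measure.map_map (hm2.prodMap measurable_id)
      (e2.measurable.comp (measurable_id.prodMap hm1)), ← Measure.map_map e2.measurable
      (measurable_id.prodMap hm1), ← Measure.map_prod_map _ _ measurable_id hm1, e1, Measure.map_id,
      e2.map_eq, ← Measure.map_prod_map _ _ hm2 measurable_id, Measure.map_id, hgM]
  have hm3 : ∀ n, Measurable fun p : X × (ℕ → unitInterval) =>
      ((p.1, g n (p.1, p.2 0)), fun i => p.2 (i + 1)) := fun n =>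
    (measurable_fst.prodMk ((hg n).comp (by fun_prop))).prodMk (by fun_prop)
  have hlaw : ∀ n, ((M 0).prod U).map (S n) = (M n).prod U := fun n => by
    induction n with
    | zero => exact Measure.map_id
    | succ n ih =>
      have hm4 : Measurable fun y => (f n y, y) := (hf n).prodMk measurable_id
      change ((M 0).prod U).map (T n ∘ S n) = _
      rw [← Measure.map_map (hT n) (hS n), ih]
      have e4 : T n = Prod.map Prod.snd id ∘ fun p : X × (ℕ → unitInterval) =>
        ((p.1, g n (p.1, p.2 0)), fun i => p.2 (i + 1)) := rfl
      rw [e4, ← Measure.map_map (measurable_snd.prodMap measurable_id) (hm3 n), hsplit,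
        ← Measure.map_prod_map _ _ measurable_snd measurable_id, Measure.map_id,
        Measure.map_map measurable_snd hm4]
      congr 1
      exact Measure.map_id
  refine ⟨X × (ℕ → unitInterval), inferInstance, (M 0).prod U, fun n ω => (S n ω).1, inferInstance,
    fun n => (hS n).fst, fun n => ?_, fun n => ?_⟩
  · change ((M 0).prod U).map (Prod.fst ∘ S n) = M n
    rw [← Measure.map_map measurable_fst (hS n), hlaw, Measure.map_fst_prod, measure_univ,
      one_smul]
  · have hpair : ((M 0).prod U).map (fun ω => ((S n ω).1, (S (n + 1) ω).1)) =
        (M (n + 1)).map fun y => (f n y, y) := by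
      have e : (fun ω => ((S n ω).1, (S (n + 1) ω).1)) = Prod.fst ∘ (fun p : X × (ℕ → unitInterval) =>
        ((p.1, g n (p.1, p.2 0)), fun i => p.2 (i + 1))) ∘ S n := rfl
      have hm4 : Measurable fun y => (f n y, y) := (hf n).prodMk measurable_id
      have : IsProbabilityMeasure ((M (n + 1)).map fun y => (f n y, y)) :=
        Measure.isProbabilityMeasure_map hm4.aemeasurable
      rw [e, ← Measure.map_map measurable_fst ((hm3 n).comp (hS n)), ← Measure.map_map (hm3 n) (hS n),
        hlaw, hsplit, Measure.map_fst_prod, measure_univ, one_smul]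
    have hmeas : MeasurableSet {p : X × X | f n p.2 = p.1} :=
      measurableSet_eq_fun ((hf n).comp measurable_snd) measurable_fst
    have hae : ∀ᵐ p ∂(M (n + 1)).map fun y => (f n y, y), f n p.2 = p.1 := by
      have hm4 : Measurable fun y => (f n y, y) := (hf n).prodMk measurable_id
      rw [ae_map_iff hm4.aemeasurable hmeas]
      exact ae_of_all _ fun y => rfl
    rw [← hpair, ae_map_iff ((hS n).fst.prodMk (hS (n + 1)).fst).aemeasurable hmeas] at hae
    exact hae

/-! ### Consistent bushes -/

/-- The probability `μ / l` of the colour black. -/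
noncomputable def blackRatio (μ l : ℝ≥0) (h : μ < l) : unitInterval := unitInterval.symm (redProb μ l h)

theorem symm_blackRatio (μ l : ℝ≥0) (h : μ < l) : unitInterval.symm (blackRatio μ l h) = redProb μ l h :=
  unitInterval.symm_symm _

theorem coe_blackRatio (μ l : ℝ≥0) (h : μ < l) : (blackRatio μ l h : ℝ) = μ / l := by
  simp [blackRatio, redProb]

theorem blackRatio_pos {μ l : ℝ≥0} (h : μ < l) (hμ : 0 < μ) : (0 : ℝ) < blackRatio μ l h := by
  rw [coe_blackRatio]
  have h1 : (0 : ℝ) < μ := by exact_mod_cast hμ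
  have h2 : (0 : ℝ) < l := by exact_mod_cast hμ.trans h
  positivity

theorem blackRatio_mul {μ l m : ℝ≥0} (h : μ < l) (h' : l < m) :
    (blackRatio l m h' : ℝ) * blackRatio μ l h = blackRatio μ m (h.trans h') := by
  have h1 : (0 : ℝ) < l := by exact_mod_cast pos_of_gt h
  have h2 : (0 : ℝ) < m := by exact_mod_cast pos_of_gt h'
  rw [coe_blackRatio, coe_blackRatio, coe_blackRatio]
  field_simp

theorem blackRatio_mul' {μ l m : ℝ≥0} (h : μ < l) (h' : l < m) :
    blackRatio l m h' * blackRatio μ l h = blackRatio μ m (h.trans h') :=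
  Subtype.ext (blackRatio_mul h h')

/-- If the root were red almost surely, the equation for the red probability would read `1 = 1 +
q(0) s`. -/
theorem blackProb_ne_zero {q : PMF ℕ} (hq : IsOffspringLaw q) {s : ℝ} (h0 : 0 < s) (h1 : s ≤ 1) :
    blackProb q s ≠ 0 := by
  intro h
  have h2 := TreeData.tsum_red_prob q zeroLife h0.le h1
  rw [TreeData.dataLaw_compl_blk, h] at h2
  simp only [tsub_zero, ENNReal.coe_one, one_pow, mul_one, q.tsum_coe] at h2
  have h3 : q 0 * ENNReal.ofReal s = 0 := by
    have : (1 : ℝ≥0∞) + 0 = 1 + q 0 * ENNReal.ofReal s := by rw [add_zero]; exact h2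
    exact ((ENNReal.add_right_inj ENNReal.one_ne_top).1 this).symm
  rcases mul_eq_zero.1 h3 with h4 | h4
  · exact hq.1.ne' h4
  · exact absurd (ENNReal.ofReal_eq_zero.1 h4) (not_le.2 h0)

section

variable {Q : ℝ≥0 → PMF ℕ} {K : ℝ≥0 → ProbabilityMeasure ℝ}

theorem ConsistentPairs.isReducedPair (h : ConsistentPairs Q K) {μ l : ℝ≥0} (hlt : μ < l) :
    IsReducedPair (unitInterval.symm (blackRatio μ l hlt)) (Q l) (K l) (Q μ) (K μ) := by
  rw [symm_blackRatio]; exact h.2 μ l hlt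

theorem ConsistentPairs.blackProb_mul (h : ConsistentPairs Q K) {μ l m : ℝ≥0} (hμ : μ < l)
    (hl : l < m) : blackProb (Q m) (blackRatio μ m (hμ.trans hl)) =
      blackProb (Q m) (blackRatio l m hl) * blackProb (Q l) (blackRatio μ l hμ) := by
  rw [← blackRatio_mul hμ hl]
  exact _root_.blackProb_mul (h.1.1 m (pos_of_gt hl)) (blackRatio_pos hl (pos_of_gt hμ))
    (h.isReducedPair hl) _

/-- The parameters of consistent bushes with parameter `β` at `1`. -/
noncomputable def bushParam (Q : ℝ≥0 → PMF ℕ) (β : ℝ≥0) (l : ℝ≥0) : ℝ≥0 :=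
  if h : l < 1 then β * blackProb (Q 1) (blackRatio l 1 h)
  else if h : 1 < l then β / blackProb (Q l) (blackRatio 1 l h) else β

theorem bushParam_one (β : ℝ≥0) : bushParam Q β 1 = β := by simp [bushParam]

/-- Multiplicativity of the probability of a black root along three levels, one of which is `1`. -/
theorem ConsistentPairs.bushParam_eq (h : ConsistentPairs Q K) (β : ℝ≥0) {μ l : ℝ≥0} (hlt : μ < l) :
    bushParam Q β μ = bushParam Q β l * blackProb (Q l) (blackRatio μ l hlt) := by
  have hne : ∀ {μ l : ℝ≥0} (hlt : μ < l), 0 < μ → blackProb (Q l) (blackRatio μ l hlt) ≠ 0 :=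
    fun hlt hμ => blackProb_ne_zero (h.1.1 _ (pos_of_gt hlt)) (blackRatio_pos hlt hμ) (blackRatio _ _ hlt).2.2
  rcases lt_trichotomy l 1 with h1 | h1 | h1
  · rw [bushParam, bushParam, dif_pos h1, dif_pos (hlt.trans h1), h.blackProb_mul hlt h1]
    ring
  · subst h1
    rw [bushParam_one, bushParam, dif_pos hlt]
  · have hl : bushParam Q β l = β / blackProb (Q l) (blackRatio 1 l h1) := by
      rw [bushParam, dif_neg (not_lt.2 h1.le), dif_pos h1]
    have hw := hne h1 one_pos
    rcases lt_trichotomy μ 1 with h2 | h2 | h2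
    · rw [hl, bushParam, dif_pos h2, h.blackProb_mul h2 h1]
      field_simp
    · subst h2
      rw [bushParam_one, hl]
      field_simp
    · have hw' := hne h2 one_pos
      have hw'' := hne hlt (pos_of_gt h2)
      rw [hl, bushParam, dif_neg (not_lt.2 h2.le), dif_pos h2, h.blackProb_mul h2 hlt]
      field_simp

theorem ConsistentPairs.prunedLaw_map_red (h : ConsistentPairs Q K) (β : ℝ≥0) {μ l : ℝ≥0}
    (hlt : μ < l) :
    (BushData.prunedLaw (Q l) (K l) (bushParam Q β l)).map (BushData.red (blackRatio μ l hlt)) =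
      BushData.prunedLaw (Q μ) (K μ) (bushParam Q β μ) := by
  rw [h.bushParam_eq β hlt]
  exact BushData.prunedLaw_map_red _
    ((isReducedPair_iff_prunedLaw (h.1.1 l (pos_of_gt hlt))).1 (h.isReducedPair hlt))

theorem lt_natCast_floor_add_one (l : ℝ≥0) {n : ℕ} (hn : ⌊l⌋₊ ≤ n) : l < ((n + 1 : ℕ) : ℝ≥0) := by
  refine (Nat.lt_floor_add_one l).trans_le ?_
  exact_mod_cast Nat.succ_le_succ hn

/-- The inverse limit provides bushes `x n` at the levels `n + 1`. The bush at level `l` is the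
reduction `y l n` of `x n` for `n = ⌊l⌋₊`, the first integer level above `l`. By `ae_red_red` a
larger `n` gives the same bush almost surely, so any two levels can be compared through one integer
level. -/
theorem ConsistentPairs.existConsistentBushes (h : ConsistentPairs Q K) (β : ℝ≥0) :
    ExistConsistentBushes Q K (bushParam Q β) := by
  let M : ℝ≥0 → Measure BushData := fun l => BushData.prunedLaw (Q l) (K l) (bushParam Q β l)
  have hlt : ∀ n : ℕ, ((n + 1 : ℕ) : ℝ≥0) < ((n + 1 + 1 : ℕ) : ℝ≥0) := fun n => by
    exact_mod_cast Nat.lt_succ_self (n + 1)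
  obtain ⟨Ω, mΩ, P, x, hP, hx, hlaw, hcons⟩ := exists_inverse_limit
    (fun n : ℕ => M (n + 1 : ℕ)) (f := fun n => BushData.red (blackRatio _ _ (hlt n)))
    (fun n => BushData.measurable_red _) (fun n => h.prunedLaw_map_red β (hlt n))
  let y : (l : ℝ≥0) → (n : ℕ) → ⌊l⌋₊ ≤ n → Ω → BushData := fun l n hn ω =>
    BushData.red (blackRatio l _ (lt_natCast_floor_add_one l hn)) (x n ω)
  have hym : ∀ l n hn, Measurable (y l n hn) := fun l n hn => (BushData.measurable_red _).comp (hx n)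
  have hyl : ∀ l n hn, P.map (y l n hn) = M l := fun l n hn => by
    have : y l n hn = BushData.red (blackRatio l _ (lt_natCast_floor_add_one l hn)) ∘ x n := rfl
    rw [this, ← Measure.map_map (BushData.measurable_red _) (hx n), hlaw]
    exact h.prunedLaw_map_red β _
  have hstep : ∀ l n (hn : ⌊l⌋₊ ≤ n), ∀ᵐ ω ∂P, y l n hn ω = y l (n + 1) (hn.trans n.le_succ) ω := by
    intro l n hn
    have h1 := BushData.ae_red_red (h.1.1 ((n + 1 + 1 : ℕ) : ℝ≥0) (pos_of_gt (hlt n)))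
      (K (n + 1 + 1 : ℕ)) (bushParam Q β (n + 1 + 1 : ℕ)) (s := blackRatio _ _ (hlt n))
      (blackRatio_pos _ (by exact_mod_cast Nat.succ_pos n))
      (blackRatio l _ (lt_natCast_floor_add_one l hn))
    have h2 : ∀ᵐ e ∂P.map (x (n + 1)), BushData.red (blackRatio l _ (lt_natCast_floor_add_one l hn))
        (BushData.red (blackRatio _ _ (hlt n)) e) = BushData.red (blackRatio _ _ (hlt n) *
          blackRatio l _ (lt_natCast_floor_add_one l hn)) e := by
      rw [hlaw (n + 1)]; exact h1
    filter_upwards [ae_of_ae_map (hx (n + 1)).aemeasurable h2, hcons n] with ω h3 h4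
    rw [h4, blackRatio_mul] at h3
    exact h3
  have hmany : ∀ l n (hn : ⌊l⌋₊ ≤ n), ∀ᵐ ω ∂P, y l ⌊l⌋₊ le_rfl ω = y l n hn ω := by
    intro l n hn
    induction hn with
    | refl => exact ae_of_all _ fun ω => rfl
    | @step m hm ih =>
      filter_upwards [ih, hstep l m hm] with ω h1 h2
      rw [h1, h2]
  have hred : ∀ {μ l : ℝ≥0} (hμ : μ < l), ∀ᵐ ω ∂P, y μ ⌊μ⌋₊ le_rfl ω =
      BushData.red (blackRatio μ l hμ) (y l ⌊l⌋₊ le_rfl ω) := by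
    intro μ l hμ
    have hfl : ⌊μ⌋₊ ≤ ⌊l⌋₊ := Nat.floor_mono hμ.le
    have h1 := BushData.ae_red_red (h.1.1 ((⌊l⌋₊ + 1 : ℕ) : ℝ≥0) (by exact_mod_cast Nat.succ_pos _))
      (K (⌊l⌋₊ + 1 : ℕ)) (bushParam Q β (⌊l⌋₊ + 1 : ℕ))
      (s := blackRatio _ _ (lt_natCast_floor_add_one l le_rfl))
      (blackRatio_pos _ (pos_of_gt hμ)) (blackRatio μ l hμ)
    have h2 : ∀ᵐ e ∂P.map (x ⌊l⌋₊), BushData.red (blackRatio μ l hμ)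
        (BushData.red (blackRatio _ _ (lt_natCast_floor_add_one l le_rfl)) e) =
        BushData.red (blackRatio _ _ (lt_natCast_floor_add_one l le_rfl) * blackRatio μ l hμ) e := by
      rw [hlaw ⌊l⌋₊]; exact h1
    filter_upwards [ae_of_ae_map (hx ⌊l⌋₊).aemeasurable h2, hmany μ ⌊l⌋₊ hfl] with ω h3 h4
    rw [blackRatio_mul] at h3
    rw [h4]
    exact h3.symm
  refine ⟨Ω, mΩ, P, fun l ω => BushData.trees (y l ⌊l⌋₊ le_rfl ω), hP,
    fun l => BushData.measurable_trees.comp (hym l ⌊l⌋₊ le_rfl), fun l => ?_, fun μ l hμ => ?_⟩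
  · change P.map (BushData.trees ∘ y l ⌊l⌋₊ le_rfl) = _
    rw [← Measure.map_map BushData.measurable_trees (hym l ⌊l⌋₊ le_rfl), hyl l ⌊l⌋₊ le_rfl,
      BushData.prunedLaw_map_trees]
  · rw [← symm_blackRatio, BushData.reductionLaw_eq_prunedLaw]
    have h1 : P.map (fun ω => (BushData.trees (y μ ⌊μ⌋₊ le_rfl ω), BushData.trees (y l ⌊l⌋₊ le_rfl ω))) =
        P.map ((fun e => (BushData.trees (BushData.red (blackRatio μ l hμ) e), BushData.trees e)) ∘
          y l ⌊l⌋₊ le_rfl) := by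
      refine Measure.map_congr ?_
      filter_upwards [hred hμ] with ω hω
      simp only [Function.comp, hω]
    have hm : Measurable fun e => (BushData.trees (BushData.red (blackRatio μ l hμ) e),
        BushData.trees e) :=
      (BushData.measurable_trees.comp (BushData.measurable_red _)).prodMk BushData.measurable_trees
    rw [h1, ← Measure.map_map hm (hym l ⌊l⌋₊ le_rfl), hyl l ⌊l⌋₊ le_rfl]

end

/-! ### Power series with coefficients of polynomial growth -/

/-- A condition that holds for probability weights, forces convergence on `(-1, 1)` and is stable
under `derivCoef`, so that termwise differentiation can be repeated. -/
def PolyGrowth (c : ℕ → ℝ) : Prop := ∃ (C : ℝ) (k : ℕ), ∀ n : ℕ, |c n| ≤ C * (n + 1) ^ k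

def derivCoef (c : ℕ → ℝ) (n : ℕ) : ℝ := (n + 1) * c (n + 1)

theorem PolyGrowth.derivCoef {c : ℕ → ℝ} (hc : PolyGrowth c) : PolyGrowth (derivCoef c) := by
  obtain ⟨C, k, h⟩ := hc
  have hC : 0 ≤ C := by
    have := (abs_nonneg _).trans (h 0)
    simpa using this
  refine ⟨C * 2 ^ k, k + 1, fun n => ?_⟩
  have h1 := h (n + 1)
  rw [_root_.derivCoef, abs_mul, abs_of_nonneg (by positivity : (0 : ℝ) ≤ n + 1)]
  have h2 : ((n + 1 : ℕ) : ℝ) + 1 ≤ 2 * (n + 1) := by push_cast; linarith [n.cast_nonneg (α := ℝ)]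
  calc (n + 1 : ℝ) * |c (n + 1)| ≤ (n + 1) * (C * (2 * (n + 1)) ^ k) := by
        gcongr
        exact h1.trans (by gcongr)
    _ = C * 2 ^ k * (n + 1) ^ (k + 1) := by rw [mul_pow]; ring

theorem PolyGrowth.summable {c : ℕ → ℝ} (hc : PolyGrowth c) {r : ℝ} (h0 : 0 ≤ r) (h1 : r < 1) :
    Summable fun n => |c n| * r ^ n := by
  obtain ⟨C, k, h⟩ := hc
  have h2 : Summable fun n : ℕ => (n : ℝ) ^ k * r ^ n :=
    summable_pow_mul_geometric_of_norm_lt_one k (by rwa [Real.norm_of_nonneg h0])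
  have h3 : Summable fun n : ℕ => C * ((n : ℝ) + 1) ^ k * r ^ n := by
    have hC : 0 ≤ C := by
      have := (abs_nonneg _).trans (h 0)
      simpa using this
    refine Summable.of_nonneg_of_le (fun n => by positivity) (fun n => ?_)
      (((h2.add (summable_geometric_of_lt_one h0 h1)).mul_left (C * 2 ^ k)))
    have h4 : ((n : ℝ) + 1) ^ k ≤ 2 ^ k * ((n : ℝ) ^ k + 1) := by
      rcases Nat.eq_zero_or_pos n with rfl | hn
      · simp only [Nat.cast_zero, zero_add, one_pow]
        have : (1 : ℝ) ≤ 2 ^ k := one_le_pow₀ (by norm_num)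
        nlinarith [pow_nonneg (le_refl (0 : ℝ)) k]
      · have hn' : (1 : ℝ) ≤ n := by exact_mod_cast hn
        calc ((n : ℝ) + 1) ^ k ≤ (2 * n) ^ k := by gcongr; linarith
          _ = 2 ^ k * (n : ℝ) ^ k := mul_pow _ _ _
          _ ≤ _ := by gcongr; linarith
    calc C * ((n : ℝ) + 1) ^ k * r ^ n ≤ C * (2 ^ k * ((n : ℝ) ^ k + 1)) * r ^ n := by gcongr
      _ = _ := by ring
  refine Summable.of_nonneg_of_le (fun n => by positivity) (fun n => ?_) h3
  gcongr
  exact h n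

theorem PolyGrowth.summable_mul_pow {c : ℕ → ℝ} (hc : PolyGrowth c) {x : ℝ} (hx : |x| < 1) :
    Summable fun n => c n * x ^ n := by
  refine Summable.of_norm ?_
  simp only [norm_mul, norm_pow, Real.norm_eq_abs]
  exact hc.summable (abs_nonneg x) hx

theorem PolyGrowth.hasDerivAt {c : ℕ → ℝ} (hc : PolyGrowth c) {x : ℝ} (hx : |x| < 1) :
    HasDerivAt (fun z => ∑' n, c n * z ^ n) (∑' n, _root_.derivCoef c n * x ^ n) x := by
  obtain ⟨ρ, h1, h2⟩ := exists_between hx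
  have h0 : 0 < ρ := (abs_nonneg x).trans_lt h1
  have hu : Summable fun n : ℕ => |c n| * (n * ρ ^ (n - 1)) := by
    rw [← summable_nat_add_iff 1]
    refine (hc.derivCoef.summable h0.le h2).congr fun n => ?_
    rw [_root_.derivCoef, abs_mul, abs_of_nonneg (by positivity : (0 : ℝ) ≤ n + 1)]
    push_cast
    ring
  have h3 := hasDerivAt_tsum_of_isPreconnected (t := Set.Ioo (-ρ) ρ) (y₀ := 0) (y := x)
    (g := fun n z => c n * z ^ n) (g' := fun n z => c n * (n * z ^ (n - 1))) hu isOpen_Ioo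
    isPreconnected_Ioo (fun n y _ => (hasDerivAt_pow n y).const_mul (c n)) (fun n y hy => by
      rw [norm_mul, norm_mul, norm_pow, Real.norm_eq_abs, Real.norm_eq_abs, Real.norm_eq_abs,
        Nat.abs_cast]
      gcongr
      exact (abs_lt.2 hy).le) ⟨by linarith, h0⟩ (hc.summable_mul_pow (by simp)) (abs_lt.1 h1)
  have hs : Summable fun n : ℕ => c n * (n * x ^ (n - 1)) := by
    refine Summable.of_norm (Summable.of_nonneg_of_le (fun n => norm_nonneg _) (fun n => ?_) hu)
    rw [norm_mul, norm_mul, norm_pow, Real.norm_eq_abs, Real.norm_eq_abs, Real.norm_eq_abs,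
        Nat.abs_cast]
    gcongr
  have e : ∑' n, _root_.derivCoef c n * x ^ n = ∑' n : ℕ, c n * (n * x ^ (n - 1)) := by
    rw [hs.tsum_eq_zero_add]
    simp only [Nat.cast_zero, zero_mul, mul_zero, zero_add]
    refine tsum_congr fun n => ?_
    simp only [_root_.derivCoef, Nat.add_sub_cancel]
    push_cast
    ring
  rw [e]
  exact h3

open FormalMultilinearSeries in
theorem PolyGrowth.hasFPowerSeriesOnBall {c : ℕ → ℝ} (hc : PolyGrowth c) :
    HasFPowerSeriesOnBall (fun z : ℝ => ∑' n, c n * z ^ n) (ofScalars ℝ c) 0 1 := by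
  have hr : 1 ≤ (ofScalars ℝ c).radius := by
    refine ENNReal.le_of_forall_nnreal_lt fun r hr => ?_
    refine le_radius_of_summable_norm _ ?_
    simp only [ofScalars_norm, Real.norm_eq_abs]
    exact hc.summable r.2 (by exact_mod_cast hr)
  have h := (ofScalars ℝ c).hasFPowerSeriesOnBall (zero_lt_one.trans_le hr)
  have h2 : (ofScalars ℝ c).sum = fun z : ℝ => ∑' n, c n * z ^ n := by
    have := ofScalarsSum_eq_tsum (E := ℝ) c
    simp only [smul_eq_mul] at this
    exact this
  rw [h2] at h
  exact h.mono one_pos hr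

theorem PolyGrowth.analyticOnNhd {c : ℕ → ℝ} (hc : PolyGrowth c) :
    AnalyticOnNhd ℝ (fun z : ℝ => ∑' n, c n * z ^ n) (Set.Ioo (-1) 1) := by
  intro x hx
  refine hc.hasFPowerSeriesOnBall.analyticOnNhd x ?_
  rw [Metric.mem_eball, edist_dist, Real.dist_eq, sub_zero, ← ENNReal.ofReal_one]
  exact (ENNReal.ofReal_lt_ofReal_iff one_pos).2 (abs_lt.2 hx)

/-! ### Generating functions -/

theorem PMF.hasSum_toReal (q : PMF ℕ) : HasSum (fun i => (q i).toReal) 1 := by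
  have h := (ENNReal.summable_toReal q.tsum_coe_ne_top).hasSum
  rwa [← ENNReal.tsum_toReal_eq q.apply_ne_top, q.tsum_coe, ENNReal.toReal_one] at h

theorem PMF.toReal_le_one (q : PMF ℕ) (n : ℕ) : (q n).toReal ≤ 1 :=
  ENNReal.toReal_le_of_le_ofReal zero_le_one (by simpa using q.coe_le_one n)

theorem PMF.polyGrowth (q : PMF ℕ) : PolyGrowth fun n => (q n).toReal :=
  ⟨1, 0, fun n => by simpa [abs_of_nonneg] using q.toReal_le_one n⟩

theorem genFun_eq (q : PMF ℕ) : genFun q = fun z => ∑' n, (q n).toReal * z ^ n := by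
  funext z
  exact tsum_congr fun n => mul_comm _ _

theorem summable_genFun (q : PMF ℕ) {s : ℝ} (hs : s ∈ Set.Icc (0 : ℝ) 1) :
    Summable fun i => s ^ i * (q i).toReal := by
  refine Summable.of_nonneg_of_le (fun i => ?_) (fun i => ?_) q.hasSum_toReal.summable
  · exact mul_nonneg (pow_nonneg hs.1 i) ENNReal.toReal_nonneg
  · exact mul_le_of_le_one_left ENNReal.toReal_nonneg (pow_le_one₀ hs.1 hs.2)

theorem genFun_one (q : PMF ℕ) : genFun q 1 = 1 := by
  simp only [genFun, one_pow, one_mul]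
  exact q.hasSum_toReal.tsum_eq

theorem genFun_zero (q : PMF ℕ) : genFun q 0 = (q 0).toReal := by
  rw [genFun, tsum_eq_single 0]
  · simp
  · intro i hi; simp [hi]

/-- The identity theorem carries equality near `z` to a neighbourhood of `0`, where coefficients are
compared. -/
theorem genFun_injective {q q' : PMF ℕ} {z : ℝ} (hz : z ∈ Set.Ioo (-1 : ℝ) 1)
    (h : ∃ᶠ y in 𝓝[≠] z, genFun q y = genFun q' y) : q = q' := by
  have h1 := q.polyGrowth.hasFPowerSeriesOnBall
  have h2 := q'.polyGrowth.hasFPowerSeriesOnBall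
  have h3 := q.polyGrowth.analyticOnNhd.eqOn_of_preconnected_of_frequently_eq
    q'.polyGrowth.analyticOnNhd isPreconnected_Ioo hz (by rwa [genFun_eq, genFun_eq] at h)
  have h4 : (fun z : ℝ => ∑' n, (q n).toReal * z ^ n) =ᶠ[𝓝 0]
      fun z => ∑' n, (q' n).toReal * z ^ n :=
    h3.eventuallyEq_of_mem (Ioo_mem_nhds (by norm_num) (by norm_num))
  have h5 := (h1.hasFPowerSeriesAt.congr h4).eq_formalMultilinearSeries h2.hasFPowerSeriesAt
  have h6 := FormalMultilinearSeries.ofScalars_series_injective ℝ ℝ h5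
  ext n
  exact (ENNReal.toReal_eq_toReal_iff' (q.apply_ne_top n) (q'.apply_ne_top n)).1 (congrFun h6 n)

/-- The function `y ↦ φ(1 - y) - (1 - y)`. -/
noncomputable def mech (q : PMF ℕ) (y : ℝ) : ℝ := genFun q (1 - y) - (1 - y)

theorem mech_zero (q : PMF ℕ) : mech q 0 = 0 := by simp [mech, genFun_one]

theorem mech_one (q : PMF ℕ) : mech q 1 = (q 0).toReal := by simp [mech, genFun_zero]

theorem convexOn_genFun (q : PMF ℕ) : ConvexOn ℝ (Set.Icc 0 1) (genFun q) := by
  refine ⟨convex_Icc 0 1, fun x hx y hy a b ha hb hab => ?_⟩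
  have hxy := convex_Icc (0 : ℝ) 1 hx hy ha hb hab
  simp only [smul_eq_mul] at hxy ⊢
  rw [genFun, genFun, genFun, ← tsum_mul_left, ← tsum_mul_left,
    ← ((summable_genFun q hx).mul_left a).tsum_add ((summable_genFun q hy).mul_left b)]
  refine (summable_genFun q hxy).tsum_le_tsum (fun i => ?_)
    (((summable_genFun q hx).mul_left a).add ((summable_genFun q hy).mul_left b))
  have h := (convexOn_pow i).2 (Set.mem_Ici.2 hx.1) (Set.mem_Ici.2 hy.1) ha hb hab
  simp only [smul_eq_mul] at h
  calc (a * x + b * y) ^ i * (q i).toReal ≤ (a * x ^ i + b * y ^ i) * (q i).toReal :=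
        mul_le_mul_of_nonneg_right h ENNReal.toReal_nonneg
    _ = _ := by ring

theorem convexOn_mech (q : PMF ℕ) : ConvexOn ℝ (Set.Icc 0 1) (mech q) := by
  refine ⟨convex_Icc 0 1, fun x hx y hy a b ha hb hab => ?_⟩
  have h := (convexOn_genFun q).2
    (show 1 - x ∈ Set.Icc 0 1 from ⟨by linarith [hx.2], by linarith [hx.1]⟩)
    (show 1 - y ∈ Set.Icc 0 1 from ⟨by linarith [hy.2], by linarith [hy.1]⟩) ha hb hab
  simp only [smul_eq_mul, mech] at h ⊢
  have e : a * (1 - x) + b * (1 - y) = 1 - (a * x + b * y) := by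
    linear_combination hab
  rw [e] at h
  have e2 : (1 - (a * x + b * y)) = a * (1 - x) + b * (1 - y) := e.symm
  linarith

/-- Star-shapedness. -/
theorem mech_lt (q : PMF ℕ) {x y : ℝ} (hx : 0 ≤ x) (hxy : x < y) (hy : y ≤ 1) (hpos : 0 < mech q y) :
    mech q x < mech q y := by
  have hy0 : 0 < y := hx.trans_lt hxy
  have h := (convexOn_mech q).2 (show (0 : ℝ) ∈ Set.Icc 0 1 from ⟨le_rfl, zero_le_one⟩)
    (show y ∈ Set.Icc 0 1 from ⟨hy0.le, hy⟩)
    (show 0 ≤ 1 - x / y by rw [sub_nonneg, div_le_one hy0]; exact hxy.le)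
    (show 0 ≤ x / y by positivity) (by ring)
  simp only [smul_eq_mul, mul_zero, zero_add, mech_zero] at h
  rw [div_mul_cancel₀ _ hy0.ne'] at h
  have h1 : x / y < 1 := (div_lt_one hy0).2 hxy
  nlinarith

/-- A convex function on `[0, 1]` that vanishes at `0` takes each positive value at most once. For
`s > 0` this singles out `blackProb q s` as the root of `mech q w = s q(0)`. -/
theorem mech_injOn (q : PMF ℕ) {x y : ℝ} (hx : x ∈ Set.Icc (0 : ℝ) 1) (hy : y ∈ Set.Icc (0 : ℝ) 1)
    (hpos : 0 < mech q x) (h : mech q x = mech q y) : x = y := by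
  rcases lt_trichotomy x y with hlt | heq | hlt
  · exact absurd h (mech_lt q hx.1 hlt hy.2 (h ▸ hpos)).ne
  · exact heq
  · exact absurd h.symm (mech_lt q hy.1 hlt hx.2 hpos).ne

/-- The series converges for `|1 - y| < 1`. The room beyond `y = 1` is essential later: derivatives
at `1` and analytic continuation past `1` identify parameters. -/
theorem hasDerivAt_mech (q : PMF ℕ) {y : ℝ} (hy : y ∈ Set.Ioo (0 : ℝ) 2) :
    HasDerivAt (mech q) (1 - ∑' n, derivCoef (fun n => (q n).toReal) n * (1 - y) ^ n) y := by
  have h1 : |1 - y| < 1 := abs_lt.2 ⟨by linarith [hy.2], by linarith [hy.1]⟩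
  have h2 := q.polyGrowth.hasDerivAt h1
  have h3 : HasDerivAt (fun y : ℝ => 1 - y) (-1) y := by
    simpa using (hasDerivAt_id y).const_sub 1
  have h4 : HasDerivAt _ (1 - ∑' n, derivCoef (fun n => (q n).toReal) n * (1 - y) ^ n) y :=
    ((h2.comp y h3).sub h3).congr_deriv (by ring)
  have e : mech q = (fun z => ∑' n, (q n).toReal * z ^ n) ∘ (fun y => 1 - y) - fun y => 1 - y := by
    funext y; simp only [mech, genFun_eq]; rfl
  rw [e]
  exact h4

theorem analyticOnNhd_mech (q : PMF ℕ) : AnalyticOnNhd ℝ (mech q) (Set.Ioo 0 2) := by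
  intro y hy
  have h1 := q.polyGrowth.analyticOnNhd (1 - y) ⟨by linarith [hy.2], by linarith [hy.1]⟩
  have h2 : AnalyticAt ℝ (fun y : ℝ => 1 - y) y := by fun_prop
  have e : mech q = (fun z => ∑' n, (q n).toReal * z ^ n) ∘ (fun y => 1 - y) - fun y => 1 - y := by
    funext y; simp only [mech, genFun_eq]; rfl
  rw [e]
  exact (h1.comp h2).sub h2

/-- The slope at `1` is `1 - q(1)`. Excluding single children thus normalises `mech q`, and this is
what fixes the constants in rescalings. -/
theorem deriv_mech_one {q : PMF ℕ} (hq : q 1 = 0) : deriv (mech q) 1 = 1 := by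
  rw [(hasDerivAt_mech q ⟨by norm_num, by norm_num⟩).deriv, tsum_eq_single 0]
  · simp [derivCoef, hq]
  · intro n hn; simp [hn]

theorem continuousOn_mech (q : PMF ℕ) : ContinuousOn (mech q) (Set.Icc 0 1) := by
  have h : ContinuousOn (genFun q) (Set.Icc 0 1) := by
    refine continuousOn_tsum (u := fun i => (q i).toReal) (fun i => by fun_prop)
      q.hasSum_toReal.summable fun i s hs => ?_
    rw [norm_mul, norm_pow, Real.norm_of_nonneg hs.1, Real.norm_of_nonneg ENNReal.toReal_nonneg]
    exact mul_le_of_le_one_left ENNReal.toReal_nonneg (pow_le_one₀ hs.1 hs.2)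
  refine ContinuousOn.sub (h.comp (by fun_prop) fun y hy => ?_) (by fun_prop)
  exact ⟨by linarith [hy.2], by linarith [hy.1]⟩

theorem mech_injective {q q' : PMF ℕ} {a : ℝ} (ha : 0 < a) (h : ∀ y ∈ Set.Ioo 0 a, mech q y = mech q' y) :
    q = q' := by
  set b := min a 1 with hb
  have hb0 : 0 < b := lt_min ha one_pos
  have hb1 : b ≤ 1 := min_le_right _ _
  refine genFun_injective (z := 1 - b / 2) ⟨by linarith, by linarith⟩ ?_
  refine Filter.Eventually.frequently ?_
  refine eventually_nhdsWithin_of_eventually_nhds ?_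
  filter_upwards [Ioo_mem_nhds (show 1 - b < 1 - b / 2 by linarith) (show 1 - b / 2 < 1 by linarith)]
    with y hy
  have := h (1 - y) ⟨by linarith [hy.2], lt_of_lt_of_le (by linarith [hy.1] : 1 - y < b) (min_le_left _ _)⟩
  simp only [mech, sub_sub_cancel] at this
  linarith

/-! ### The reduced pair in terms of generating functions -/

open TreeData

/-- Each object contributes a factor `r` if deleted and `w X` if kept; the binomial theorem collects
the terms. -/
theorem tsum_pow_mul_thin (q : PMF ℕ) (w r X : ℝ≥0∞) :
    ∑' k, X ^ k * thin q.toMeasure w r k = ∑' n, q n * (r + w * X) ^ n := by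
  have h1 : ∀ k, X ^ k * thin q.toMeasure w r k =
      ∑' j, q (k + j) * ((k + j).choose k * ((w * X) ^ k * r ^ j)) := fun k => by
    rw [thin, ← ENNReal.tsum_mul_left]
    refine tsum_congr fun j => ?_
    rw [toMeasure_singleton_nat, mul_pow]
    ring
  rw [tsum_congr h1, ← ENNReal.tsum_prod (f := fun k j =>
    q (k + j) * ((k + j).choose k * ((w * X) ^ k * r ^ j))),
    ← (Finset.HasAntidiagonal.sigmaAntidiagonalEquivProd (A := ℕ)).tsum_eq, ENNReal.tsum_sigma']
  refine tsum_congr fun n => ?_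
  rw [tsum_fintype, add_comm r, (Commute.all (w * X) r).add_pow', Finset.mul_sum,
    ← Finset.sum_coe_sort (Finset.HasAntidiagonal.antidiagonal n)
      (fun x => q n * (n.choose x.1 • ((w * X) ^ x.1 * r ^ x.2)))]
  refine Finset.sum_congr rfl fun x _ => ?_
  have hx := Finset.HasAntidiagonal.mem_antidiagonal.1 x.2
  change q (x.1.1 + x.1.2) * (((x.1.1 + x.1.2).choose x.1.1 : ℕ) * _) = _
  rw [hx, nsmul_eq_mul]
  rfl

theorem toReal_tsum_pow (q : PMF ℕ) (x : ℝ≥0) :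
    (∑' n, q n * (x : ℝ≥0∞) ^ n).toReal = genFun q x := by
  rw [ENNReal.tsum_toReal_eq, genFun]
  · refine tsum_congr fun n => ?_
    rw [ENNReal.toReal_mul, ENNReal.toReal_pow, ENNReal.coe_toReal, mul_comm]
  · exact fun n => ENNReal.mul_ne_top (q.apply_ne_top n) (ENNReal.pow_ne_top ENNReal.coe_ne_top)

theorem tsum_pow_ne_top (q : PMF ℕ) {x : ℝ≥0} (hx : x ≤ 1) :
    ∑' n, q n * (x : ℝ≥0∞) ^ n ≠ ∞ := by
  refine ne_top_of_le_ne_top q.tsum_coe_ne_top (ENNReal.tsum_le_tsum fun n => ?_)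
  refine mul_le_of_le_one_right' (pow_le_one₀ zero_le ?_)
  exact_mod_cast hx

/-- The equation `φ(r) = r + q(0) s` for the red probability, at `r = 1 - w`: all children are red
exactly if the root is red or a black leaf. -/
theorem mech_blackProb (q : PMF ℕ) {s : ℝ} (h0 : 0 ≤ s) (h1 : s ≤ 1) :
    mech q (blackProb q s) = s * (q 0).toReal := by
  have h := tsum_red_prob q zeroLife h0 h1
  rw [dataLaw_compl_blk] at h
  have h2 := congrArg ENNReal.toReal h
  rw [toReal_tsum_pow q, ENNReal.toReal_add ENNReal.coe_ne_top
    (ENNReal.mul_ne_top (q.apply_ne_top 0) ENNReal.ofReal_ne_top), ENNReal.toReal_mul,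
    ENNReal.toReal_ofReal h0, ENNReal.coe_toReal, NNReal.coe_sub (blackProb_le_one q s)] at h2
  rw [mech]
  push_cast at h2
  linarith

theorem coe_blackProb_le_one (q : PMF ℕ) (s : ℝ) : (blackProb q s : ℝ) ≤ 1 := by
  exact_mod_cast blackProb_le_one q s

theorem blackProb_pos {q : PMF ℕ} {s : ℝ} (h : blackProb q s ≠ 0) : (0 : ℝ) < blackProb q s := by
  exact_mod_cast pos_iff_ne_zero.2 h

/-- Both sides are `φ'(1 - w)`; the slope of `mech q` at `w` is thus the probability that a chain
ends at a given individual. -/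
theorem singleProb_toReal (q : PMF ℕ) {s : ℝ} (hw : blackProb q s ≠ 0) :
    (singleProb q (1 - blackProb q s : ℝ≥0)).toReal = 1 - deriv (mech q) (blackProb q s) := by
  have h1 := coe_blackProb_le_one q s
  have h0 := blackProb_pos hw
  rw [(hasDerivAt_mech q ⟨h0, by linarith⟩).deriv, sub_sub_cancel, singleProb, ENNReal.tsum_toReal_eq]
  · refine tsum_congr fun n => ?_
    rw [ENNReal.toReal_mul, ENNReal.toReal_mul, ENNReal.toReal_pow, ENNReal.coe_toReal,
      ENNReal.toReal_natCast, NNReal.coe_sub (blackProb_le_one q s), derivCoef]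
    push_cast
    ring
  · exact fun n => ENNReal.mul_ne_top (q.apply_ne_top _)
      (ENNReal.mul_ne_top (ENNReal.natCast_ne_top _) (ENNReal.pow_ne_top ENNReal.coe_ne_top))

theorem deriv_mech_mem {q : PMF ℕ} (hq : IsOffspringLaw q) {s : ℝ} (h0 : 0 ≤ s) (h1 : s ≤ 1)
    (hw : blackProb q s ≠ 0) : deriv (mech q) (blackProb q s) ∈ Set.Ioc (0 : ℝ) 1 := by
  have hw' : dataLaw q zeroLife (blk s) ≠ 0 := by rw [dataLaw_blk]; exact_mod_cast hw
  have hlt := singleProb_lt_one q zeroLife hq h0 h1 hw'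
  rw [dataLaw_compl_blk] at hlt
  have h2 : (singleProb q (1 - blackProb q s : ℝ≥0)).toReal < 1 := by
    rw [← ENNReal.toReal_one]
    exact (ENNReal.toReal_lt_toReal hlt.ne_top ENNReal.one_ne_top).2 hlt
  have h3 : 0 ≤ (singleProb q (1 - blackProb q s : ℝ≥0)).toReal := ENNReal.toReal_nonneg
  rw [singleProb_toReal q hw] at h2 h3
  exact ⟨by linarith, by linarith⟩

theorem toReal_blkNe {q : PMF ℕ} (κ : ProbabilityMeasure ℝ) (hq : IsOffspringLaw q) {s : ℝ}
    (h0 : 0 ≤ s) (h1 : s ≤ 1) (hw : blackProb q s ≠ 0) :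
    (dataLaw q κ (blkNe s)).toReal = blackProb q s * deriv (mech q) (blackProb q s) := by
  have hw' : dataLaw q κ (blk s) ≠ 0 := by rw [dataLaw_blk]; exact_mod_cast hw
  have hlt := singleProb_lt_one q κ hq h0 h1 hw'
  have h := congrArg ENNReal.toReal (dataLaw_blk_eq q κ s)
  rw [ENNReal.toReal_add (measure_ne_top _ _) (ENNReal.mul_ne_top hlt.ne_top (measure_ne_top _ _)),
    ENNReal.toReal_mul, dataLaw_compl_blk, dataLaw_blk, singleProb_toReal q hw,
    ENNReal.coe_toReal] at h
  linear_combination -h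

/-- The generating function of the reduced offspring law. -/
theorem mech_reduced {q q₁ : PMF ℕ} (κ : ProbabilityMeasure ℝ) (hq : IsOffspringLaw q) {s : ℝ}
    (h0 : 0 ≤ s) (h1 : s ≤ 1) (hw : blackProb q s ≠ 0)
    (h : ∀ k, q₁ k = (dataLaw q κ (blkNe s))⁻¹ *
      redCoef q s (blackProb q s) (1 - blackProb q s : ℝ≥0) k)
    {y : ℝ} (hy : y ∈ Set.Icc (0 : ℝ) 1) :
    mech q₁ y = mech q (blackProb q s * y) /
      (blackProb q s * deriv (mech q) (blackProb q s)) := by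
  set w := blackProb q s with hwdef
  set c := dataLaw q κ (blkNe s) with hc
  have hw1 : w ≤ 1 := blackProb_le_one q s
  have hw' : dataLaw q κ (blk s) ≠ 0 := by rw [dataLaw_blk]; exact_mod_cast hw
  have hc0 : c ≠ 0 := dataLaw_blkNe_pos q κ hq h0 h1 hw'
  have hct : c ≠ ∞ := measure_ne_top _ _
  set r : ℝ≥0 := 1 - w with hr
  have hlt : singleProb q r < 1 := by
    have := singleProb_lt_one q κ hq h0 h1 hw'
    rwa [dataLaw_compl_blk] at this
  set x : ℝ≥0 := ⟨1 - y, by linarith [hy.2]⟩ with hx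
  have hx1 : x ≤ 1 := by
    rw [← NNReal.coe_le_coe]; change 1 - y ≤ 1; linarith [hy.1]
  have hrw : r + w * x ≤ 1 := by
    calc r + w * x ≤ r + w := by gcongr; exact mul_le_of_le_one_right' hx1
      _ = 1 := tsub_add_cancel_of_le hw1
  -- the identity between the series
  have hsplit : ∀ f : ℕ → ℝ≥0∞, ∑' k, f k = f 0 + (f (0 + 1) + ∑' k, f (k + 1 + 1)) := fun f => by
    rw [tsum_eq_zero_add' ENNReal.summable, tsum_eq_zero_add' ENNReal.summable]
  have hthin0 : thin q.toMeasure w r 0 = r + q 0 * ENNReal.ofReal s := by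
    have e := tsum_red_prob q κ h0 h1
    rw [dataLaw_compl_blk] at e
    rw [← e, thin]
    refine tsum_congr fun j => ?_
    rw [toMeasure_singleton_nat]
    simp
    rfl
  -- The weights of `q₁` are those of the thinned offspring number up to `c`, except that the red
  -- root (weight `r`) is missing at `0` and the single black child (weight `w * singleProb`) at
  -- `1`.
  have hser : c * ∑' k, (q₁ k) * (x : ℝ≥0∞) ^ k + r + w * singleProb q r * x =
      ∑' n, q n * ((r + w * x : ℝ≥0) : ℝ≥0∞) ^ n := by
    have e1 : c * ∑' k, (q₁ k) * (x : ℝ≥0∞) ^ k =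
        ∑' k, (x : ℝ≥0∞) ^ k * redCoef q s w r k := by
      rw [← ENNReal.tsum_mul_left]
      refine tsum_congr fun k => ?_
      rw [h, ← mul_assoc, ← mul_assoc, ENNReal.mul_inv_cancel hc0 hct, one_mul, mul_comm]
    have e2 := tsum_pow_mul_thin q w r x
    rw [hsplit] at e2
    rw [e1, hsplit]
    simp only [redCoef, if_true, zero_add, one_ne_zero, if_false, mul_zero, pow_zero, one_mul,
      pow_one] at e2 ⊢
    rw [hthin0, thin_one] at e2
    push_cast
    rw [← e2]
    ring
  have hreal := congrArg ENNReal.toReal hser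
  have ht1 : c * ∑' k, (q₁ k) * (x : ℝ≥0∞) ^ k ≠ ∞ := ENNReal.mul_ne_top hct (tsum_pow_ne_top q₁ hx1)
  have ht2 : (w : ℝ≥0∞) * singleProb q r * x ≠ ∞ :=
    ENNReal.mul_ne_top (ENNReal.mul_ne_top ENNReal.coe_ne_top hlt.ne_top) ENNReal.coe_ne_top
  rw [ENNReal.toReal_add (ENNReal.add_ne_top.2 ⟨ht1, ENNReal.coe_ne_top⟩) ht2,
    ENNReal.toReal_add ht1 ENNReal.coe_ne_top, ENNReal.toReal_mul, toReal_tsum_pow q₁,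
    toReal_tsum_pow q, ENNReal.toReal_mul, ENNReal.toReal_mul, ENNReal.coe_toReal,
    ENNReal.coe_toReal, ENNReal.coe_toReal, hr, singleProb_toReal q hw,
    toReal_blkNe κ hq h0 h1 hw] at hreal
  have hα := deriv_mech_mem hq h0 h1 hw
  have hwpos := blackProb_pos hw
  have hxr : (x : ℝ) = 1 - y := rfl
  rw [← hwdef] at hα hwpos hreal
  have harg : ((1 - w + w * x : ℝ≥0) : ℝ) = 1 - w * y := by
    rw [NNReal.coe_add, NNReal.coe_sub hw1, NNReal.coe_mul, hxr, NNReal.coe_one]; ring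
  rw [harg, hxr, NNReal.coe_sub hw1, NNReal.coe_one] at hreal
  have hne : (w : ℝ) * deriv (mech q) w ≠ 0 := (mul_pos hwpos hα.1).ne'
  rw [eq_div_iff hne, mech, mech]
  linear_combination hreal

/-! ### The relation between lifetime laws -/

theorem GeomRel.right_unique {α : ℝ} (hα : α ∈ Set.Ioc (0 : ℝ) 1) {κ κ₁ κ₂ : ProbabilityMeasure ℝ}
    (h1 : GeomRel α κ κ₁) (h2 : GeomRel α κ κ₂) : κ₁ = κ₂ := by
  refine Subtype.ext (Measure.ext_of_charFun (μ := (κ₁ : Measure ℝ)) (ν := (κ₂ : Measure ℝ))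
    (funext fun t => ?_))
  have hne := norm_mul_charFun_lt_one (d := 1 - α) (by linarith [hα.2]) (by linarith [hα.1]) κ t
  have e1 := h1 t
  have e2 := h2 t
  push_cast at hne
  exact mul_right_cancel₀ hne (e1.trans e2.symm)

/-- The relation is a Möbius transformation between the values of the characteristic functions,
invertible for `α ≠ 0`. -/
theorem GeomRel.left_unique {α : ℝ} (hα : α ∈ Set.Ioc (0 : ℝ) 1) {κ κ₁ κ₂ : ProbabilityMeasure ℝ}
    (h1 : GeomRel α κ₁ κ) (h2 : GeomRel α κ₂ κ) : κ₁ = κ₂ := by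
  refine Subtype.ext (Measure.ext_of_charFun (μ := (κ₁ : Measure ℝ)) (ν := (κ₂ : Measure ℝ))
    (funext fun t => ?_))
  have e1 := h1 t
  have e2 := h2 t
  set f := charFun (κ : Measure ℝ) t
  set f₁ := charFun (κ₁ : Measure ℝ) t
  set f₂ := charFun (κ₂ : Measure ℝ) t
  have hne : (α : ℂ) + (1 - α) * f ≠ 0 := by
    intro h0
    have h3 : f = 0 := by
      have : f = f₁ * (α + (1 - α) * f) := by linear_combination e1
      rw [this, h0, mul_zero]
    rw [h3, mul_zero, add_zero] at h0
    exact hα.1.ne' (by exact_mod_cast h0)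
  refine mul_right_cancel₀ hne ?_
  linear_combination e2 - e1

/-- The reduced pair. -/
theorem isReducedPair_iff {q q' : PMF ℕ} {κ κ' : ProbabilityMeasure ℝ} (hq : IsOffspringLaw q)
    {s : unitInterval} (hw : blackProb q s ≠ 0) :
    IsReducedPair (unitInterval.symm s) q κ q' κ' ↔
      (∀ y ∈ Set.Icc (0 : ℝ) 1, mech q' y = mech q (blackProb q s * y) /
        (blackProb q s * deriv (mech q) (blackProb q s))) ∧
      GeomRel (deriv (mech q) (blackProb q s)) κ κ' := by
  obtain ⟨q₁, κ₁, h1, -, h3, h4, -⟩ := isReducedPair_iff_exists (κ := κ) hq hw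
  rw [singleProb_toReal q hw, sub_sub_cancel] at h4
  have h5 := fun y => mech_reduced (y := y) κ hq s.2.1 s.2.2 hw h3
  rw [h1]
  constructor
  · rintro ⟨rfl, rfl⟩
    exact ⟨h5, h4⟩
  · rintro ⟨h6, h7⟩
    refine ⟨mech_injective one_pos fun y hy => ?_, h7.right_unique
      (deriv_mech_mem hq s.2.1 s.2.2 hw) h4⟩
    rw [h6 y ⟨hy.1.le, hy.2.le⟩, h5 y ⟨hy.1.le, hy.2.le⟩]

/-- Both rescaled functions are analytic on `(0, 2 / w₁)`, hence equal there. Their values at `1`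
give the same ratio `qᵢ(0) / (wᵢ αᵢ)`, so evaluation at `1 / w₁` yields `mech q₂ 1 = mech q₂ (w₂ /
w₁)` and `w₁ = w₂` by injectivity. The slope at `1 / w₁` is `1 / αᵢ`, by the normalisation at `1`,
so `α₁ = α₂`. -/
theorem eq_of_rescaled_mech_eq {q₁ q₂ : PMF ℕ} (hq₁ : IsOffspringLaw q₁) (hq₂ : IsOffspringLaw q₂)
    {s w₁ w₂ α₁ α₂ : ℝ} (hs : 0 < s) (hp₁ : 0 < w₁) (hp₂ : 0 < w₂) (hw : w₂ ≤ w₁) (hle₁ : w₁ ≤ 1)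
    (hα₁ : 0 < α₁) (hα₂ : 0 < α₂) (hm₁ : mech q₁ w₁ = s * (q₁ 0).toReal)
    (hm₂ : mech q₂ w₂ = s * (q₂ 0).toReal)
    (e : ∀ y ∈ Set.Icc (0 : ℝ) 1, mech q₁ (w₁ * y) / (w₁ * α₁) = mech q₂ (w₂ * y) / (w₂ * α₂)) :
    q₁ = q₂ := by
  set G₁ : ℝ → ℝ := fun x => mech q₁ (w₁ * x) / (w₁ * α₁) with hG₁
  set G₂ : ℝ → ℝ := fun x => mech q₂ (w₂ * x) / (w₂ * α₂) with hG₂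
  have hc₁ : 0 < w₁ * α₁ := mul_pos hp₁ hα₁
  have hc₂ : 0 < w₂ * α₂ := mul_pos hp₂ hα₂
  have ha : ∀ {q : PMF ℕ} {w c : ℝ}, 0 < w → w ≤ w₁ →
      AnalyticOnNhd ℝ (fun x => mech q (w * x) / c) (Set.Ioo 0 (2 / w₁)) := by
    intro q w c h0 h1 x hx
    have hx2 : w * x < 2 := by
      have := (lt_div_iff₀ hp₁).1 hx.2
      nlinarith [hx.1]
    have e := analyticOnNhd_mech q (w * x) ⟨mul_pos h0 hx.1, hx2⟩
    have e' : AnalyticAt ℝ (fun x : ℝ => w * x) x := by fun_prop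
    exact (AnalyticAt.comp (g := mech q) (f := fun x : ℝ => w * x) e e').div_const
  have h1w : 1 ≤ 1 / w₁ := (one_le_div hp₁).2 hle₁
  have h2w : 1 / w₁ < 2 / w₁ := div_lt_div_of_pos_right one_lt_two hp₁
  have heq : Set.EqOn G₁ G₂ (Set.Ioo 0 (2 / w₁)) := by
    refine (ha hp₁ le_rfl).eqOn_of_preconnected_of_eventuallyEq (ha hp₂ hw) isPreconnected_Ioo
      (z₀ := 1 / 2) ⟨by norm_num, by linarith⟩ ?_
    filter_upwards [Ioo_mem_nhds (show (0 : ℝ) < 1 / 2 by norm_num) (show (1 / 2 : ℝ) < 1 by norm_num)]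
      with x hx
    exact e x ⟨hx.1.le, hx.2.le⟩
  have hq0 : ∀ {q : PMF ℕ}, IsOffspringLaw q → 0 < (q 0).toReal := fun {q} h =>
    ENNReal.toReal_pos h.1.ne' (q.apply_ne_top 0)
  have hG1 : mech q₁ w₁ / (w₁ * α₁) = mech q₂ w₂ / (w₂ * α₂) := by
    simpa using e 1 ⟨zero_le_one, le_rfl⟩
  have hww : w₁ = w₂ := by
    have e3 := heq (x := 1 / w₁) ⟨by positivity, h2w⟩
    simp only [hG₁, hG₂] at e3
    rw [mul_one_div_cancel hp₁.ne', mech_one] at e3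
    rw [hm₁, hm₂, mul_div_assoc, mul_div_assoc] at hG1
    rw [mul_left_cancel₀ hs.ne' hG1, ← mech_one, div_left_inj' hc₂.ne'] at e3
    have e4 := mech_injOn q₂ ⟨zero_le_one, le_rfl⟩
      ⟨by positivity, by rw [mul_one_div, div_le_one hp₁]; exact hw⟩
      (by rw [mech_one]; exact hq0 hq₂) e3
    rw [mul_one_div, eq_comm, div_eq_one_iff_eq hp₁.ne'] at e4
    exact e4.symm
  have hα : α₁ = α₂ := by
    have hd : ∀ {q : PMF ℕ} {α : ℝ}, IsOffspringLaw q → α ≠ 0 →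
        HasDerivAt (fun x => mech q (w₁ * x) / (w₁ * α)) (1 / α) (1 / w₁) := fun {q α} hq hα => by
      have d1 : HasDerivAt (mech q) 1 (w₁ * (1 / w₁)) := by
        rw [mul_one_div_cancel hp₁.ne']
        have := hasDerivAt_mech q (y := 1) ⟨by norm_num, by norm_num⟩
        rwa [← this.deriv, deriv_mech_one hq.2] at this
      have d2 : HasDerivAt (fun x : ℝ => w₁ * x) w₁ (1 / w₁) := by
        simpa using (hasDerivAt_id (1 / w₁)).const_mul w₁
      refine ((d1.comp _ d2).div_const (w₁ * α)).congr_deriv ?_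
      field_simp
    have d1 := hd hq₁ hα₁.ne'
    have d2 := hd hq₂ hα₂.ne'
    have hev : G₁ =ᶠ[𝓝 (1 / w₁)] G₂ :=
      heq.eventuallyEq_of_mem (Ioo_mem_nhds (by positivity) h2w)
    have d2' : HasDerivAt G₂ (1 / α₂) (1 / w₁) := by
      rw [hG₂, ← hww]; exact d2
    have := d1.unique (d2'.congr_of_eventuallyEq hev)
    have e5 := one_div_one_div α₁
    rw [this, one_div_one_div] at e5
    exact e5.symm
  refine mech_injective one_pos fun y hy => ?_
  have e6 := heq (x := y / w₁) ⟨div_pos hy.1 hp₁, by gcongr; linarith [hy.2]⟩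
  simp only [hG₁, hG₂] at e6
  rw [← hww, ← hα, mul_div_cancel₀ _ hp₁.ne', div_left_inj' hc₁.ne'] at e6
  exact e6

/-- A law with positive probability of black leaves is determined by its reduction. -/
theorem IsReducedPair.offspring_unique {q₁ q₂ q : PMF ℕ} {κ₁ κ₂ κ κ' : ProbabilityMeasure ℝ}
    (hq₁ : IsOffspringLaw q₁) (hq₂ : IsOffspringLaw q₂) {s : unitInterval} (hs : 0 < (s : ℝ))
    (h₁ : IsReducedPair (unitInterval.symm s) q₁ κ₁ q κ)
    (h₂ : IsReducedPair (unitInterval.symm s) q₂ κ₂ q κ') : q₁ = q₂ := by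
  have hw₁ := blackProb_ne_zero hq₁ hs s.2.2
  have hw₂ := blackProb_ne_zero hq₂ hs s.2.2
  have e₁ := ((isReducedPair_iff hq₁ hw₁).1 h₁).1
  have e₂ := ((isReducedPair_iff hq₂ hw₂).1 h₂).1
  have hα₁ := (deriv_mech_mem hq₁ s.2.1 s.2.2 hw₁).1
  have hα₂ := (deriv_mech_mem hq₂ s.2.1 s.2.2 hw₂).1
  have hm₁ := mech_blackProb q₁ s.2.1 s.2.2
  have hm₂ := mech_blackProb q₂ s.2.1 s.2.2
  rcases le_total (blackProb q₂ s : ℝ) (blackProb q₁ s) with hw | hw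
  · exact eq_of_rescaled_mech_eq hq₁ hq₂ hs (blackProb_pos hw₁) (blackProb_pos hw₂) hw
      (coe_blackProb_le_one q₁ s) hα₁ hα₂ hm₁ hm₂ fun y hy => (e₁ y hy).symm.trans (e₂ y hy)
  · exact (eq_of_rescaled_mech_eq hq₂ hq₁ hs (blackProb_pos hw₂) (blackProb_pos hw₁) hw
      (coe_blackProb_le_one q₂ s) hα₂ hα₁ hm₂ hm₁ fun y hy => (e₂ y hy).symm.trans (e₁ y hy)).symm

theorem IsReducedPair.lifetime_unique {q₁ q : PMF ℕ} {κ₁ κ₂ κ : ProbabilityMeasure ℝ}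
    (hq₁ : IsOffspringLaw q₁) {s : unitInterval} (hs : 0 < (s : ℝ))
    (h₁ : IsReducedPair (unitInterval.symm s) q₁ κ₁ q κ)
    (h₂ : IsReducedPair (unitInterval.symm s) q₁ κ₂ q κ) : κ₁ = κ₂ := by
  have hw := blackProb_ne_zero hq₁ hs s.2.2
  exact ((isReducedPair_iff hq₁ hw).1 h₁).2.left_unique (deriv_mech_mem hq₁ s.2.1 s.2.2 hw)
    ((isReducedPair_iff hq₁ hw).1 h₂).2

/-! ### Geometric divisibility -/

/-- Geometric divisibility prescribes `P(G = k)` only for `k ≥ 1`; the total mass settles `k = 0`.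
-/
theorem Measure.ext_of_succ_singleton {μ ν : Measure ℕ} [IsProbabilityMeasure μ]
    [IsProbabilityMeasure ν] (h : ∀ k, μ {k + 1} = ν {k + 1}) : μ = ν := by
  have hc : ({0}ᶜ : Set ℕ) = ⋃ k, {k + 1} := by
    ext n
    cases n <;> simp
  have hm : ∀ μ : Measure ℕ, μ ({0}ᶜ : Set ℕ) = ∑' k, μ {k + 1} := fun μ => by
    rw [hc, measure_iUnion _ fun _ => measurableSet_singleton _]
    intro i j hij
    simpa using hij
  refine Measure.ext_of_singleton fun n => ?_
  cases n with
  | succ k => exact h k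
  | zero =>
    rw [← compl_compl ({0} : Set ℕ), prob_compl_eq_one_sub (measurableSet_singleton 0).compl,
      prob_compl_eq_one_sub (measurableSet_singleton 0).compl, hm, hm, tsum_congr h]

theorem measurable_sum_range : Measurable fun x : (ℕ → ℝ) × ℕ => ∑ j ∈ Finset.range x.2, x.1 j :=
  measurable_from_prod_countable_left fun n => by
    dsimp only
    fun_prop

/-- The characteristic function of a geometric sum. -/
theorem charFun_geometric_sum {Ω : Type*} [MeasurableSpace Ω] {P : Measure Ω}
    [IsProbabilityMeasure P] {X : ℕ → Ω → ℝ} {G : Ω → ℕ} {α : ℝ} (hα : α ∈ Set.Ioc (0 : ℝ) 1)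
    (hX : ∀ j, Measurable (X j)) (hG : Measurable G) (hi : iIndepFun X P)
    (hid : ∀ j, IdentDistrib (X j) (X 0) P P) (hXG : IndepFun (fun ω j => X j ω) G P)
    (hgeo : ∀ k : ℕ, 1 ≤ k → P (G ⁻¹' {k}) = ENNReal.ofReal (α * (1 - α) ^ (k - 1))) (t : ℝ) :
    charFun (P.map fun ω => ∑ j ∈ Finset.range (G ω), X j ω) t *
      (1 - (1 - α) * charFun (P.map (X 0)) t) = α * charFun (P.map (X 0)) t := by
  set φ := charFun (P.map (X 0)) t with hφ
  have hX0 : IsProbabilityMeasure (P.map (X 0)) := Measure.isProbabilityMeasure_map (hX 0).aemeasurable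
  set p : unitInterval := ⟨α, hα.1.le, hα.2⟩ with hp
  have hp0 : p ≠ 0 := fun h => hα.1.ne' (congrArg Subtype.val h)
  have hXm : Measurable fun ω j => X j ω := measurable_pi_iff.2 hX
  have hGlaw : P.map G = (geometricMeasure p).map (· + 1) := by
    have h1 : IsProbabilityMeasure (P.map G) := Measure.isProbabilityMeasure_map hG.aemeasurable
    have h2 : IsProbabilityMeasure ((geometricMeasure p).map (· + 1)) :=
      Measure.isProbabilityMeasure_map (by fun_prop)
    refine Measure.ext_of_succ_singleton fun k => ?_
    rw [Measure.map_apply hG (measurableSet_singleton _), hgeo _ (by omega),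
      Measure.map_apply (by fun_prop) (measurableSet_singleton _)]
    have : (fun n : ℕ => n + 1) ⁻¹' {k + 1} = {k} := by ext n; simp
    rw [this, geometricMeasure_singleton hp0, Nat.add_sub_cancel, mul_comm]
  set F : (ℕ → ℝ) × ℕ → ℂ :=
    fun x => Complex.exp (t * (∑ j ∈ Finset.range x.2, x.1 j : ℝ) * Complex.I) with hF
  have hS : Measurable fun x : (ℕ → ℝ) × ℕ => ∑ j ∈ Finset.range x.2, x.1 j :=
    measurable_sum_range
  have hFm : Measurable F := by
    simp only [hF]; fun_prop
  have hFn : ∀ x, ‖F x‖ = 1 := fun x => by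
    simp only [hF]
    rw [← Complex.ofReal_mul, Complex.norm_exp_ofReal_mul_I]
  have hpow : ∀ k : ℕ, ∫ x, F (x, k) ∂(P.map fun ω j => X j ω) = φ ^ k := fun k => by
    have h1 := (hi.restrict (Finset.range k)).charFun_map_fun_finsetSum_eq_prod
      (fun j _ => (hX j).aemeasurable)
    have h2 := congrFun h1 t
    rw [Finset.prod_apply, Finset.prod_congr rfl fun j _ => by rw [(hid j).map_eq],
      Finset.prod_const, Finset.card_range, charFun_apply_real,
      integral_map (by fun_prop) (by fun_prop)] at h2
    rw [← hφ] at h2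
    have h3 : Measurable fun x : ℕ → ℝ => F (x, k) := hFm.comp (by fun_prop)
    rw [integral_map hXm.aemeasurable h3.aestronglyMeasurable, ← h2]
  have hmap : P.map (fun ω => ∑ j ∈ Finset.range (G ω), X j ω) =
      (P.map fun ω => ((fun j => X j ω), G ω)).map
        (fun x : (ℕ → ℝ) × ℕ => ∑ j ∈ Finset.range x.2, x.1 j) :=
    (Measure.map_map hS (hXm.prodMk hG)).symm
  have hXl : IsProbabilityMeasure (P.map fun ω j => X j ω) :=
    Measure.isProbabilityMeasure_map hXm.aemeasurable
  have hφn : ‖φ‖ ≤ 1 := norm_charFun_le_one t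
  have hlt : ‖(1 - α : ℂ) * φ‖ < 1 := by
    rw [norm_mul, ← Complex.ofReal_one, ← Complex.ofReal_sub, Complex.norm_real,
      Real.norm_of_nonneg (by linarith [hα.2])]
    nlinarith [hα.1, hα.2, norm_nonneg φ]
  have hval : charFun (P.map fun ω => ∑ j ∈ Finset.range (G ω), X j ω) t =
      α * φ * (1 - (1 - α) * φ)⁻¹ := by
    rw [charFun_apply_real, hmap, integral_map hS.aemeasurable (by fun_prop),
      (indepFun_iff_map_prod_eq_prod_map_map hXm.aemeasurable hG.aemeasurable).1 hXG, hGlaw]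
    have : IsProbabilityMeasure ((geometricMeasure p).map (· + 1)) :=
      Measure.isProbabilityMeasure_map (by fun_prop)
    change ∫ x, F x ∂_ = _
    rw [integral_prod_symm _ (Integrable.of_bound hFm.aestronglyMeasurable 1
      (ae_of_all _ fun x => (hFn x).le)), integral_congr_ae (ae_of_all _ hpow),
      integral_map (by fun_prop) (by fun_prop)]
    have hs := hasSum_integral_geometricMeasure (f := fun n => φ ^ (n + 1)) hp0
      (Integrable.of_bound (by fun_prop) 1 (ae_of_all _ fun n => by
        rw [norm_pow]; exact pow_le_one₀ (norm_nonneg _) hφn))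
    refine hs.unique ?_
    refine ((hasSum_geometric_of_norm_lt_one hlt).mul_left (α * φ)).congr_fun ?_
    intro n
    simp only [Complex.real_smul, hp]
    push_cast
    rw [mul_pow]
    ring
  rw [hval, mul_assoc, inv_mul_cancel₀, mul_one]
  intro h0
  rw [← sub_eq_zero.1 h0, norm_one] at hlt
  exact lt_irrefl _ hlt

theorem IsGeometricallyDivisible.exists_geomRel {κ : ProbabilityMeasure ℝ} {α : ℝ}
    (hα : α ∈ Set.Ioc (0 : ℝ) 1) (hκ : IsLifetimeLaw κ) (h : IsGeometricallyDivisible κ α) :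
    ∃ ν, IsLifetimeLaw ν ∧ GeomRel α ν κ := by
  obtain ⟨Ω, _, P, X, G, hP, hX, hG, hi, hid, hXG, hgeo, hlaw⟩ := h
  have hX0 : IsProbabilityMeasure (P.map (X 0)) := Measure.isProbabilityMeasure_map (hX 0).aemeasurable
  refine ⟨⟨P.map (X 0), hX0⟩, ?_, fun t => ?_⟩
  · change P.map (X 0) (Set.Iic 0) = 0
    rw [Measure.map_apply (hX 0) measurableSet_Iic]
    have hXm : Measurable fun ω j => X j ω := measurable_pi_iff.2 hX
    -- With probability `α > 0` the sum consists of one summand, so a summand cannot be nonpositive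
    -- with positive probability.
    have h1 : P (X 0 ⁻¹' Set.Iic 0 ∩ G ⁻¹' {1}) = P (X 0 ⁻¹' Set.Iic 0) * P (G ⁻¹' {1}) :=
      hXG.measure_inter_preimage_eq_mul {x : ℕ → ℝ | x 0 ∈ Set.Iic 0} {1}
        (measurable_pi_apply 0 measurableSet_Iic) (measurableSet_singleton 1)
    have h2 : P (X 0 ⁻¹' Set.Iic 0 ∩ G ⁻¹' {1}) = 0 := by
      refine measure_mono_null (t := (fun ω => ∑ j ∈ Finset.range (G ω), X j ω) ⁻¹' Set.Iic 0) ?_ ?_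
      · rintro ω ⟨ha, hb⟩
        have hb' : G ω = 1 := hb
        simpa [hb'] using ha
      · rw [← Measure.map_apply _ measurableSet_Iic, hlaw]
        · exact hκ
        · exact measurable_sum_range.comp (hXm.prodMk hG)
    rw [h2, eq_comm, mul_eq_zero] at h1
    refine h1.resolve_right ?_
    rw [hgeo 1 le_rfl]
    simpa using hα.1
  · have := charFun_geometric_sum hα hX hG hi hid hXG hgeo t
    rw [hlaw] at this
    exact this

/-- The summands and the geometric number are the coordinates of a product space; Mathlib's
`geometricMeasure` starts at `0`, whence `G = ω.2 + 1`. -/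
theorem GeomRel.isGeometricallyDivisible {κ ν : ProbabilityMeasure ℝ} {α : ℝ}
    (hα : α ∈ Set.Ioc (0 : ℝ) 1) (h : GeomRel α ν κ) : IsGeometricallyDivisible κ α := by
  set p : unitInterval := ⟨α, hα.1.le, hα.2⟩ with hp
  have hp0 : p ≠ 0 := fun h => hα.1.ne' (congrArg Subtype.val h)
  set I : Measure (ℕ → ℝ) := Measure.infinitePi fun _ : ℕ => (ν : Measure ℝ) with hI
  set P : Measure ((ℕ → ℝ) × ℕ) := I.prod (geometricMeasure p) with hPdef
  have hX : ∀ j : ℕ, Measurable fun ω : (ℕ → ℝ) × ℕ => ω.1 j := fun j => by fun_prop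
  have hG : Measurable fun ω : (ℕ → ℝ) × ℕ => ω.2 + 1 := by fun_prop
  have hXG : IndepFun (fun (ω : (ℕ → ℝ) × ℕ) j => ω.1 j) (fun ω => ω.2 + 1) P :=
    indepFun_prod (X := fun x : ℕ → ℝ => x) (Y := fun n : ℕ => n + 1) measurable_id (by fun_prop)
  have hmapX : ∀ j : ℕ, P.map (fun ω => ω.1 j) = (ν : Measure ℝ) := fun j => by
    have : (fun ω : (ℕ → ℝ) × ℕ => ω.1 j) = (fun x : ℕ → ℝ => x j) ∘ Prod.fst := rfl
    rw [this, ← Measure.map_map (by fun_prop) (by fun_prop), hPdef, measurePreserving_fst.map_eq,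
      hI, Measure.infinitePi_map_eval]
  have hi : iIndepFun (fun (j : ℕ) (ω : (ℕ → ℝ) × ℕ) => ω.1 j) P := by
    rw [iIndepFun_iff_map_fun_eq_infinitePi_map hX, funext hmapX]
    exact measurePreserving_fst.map_eq
  have hid : ∀ j : ℕ, IdentDistrib (fun ω : (ℕ → ℝ) × ℕ => ω.1 j) (fun ω => ω.1 0) P P := fun j =>
    ⟨(hX j).aemeasurable, (hX 0).aemeasurable, (hmapX j).trans (hmapX 0).symm⟩
  have hgeo : ∀ k : ℕ, 1 ≤ k → P ((fun ω => ω.2 + 1) ⁻¹' {k}) =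
      ENNReal.ofReal (α * (1 - α) ^ (k - 1)) := fun k hk => by
    have e : (fun ω : (ℕ → ℝ) × ℕ => ω.2 + 1) ⁻¹' {k} = Prod.snd ⁻¹' {k - 1} := by
      ext ω
      simp only [Set.mem_preimage, Set.mem_singleton_iff]
      omega
    rw [e, ← Measure.map_apply measurable_snd (measurableSet_singleton _), hPdef,
      measurePreserving_snd.map_eq, geometricMeasure_singleton hp0, mul_comm]
  refine ⟨(ℕ → ℝ) × ℕ, inferInstance, P, fun j ω => ω.1 j, fun ω => ω.2 + 1, inferInstance, hX, hG,
    hi, hid, hXG, hgeo, ?_⟩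
  have hS : Measurable fun x : (ℕ → ℝ) × ℕ => ∑ j ∈ Finset.range (x.2 + 1), x.1 j :=
    measurable_sum_range.comp (measurable_fst.prodMk hG)
  have hprob := Measure.isProbabilityMeasure_map (μ := P) hS.aemeasurable
  refine Measure.ext_of_charFun (funext fun t => ?_)
  have e1 := charFun_geometric_sum hα hX hG hi hid hXG hgeo t
  have e2 := h t
  have hne := norm_mul_charFun_lt_one (d := 1 - α) (by linarith [hα.2]) (by linarith [hα.1]) ν t
  push_cast at hne
  rw [hmapX 0] at e1
  exact mul_right_cancel₀ hne (e1.trans e2.symm)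

theorem geomRel_one (κ : ProbabilityMeasure ℝ) : GeomRel 1 κ κ := fun t => by
  simp

/-! ### Branching mechanisms -/

theorem IsLevyMeasure.ae_pos {Pi : Measure ℝ} (h : IsLevyMeasure Pi) : ∀ᵐ x ∂Pi, 0 < x := by
  rw [ae_iff]
  convert h.1 using 2
  ext x
  simp

theorem IsLevyMeasure.integrable_min {Pi : Measure ℝ} (h : IsLevyMeasure Pi) :
    Integrable (fun x : ℝ => min 1 (x ^ 2)) Pi := by
  refine ⟨by fun_prop, ?_⟩
  rw [hasFiniteIntegral_iff_ofReal (ae_of_all _ fun x => by positivity)]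
  exact h.2

theorem IsLevyMeasure.integrable_of_bound {Pi : Measure ℝ} (h : IsLevyMeasure Pi) {f : ℝ → ℝ}
    (hf : Measurable f) (C : ℝ) (hC : ∀ x, 0 < x → |f x| ≤ C * min 1 (x ^ 2)) :
    Integrable f Pi :=
  (h.integrable_min.const_mul C).mono' hf.aestronglyMeasurable
    (h.ae_pos.mono fun x hx => hC x hx)

theorem min_one_sq_of_lt {x : ℝ} (h0 : 0 < x) (h1 : x < 1) : min 1 (x ^ 2) = x ^ 2 :=
  min_eq_right (by nlinarith)

theorem min_one_sq_of_le {x : ℝ} (h1 : 1 ≤ x) : min 1 (x ^ 2) = 1 :=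
  min_eq_left (by nlinarith)

theorem measurable_ite_lt_one {f : ℝ → ℝ} (hf : Measurable f) :
    Measurable fun x : ℝ => if x < 1 then f x else 0 :=
  Measurable.ite measurableSet_Iio hf measurable_const

theorem exp_neg_sub_one_add_le {y : ℝ} (hy : 0 ≤ y) : Real.exp (-y) - 1 + y ≤ y ^ 2 := by
  rcases le_total y 1 with h | h
  · have := Real.abs_exp_sub_one_sub_id_le (x := -y) (by rwa [abs_neg, abs_of_nonneg hy])
    rw [abs_le] at this
    nlinarith [this.2]
  · have : Real.exp (-y) ≤ 1 := Real.exp_le_one_iff.2 (by linarith)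
    nlinarith

theorem mul_exp_neg_le_one (y : ℝ) : y * Real.exp (-y) ≤ 1 := by
  have h := Real.add_one_le_exp y
  have h2 : Real.exp y * Real.exp (-y) = 1 := by rw [← Real.exp_add]; simp
  nlinarith [Real.exp_pos (-y)]

theorem sq_mul_exp_neg_le {y : ℝ} (hy : 0 ≤ y) : y ^ 2 * Real.exp (-y) ≤ 2 := by
  have h := Real.quadratic_le_exp_of_nonneg hy
  have h2 : Real.exp y * Real.exp (-y) = 1 := by rw [← Real.exp_add]; simp
  nlinarith [Real.exp_pos (-y)]

/-- This and the next two bounds compare the integrand and its derivatives in `r` with `min 1 (x ^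
2)`, locally uniformly in `r`, to allow differentiation under the integral. For the derivatives,
large `x` is controlled by the exponential, which needs `r > 0`. -/
theorem abs_levyIntegrand_le {r x : ℝ} (hr : 0 ≤ r) (hx : 0 < x) :
    |Real.exp (-(r * x)) - 1 + (if x < 1 then r * x else 0)| ≤ (1 + r ^ 2) * min 1 (x ^ 2) := by
  have hrx : 0 ≤ r * x := mul_nonneg hr hx.le
  split_ifs with h
  · rw [min_one_sq_of_lt hx h, abs_of_nonneg (by linarith [Real.add_one_le_exp (-(r * x))])]
    have := exp_neg_sub_one_add_le hrx
    nlinarith [sq_nonneg x]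
  · rw [min_one_sq_of_le (not_lt.1 h), add_zero, mul_one, abs_le]
    have h1 := Real.exp_pos (-(r * x))
    have h2 : Real.exp (-(r * x)) ≤ 1 := Real.exp_le_one_iff.2 (by linarith)
    constructor <;> nlinarith [sq_nonneg r]

theorem abs_levyIntegrand_deriv_le {r x : ℝ} (hr : 0 < r) (hx : 0 < x) :
    |-(x * Real.exp (-(r * x))) + (if x < 1 then x else 0)| ≤ (r + 1 / r) * min 1 (x ^ 2) := by
  have hrx : 0 < r * x := mul_pos hr hx
  have hr' : 0 < 1 / r := by positivity
  have h1 := Real.exp_pos (-(r * x))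
  have h2 : Real.exp (-(r * x)) ≤ 1 := Real.exp_le_one_iff.2 (by linarith)
  split_ifs with h
  · rw [min_one_sq_of_lt hx h, abs_of_nonneg (by nlinarith)]
    have h3 := Real.add_one_le_exp (-(r * x))
    nlinarith [sq_nonneg x]
  · rw [min_one_sq_of_le (not_lt.1 h), add_zero, mul_one, abs_neg, abs_of_nonneg (by positivity)]
    have h3 := mul_exp_neg_le_one (r * x)
    have h4 : x * Real.exp (-(r * x)) ≤ 1 / r := by
      rw [le_div_iff₀ hr]; linarith
    linarith

theorem abs_levyIntegrand_deriv2_le {r x : ℝ} (hr : 0 < r) (hx : 0 < x) :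
    |x ^ 2 * Real.exp (-(r * x))| ≤ (1 + 2 / r ^ 2) * min 1 (x ^ 2) := by
  have hrx : 0 < r * x := mul_pos hr hx
  have hr' : 0 < 2 / r ^ 2 := by positivity
  have h1 := Real.exp_pos (-(r * x))
  have h2 : Real.exp (-(r * x)) ≤ 1 := Real.exp_le_one_iff.2 (by linarith)
  rw [abs_of_nonneg (by positivity)]
  rcases lt_or_ge x 1 with h | h
  · rw [min_one_sq_of_lt hx h]
    nlinarith [sq_nonneg x]
  · rw [min_one_sq_of_le h, mul_one]
    have h3 := sq_mul_exp_neg_le hrx.le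
    have h4 : x ^ 2 * Real.exp (-(r * x)) ≤ 2 / r ^ 2 := by
      rw [le_div_iff₀ (by positivity)]; nlinarith
    linarith

namespace IsLevyMeasure

variable {Pi : Measure ℝ}

theorem integrable_levyIntegrand (h : IsLevyMeasure Pi) {r : ℝ} (hr : 0 ≤ r) :
    Integrable (fun x => Real.exp (-(r * x)) - 1 + (if x < 1 then r * x else 0)) Pi :=
  h.integrable_of_bound ((by fun_prop : Measurable fun x : ℝ => Real.exp (-(r * x)) - 1).add
    (measurable_ite_lt_one (by fun_prop))) _ fun _ hx => abs_levyIntegrand_le hr hx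

theorem measurable_levyIntegrand_deriv (r : ℝ) :
    Measurable fun x : ℝ => -(x * Real.exp (-(r * x))) + (if x < 1 then x else 0) :=
  (by fun_prop : Measurable fun x : ℝ => -(x * Real.exp (-(r * x)))).add
    (measurable_ite_lt_one measurable_id)

theorem integrable_levyIntegrand_deriv (h : IsLevyMeasure Pi) {r : ℝ} (hr : 0 < r) :
    Integrable (fun x => -(x * Real.exp (-(r * x))) + (if x < 1 then x else 0)) Pi :=
  h.integrable_of_bound (measurable_levyIntegrand_deriv r) _
    fun _ hx => abs_levyIntegrand_deriv_le hr hx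

theorem integrable_levyIntegrand_deriv2 (h : IsLevyMeasure Pi) {r : ℝ} (hr : 0 < r) :
    Integrable (fun x => x ^ 2 * Real.exp (-(r * x))) Pi :=
  h.integrable_of_bound (by fun_prop) _ fun _ hx => abs_levyIntegrand_deriv2_le hr hx

end IsLevyMeasure

theorem branchingMechanism_zero (b a : ℝ) (Pi : Measure ℝ) : branchingMechanism b a Pi 0 = 0 := by
  simp [branchingMechanism]

/-- The derivative of `branchingMechanism b a Pi`. -/
noncomputable def mechanismDeriv (b a : ℝ) (Pi : Measure ℝ) (r : ℝ) : ℝ :=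
  b + 2 * a * r + ∫ x, (-(x * Real.exp (-(r * x))) + (if x < 1 then x else 0)) ∂Pi

/-- The second derivative of `branchingMechanism b a Pi`. -/
noncomputable def mechanismDeriv2 (a : ℝ) (Pi : Measure ℝ) (r : ℝ) : ℝ :=
  2 * a + ∫ x, x ^ 2 * Real.exp (-(r * x)) ∂Pi

theorem hasDerivAt_exp_neg_mul (x r : ℝ) :
    HasDerivAt (fun r : ℝ => Real.exp (-(r * x))) (-(x * Real.exp (-(r * x)))) r :=
  (((hasDerivAt_id r).mul_const x).neg.exp).congr_deriv (by simp; ring)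

theorem mem_ball_half {r r' : ℝ} (h : r' ∈ Metric.ball r (r / 2)) : r / 2 < r' ∧ r' < 3 * r / 2 := by
  rw [Metric.mem_ball, Real.dist_eq, abs_lt] at h
  constructor <;> linarith [h.1, h.2]

theorem hasDerivAt_branchingMechanism (b a : ℝ) {Pi : Measure ℝ} (h : IsLevyMeasure Pi) {r : ℝ}
    (hr : 0 < r) : HasDerivAt (branchingMechanism b a Pi) (mechanismDeriv b a Pi r) r := by
  have h1 : HasDerivAt (fun r : ℝ => ∫ x, (Real.exp (-(r * x)) - 1 + (if x < 1 then r * x else 0)) ∂Pi)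
      (∫ x, (-(x * Real.exp (-(r * x))) + (if x < 1 then x else 0)) ∂Pi) r := by
    -- On this ball `r / 2 < r' < 3 r / 2`, whence the bound on `r' + 1 / r'`.
    refine (hasDerivAt_integral_of_dominated_loc_of_deriv_le (s := Metric.ball r (r / 2))
      (bound := fun x => (3 * r / 2 + 2 / r) * min 1 (x ^ 2))
      (F' := fun r x => -(x * Real.exp (-(r * x))) + (if x < 1 then x else 0))
      (Metric.ball_mem_nhds r (by positivity)) ?_ (h.integrable_levyIntegrand hr.le)
      (IsLevyMeasure.measurable_levyIntegrand_deriv r).aestronglyMeasurable ?_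
      (h.integrable_min.const_mul _) ?_).2
    · refine Eventually.of_forall fun r' => Measurable.aestronglyMeasurable ?_
      exact (by fun_prop : Measurable fun x : ℝ => Real.exp (-(r' * x)) - 1).add
        (measurable_ite_lt_one (by fun_prop))
    · filter_upwards [h.ae_pos] with x hx r' hr'
      have hb := mem_ball_half hr'
      refine (abs_levyIntegrand_deriv_le (by linarith) hx).trans ?_
      have : 1 / r' ≤ 2 / r := by
        rw [div_le_div_iff₀ (by linarith) hr]; linarith
      gcongr
      exact hb.2.le
    · refine ae_of_all _ fun x r' _ => ?_
      split_ifs with hx1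
      · exact (((hasDerivAt_exp_neg_mul x r').sub_const 1).add
          ((hasDerivAt_id r').mul_const x)).congr_deriv (by simp)
      · simpa using (hasDerivAt_exp_neg_mul x r').sub_const 1
  have h2 : HasDerivAt (fun r : ℝ => b * r + a * r ^ 2) (b + 2 * a * r) r :=
    (((hasDerivAt_id r).const_mul b).add ((hasDerivAt_pow 2 r).const_mul a)).congr_deriv
      (by simp; ring)
  exact h2.add h1

theorem hasDerivAt_mechanismDeriv (b a : ℝ) {Pi : Measure ℝ} (h : IsLevyMeasure Pi) {r : ℝ}
    (hr : 0 < r) : HasDerivAt (mechanismDeriv b a Pi) (mechanismDeriv2 a Pi r) r := by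
  have h1 : HasDerivAt
      (fun r : ℝ => ∫ x, (-(x * Real.exp (-(r * x))) + (if x < 1 then x else 0)) ∂Pi)
      (∫ x, x ^ 2 * Real.exp (-(r * x)) ∂Pi) r := by
    refine (hasDerivAt_integral_of_dominated_loc_of_deriv_le (s := Metric.ball r (r / 2))
      (bound := fun x => (1 + 2 / (r / 2) ^ 2) * min 1 (x ^ 2))
      (F' := fun r x => x ^ 2 * Real.exp (-(r * x)))
      (Metric.ball_mem_nhds r (by positivity)) (Eventually.of_forall fun r' =>
      (IsLevyMeasure.measurable_levyIntegrand_deriv r').aestronglyMeasurable)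
      (h.integrable_levyIntegrand_deriv hr) (by fun_prop) ?_ (h.integrable_min.const_mul _) ?_).2
    · filter_upwards [h.ae_pos] with x hx r' hr'
      have hb := mem_ball_half hr'
      refine (abs_levyIntegrand_deriv2_le (by linarith) hx).trans ?_
      gcongr
      exact hb.1.le
    · refine ae_of_all _ fun x r' _ => ?_
      exact ((((hasDerivAt_exp_neg_mul x r').const_mul x).neg).add_const _).congr_deriv (by ring)
  have h2 : HasDerivAt (fun r : ℝ => b + 2 * a * r) (2 * a) r :=
    (((hasDerivAt_id r).const_mul (2 * a)).const_add b).congr_deriv (by simp)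
  exact h2.add h1

theorem continuousOn_branchingMechanism (b a : ℝ) {Pi : Measure ℝ} (h : IsLevyMeasure Pi) :
    ContinuousOn (branchingMechanism b a Pi) (Set.Ici 0) := by
  intro r hr
  rcases (Set.mem_Ici.1 hr).eq_or_lt with rfl | hr
  · refine ContinuousWithinAt.add (by fun_prop) ?_
    refine continuousWithinAt_of_dominated (bound := fun x => 2 * min 1 (x ^ 2)) ?_ ?_
      (h.integrable_min.const_mul _) ?_
    · refine Eventually.of_forall fun r' => Measurable.aestronglyMeasurable ?_
      exact (by fun_prop : Measurable fun x : ℝ => Real.exp (-(r' * x)) - 1).add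
        (measurable_ite_lt_one (by fun_prop))
    · filter_upwards [self_mem_nhdsWithin, nhdsWithin_le_nhds (Iio_mem_nhds one_pos)] with r' h0 h1
      filter_upwards [h.ae_pos] with x hx
      refine (abs_levyIntegrand_le h0 hx).trans ?_
      gcongr
      have : r' < 1 := h1
      have : 0 ≤ r' := h0
      nlinarith
    · refine ae_of_all _ fun x => ?_
      split_ifs <;> fun_prop
  · exact (hasDerivAt_branchingMechanism b a h hr).continuousAt.continuousWithinAt

theorem deriv_branchingMechanism (b a : ℝ) {Pi : Measure ℝ} (h : IsLevyMeasure Pi) {r : ℝ}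
    (hr : 0 < r) : deriv (branchingMechanism b a Pi) r = mechanismDeriv b a Pi r :=
  (hasDerivAt_branchingMechanism b a h hr).deriv

theorem mechanismDeriv2_nonneg {a : ℝ} (ha : 0 ≤ a) {Pi : Measure ℝ} (r : ℝ) :
    0 ≤ mechanismDeriv2 a Pi r :=
  add_nonneg (by linarith) (integral_nonneg fun x => by positivity)

theorem mechanismDeriv2_pos {a : ℝ} (ha : 0 ≤ a) {Pi : Measure ℝ} (h : IsLevyMeasure Pi)
    (hne : a ≠ 0 ∨ Pi ≠ 0) {r : ℝ} (hr : 0 < r) : 0 < mechanismDeriv2 a Pi r := by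
  rcases ha.eq_or_lt with rfl | ha
  · have hPi : Pi ≠ 0 := by simpa using hne
    rw [mechanismDeriv2, mul_zero, zero_add, integral_pos_iff_support_of_nonneg
      (fun x => by positivity) (h.integrable_levyIntegrand_deriv2 hr)]
    rw [pos_iff_ne_zero]
    intro h0
    refine hPi (Measure.measure_univ_eq_zero.1 ?_)
    refine measure_mono_null (t := (Function.support fun x : ℝ => x ^ 2 * Real.exp (-(r * x))) ∪
      Set.Iic 0) (fun x _ => ?_) (measure_union_null h0 h.1)
    rcases le_or_gt x 0 with hx | hx
    · exact Or.inr hx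
    · exact Or.inl (by simp [hx.ne', (Real.exp_pos _).ne'])
  · exact add_pos_of_pos_of_nonneg (by linarith) (integral_nonneg fun x => by positivity)

theorem monotoneOn_mechanismDeriv (b : ℝ) {a : ℝ} (ha : 0 ≤ a) {Pi : Measure ℝ}
    (h : IsLevyMeasure Pi) : MonotoneOn (mechanismDeriv b a Pi) (Set.Ioi 0) := by
  refine monotoneOn_of_deriv_nonneg (convex_Ioi 0)
    (fun r hr => (hasDerivAt_mechanismDeriv b a h hr).continuousAt.continuousWithinAt)
    (fun r hr => ?_) fun r hr => ?_
  · rw [interior_Ioi] at hr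
    exact (hasDerivAt_mechanismDeriv b a h hr).differentiableAt.differentiableWithinAt
  · rw [interior_Ioi] at hr
    rw [(hasDerivAt_mechanismDeriv b a h hr).deriv]
    exact mechanismDeriv2_nonneg ha r

theorem strictMonoOn_mechanismDeriv (b : ℝ) {a : ℝ} (ha : 0 ≤ a) {Pi : Measure ℝ}
    (h : IsLevyMeasure Pi) (hne : a ≠ 0 ∨ Pi ≠ 0) :
    StrictMonoOn (mechanismDeriv b a Pi) (Set.Ioi 0) := by
  refine strictMonoOn_of_deriv_pos (convex_Ioi 0)
    (fun r hr => (hasDerivAt_mechanismDeriv b a h hr).continuousAt.continuousWithinAt)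
    fun r hr => ?_
  rw [interior_Ioi] at hr
  rw [(hasDerivAt_mechanismDeriv b a h hr).deriv]
  exact mechanismDeriv2_pos ha h hne hr

theorem mechanismDeriv_zero_zero (b r : ℝ) : mechanismDeriv b 0 0 r = b := by
  simp [mechanismDeriv]

/-! ### Offspring laws from branching mechanisms -/

theorem hasSum_exp_tail (z : ℝ) :
    HasSum (fun k : ℕ => z ^ (k + 2) / (k + 2).factorial) (Real.exp z - 1 - z) := by
  have h : HasSum (fun n : ℕ => z ^ n / n.factorial) (Real.exp z) := by
    rw [Real.exp_eq_exp_ℝ]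
    exact NormedSpace.expSeries_div_hasSum_exp z
  have h2 := (hasSum_nat_add_iff' 2).2 h
  simp only [Finset.sum_range_succ, Finset.sum_range_zero, zero_add, pow_zero, pow_one,
    Nat.factorial_zero, Nat.factorial_one, Nat.cast_one, div_one] at h2
  rwa [← sub_sub] at h2

section

variable (b : ℝ) {a : ℝ} {Pi : Measure ℝ} {θ : ℝ}

/-- The part of order at least two of the expansion in `s` of the integrand at `θ (1 - s)`. It is
nonnegative, and the cut-off at `x = 1` drops out of it. -/
theorem levyIntegrand_identity (θ s x : ℝ) :
    Real.exp (-(θ * x)) * (Real.exp (θ * s * x) - 1 - θ * s * x) =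
      (Real.exp (-(θ * (1 - s) * x)) - 1 + (if x < 1 then θ * (1 - s) * x else 0)) +
        θ * s * (-(x * Real.exp (-(θ * x))) + (if x < 1 then x else 0)) -
        (Real.exp (-(θ * x)) - 1 + (if x < 1 then θ * x else 0)) := by
  have h : Real.exp (-(θ * (1 - s) * x)) = Real.exp (-(θ * x)) * Real.exp (θ * s * x) := by
    rw [← Real.exp_add]; congr 1; ring
  rw [h]
  split_ifs <;> ring

theorem integrable_expTail (h : IsLevyMeasure Pi) (hθ : 0 < θ) {s : ℝ} (hs : s ≤ 1) :
    Integrable (fun x => Real.exp (-(θ * x)) * (Real.exp (θ * s * x) - 1 - θ * s * x)) Pi := by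
  simp only [levyIntegrand_identity]
  exact ((h.integrable_levyIntegrand (mul_nonneg hθ.le (sub_nonneg.2 hs))).add
    ((h.integrable_levyIntegrand_deriv hθ).const_mul _)).sub (h.integrable_levyIntegrand hθ.le)

theorem branchingMechanism_expansion (a : ℝ) (h : IsLevyMeasure Pi) (hθ : 0 < θ) {s : ℝ}
    (hs : s ≤ 1) : branchingMechanism b a Pi (θ * (1 - s)) + θ * s * mechanismDeriv b a Pi θ =
      branchingMechanism b a Pi θ + a * θ ^ 2 * s ^ 2 +
        ∫ x, Real.exp (-(θ * x)) * (Real.exp (θ * s * x) - 1 - θ * s * x) ∂Pi := by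
  have h1 := h.integrable_levyIntegrand (mul_nonneg hθ.le (sub_nonneg.2 hs))
  have h2 := h.integrable_levyIntegrand_deriv hθ
  have h3 := h.integrable_levyIntegrand hθ.le
  simp only [levyIntegrand_identity]
  have h12 : Integrable (fun x => (Real.exp (-(θ * (1 - s) * x)) - 1 +
      (if x < 1 then θ * (1 - s) * x else 0)) +
        θ * s * (-(x * Real.exp (-(θ * x))) + (if x < 1 then x else 0))) Pi :=
    h1.add (h2.const_mul _)
  rw [integral_sub h12 h3, integral_add h1 (h2.const_mul _), integral_const_mul, branchingMechanism, branchingMechanism, mechanismDeriv]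
  ring

/-- The offspring probabilities of the law associated with `r ↦ ψ(θ r) / (θ ψ'(θ))`. -/
noncomputable def mechanismCoef (b a : ℝ) (Pi : Measure ℝ) (θ c : ℝ) : ℕ → ℝ≥0∞
  | 0 => ENNReal.ofReal (branchingMechanism b a Pi θ / c)
  | 1 => 0
  | k + 2 => ENNReal.ofReal (if k = 0 then a * θ ^ 2 / c else 0) + ENNReal.ofReal c⁻¹ *
      ∫⁻ x, ENNReal.ofReal (Real.exp (-(θ * x)) * ((θ * x) ^ (k + 2) / (k + 2).factorial)) ∂Pi

/-- The exponential tail is integrated term by term, all terms being nonnegative. The summand `θ s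
ψ'(θ)` cancels the linear term of `ψ(θ (1 - s))`, which is the only one without a definite sign once
`ψ(θ) > 0`. -/
theorem tsum_mechanismCoef (ha : 0 ≤ a) (h : IsLevyMeasure Pi) (hθ : 0 < θ) {c : ℝ} (hc : 0 < c)
    (hv : 0 < branchingMechanism b a Pi θ) {s : ℝ} (hs : s ∈ Set.Icc (0 : ℝ) 1) :
    ∑' n, mechanismCoef b a Pi θ c n * ENNReal.ofReal s ^ n =
      ENNReal.ofReal ((branchingMechanism b a Pi (θ * (1 - s)) +
        θ * s * mechanismDeriv b a Pi θ) / c) := by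
  set J : ℝ → ℝ := fun x => Real.exp (-(θ * x)) * (Real.exp (θ * s * x) - 1 - θ * s * x)
  have hJ0 : ∀ x, 0 ≤ J x := fun x => mul_nonneg (Real.exp_pos _).le
    (by linarith [Real.add_one_le_exp (θ * s * x)])
  have e1 : ∑' k : ℕ, ENNReal.ofReal (if k = 0 then a * θ ^ 2 / c else 0) *
      ENNReal.ofReal s ^ (k + 2) = ENNReal.ofReal (a * θ ^ 2 * s ^ 2 / c) := by
    rw [tsum_eq_single 0 fun k hk => by simp [hk], if_pos rfl, ← ENNReal.ofReal_pow hs.1,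
      ← ENNReal.ofReal_mul (by positivity)]
    congr 1
    ring
  have e2 : ∑' k : ℕ, ENNReal.ofReal c⁻¹ * (∫⁻ x, ENNReal.ofReal
      (Real.exp (-(θ * x)) * ((θ * x) ^ (k + 2) / (k + 2).factorial)) ∂Pi) *
      ENNReal.ofReal s ^ (k + 2) = ENNReal.ofReal ((∫ x, J x ∂Pi) / c) := by
    simp only [mul_assoc]
    rw [ENNReal.tsum_mul_left]
    have e3 : ∀ k : ℕ, (∫⁻ x, ENNReal.ofReal
        (Real.exp (-(θ * x)) * ((θ * x) ^ (k + 2) / (k + 2).factorial)) ∂Pi) *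
        ENNReal.ofReal s ^ (k + 2) = ∫⁻ x, ENNReal.ofReal
        (Real.exp (-(θ * x)) * ((θ * s * x) ^ (k + 2) / (k + 2).factorial)) ∂Pi := fun k => by
      rw [← lintegral_mul_const _ (by fun_prop)]
      refine lintegral_congr fun x => ?_
      rw [← ENNReal.ofReal_pow hs.1, ← ENNReal.ofReal_mul' (by positivity [hs.1])]
      congr 1
      ring
    simp only [e3]
    rw [← lintegral_tsum fun k => by fun_prop, div_eq_inv_mul, ENNReal.ofReal_mul (by positivity),
      ofReal_integral_eq_lintegral_ofReal (integrable_expTail h hθ hs.2) (ae_of_all _ hJ0)]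
    congr 1
    refine lintegral_congr_ae (h.ae_pos.mono fun x hx => ?_)
    have hz : 0 ≤ θ * s * x := mul_nonneg (mul_nonneg hθ.le hs.1) hx.le
    have hsum := (hasSum_exp_tail (θ * s * x)).mul_left (Real.exp (-(θ * x)))
    change _ = ENNReal.ofReal (Real.exp (-(θ * x)) * (Real.exp (θ * s * x) - 1 - θ * s * x))
    rw [← hsum.tsum_eq, ENNReal.ofReal_tsum_of_nonneg (fun k => by positivity) hsum.summable]
  rw [tsum_eq_zero_add' ENNReal.summable, tsum_eq_zero_add' ENNReal.summable]
  simp only [mechanismCoef, zero_add, pow_zero, mul_one, zero_mul, add_mul]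
  rw [ENNReal.tsum_add, e1, e2, branchingMechanism_expansion b a h hθ hs.2,
    ← ENNReal.ofReal_add (by positivity [hs.1]) (div_nonneg (integral_nonneg hJ0) hc.le),
    ← ENNReal.ofReal_add (by positivity)
      (add_nonneg (by positivity [hs.1]) (div_nonneg (integral_nonneg hJ0) hc.le))]
  congr 1
  ring

theorem exists_offspringLaw_of_mechanism (ha : 0 ≤ a) (h : IsLevyMeasure Pi) (hθ : 0 < θ)
    (hv : 0 < branchingMechanism b a Pi θ) (hd : 0 < mechanismDeriv b a Pi θ) :
    ∃ Q : PMF ℕ, IsOffspringLaw Q ∧ ∀ y ∈ Set.Icc (0 : ℝ) 1,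
      mech Q y = branchingMechanism b a Pi (θ * y) / (θ * mechanismDeriv b a Pi θ) := by
  set c := θ * mechanismDeriv b a Pi θ with hc
  have hc0 : 0 < c := mul_pos hθ hd
  -- At `s = 1` the series has the sum `(ψ(0) + θ ψ'(θ)) / c = 1`.
  have hone : ∑' n, mechanismCoef b a Pi θ c n = 1 := by
    have := tsum_mechanismCoef b ha h hθ hc0 hv (s := 1) ⟨zero_le_one, le_rfl⟩
    simp only [ENNReal.ofReal_one, one_pow, mul_one, sub_self, mul_zero,
      branchingMechanism_zero, zero_add] at this
    rw [this, ← hc, div_self hc0.ne', ENNReal.ofReal_one]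
  obtain ⟨Q, hQ⟩ : ∃ Q : PMF ℕ, ∀ n, Q n = mechanismCoef b a Pi θ c n :=
    ⟨⟨mechanismCoef b a Pi θ c, hone ▸ ENNReal.summable.hasSum⟩, fun _ => rfl⟩
  refine ⟨Q, ⟨?_, by rw [hQ]; rfl⟩, fun y hy => ?_⟩
  · rw [hQ]
    exact ENNReal.ofReal_pos.2 (div_pos hv hc0)
  · have hs : 1 - y ∈ Set.Icc (0 : ℝ) 1 := ⟨by linarith [hy.2], by linarith [hy.1]⟩
    have e := tsum_mechanismCoef b ha h hθ hc0 hv hs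
    have hnn : 0 ≤ (branchingMechanism b a Pi (θ * (1 - (1 - y))) +
        θ * (1 - y) * mechanismDeriv b a Pi θ) / c := by
      rw [branchingMechanism_expansion b a h hθ hs.2]
      refine div_nonneg (add_nonneg (by positivity) (integral_nonneg fun x => ?_)) hc0.le
      exact mul_nonneg (Real.exp_pos _).le (by linarith [Real.add_one_le_exp (θ * (1 - y) * x)])
    have e2 := toReal_tsum_pow Q ⟨1 - y, hs.1⟩
    have e3 : ENNReal.ofNNReal ⟨1 - y, hs.1⟩ = ENNReal.ofReal (1 - y) :=
      (ENNReal.ofReal_eq_coe_nnreal hs.1).symm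
    simp only [hQ] at e2
    rw [e3, e, ENNReal.toReal_ofReal hnn, sub_sub_cancel] at e2
    have e4 : genFun Q (1 - y) =
        (branchingMechanism b a Pi (θ * y) + θ * (1 - y) * mechanismDeriv b a Pi θ) / c := e2.symm
    rw [mech, e4, hc]
    field_simp
    ring

end

/-- Made for the end point `1`, where agreement on one side is enough to compare derivatives. -/
theorem HasDerivAt.eq_of_eqOn_Icc {f g : ℝ → ℝ} {f' g' x : ℝ} (hf : HasDerivAt f f' x)
    (hg : HasDerivAt g g' x) (h : Set.EqOn f g (Set.Icc 0 1)) (hx : x ∈ Set.Icc (0 : ℝ) 1) :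
    f' = g' :=
  (uniqueDiffOn_Icc zero_lt_one x hx).eq_deriv _ hf.hasDerivWithinAt
    (hg.hasDerivWithinAt.congr h (h hx))

/-- Divisibility for all parameters that the mechanism allows. -/
def IsDivisibleFor (κ : ProbabilityMeasure ℝ) (ψ : ℝ → ℝ) : Prop :=
  (∀ m : ℝ, Tendsto (deriv ψ) atTop (𝓝 m) →
    ∀ α ∈ Set.Ioc (0 : ℝ) 1, 1 / m < α → IsGeometricallyDivisible κ α) ∧
  (Tendsto (deriv ψ) atTop atTop → ∀ α ∈ Set.Ioc (0 : ℝ) 1, IsGeometricallyDivisible κ α)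

section

variable {q : PMF ℕ} {κ : ProbabilityMeasure ℝ} {b a : ℝ} {Pi : Measure ℝ}

/-- If `ψ'(θ) = 1`, nothing has to be divided. Otherwise `ψ` is not linear, so `ψ'` is strictly
increasing and stays below its limit at `θ`; hence `1 / ψ'(θ)` is an admissible parameter. -/
theorem IsDivisibleFor.exists_geomRel (ha : 0 ≤ a) (h : IsLevyMeasure Pi) (hκ : IsLifetimeLaw κ)
    (hdiv : IsDivisibleFor κ (branchingMechanism b a Pi)) (h1 : mechanismDeriv b a Pi 1 = 1)
    {θ : ℝ} (hθ : 1 ≤ θ) : ∃ ν, IsLifetimeLaw ν ∧ GeomRel (1 / mechanismDeriv b a Pi θ) ν κ := by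
  have hmono := monotoneOn_mechanismDeriv b ha h
  have hge : 1 ≤ mechanismDeriv b a Pi θ := by
    rw [← h1]
    exact hmono (Set.mem_Ioi.2 one_pos) (Set.mem_Ioi.2 (one_pos.trans_le hθ)) hθ
  rcases hge.eq_or_lt with heq | hlt
  · exact ⟨κ, hκ, by rw [← heq, one_div_one]; exact geomRel_one κ⟩
  have hα : 1 / mechanismDeriv b a Pi θ ∈ Set.Ioc (0 : ℝ) 1 :=
    ⟨by positivity, (div_le_one (by positivity)).2 hge⟩
  refine IsGeometricallyDivisible.exists_geomRel hα hκ ?_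
  have hne : a ≠ 0 ∨ Pi ≠ 0 := by
    by_contra! hcon
    obtain ⟨rfl, rfl⟩ := hcon
    rw [mechanismDeriv_zero_zero] at h1 hlt
    linarith
  have hstrict := strictMonoOn_mechanismDeriv b ha h hne
  -- Freezing the derivative below `θ` makes it monotone on the whole line, so that it has a limit
  -- or tends to infinity.
  have hev : deriv (branchingMechanism b a Pi) =ᶠ[atTop]
      fun r => mechanismDeriv b a Pi (max r θ) := by
    filter_upwards [eventually_ge_atTop θ] with r hr
    rw [max_eq_left hr, deriv_branchingMechanism b a h (by linarith)]
  have hmono' : Monotone fun r => mechanismDeriv b a Pi (max r θ) := fun r r' hr =>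
    hmono (Set.mem_Ioi.2 (by linarith [le_max_right r θ]))
      (Set.mem_Ioi.2 (by linarith [le_max_right r' θ])) (max_le_max_right θ hr)
  rcases tendsto_atTop_of_monotone hmono' with htop | ⟨m, hm⟩
  · exact hdiv.2 (htop.congr' hev.symm) _ hα
  · refine hdiv.1 m (hm.congr' hev.symm) _ hα ?_
    have h2 : mechanismDeriv b a Pi θ < mechanismDeriv b a Pi (θ + 1) :=
      hstrict (Set.mem_Ioi.2 (by linarith)) (Set.mem_Ioi.2 (by linarith)) (by linarith)
    have h3 := hmono'.ge_of_tendsto hm (θ + 1)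
    simp only [max_eq_left (by linarith : θ ≤ θ + 1)] at h3
    exact one_div_lt_one_div_of_lt (by linarith) (h2.trans_le h3)

/-- Choose `θ ≥ 1` with `ψ(θ) = q(0) / s` and rescale `ψ` by `θ`. The new law has black-root
probability `1 / θ` at level `s` and slope `1 / ψ'(θ)` there, so reduction undoes the rescaling; the
lifetime law is a geometric divisor of `κ` for this slope. -/
theorem exists_preimage_pair (hq : IsOffspringLaw q) (hκ : IsLifetimeLaw κ) (ha : 0 ≤ a)
    (h : IsLevyMeasure Pi)
    (hgen : ∀ y ∈ Set.Icc (0 : ℝ) 1, mech q y = branchingMechanism b a Pi y)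
    (hdiv : IsDivisibleFor κ (branchingMechanism b a Pi)) {s : unitInterval} (hs : 0 < (s : ℝ)) :
    ∃ (Q : PMF ℕ) (K : ProbabilityMeasure ℝ), IsOffspringLaw Q ∧ IsLifetimeLaw K ∧
      IsReducedPair (unitInterval.symm s) Q K q κ := by
  set ψ := branchingMechanism b a Pi with hψ
  set q0 := (q 0).toReal with hq0def
  have hq0 : 0 < q0 := ENNReal.toReal_pos hq.1.ne' (q.apply_ne_top 0)
  have hψ1 : ψ 1 = q0 := by rw [← hgen 1 ⟨zero_le_one, le_rfl⟩, mech_one]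
  have hd1 : mechanismDeriv b a Pi 1 = 1 := by
    have e1 := hasDerivAt_mech q (y := 1) ⟨by norm_num, by norm_num⟩
    rw [← e1.deriv, deriv_mech_one hq.2] at e1
    exact (e1.eq_of_eqOn_Icc (hasDerivAt_branchingMechanism b a h one_pos) hgen
      ⟨zero_le_one, le_rfl⟩).symm
  have hdge : ∀ r, 1 ≤ r → 1 ≤ mechanismDeriv b a Pi r := fun r hr => by
    rw [← hd1]
    exact monotoneOn_mechanismDeriv b ha h (Set.mem_Ioi.2 one_pos)
      (Set.mem_Ioi.2 (one_pos.trans_le hr)) hr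
  have hcont : ContinuousOn ψ (Set.Ici 1) :=
    (continuousOn_branchingMechanism b a h).mono (Set.Ici_subset_Ici.2 zero_le_one)
  obtain ⟨θ, hθ1, hθ⟩ : ∃ θ, 1 ≤ θ ∧ ψ θ = q0 / s := by
    have hR : 1 ≤ 1 + q0 / s := by have : 0 < q0 / s := by positivity
                                   linarith
    -- On `[1, ∞)` the slope of `ψ` is at least `ψ'(1) = 1`, so `ψ` grows at least linearly and
    -- reaches `q(0) / s` here at the latest.
    have hlow : q0 / s ≤ ψ (1 + q0 / s) := by
      have hm : MonotoneOn (fun r => ψ r - r) (Set.Ici 1) := by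
        refine monotoneOn_of_deriv_nonneg (convex_Ici 1) (hcont.sub continuousOn_id)
          (fun r hr => ?_) fun r hr => ?_
        all_goals
          rw [interior_Ici] at hr
          have hr1 : (1 : ℝ) < r := hr
          have hder := (hasDerivAt_branchingMechanism b a h (one_pos.trans hr1)).sub (hasDerivAt_id r)
        · exact hder.differentiableAt.differentiableWithinAt
        · have e : deriv (fun r => ψ r - r) r = mechanismDeriv b a Pi r - 1 := hder.deriv
          rw [e]
          linarith [hdge r hr1.le]
      have := hm (Set.mem_Ici.2 le_rfl) (Set.mem_Ici.2 hR) hR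
      simp only [hψ1] at this
      linarith
    have hup : ψ 1 ≤ q0 / s := by rw [hψ1, le_div_iff₀ hs]; nlinarith [s.2.2]
    obtain ⟨θ, hθ, he⟩ := intermediate_value_Icc hR (hcont.mono Set.Icc_subset_Ici_self)
      ⟨hup, hlow⟩
    exact ⟨θ, hθ.1, he⟩
  have hθ0 : 0 < θ := one_pos.trans_le hθ1
  set d := mechanismDeriv b a Pi θ with hd
  have hd0 : 0 < d := one_pos.trans_le (hdge θ hθ1)
  have hv : 0 < ψ θ := by rw [hθ]; positivity
  obtain ⟨Q, hQ, hQm⟩ := exists_offspringLaw_of_mechanism b ha h hθ0 hv hd0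
  obtain ⟨K, hK, hrel⟩ := hdiv.exists_geomRel ha h hκ hd1 hθ1
  rw [← hψ, ← hd] at hQm
  rw [← hd] at hrel
  have hw := blackProb_ne_zero hQ hs s.2.2
  have hinv : 1 / θ ∈ Set.Icc (0 : ℝ) 1 := ⟨by positivity, (div_le_one hθ0).2 hθ1⟩
  have hmw : mech Q (1 / θ) = q0 / (θ * d) := by
    rw [hQm _ hinv, mul_one_div_cancel hθ0.ne', ← hψ1]
  -- Both points give `mech Q` the same positive value: `ψ(1) / (θ d) = s ψ(θ) / (θ d)` by the
  -- choice of `θ`.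
  have hwθ : (blackProb Q s : ℝ) = 1 / θ := by
    refine (mech_injOn Q hinv ⟨NNReal.coe_nonneg _, coe_blackProb_le_one Q s⟩ ?_ ?_).symm
    · rw [hmw]; positivity
    · rw [hmw, mech_blackProb Q s.2.1 s.2.2, ← mech_one, hQm 1 ⟨zero_le_one, le_rfl⟩, mul_one]
      rw [hθ]
      field_simp
  have hα : deriv (mech Q) (1 / θ) = 1 / d := by
    have e1 := hasDerivAt_mech Q (y := 1 / θ) ⟨by positivity, by linarith [hinv.2]⟩
    have e2 : HasDerivAt (fun y => ψ (θ * y) / (θ * d)) (1 / d) (1 / θ) := by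
      have e3 : HasDerivAt ψ 1 (θ * (1 / θ)) := by
        rw [mul_one_div_cancel hθ0.ne']
        exact (hasDerivAt_branchingMechanism b a h one_pos).congr_deriv hd1
      have e4 : HasDerivAt (fun y : ℝ => θ * y) θ (1 / θ) := by
        simpa using (hasDerivAt_id (1 / θ)).const_mul θ
      exact ((e3.comp _ e4).div_const (θ * d)).congr_deriv (by field_simp)
    rw [e1.deriv]
    exact e1.eq_of_eqOn_Icc e2 hQm hinv
  refine ⟨Q, K, hQ, hK, (isReducedPair_iff hQ hw).2 ⟨fun y hy => ?_, ?_⟩⟩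
  · have hy' : 1 / θ * y ∈ Set.Icc (0 : ℝ) 1 :=
      ⟨mul_nonneg hinv.1 hy.1, mul_le_one₀ hinv.2 hy.1 hy.2⟩
    rw [hwθ, hα, hQm _ hy', ← mul_assoc, mul_one_div_cancel hθ0.ne', one_mul, hgen y hy]
    field_simp
  · rw [hwθ, hα]
    exact hrel

end

/-! ### Consistent families from preimages -/

/-- Reductions compose and are unique while black roots have positive probability; so the reduction
of the intermediate pair must be the given one. -/
theorem IsReducedPair.cancel {q q₁ q₂ : PMF ℕ} {κ κ₁ κ₂ : ProbabilityMeasure ℝ}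
    (hq : IsOffspringLaw q) {s s' : unitInterval} (hs : 0 < (s : ℝ))
    (h₁ : IsReducedPair (unitInterval.symm s) q κ q₁ κ₁)
    (h₂ : IsReducedPair (unitInterval.symm (s * s')) q κ q₂ κ₂) :
    IsReducedPair (unitInterval.symm s') q₁ κ₁ q₂ κ₂ := by
  have hw := blackProb_ne_zero hq hs s.2.2
  have hq₁ := h₁.isOffspringLaw hq hs hw
  by_cases hw' : blackProb q₁ s' = 0
  · exact isReducedPair_of_blackProb_eq_zero hw' _ _
  · obtain ⟨q₃, κ₃, h3, -⟩ := isReducedPair_iff_exists (κ := κ₁) hq₁ hw'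
    have h4 := h₁.trans hq hq₁ hs ((h3 _ _).2 ⟨rfl, rfl⟩)
    have hww : blackProb q ((s * s' : unitInterval) : ℝ) ≠ 0 := by
      have := blackProb_mul hq hs h₁ s'
      change blackProb q (s * s') ≠ 0
      rw [this]
      exact mul_ne_zero hw hw'
    obtain ⟨q₄, κ₄, h5, -⟩ := isReducedPair_iff_exists (κ := κ) hq hww
    obtain ⟨rfl, rfl⟩ := (h5 _ _).1 h4
    exact (h3 _ _).2 ((h5 _ _).1 h₂)

theorem exists_reduced_pair {q : PMF ℕ} {κ : ProbabilityMeasure ℝ} (hq : IsOffspringLaw q)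
    (hκ : IsLifetimeLaw κ) (s : unitInterval) :
    ∃ (Q : PMF ℕ) (K : ProbabilityMeasure ℝ), (0 < (s : ℝ) → IsOffspringLaw Q) ∧ IsLifetimeLaw K ∧
      IsReducedPair (unitInterval.symm s) q κ Q K := by
  by_cases hw : blackProb q s = 0
  -- If the root is red almost surely, any pair will do.
  · exact ⟨q, κ, fun _ => hq, hκ, isReducedPair_of_blackProb_eq_zero hw _ _⟩
  · obtain ⟨q₁, κ₁, h1, -, -, -, h5⟩ := isReducedPair_iff_exists (κ := κ) hq hw
    have h2 := (h1 _ _).2 ⟨rfl, rfl⟩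
    exact ⟨q₁, κ₁, fun hs => h2.isOffspringLaw hq hs hw, h5 hκ, h2⟩

/-- Below level `1` the family consists of reductions of `(q, κ)`, above it of preimages.
Consistency is composition for levels on different sides of `1`, cancellation below `1`, and
uniqueness of preimages above `1`. -/
theorem exists_consistentPairs {q : PMF ℕ} {κ : ProbabilityMeasure ℝ} (hq : IsOffspringLaw q)
    (hκ : IsLifetimeLaw κ) (hpre : ∀ s : unitInterval, 0 < (s : ℝ) →
      ∃ (Q : PMF ℕ) (K : ProbabilityMeasure ℝ), IsOffspringLaw Q ∧ IsLifetimeLaw K ∧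
        IsReducedPair (unitInterval.symm s) Q K q κ) :
    ∃ (Q : ℝ≥0 → PMF ℕ) (K : ℝ≥0 → ProbabilityMeasure ℝ),
      Q 1 = q ∧ K 1 = κ ∧ ConsistentPairs Q K := by
  have key : ∀ l : ℝ≥0, ∃ x : PMF ℕ × ProbabilityMeasure ℝ, (0 < l → IsOffspringLaw x.1) ∧
      IsLifetimeLaw x.2 ∧ (l = 1 → x = (q, κ)) ∧
      (∀ h : 1 < l, IsReducedPair (unitInterval.symm (blackRatio 1 l h)) x.1 x.2 q κ) ∧
      ∀ h : l < 1, IsReducedPair (unitInterval.symm (blackRatio l 1 h)) q κ x.1 x.2 := by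
    intro l
    rcases lt_trichotomy l 1 with h | rfl | h
    · obtain ⟨Q, K, h1, h2, h3⟩ := exists_reduced_pair hq hκ (blackRatio l 1 h)
      exact ⟨(Q, K), fun hl => h1 (blackRatio_pos h hl), h2, fun h' => absurd h' h.ne,
        fun h' => absurd h' h.not_gt, fun _ => h3⟩
    · exact ⟨(q, κ), fun _ => hq, hκ, fun _ => rfl, fun h => absurd h (lt_irrefl 1),
        fun h => absurd h (lt_irrefl 1)⟩
    · obtain ⟨Q, K, h1, h2, h3⟩ := hpre (blackRatio 1 l h) (blackRatio_pos h one_pos)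
      exact ⟨(Q, K), fun _ => h1, h2, fun h' => absurd h' h.ne', fun _ => h3,
        fun h' => absurd h' h.not_gt⟩
  choose x h1 h2 h3 h4 h5 using key
  refine ⟨fun l => (x l).1, fun l => (x l).2, by simp [h3], by simp [h3], ⟨h1, h2⟩,
    fun μ l hlt => ?_⟩
  rw [← symm_blackRatio]
  dsimp only
  have hl0 : 0 < l := pos_of_gt hlt
  have hx1 : x 1 = (q, κ) := h3 1 rfl
  rcases lt_trichotomy l 1 with hl | rfl | hl
  · refine (h5 l hl).cancel hq (blackRatio_pos hl hl0) ?_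
    rw [blackRatio_mul' hlt hl]
    exact h5 μ _
  · rw [hx1]
    exact h5 μ hlt
  · rcases lt_trichotomy μ 1 with hμ | rfl | hμ
    · have := (h4 l hl).trans (h1 l hl0) hq (blackRatio_pos hl one_pos) (h5 μ hμ)
      rwa [blackRatio_mul' hμ hl] at this
    · rw [hx1]
      exact h4 l hlt
    · have hμ0 : 0 < μ := one_pos.trans hμ
      -- The reduction from `l` to `μ` is another preimage of `(q, κ)` for the levels `μ` and `1`,
      -- so it coincides with the chosen one.
      obtain ⟨q₁, κ₁, -, -, h6⟩ := exists_reduced_pair (h1 l hl0) (h2 l) (blackRatio μ l hlt)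
      have hpos := blackRatio_pos hlt hμ0
      have hq₁ := h6.isOffspringLaw (h1 l hl0) hpos
        (blackProb_ne_zero (h1 l hl0) hpos (blackRatio μ l hlt).2.2)
      have h7 : IsReducedPair (unitInterval.symm (blackRatio 1 μ hμ)) q₁ κ₁ q κ := by
        refine h6.cancel (h1 l hl0) hpos ?_
        rw [blackRatio_mul' hμ hlt]
        exact h4 l hl
      have hpos' := blackRatio_pos hμ one_pos
      have e1 := h7.offspring_unique hq₁ (h1 μ hμ0) hpos' (h4 μ hμ)
      subst e1
      have e2 := h7.lifetime_unique hq₁ hpos' (h4 μ hμ)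
      subst e2
      exact h6

/-! ### Uniqueness of the parameter families -/

section

variable {Q Q' : ℝ≥0 → PMF ℕ} {K K' : ℝ≥0 → ProbabilityMeasure ℝ} {b b' : ℝ≥0 → ℝ≥0}

theorem ConsistentTriplets.param_eq (h : ConsistentTriplets Q K b) {μ l : ℝ≥0} (hlt : μ < l) :
    b μ = b l * blackProb (Q l) (blackRatio μ l hlt) := by
  have := h.2 μ l hlt
  rw [← symm_blackRatio, isReducedTriplet_iff (h.1.1 l (pos_of_gt hlt))] at this
  exact this.1

theorem ConsistentTriplets.isReducedPair (h : ConsistentTriplets Q K b) {μ l : ℝ≥0} (hlt : μ < l)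
    (hb : b l ≠ 0) : IsReducedPair (unitInterval.symm (blackRatio μ l hlt)) (Q l) (K l) (Q μ) (K μ) := by
  have := h.2 μ l hlt
  rw [← symm_blackRatio, isReducedTriplet_iff (h.1.1 l (pos_of_gt hlt))] at this
  exact this.2 hb

theorem ConsistentTriplets.param_ne_zero (h : ConsistentTriplets Q K b) (hb : 0 < b 1) {l : ℝ≥0}
    (hl : 1 < l) : b l ≠ 0 := fun h0 => by
  have := h.param_eq hl
  rw [h0, zero_mul] at this
  exact hb.ne' this

/-- At `l = 0` the bush parameter is `b 1` times this probability; so `0 < b 0` is what makes the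
pair at `0` determined. -/
theorem ConsistentTriplets.blackProb_ne_zero (h : ConsistentTriplets Q K b)
    {l : ℝ≥0} (hl : l < 1) (h0 : 0 < l ∨ 0 < b 0) :
    blackProb (Q 1) (blackRatio l 1 hl) ≠ 0 := by
  rcases eq_zero_or_pos l with rfl | hpos
  · intro hw
    have := h.param_eq hl
    rw [hw, mul_zero] at this
    exact (h0.resolve_left (lt_irrefl 0)).ne' this
  · exact _root_.blackProb_ne_zero (h.1.1 1 one_pos) (blackRatio_pos hl hpos) (blackRatio l 1 hl).2.2

/-- Below `1` the explicit formula for the reduction decides, above `1` the uniqueness of preimages.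
Neither involves lifetimes or bush parameters. -/
theorem ConsistentTriplets.offspring_eq (h : ConsistentTriplets Q K b)
    (h' : ConsistentTriplets Q' K' b') (hb : 0 < b 1) (hb' : 0 < b' 1) (hq : Q 1 = Q' 1) {l : ℝ≥0}
    (h0 : 0 < l ∨ 0 < b 0) : Q l = Q' l := by
  rcases lt_trichotomy l 1 with hl | rfl | hl
  · have hw := h.blackProb_ne_zero hl h0
    have e1 := ((isReducedPair_iff (h.1.1 1 one_pos) hw).1 (h.isReducedPair hl hb.ne')).1
    have e2 := ((isReducedPair_iff (h'.1.1 1 one_pos) (hq ▸ hw)).1 (h'.isReducedPair hl hb'.ne')).1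
    rw [← hq] at e2
    exact mech_injective one_pos fun y hy =>
      (e1 y ⟨hy.1.le, hy.2.le⟩).trans (e2 y ⟨hy.1.le, hy.2.le⟩).symm
  · exact hq
  · have hl0 : 0 < l := one_pos.trans hl
    have e1 := h.isReducedPair hl (h.param_ne_zero hb hl)
    have e2 := h'.isReducedPair hl (h'.param_ne_zero hb' hl)
    rw [hq] at e1
    exact e1.offspring_unique (h.1.1 l hl0) (h'.1.1 l hl0) (blackRatio_pos hl one_pos) e2

theorem ConsistentTriplets.lifetime_eq (h : ConsistentTriplets Q K b)
    (h' : ConsistentTriplets Q' K' b') (hb : 0 < b 1) (hb' : 0 < b' 1) (hq : Q 1 = Q' 1)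
    (hκ : K 1 = K' 1) {l : ℝ≥0} (h0 : 0 < l ∨ 0 < b 0) : K l = K' l := by
  rcases lt_trichotomy l 1 with hl | rfl | hl
  · have hq1 := h.1.1 1 one_pos
    have hw := h.blackProb_ne_zero hl h0
    have e1 := ((isReducedPair_iff hq1 hw).1 (h.isReducedPair hl hb.ne')).2
    have e2 := ((isReducedPair_iff (h'.1.1 1 one_pos) (hq ▸ hw)).1 (h'.isReducedPair hl hb'.ne')).2
    rw [← hq, ← hκ] at e2
    exact e1.right_unique (deriv_mech_mem hq1 (blackRatio l 1 hl).2.1 (blackRatio l 1 hl).2.2 hw) e2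
  · exact hκ
  · have hl0 : 0 < l := one_pos.trans hl
    have e1 := h.isReducedPair hl (h.param_ne_zero hb hl)
    have e2 := h'.isReducedPair hl (h'.param_ne_zero hb' hl)
    rw [← hq, ← hκ, ← h.offspring_eq h' hb hb' hq (Or.inl hl0)] at e2
    exact e1.lifetime_unique (h.1.1 l hl0) (blackRatio_pos hl one_pos) e2

theorem ConsistentTriplets.param_unique (h : ConsistentTriplets Q K b)
    (h' : ConsistentTriplets Q' K' b') (hb : 0 < b 1) (hq : Q 1 = Q' 1) (hbb : b 1 = b' 1)
    (l : ℝ≥0) : b l = b' l := by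
  rcases lt_trichotomy l 1 with hl | rfl | hl
  · rw [h.param_eq hl, h'.param_eq hl, hbb, hq]
  · exact hbb
  · have hl0 : 0 < l := one_pos.trans hl
    have e1 := h.param_eq hl
    have e2 := h'.param_eq hl
    rw [← hbb, ← h.offspring_eq h' hb (hbb ▸ hb) hq (Or.inl hl0), e1] at e2
    exact mul_right_cancel₀ (_root_.blackProb_ne_zero (h.1.1 l hl0) (blackRatio_pos hl one_pos)
      (blackRatio 1 l hl).2.2) e2

end

/-! ### Laplace transforms as limits of power series -/

/-- From `θ log (1 - t / θ) → -t` for `t = x` and `t = 1`. The sequence is the exponent for which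
`exp (-m / θ)` to this power is the `m`-th power of the ratio of `1 - x / θ` to `1 - 1 / θ`. -/
theorem tendsto_rescaled_log {θ : ℕ → ℝ} (hθ1 : ∀ n, 1 < θ n) (hθ : Tendsto θ atTop atTop) (x : ℝ) :
    Tendsto (fun n => -(θ n * Real.log ((1 - x / θ n) / (1 - 1 / θ n)))) atTop (𝓝 (x - 1)) := by
  have h := fun t : ℝ => (Real.tendsto_mul_log_one_add_div_atTop t).comp hθ
  have h2 := (h (-1)).sub (h (-x))
  have e : (-1 - -x : ℝ) = x - 1 := by ring
  rw [e] at h2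
  refine h2.congr' ?_
  filter_upwards [hθ.eventually_gt_atTop x] with n hn
  have h0 : 0 < θ n := one_pos.trans (hθ1 n)
  have h3 : 0 < 1 - x / θ n := sub_pos.2 ((div_lt_one h0).2 hn)
  have h4 : 0 < 1 - 1 / θ n := sub_pos.2 ((div_lt_one h0).2 (hθ1 n))
  simp only [Function.comp]
  rw [Real.log_div h3.ne' h4.ne', neg_div, neg_div, ← sub_eq_add_neg, ← sub_eq_add_neg]
  ring

section

variable {f : ℝ → ℝ} {θ : ℕ → ℝ} {c : ℕ → ℕ → ℝ}

/-- The limit, as `θ → ∞`, of the laws that put on `exp (- m / θ)` mass proportional to the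
`m`-th term of the series at `1`. -/
theorem exists_weak_limit (hθ1 : ∀ n, 1 < θ n) (hθ : Tendsto θ atTop atTop)
    (hc : ∀ n m, 0 ≤ c n m)
    (hs : ∀ n x, 0 < x → x < θ n → HasSum (fun m => c n m * (1 - x / θ n) ^ m) (f x))
    (hf1 : 0 < f 1) :
    ∃ σ : ProbabilityMeasure unitInterval, ∀ x > 0, ∀ γ : ℝ, ∀ g : C(unitInterval, ℝ),
      (x - 1 < γ → (∀ v : unitInterval, 0 < (v : ℝ) → g v ≤ (v : ℝ) ^ γ) →
        ∫ v, g v ∂(σ : Measure unitInterval) ≤ f x / f 1) ∧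
      (γ < x - 1 → (∀ v : unitInterval, 0 < (v : ℝ) → (v : ℝ) ^ γ ≤ g v) →
        f x / f 1 ≤ ∫ v, g v ∂(σ : Measure unitInterval)) := by
  have hθ0 : ∀ n, 0 < θ n := fun n => one_pos.trans (hθ1 n)
  have hb : ∀ n, 0 < 1 - 1 / θ n := fun n => sub_pos.2 ((div_lt_one (hθ0 n)).2 (hθ1 n))
  set w : ℕ → ℕ → ℝ := fun n m => c n m * (1 - 1 / θ n) ^ m / f 1 with hw
  have hw0 : ∀ n m, 0 ≤ w n m := fun n m =>
    div_nonneg (mul_nonneg (hc n m) (pow_nonneg (hb n).le m)) hf1.le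
  have hw1 : ∀ n, HasSum (w n) 1 := fun n => by
    have := (hs n 1 one_pos (hθ1 n)).div_const (f 1)
    rwa [div_self hf1.ne'] at this
  have hpmf : ∀ n, ∃ p : PMF ℕ, ∀ m, (p m).toReal = w n m := fun n => by
    refine ⟨⟨fun m => ENNReal.ofReal (w n m), ?_⟩, fun m => ENNReal.toReal_ofReal (hw0 n m)⟩
    rw [ENNReal.summable.hasSum_iff, ← ENNReal.ofReal_tsum_of_nonneg (hw0 n) (hw1 n).summable,
      (hw1 n).tsum_eq, ENNReal.ofReal_one]
  choose p hp using hpmf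
  set v : ℕ → ℕ → unitInterval := fun n m => ⟨Real.exp (-(m / θ n)), (Real.exp_pos _).le,
    Real.exp_le_one_iff.2 (neg_nonpos.2 (div_nonneg m.cast_nonneg (hθ0 n).le))⟩ with hv
  have hv0 : ∀ n m, 0 < (v n m : ℝ) := fun n m => Real.exp_pos _
  have hvm : ∀ n, Measurable (v n) := fun n => measurable_of_countable _
  set μ : ℕ → ProbabilityMeasure unitInterval := fun n => ⟨(p n).toMeasure.map (v n),
    Measure.isProbabilityMeasure_map (hvm n).aemeasurable⟩ with hμ
  have hint : ∀ n (g : C(unitInterval, ℝ)),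
      HasSum (fun m => w n m * g (v n m)) (∫ u, g u ∂(μ n : Measure unitInterval)) := by
    intro n g
    have hbd : ∀ m, ‖g (v n m)‖ ≤ ‖g‖ := fun m => g.norm_coe_le_norm _
    have e : ∫ u, g u ∂(μ n : Measure unitInterval) = ∑' m, w n m * g (v n m) := by
      change ∫ u, g u ∂((p n).toMeasure.map (v n)) = _
      rw [integral_map (hvm n).aemeasurable g.continuous.aestronglyMeasurable,
        PMF.integral_eq_tsum _ _ (Integrable.of_bound
          (measurable_of_countable _).aestronglyMeasurable ‖g‖ (ae_of_all _ hbd))]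
      exact tsum_congr fun m => by rw [hp, smul_eq_mul]
    rw [e]
    refine (Summable.of_norm_bounded (g := fun m => w n m * ‖g‖) ((hw1 n).summable.mul_right _)
      fun m => ?_).hasSum
    rw [norm_mul, Real.norm_of_nonneg (hw0 n m)]
    exact mul_le_mul_of_nonneg_left (hbd m) (hw0 n m)
  -- Probability measures on the compact interval form a compact space; a limit along an ultrafilter
  -- replaces the choice of a subsequence.
  obtain ⟨σ, -, hσ⟩ := isCompact_univ.ultrafilter_le_nhds ((hyperfilter ℕ).map μ)
    (by rw [principal_univ]; exact le_top)
  have hlim : ∀ g : C(unitInterval, ℝ), Tendsto (fun n => ∫ u, g u ∂(μ n : Measure unitInterval))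
      (hyperfilter ℕ : Filter ℕ) (𝓝 (∫ u, g u ∂(σ : Measure unitInterval))) := fun g =>
    ProbabilityMeasure.tendsto_iff_forall_integral_tendsto.1 hσ
      (BoundedContinuousFunction.mkOfCompact g)
  -- `f x / f 1` is the integral of `v ^ B n x` for the `n`-th law, and `B n x → x - 1`. Powers of
  -- `v ≤ 1` decrease in the exponent, so a strict inequality between `γ` and `x - 1` makes the
  -- comparison with `v ^ γ` hold eventually.
  set B : ℕ → ℝ → ℝ := fun n x => -(θ n * Real.log ((1 - x / θ n) / (1 - 1 / θ n))) with hB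
  have hfx : ∀ n x, 0 < x → x < θ n → HasSum (fun m => w n m * (v n m : ℝ) ^ B n x) (f x / f 1) := by
    intro n x hx hxn
    refine ((hs n x hx hxn).div_const (f 1)).congr_fun fun m => ?_
    have h3 : 0 < 1 - x / θ n := sub_pos.2 ((div_lt_one (hθ0 n)).2 hxn)
    have h5 : (v n m : ℝ) ^ B n x = ((1 - x / θ n) / (1 - 1 / θ n)) ^ m := by
      rw [hB, hv]
      simp only
      rw [← Real.exp_mul, ← Real.rpow_natCast, Real.rpow_def_of_pos (div_pos h3 (hb n))]
      congr 1
      have := (hθ0 n).ne'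
      field_simp
    rw [h5, hw, div_pow]
    have := (pow_pos (hb n) m).ne'
    field_simp
  refine ⟨σ, fun x hx γ g => ⟨fun hγ hg => ?_, fun hγ hg => ?_⟩⟩
  · refine le_of_tendsto (hlim g) (Eventually.filter_mono Nat.hyperfilter_le_atTop ?_)
    filter_upwards [hθ.eventually_gt_atTop x,
      (tendsto_rescaled_log hθ1 hθ x).eventually_lt_const hγ] with n hn hBn
    refine hasSum_le (fun m => mul_le_mul_of_nonneg_left ?_ (hw0 n m)) (hint n g) (hfx n x hx hn)
    exact (hg _ (hv0 n m)).trans (Real.rpow_le_rpow_of_exponent_ge (hv0 n m) (v n m).2.2 hBn.le)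
  · refine ge_of_tendsto (hlim g) (Eventually.filter_mono Nat.hyperfilter_le_atTop ?_)
    filter_upwards [hθ.eventually_gt_atTop x,
      (tendsto_rescaled_log hθ1 hθ x).eventually_const_lt hγ] with n hn hBn
    refine hasSum_le (fun m => mul_le_mul_of_nonneg_left ?_ (hw0 n m)) (hfx n x hx hn) (hint n g)
    exact (Real.rpow_le_rpow_of_exponent_ge (hv0 n m) (v n m).2.2 hBn.le).trans (hg _ (hv0 n m))

/-- The limit law on `[0, 1]` is transported by `-log`. Negative powers of `v` are not continuous at
`0`; bounds on truncated powers show that there is no mass at `0` and that all exponents above `-1`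
are integrable. The formula holds for `x > 1` by squeezing, and for `x > 0` because both sides are
analytic. -/
theorem exists_laplace_of_pos (hf : AnalyticOnNhd ℝ f (Set.Ioi 0)) (hθ1 : ∀ n, 1 < θ n)
    (hθ : Tendsto θ atTop atTop) (hc : ∀ n m, 0 ≤ c n m)
    (hs : ∀ n x, 0 < x → x < θ n → HasSum (fun m => c n m * (1 - x / θ n) ^ m) (f x))
    (hf1 : 0 < f 1) :
    ∃ σ : Measure ℝ, IsProbabilityMeasure σ ∧ σ (Set.Iio 0) = 0 ∧ ∀ x, 0 < x →
      Integrable (fun y => Real.exp (-((x - 1) * y))) σ ∧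
      f x = f 1 * ∫ y, Real.exp (-((x - 1) * y)) ∂σ := by
  obtain ⟨σ, hσ⟩ := exists_weak_limit hθ1 hθ hc hs hf1
  set τ : Measure unitInterval := (σ : Measure unitInterval) with hτ
  -- truncated powers
  have hcont : ∀ (δ γ : ℝ), 0 < δ → Continuous fun v : unitInterval => (max (v : ℝ) δ) ^ γ :=
    fun δ γ hδ => by
      refine Continuous.rpow_const (by fun_prop) fun v => Or.inl ?_
      exact (hδ.trans_le (le_max_right _ _)).ne'
  have htrunc : ∀ x > 0, ∀ γ : ℝ, x - 1 < γ → γ ≤ 0 → ∀ δ > 0,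
      ∫ v : unitInterval, (max (v : ℝ) δ) ^ γ ∂τ ≤ f x / f 1 := fun x hx γ hγ hγ0 δ hδ =>
    (hσ x hx γ ⟨_, hcont δ γ hδ⟩).1 hγ fun v hv =>
      Real.rpow_le_rpow_of_nonpos hv (le_max_left _ _) hγ0
  have hlint : ∀ γ : ℝ, -1 < γ → γ ≤ 0 → ∃ C : ℝ≥0∞, C < ∞ ∧ ∀ δ > 0,
      ∫⁻ v : unitInterval, ENNReal.ofReal ((max (v : ℝ) δ) ^ γ) ∂τ ≤ C := by
    intro γ h1 h0
    refine ⟨ENNReal.ofReal (f ((γ + 1) / 2) / f 1), ENNReal.ofReal_lt_top, fun δ hδ => ?_⟩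
    rw [← ofReal_integral_eq_lintegral_ofReal]
    · exact ENNReal.ofReal_le_ofReal (htrunc _ (by linarith) γ (by linarith) h0 δ hδ)
    · exact (hcont δ γ hδ).integrable_of_hasCompactSupport (HasCompactSupport.of_compactSpace _)
    · exact ae_of_all _ fun v => Real.rpow_nonneg (hδ.le.trans (le_max_right _ _)) _
  -- no mass at zero
  have hzero : τ {0} = 0 := by
    obtain ⟨C, hC, h⟩ := hlint (-1 / 2) (by norm_num) (by norm_num)
    by_contra hne
    have h1 : ∀ k : ℕ, (k : ℝ≥0∞) * τ {0} ≤ C := fun k => by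
      have hδ : (0 : ℝ) < 1 / ((k : ℝ) + 1) ^ 2 := by positivity
      refine le_trans ?_ (h _ hδ)
      rw [← setLIntegral_const]
      refine (setLIntegral_mono' (measurableSet_singleton 0) fun v hv => ?_).trans
        (setLIntegral_le_lintegral _ _)
      rw [Set.mem_singleton_iff.1 hv]
      have e : (max (((0 : unitInterval) : ℝ)) (1 / ((k : ℝ) + 1) ^ 2)) ^ (-1 / 2 : ℝ) = k + 1 := by
        rw [Set.Icc.coe_zero, max_eq_right hδ.le, one_div, ← Real.rpow_natCast,
          ← Real.rpow_neg (by positivity), ← Real.rpow_mul (by positivity)]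
        norm_num
      rw [e, ← ENNReal.ofReal_natCast]
      exact ENNReal.ofReal_le_ofReal (by linarith)
    have h2 : (∞ : ℝ≥0∞) * τ {0} ≤ C := by
      rw [← ENNReal.iSup_natCast, ENNReal.iSup_mul]
      exact iSup_le h1
    rw [ENNReal.top_mul hne] at h2
    exact absurd hC (not_lt.2 h2)
  have hpos : ∀ᵐ v : unitInterval ∂τ, 0 < (v : ℝ) := by
    rw [ae_iff]
    refine measure_mono_null (fun v hv => ?_) hzero
    exact Set.mem_singleton_iff.2 (Subtype.ext (le_antisymm (not_lt.1 hv) v.2.1))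
  have hrpow : ∀ t : ℝ, (fun v : unitInterval => Real.exp (t * Real.log v)) =ᵐ[τ]
      fun v : unitInterval => (v : ℝ) ^ t := fun t => by
    filter_upwards [hpos] with v hv
    rw [Real.rpow_def_of_pos hv, mul_comm]
  have hmeas : ∀ t : ℝ, Measurable fun v : unitInterval => Real.exp (t * Real.log v) := fun t => by
    fun_prop
  have hset : Set.Ioi (-1 : ℝ) ⊆ integrableExpSet (fun v : unitInterval => Real.log v) τ := by
    intro t ht
    change Integrable _ τ
    rcases le_total 0 t with h0 | h0
    · refine Integrable.of_bound (hmeas t).aestronglyMeasurable 1 (ae_of_all _ fun v => ?_)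
      rw [Real.norm_of_nonneg (Real.exp_pos _).le]
      exact Real.exp_le_one_iff.2 (mul_nonpos_of_nonneg_of_nonpos h0 (Real.log_nonpos v.2.1 v.2.2))
    · obtain ⟨C, hC, h⟩ := hlint t ht h0
      refine ⟨(hmeas t).aestronglyMeasurable, ?_⟩
      rw [hasFiniteIntegral_iff_ofReal (ae_of_all _ fun v => (Real.exp_pos _).le)]
      refine lt_of_le_of_lt ?_ hC
      -- Fatou's lemma as the truncation `1 / (k + 1)` tends to `0`.
      have hl : ∀ᵐ v : unitInterval ∂τ, ENNReal.ofReal (Real.exp (t * Real.log v)) ≤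
          liminf (fun k : ℕ => ENNReal.ofReal ((max (v : ℝ) (1 / (k + 1 : ℝ))) ^ t)) atTop := by
        filter_upwards [hpos, hrpow t] with v hv hv2
        rw [hv2]
        refine le_liminf_of_le (by isBoundedDefault) ?_
        filter_upwards [tendsto_one_div_add_atTop_nhds_zero_nat.eventually_lt_const hv] with k hk
        rw [max_eq_left hk.le]
      refine (lintegral_mono_ae hl).trans ((lintegral_liminf_le fun k => ?_).trans ?_)
      · exact ((hcont _ t (by positivity)).measurable).ennreal_ofReal
      · refine liminf_le_of_le (by isBoundedDefault) fun b hb => ?_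
        obtain ⟨k, hk⟩ := hb.exists
        exact hk.trans (h _ (by positivity))
  have hmgf : ∀ t : ℝ, mgf (fun v : unitInterval => Real.log v) τ t =
      ∫ v : unitInterval, (v : ℝ) ^ t ∂τ := fun t => integral_congr_ae (hrpow t)
  have hint : Set.Ioi (-1 : ℝ) ⊆
      interior (integrableExpSet (fun v : unitInterval => Real.log v) τ) :=
    interior_maximal hset isOpen_Ioi
  have hcpow : ∀ γ : ℝ, 0 ≤ γ → Continuous fun v : unitInterval => (v : ℝ) ^ γ := fun γ hγ =>
    (Real.continuous_rpow_const hγ).comp continuous_subtype_val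
  -- Exponents `γ` slightly below and above `x - 1` are nonnegative powers, hence continuous test
  -- functions; continuity of the moment generating function closes the gap.
  have hgt : ∀ x, 1 < x → f x = f 1 * mgf (fun v : unitInterval => Real.log v) τ (x - 1) := by
    intro x hx
    have hc : ContinuousAt (mgf (fun v : unitInterval => Real.log v) τ) (x - 1) :=
      (analyticAt_mgf (hint (Set.mem_Ioi.2 (by linarith)))).continuousAt
    have h1 : f x / f 1 ≤ mgf (fun v : unitInterval => Real.log v) τ (x - 1) := by
      refine ge_of_tendsto (hc.tendsto.mono_left (nhdsWithin_le_nhds (s := Set.Iio (x - 1)))) ?_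
      filter_upwards [self_mem_nhdsWithin,
        nhdsWithin_le_nhds (Ioi_mem_nhds (show 0 < x - 1 by linarith))] with γ hγ hγ0
      rw [hmgf]
      exact (hσ x (by linarith) γ ⟨_, hcpow γ (le_of_lt hγ0)⟩).2 hγ fun v _ => le_rfl
    have h2 : mgf (fun v : unitInterval => Real.log v) τ (x - 1) ≤ f x / f 1 := by
      refine le_of_tendsto (hc.tendsto.mono_left (nhdsWithin_le_nhds (s := Set.Ioi (x - 1)))) ?_
      filter_upwards [self_mem_nhdsWithin] with γ hγ
      have hγ' : x - 1 < γ := hγ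
      rw [hmgf]
      exact (hσ x (by linarith) γ ⟨_, hcpow γ (by linarith)⟩).1 hγ fun v _ => le_rfl
    rw [← le_antisymm h1 h2, mul_div_cancel₀ _ hf1.ne']
  have hall : Set.EqOn f (fun x => f 1 * mgf (fun v : unitInterval => Real.log v) τ (x - 1))
      (Set.Ioi 0) := by
    refine hf.eqOn_of_preconnected_of_eventuallyEq (fun x hx => ?_) isPreconnected_Ioi
      (z₀ := 2) (Set.mem_Ioi.2 two_pos) ?_
    · have hx' : (0 : ℝ) < x := hx
      have e1 := analyticAt_mgf (hint (Set.mem_Ioi.2 (show -1 < x - 1 by linarith)))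
      have e2 : AnalyticAt ℝ (fun x : ℝ => x - 1) x := by fun_prop
      exact analyticAt_const.mul (AnalyticAt.comp (f := fun x : ℝ => x - 1) e1 e2)
    · filter_upwards [Ioi_mem_nhds one_lt_two] with x hx
      exact hgt x hx
  have hlm : Measurable fun v : unitInterval => -Real.log v := by fun_prop
  have hexp : ∀ x : ℝ, Measurable fun y : ℝ => Real.exp (-((x - 1) * y)) := fun x => by fun_prop
  refine ⟨τ.map fun v : unitInterval => -Real.log v, Measure.isProbabilityMeasure_map hlm.aemeasurable, ?_,
    fun x hx => ?_⟩
  · rw [Measure.map_apply hlm measurableSet_Iio]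
    convert measure_empty (μ := τ)
    ext v
    simpa using Real.log_nonpos v.2.1 v.2.2
  · have e : ((fun y : ℝ => Real.exp (-((x - 1) * y))) ∘ fun v : unitInterval => -Real.log v) =
        fun v : unitInterval => Real.exp ((x - 1) * Real.log v) := by
      funext v
      simp
    rw [integrable_map_measure (hexp x).aestronglyMeasurable hlm.aemeasurable, e,
      integral_map hlm.aemeasurable (hexp x).aestronglyMeasurable]
    refine ⟨hset (Set.mem_Ioi.2 (by linarith)), ?_⟩
    rw [hall (Set.mem_Ioi.2 hx)]
    have := congrArg (fun F : unitInterval → ℝ => ∫ v, F v ∂τ) e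
    simp only [Function.comp] at this
    rw [this]
    rfl

/-- A function which for arbitrarily large `θ` is a power series in `1 - x / θ` with nonnegative
coefficients is a Laplace transform. -/
theorem exists_laplace (hf : AnalyticOnNhd ℝ f (Set.Ioi 0)) (hθ1 : ∀ n, 1 < θ n)
    (hθ : Tendsto θ atTop atTop) (hc : ∀ n m, 0 ≤ c n m)
    (hs : ∀ n x, 0 < x → x < θ n → HasSum (fun m => c n m * (1 - x / θ n) ^ m) (f x)) :
    ∃ σ : Measure ℝ, IsFiniteMeasure σ ∧ σ (Set.Iio 0) = 0 ∧ ∀ x, 0 < x →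
      Integrable (fun y => Real.exp (-((x - 1) * y))) σ ∧
      f x = ∫ y, Real.exp (-((x - 1) * y)) ∂σ := by
  have hb : ∀ n, 0 < 1 - 1 / θ n := fun n =>
    sub_pos.2 ((div_lt_one (one_pos.trans (hθ1 n))).2 (hθ1 n))
  have hnn : ∀ n m, 0 ≤ c n m * (1 - 1 / θ n) ^ m := fun n m =>
    mul_nonneg (hc n m) (pow_nonneg (hb n).le m)
  have hf0 : 0 ≤ f 1 := (hs 0 1 one_pos (hθ1 0)).nonneg (hnn 0)
  rcases hf0.eq_or_lt with h0 | h0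
  · refine ⟨0, inferInstance, by simp, fun x hx => ⟨integrable_zero_measure, ?_⟩⟩
    obtain ⟨n, hn⟩ := (hθ.eventually_gt_atTop x).exists
    have h1 := hs n 1 one_pos (hθ1 n)
    rw [← h0, hasSum_zero_iff_of_nonneg (hnn n)] at h1
    have h2 : ∀ m, c n m = 0 := fun m =>
      (mul_eq_zero.1 (congrFun h1 m)).resolve_right (pow_pos (hb n) m).ne'
    have h3 := hs n x hx hn
    simp only [h2, zero_mul] at h3
    rw [integral_zero_measure]
    exact h3.unique hasSum_zero
  · obtain ⟨σ, hσ, h1, h2⟩ := exists_laplace_of_pos hf hθ1 hθ hc hs h0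
    refine ⟨ENNReal.ofReal (f 1) • σ, σ.smul_finite ENNReal.ofReal_ne_top, by simp [h1],
      fun x hx => ⟨(h2 x hx).1.smul_measure ENNReal.ofReal_ne_top, ?_⟩⟩
    rw [integral_smul_measure, ENNReal.toReal_ofReal hf0, smul_eq_mul]
    exact (h2 x hx).2

end

/-! ### The mechanism of a consistent family -/

theorem hasDerivAt_deriv_mech (q : PMF ℕ) {y : ℝ} (hy : y ∈ Set.Ioo (0 : ℝ) 2) :
    HasDerivAt (deriv (mech q))
      (∑' n, derivCoef (derivCoef fun n => (q n).toReal) n * (1 - y) ^ n) y := by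
  have h1 : |1 - y| < 1 := abs_lt.2 ⟨by linarith [hy.2], by linarith [hy.1]⟩
  have h2 := q.polyGrowth.derivCoef.hasDerivAt h1
  have h3 : HasDerivAt (fun y : ℝ => 1 - y) (-1) y := by
    simpa using (hasDerivAt_id y).const_sub 1
  have h4 := ((h2.comp y h3).const_sub 1).congr_deriv
    (show -((∑' n, derivCoef (derivCoef fun n => (q n).toReal) n * (1 - y) ^ n) * -1) =
      ∑' n, derivCoef (derivCoef fun n => (q n).toReal) n * (1 - y) ^ n by ring)
  refine h4.congr_of_eventuallyEq ?_
  filter_upwards [Ioo_mem_nhds hy.1 hy.2] with z hz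
  exact (hasDerivAt_mech q hz).deriv

/-- In terms of `φ` this is `φ'(z) ≤ φ''(z)` at `z = 1 - y`: since `q(1) = 0`, only terms with `n ≥
2` occur, and for them `n ≤ n (n - 1)`. -/
theorem one_le_deriv_mech_add {q : PMF ℕ} (hq : q 1 = 0) {y : ℝ} (hy : y ∈ Set.Ioc (0 : ℝ) 1) :
    1 ≤ deriv (mech q) y + deriv (deriv (mech q)) y := by
  have hy' : y ∈ Set.Ioo (0 : ℝ) 2 := ⟨hy.1, by linarith [hy.2]⟩
  have h1 : |1 - y| < 1 := abs_lt.2 ⟨by linarith [hy.2], by linarith [hy.1]⟩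
  have h0 : 0 ≤ 1 - y := by linarith [hy.2]
  rw [(hasDerivAt_mech q hy').deriv, (hasDerivAt_deriv_mech q hy').deriv]
  have s1 := q.polyGrowth.derivCoef.summable_mul_pow h1
  have s2 := q.polyGrowth.derivCoef.derivCoef.summable_mul_pow h1
  rw [s1.tsum_eq_zero_add]
  have e0 : derivCoef (fun n => (q n).toReal) 0 * (1 - y) ^ 0 = 0 := by simp [derivCoef, hq]
  rw [e0, zero_add]
  have hle : ∑' n : ℕ, derivCoef (fun n => (q n).toReal) (n + 1) * (1 - y) ^ (n + 1) ≤
      ∑' n, derivCoef (derivCoef fun n => (q n).toReal) n * (1 - y) ^ n := by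
    refine ((summable_nat_add_iff 1).2 s1).tsum_le_tsum (fun n => ?_) s2
    have hd : 0 ≤ derivCoef (fun n => (q n).toReal) (n + 1) :=
      mul_nonneg (by positivity) ENNReal.toReal_nonneg
    have e : derivCoef (derivCoef fun n => (q n).toReal) n =
        (n + 1) * derivCoef (fun n => (q n).toReal) (n + 1) := rfl
    rw [e, pow_succ]
    have hp : 0 ≤ (1 - y) ^ n := pow_nonneg h0 n
    have h3 : (1 - y) ≤ (n + 1 : ℝ) := by linarith [hy.1, n.cast_nonneg (α := ℝ)]
    calc derivCoef (fun n => (q n).toReal) (n + 1) * ((1 - y) ^ n * (1 - y))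
        = derivCoef (fun n => (q n).toReal) (n + 1) * (1 - y) ^ n * (1 - y) := by ring
      _ ≤ derivCoef (fun n => (q n).toReal) (n + 1) * (1 - y) ^ n * (n + 1) := by gcongr
      _ = _ := by ring
  linarith

/-- The probability that the root is black when the law at `l` is reduced to the law at `1`. -/
noncomputable def rootProb (Q : ℝ≥0 → PMF ℕ) (l : ℝ≥0) : ℝ := blackProb (Q l) (1 / l : ℝ)

noncomputable def rootDeriv (Q : ℝ≥0 → PMF ℕ) (l : ℝ≥0) : ℝ := deriv (mech (Q l)) (rootProb Q l)

/-- For a consistent family this is `mech (Q 1)` on `[0, 1]` (`reduction`), but it is analytic up to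
`2 / rootProb Q l`. -/
noncomputable def rescaledMech (Q : ℝ≥0 → PMF ℕ) (l : ℝ≥0) (x : ℝ) : ℝ :=
  mech (Q l) (rootProb Q l * x) / (rootProb Q l * rootDeriv Q l)

namespace ConsistentPairs

variable {Q : ℝ≥0 → PMF ℕ} {K : ℝ≥0 → ProbabilityMeasure ℝ} {l : ℝ≥0}

theorem coe_blackRatio_one (hl : 1 < l) : (blackRatio 1 l hl : ℝ) = 1 / l := by
  rw [coe_blackRatio, NNReal.coe_one]

theorem rootProb_ne_zero (h : ConsistentPairs Q K) (hl : 1 < l) :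
    blackProb (Q l) (1 / l : ℝ) ≠ 0 := by
  have := blackProb_ne_zero (h.1.1 l (one_pos.trans hl)) (blackRatio_pos hl one_pos)
    (blackRatio 1 l hl).2.2
  rwa [coe_blackRatio_one] at this

theorem one_div_mem (hl : 1 < l) : (0 : ℝ) ≤ 1 / l ∧ (1 / l : ℝ) ≤ 1 := by
  rw [← coe_blackRatio_one hl]
  exact (blackRatio 1 l hl).2

theorem rootProb_pos (h : ConsistentPairs Q K) (hl : 1 < l) : 0 < rootProb Q l :=
  blackProb_pos (h.rootProb_ne_zero hl)

theorem rootDeriv_mem (h : ConsistentPairs Q K) (hl : 1 < l) : rootDeriv Q l ∈ Set.Ioc (0 : ℝ) 1 :=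
  deriv_mech_mem (h.1.1 l (one_pos.trans hl)) (one_div_mem hl).1 (one_div_mem hl).2
    (h.rootProb_ne_zero hl)

theorem toReal_zero_pos (h : ConsistentPairs Q K) (hl : 0 < l) : 0 < (Q l 0).toReal :=
  ENNReal.toReal_pos (h.1.1 l hl).1.ne' ((Q l).apply_ne_top 0)

theorem mech_rootProb (hl : 1 < l) :
    mech (Q l) (rootProb Q l) = 1 / l * (Q l 0).toReal :=
  mech_blackProb (Q l) (one_div_mem hl).1 (one_div_mem hl).2

theorem rootProb_lt_one (h : ConsistentPairs Q K) (hl : 1 < l) : rootProb Q l < 1 := by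
  refine lt_of_le_of_ne (coe_blackProb_le_one _ _) fun h1 => ?_
  have h2 := mech_rootProb (Q := Q) hl
  rw [h1, mech_one] at h2
  have h3 := h.toReal_zero_pos (one_pos.trans hl)
  have h4 : (1 : ℝ) / l < 1 := (div_lt_one (by exact_mod_cast one_pos.trans hl)).2 (by exact_mod_cast hl)
  nlinarith

theorem reduction (h : ConsistentPairs Q K) (hl : 1 < l) :
    (∀ y ∈ Set.Icc (0 : ℝ) 1, mech (Q 1) y = rescaledMech Q l y) ∧
      GeomRel (rootDeriv Q l) (K l) (K 1) := by
  have h1 := h.isReducedPair hl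
  have hw := h.rootProb_ne_zero hl
  rw [← coe_blackRatio_one hl] at hw
  have h2 := (isReducedPair_iff (h.1.1 l (one_pos.trans hl)) hw).1 h1
  rw [coe_blackRatio_one] at h2
  exact h2

theorem mul_mem_Ioo (h : ConsistentPairs Q K) (hl : 1 < l) {x : ℝ}
    (hx : x ∈ Set.Ioo 0 (2 / rootProb Q l)) : rootProb Q l * x ∈ Set.Ioo (0 : ℝ) 2 := by
  have hp := h.rootProb_pos hl
  refine ⟨mul_pos hp hx.1, ?_⟩
  rw [mul_comm]
  exact (lt_div_iff₀ hp).1 hx.2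

theorem hasDerivAt_rescaledMech (h : ConsistentPairs Q K) (hl : 1 < l) {x : ℝ}
    (hx : x ∈ Set.Ioo 0 (2 / rootProb Q l)) :
    HasDerivAt (rescaledMech Q l) (deriv (mech (Q l)) (rootProb Q l * x) / rootDeriv Q l) x := by
  have hp := h.rootProb_pos hl
  have hd := (h.rootDeriv_mem hl).1
  have d1 := hasDerivAt_mech (Q l) (h.mul_mem_Ioo hl hx)
  rw [← d1.deriv] at d1
  have d2 : HasDerivAt (fun x : ℝ => rootProb Q l * x) (rootProb Q l) x := by
    simpa using (hasDerivAt_id x).const_mul (rootProb Q l)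
  exact ((d1.comp x d2).div_const (rootProb Q l * rootDeriv Q l)).congr_deriv (by field_simp)

theorem hasDerivAt_deriv_rescaledMech (h : ConsistentPairs Q K) (hl : 1 < l) {x : ℝ}
    (hx : x ∈ Set.Ioo 0 (2 / rootProb Q l)) :
    HasDerivAt (deriv (rescaledMech Q l))
      (rootProb Q l / rootDeriv Q l * deriv (deriv (mech (Q l))) (rootProb Q l * x)) x := by
  have d1 := hasDerivAt_deriv_mech (Q l) (h.mul_mem_Ioo hl hx)
  rw [← d1.deriv] at d1
  have d2 : HasDerivAt (fun x : ℝ => rootProb Q l * x) (rootProb Q l) x := by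
    simpa using (hasDerivAt_id x).const_mul (rootProb Q l)
  refine (((d1.comp x d2).div_const (rootDeriv Q l)).congr_deriv (by ring)).congr_of_eventuallyEq ?_
  filter_upwards [Ioo_mem_nhds hx.1 hx.2] with z hz
  exact (h.hasDerivAt_rescaledMech hl hz).deriv

theorem analyticOnNhd_rescaledMech (h : ConsistentPairs Q K) (hl : 1 < l) :
    AnalyticOnNhd ℝ (rescaledMech Q l) (Set.Ioo 0 (2 / rootProb Q l)) := by
  intro x hx
  have e := analyticOnNhd_mech (Q l) _ (h.mul_mem_Ioo hl hx)
  have e' : AnalyticAt ℝ (fun x : ℝ => rootProb Q l * x) x := by fun_prop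
  exact (AnalyticAt.comp (g := mech (Q l)) (f := fun x : ℝ => rootProb Q l * x) e e').div_const

theorem one_lt_inv (h : ConsistentPairs Q K) (hl : 1 < l) : 1 < 1 / rootProb Q l :=
  (one_lt_div (h.rootProb_pos hl)).2 (h.rootProb_lt_one hl)

theorem inv_mem (h : ConsistentPairs Q K) (hl : 1 < l) :
    1 / rootProb Q l ∈ Set.Ioo 0 (2 / rootProb Q l) :=
  ⟨by linarith [h.one_lt_inv hl], div_lt_div_of_pos_right one_lt_two (h.rootProb_pos hl)⟩

theorem rescaledMech_zero : rescaledMech Q l 0 = 0 := by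
  simp [rescaledMech, mech_zero]

theorem rescaledMech_inv (h : ConsistentPairs Q K) (hl : 1 < l) :
    rescaledMech Q l (1 / rootProb Q l) = l * (Q 1 0).toReal := by
  have hp := (h.rootProb_pos hl).ne'
  have h1 := (h.reduction hl).1 1 ⟨zero_le_one, le_rfl⟩
  have hl0 : (l : ℝ) ≠ 0 := by exact_mod_cast (one_pos.trans hl).ne'
  rw [mech_one, rescaledMech, mul_one, mech_rootProb hl] at h1
  rw [h1, rescaledMech, mul_one_div_cancel hp, mech_one]
  field_simp

theorem deriv_rescaledMech_inv (h : ConsistentPairs Q K) (hl : 1 < l) :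
    deriv (rescaledMech Q l) (1 / rootProb Q l) = 1 / rootDeriv Q l := by
  rw [(h.hasDerivAt_rescaledMech hl (h.inv_mem hl)).deriv,
    mul_one_div_cancel (h.rootProb_pos hl).ne', deriv_mech_one (h.1.1 l (one_pos.trans hl)).2]

theorem rescaledMech_eqOn (h : ConsistentPairs Q K) (hl : 1 < l) :
    Set.EqOn (rescaledMech Q l) (mech (Q 1)) (Set.Ioo 0 2) := by
  have h2 : 2 ≤ 2 / rootProb Q l := by
    rw [le_div_iff₀ (h.rootProb_pos hl)]; linarith [h.rootProb_lt_one hl]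
  refine ((h.analyticOnNhd_rescaledMech hl).mono
    (Set.Ioo_subset_Ioo_right h2)).eqOn_of_preconnected_of_eventuallyEq
    (analyticOnNhd_mech (Q 1)) isPreconnected_Ioo (z₀ := 1 / 2) ⟨by norm_num, by norm_num⟩ ?_
  filter_upwards [Ioo_mem_nhds (show (0 : ℝ) < 1 / 2 by norm_num) (show (1 / 2 : ℝ) < 1 by norm_num)]
    with x hx
  exact ((h.reduction hl).1 x ⟨hx.1.le, hx.2.le⟩).symm

/-- Forces `1 / w → ∞` as `l → ∞`, where `w = rootProb Q l`. With slope `d` at `w`, the value of the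
rescaled mechanism at `1 / w` is `l q(0) = Q l 0 / (w d) ≤ 1 / (w d)`. The second derivative at `1`
is the same for all `l`, so `one_le_deriv_mech_add` at `w` bounds `1 / d` by `1 + F / w`. -/
theorem le_inv_rootProb (h : ConsistentPairs Q K) (hl : 1 < l) :
    (l : ℝ) * (Q 1 0).toReal ≤ 1 / rootProb Q l *
      (1 + |deriv (deriv (mech (Q 1))) 1| * (1 / rootProb Q l)) := by
  have hp := h.rootProb_pos hl
  have hα := (h.rootDeriv_mem hl).1
  have h1 := one_le_deriv_mech_add (h.1.1 l (one_pos.trans hl)).2 ⟨hp, (h.rootProb_lt_one hl).le⟩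
  have hev : rescaledMech Q l =ᶠ[𝓝 1] mech (Q 1) :=
    (h.rescaledMech_eqOn hl).eventuallyEq_of_mem (Ioo_mem_nhds one_pos one_lt_two)
  have hone : (1 : ℝ) ∈ Set.Ioo 0 (2 / rootProb Q l) :=
    ⟨one_pos, by linarith [h.one_lt_inv hl, (h.inv_mem hl).2]⟩
  have h2 := hev.deriv.deriv_eq
  rw [(h.hasDerivAt_deriv_rescaledMech hl hone).deriv, mul_one] at h2
  have h3 := h.rescaledMech_inv hl
  rw [rescaledMech, mul_one_div_cancel hp.ne', mech_one] at h3
  have h4 := (Q l).toReal_le_one 0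
  change 1 ≤ rootDeriv Q l + _ at h1
  have h5 : deriv (deriv (mech (Q l))) (rootProb Q l) =
      deriv (deriv (mech (Q 1))) 1 * rootDeriv Q l / rootProb Q l := by
    rw [← h2]; field_simp
  rw [h5] at h1
  have h6 := le_abs_self (deriv (deriv (mech (Q 1))) 1)
  set F := |deriv (deriv (mech (Q 1))) 1|
  have h7 : 1 ≤ rootDeriv Q l * (1 + F * (1 / rootProb Q l)) := by
    refine h1.trans ?_
    have : deriv (deriv (mech (Q 1))) 1 * rootDeriv Q l / rootProb Q l ≤
        F * rootDeriv Q l / rootProb Q l := by gcongr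
    calc rootDeriv Q l + _ ≤ rootDeriv Q l + F * rootDeriv Q l / rootProb Q l := by gcongr
      _ = _ := by ring
  rw [← h3, div_le_iff₀ (mul_pos hp hα)]
  calc (Q l 0).toReal ≤ 1 := h4
    _ ≤ rootDeriv Q l * (1 + F * (1 / rootProb Q l)) := h7
    _ = _ := by field_simp

theorem exists_inv_rootProb_gt (h : ConsistentPairs Q K) (R : ℝ) :
    ∃ N : ℝ≥0, 1 < N ∧ ∀ l, N ≤ l → R < 1 / rootProb Q l := by
  have hq := h.toReal_zero_pos one_pos
  set F := |deriv (deriv (mech (Q 1))) 1| with hF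
  set T : ℝ := max 0 R * (1 + F * max 0 R) / (Q 1 0).toReal with hT
  have hT0 : 0 ≤ T := by positivity
  refine ⟨⟨T, hT0⟩ + 2, ?_, fun l hl => ?_⟩
  · exact lt_of_lt_of_le one_lt_two le_add_self
  · have hl1 : 1 < l := lt_of_lt_of_le (lt_of_lt_of_le one_lt_two le_add_self) hl
    have hl2 : T + 2 ≤ l := by exact_mod_cast hl
    by_contra! hR
    have h1 := h.le_inv_rootProb hl1
    have h2 : 1 / rootProb Q l ≤ max 0 R := hR.trans (le_max_right _ _)
    have h3 : 0 ≤ 1 / rootProb Q l := by linarith [h.one_lt_inv hl1]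
    have h4 : (l : ℝ) * (Q 1 0).toReal ≤ max 0 R * (1 + F * max 0 R) := by
      refine h1.trans ?_
      gcongr
    have h5 : (l : ℝ) ≤ T := by
      rw [hT, le_div_iff₀ hq]
      exact h4
    linarith

/-- The mechanisms of all laws of the family are rescaled restrictions of one function. -/
theorem exists_mechanism (h : ConsistentPairs Q K) : ∃ Ψ : ℝ → ℝ,
    (∀ l, 1 < l → Set.EqOn Ψ (rescaledMech Q l) (Set.Ico 0 (2 / rootProb Q l))) ∧
    Set.EqOn Ψ (mech (Q 1)) (Set.Icc 0 1) ∧ AnalyticOnNhd ℝ Ψ (Set.Ioi 0) := by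
  have hex : ∀ x : ℝ, ∃ l : ℝ≥0, 1 < l ∧ x < 1 / rootProb Q l := fun x => by
    obtain ⟨N, hN, h1⟩ := h.exists_inv_rootProb_gt x
    exact ⟨N, hN, h1 N le_rfl⟩
  choose L hL1 hL2 using hex
  -- Both sides continue `mech (Q 1)` analytically from `(0, 2)`.
  have hagree : ∀ {l l' : ℝ≥0}, 1 < l → 1 < l' → ∀ {x : ℝ}, 0 < x → x < 2 / rootProb Q l →
      x < 2 / rootProb Q l' → rescaledMech Q l x = rescaledMech Q l' x := by
    intro l l' hl hl' x hx h1 h2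
    have h2l : ∀ {l : ℝ≥0}, 1 < l → 2 ≤ 2 / rootProb Q l := fun {l} hl => by
      rw [le_div_iff₀ (h.rootProb_pos hl)]; linarith [h.rootProb_lt_one hl]
    refine ((h.analyticOnNhd_rescaledMech hl).mono (Set.Ioo_subset_Ioo_right
      (min_le_left _ (2 / rootProb Q l')))).eqOn_of_preconnected_of_eventuallyEq
      ((h.analyticOnNhd_rescaledMech hl').mono (Set.Ioo_subset_Ioo_right (min_le_right _ _)))
      isPreconnected_Ioo (z₀ := 1) ⟨one_pos, ?_⟩ ?_ ⟨hx, lt_min h1 h2⟩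
    · exact lt_min (by linarith [h2l hl]) (by linarith [h2l hl'])
    · filter_upwards [Ioo_mem_nhds one_pos one_lt_two] with z hz
      rw [h.rescaledMech_eqOn hl hz, h.rescaledMech_eqOn hl' hz]
  have hEq : ∀ l, 1 < l → Set.EqOn (fun x => rescaledMech Q (L x) x) (rescaledMech Q l)
      (Set.Ico 0 (2 / rootProb Q l)) := by
    intro l hl x hx
    rcases hx.1.eq_or_lt with rfl | hx0
    · simp only [rescaledMech_zero]
    · exact hagree (hL1 x) hl hx0 ((hL2 x).trans (h.inv_mem (hL1 x)).2) hx.2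
  refine ⟨fun x => rescaledMech Q (L x) x, hEq,
    fun x hx => ((h.reduction (hL1 x)).1 x hx).symm, fun x hx => ?_⟩
  have hx0 : 0 < x := hx
  have hx2 : x < 2 / rootProb Q (L x) := (hL2 x).trans (h.inv_mem (hL1 x)).2
  refine (h.analyticOnNhd_rescaledMech (hL1 x) x ⟨hx0, hx2⟩).congr ?_
  filter_upwards [Ioo_mem_nhds hx0 hx2] with z hz
  exact (hEq _ (hL1 x) ⟨hz.1.le, hz.2⟩).symm

/-- Up to a positive factor `Ψ''(x)` is the second derivative of a generating function at `1 - w x`,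
a power series with nonnegative coefficients in `1 - x / θ` for `θ = 1 / w`. -/
theorem exists_laplace_deriv2 (h : ConsistentPairs Q K) {Ψ : ℝ → ℝ}
    (hΨ : ∀ l, 1 < l → Set.EqOn Ψ (rescaledMech Q l) (Set.Ico 0 (2 / rootProb Q l)))
    (han : AnalyticOnNhd ℝ Ψ (Set.Ioi 0)) :
    ∃ σ : Measure ℝ, IsFiniteMeasure σ ∧ σ (Set.Iio 0) = 0 ∧ ∀ x, 0 < x →
      Integrable (fun y => Real.exp (-((x - 1) * y))) σ ∧
      deriv (deriv Ψ) x = ∫ y, Real.exp (-((x - 1) * y)) ∂σ := by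
  have hl : ∀ n : ℕ, (1 : ℝ≥0) < n + 2 := fun n => lt_of_lt_of_le one_lt_two le_add_self
  refine exists_laplace (θ := fun n => 1 / rootProb Q (n + 2))
    (c := fun n m => rootProb Q (n + 2) / rootDeriv Q (n + 2) *
      derivCoef (derivCoef fun k => (Q (n + 2) k).toReal) m) han.deriv.deriv
    (fun n => h.one_lt_inv (hl n)) ?_ (fun n m => ?_) fun n x hx hxn => ?_
  · refine tendsto_atTop.2 fun R => ?_
    obtain ⟨N, -, hN⟩ := h.exists_inv_rootProb_gt R
    obtain ⟨k, hk⟩ := exists_nat_ge N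
    filter_upwards [eventually_ge_atTop k] with n hn
    refine (hN _ (hk.trans ?_)).le
    have : (k : ℝ≥0) ≤ n := by exact_mod_cast hn
    exact this.trans le_self_add
  · refine mul_nonneg (div_nonneg (h.rootProb_pos (hl n)).le (h.rootDeriv_mem (hl n)).1.le) ?_
    exact mul_nonneg (by positivity) (mul_nonneg (by positivity) ENNReal.toReal_nonneg)
  · have hp := h.rootProb_pos (hl n)
    have hx' : x ∈ Set.Ioo 0 (2 / rootProb Q (n + 2)) := ⟨hx, hxn.trans (h.inv_mem (hl n)).2⟩
    have hev : Ψ =ᶠ[𝓝 x] rescaledMech Q (n + 2) := by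
      filter_upwards [Ioo_mem_nhds hx'.1 hx'.2] with z hz
      exact hΨ _ (hl n) ⟨hz.1.le, hz.2⟩
    have hm := h.mul_mem_Ioo (hl n) hx'
    rw [hev.deriv.deriv_eq, (h.hasDerivAt_deriv_rescaledMech (hl n) hx').deriv,
      (hasDerivAt_deriv_mech _ hm).deriv]
    have h1 : |1 - rootProb Q (n + 2) * x| < 1 := abs_lt.2 ⟨by linarith [hm.2], by linarith [hm.1]⟩
    have hs := ((Q (n + 2)).polyGrowth.derivCoef.derivCoef.summable_mul_pow h1).hasSum.mul_left
      (rootProb Q (n + 2) / rootDeriv Q (n + 2))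
    refine hs.congr_fun fun m => ?_
    rw [div_div_eq_mul_div, div_one, mul_comm x, mul_assoc]

end ConsistentPairs

/-! ### Mechanisms whose second derivative is a Laplace transform -/

/-- The measure `e^y y⁻² σ(dy)` on `S`. -/
noncomputable def levyOf (σ : Measure ℝ) (S : Set ℝ) : Measure ℝ :=
  (σ.restrict S).withDensity fun y => ENNReal.ofReal (Real.exp y / y ^ 2)

theorem measurable_levyDensity : Measurable fun y : ℝ => ENNReal.ofReal (Real.exp y / y ^ 2) := by
  fun_prop

theorem levyOf_Iic (σ : Measure ℝ) {S : Set ℝ} (hS : S ⊆ Set.Ioi 0) :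
    levyOf σ S (Set.Iic 0) = 0 := by
  refine withDensity_absolutelyContinuous _ _ ?_
  rw [Measure.restrict_apply measurableSet_Iic]
  convert measure_empty (μ := σ)
  ext y
  simp only [Set.mem_inter_iff, Set.mem_Iic, Set.mem_empty_iff_false, iff_false, not_and]
  exact fun h1 h2 => absurd (hS h2) (not_lt.2 h1)

theorem lintegral_min_levyOf (σ : Measure ℝ) (S : Set ℝ) :
    ∫⁻ y, ENNReal.ofReal (min 1 (y ^ 2)) ∂(levyOf σ S) =
      ∫⁻ y in S, ENNReal.ofReal (Real.exp y / y ^ 2 * min 1 (y ^ 2)) ∂σ := by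
  rw [levyOf, lintegral_withDensity_eq_lintegral_mul _ measurable_levyDensity (by fun_prop)]
  refine lintegral_congr fun y => ?_
  rw [Pi.mul_apply, ← ENNReal.ofReal_mul (by positivity)]

/-- Explains the density of `levyOf`: `y⁻²` compensates the two derivatives, and `e^y` the shift
from `x - 1` to `x`. -/
theorem integral_sq_levyOf (σ : Measure ℝ) {S : Set ℝ} (hSm : MeasurableSet S)
    (hS : S ⊆ Set.Ioi 0) (x : ℝ) :
    ∫ y, y ^ 2 * Real.exp (-(x * y)) ∂(levyOf σ S) = ∫ y in S, Real.exp (-((x - 1) * y)) ∂σ := by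
  rw [levyOf, integral_withDensity_eq_integral_toReal_smul measurable_levyDensity
    (ae_of_all _ fun y => ENNReal.ofReal_lt_top)]
  refine setIntegral_congr_fun hSm fun y hy => ?_
  have hy0 : (0 : ℝ) < y := hS hy
  change (ENNReal.ofReal (Real.exp y / y ^ 2)).toReal • (y ^ 2 * Real.exp (-(x * y))) = _
  rw [ENNReal.toReal_ofReal (by positivity), smul_eq_mul, ← mul_assoc,
    div_mul_cancel₀ _ (pow_pos hy0 2).ne', ← Real.exp_add]
  congr 1
  ring

/-- Since `exp x ≥ 1 + x + x² / 2`, the right side is at least `(5/2) x² / (1 + x + x² / 2)`. The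
denominator is at most `5/2` for `x ≤ 1` and at most `(5/2) x²` for `x ≥ 1`, whence the constant. -/
theorem min_le_expTail {x : ℝ} (hx : 0 < x) :
    min 1 (x ^ 2) ≤ 5 * (Real.exp (-x) * (Real.exp x - 1 - x)) := by
  have h1 := Real.quadratic_le_exp_of_nonneg hx.le
  have h2 : Real.exp (-x) * (Real.exp x - 1 - x) = 1 - (1 + x) / Real.exp x := by
    rw [Real.exp_neg]
    field_simp
    ring
  have h3 : (1 + x) / Real.exp x ≤ (1 + x) / (1 + x + x ^ 2 / 2) := by gcongr
  rw [h2]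
  have h4 : min 1 (x ^ 2) ≤ 5 * (1 - (1 + x) / (1 + x + x ^ 2 / 2)) := by
    have hp : 0 < 1 + x + x ^ 2 / 2 := by positivity
    have e : 5 * (1 - (1 + x) / (1 + x + x ^ 2 / 2)) = (5 / 2 * x ^ 2) / (1 + x + x ^ 2 / 2) := by
      field_simp
      ring
    rw [e, le_div_iff₀ hp]
    rcases le_total x 1 with h | h
    · have : min 1 (x ^ 2) ≤ x ^ 2 := min_le_right _ _
      have h5 : 1 + x + x ^ 2 / 2 ≤ 5 / 2 := by nlinarith
      calc min 1 (x ^ 2) * (1 + x + x ^ 2 / 2) ≤ x ^ 2 * (5 / 2) := by gcongr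
        _ = 5 / 2 * x ^ 2 := by ring
    · have : min 1 (x ^ 2) ≤ 1 := min_le_left _ _
      nlinarith
  linarith

theorem exists_mvt_zero {g g' : ℝ → ℝ} (hc : ContinuousOn g (Set.Ici 0))
    (hd : ∀ x, 0 < x → HasDerivAt g (g' x) x) {x : ℝ} (hx : 0 < x) :
    ∃ ξ ∈ Set.Ioo 0 x, g x - g 0 = g' ξ * x := by
  obtain ⟨ξ, hξ, h⟩ := exists_hasDerivAt_eq_slope g g' hx (hc.mono Set.Icc_subset_Ici_self)
    fun y hy => hd y hy.1
  refine ⟨ξ, hξ, ?_⟩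
  rw [h, sub_zero, div_mul_cancel₀ _ hx.ne']

section

variable {Ψ : ℝ → ℝ} {σ : Measure ℝ}

/-- Cut off at `M`, the measure is a Lévy measure, with a mechanism `B` such that `B'' ≤ Ψ''`. Then
`Ψ' - B'` is nondecreasing and the mean value theorem on `[0, 1]` gives `B'(1) - B(1) ≤ Ψ'(1) -
Ψ(1)`. The left side is the integral of the exponential tail, which dominates `min 1 (y²)`; the
bound does not depend on `M`. -/
theorem lintegral_min_levyOf_le [IsFiniteMeasure σ] (hc : ContinuousOn Ψ (Set.Ici 0)) (h0 : Ψ 0 = 0)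
    (han : AnalyticOnNhd ℝ Ψ (Set.Ioi 0))
    (hL : ∀ x, 0 < x → Integrable (fun y => Real.exp (-((x - 1) * y))) σ ∧
      deriv (deriv Ψ) x = ∫ y, Real.exp (-((x - 1) * y)) ∂σ) (M : ℝ) :
    ∫⁻ y, ENNReal.ofReal (min 1 (y ^ 2)) ∂(levyOf σ (Set.Ioc 0 M)) ≤
      ENNReal.ofReal (5 * (deriv Ψ 1 - Ψ 1)) := by
  set Pi := levyOf σ (Set.Ioc 0 M) with hPi
  have hS : Set.Ioc 0 M ⊆ Set.Ioi 0 := Set.Ioc_subset_Ioi_self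
  have hlevy : IsLevyMeasure Pi := by
    refine ⟨levyOf_Iic σ hS, ?_⟩
    rw [lintegral_min_levyOf]
    calc ∫⁻ y in Set.Ioc 0 M, ENNReal.ofReal (Real.exp y / y ^ 2 * min 1 (y ^ 2)) ∂σ
        ≤ ∫⁻ _ in Set.Ioc 0 M, ENNReal.ofReal (Real.exp M) ∂σ := by
          refine setLIntegral_mono' measurableSet_Ioc fun y hy => ENNReal.ofReal_le_ofReal ?_
          have hy2 : 0 < y ^ 2 := pow_pos hy.1 2
          calc Real.exp y / y ^ 2 * min 1 (y ^ 2) ≤ Real.exp y / y ^ 2 * y ^ 2 := by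
                gcongr; exact min_le_right _ _
            _ = Real.exp y := div_mul_cancel₀ _ hy2.ne'
            _ ≤ Real.exp M := Real.exp_le_exp.2 hy.2
      _ < ∞ := by
          rw [setLIntegral_const]
          exact ENNReal.mul_lt_top ENNReal.ofReal_lt_top (measure_lt_top _ _)
  set B := branchingMechanism 0 0 Pi with hB
  have hd2 : ∀ x, 0 < x → mechanismDeriv2 0 Pi x ≤ deriv (deriv Ψ) x := fun x hx => by
    rw [(hL x hx).2, mechanismDeriv2, mul_zero, zero_add, hPi, integral_sq_levyOf σ measurableSet_Ioc hS]
    exact setIntegral_le_integral (hL x hx).1 (ae_of_all _ fun y => (Real.exp_pos _).le)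
  have hder : ∀ x, 0 < x → HasDerivAt (fun x => Ψ x - B x) (deriv Ψ x - mechanismDeriv 0 0 Pi x) x :=
    fun x hx => (han x hx).differentiableAt.hasDerivAt.sub
      (hasDerivAt_branchingMechanism 0 0 hlevy hx)
  have hder2 : ∀ x, 0 < x → HasDerivAt (fun x => deriv Ψ x - mechanismDeriv 0 0 Pi x)
      (deriv (deriv Ψ) x - mechanismDeriv2 0 Pi x) x := fun x hx =>
    (han.deriv x hx).differentiableAt.hasDerivAt.sub (hasDerivAt_mechanismDeriv 0 0 hlevy hx)
  have hmono : MonotoneOn (fun x => deriv Ψ x - mechanismDeriv 0 0 Pi x) (Set.Ioi 0) := by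
    refine monotoneOn_of_deriv_nonneg (convex_Ioi 0)
      (fun x hx => (hder2 x hx).continuousAt.continuousWithinAt) (fun x hx => ?_) fun x hx => ?_
    · rw [interior_Ioi] at hx
      exact (hder2 x hx).differentiableAt.differentiableWithinAt
    · rw [interior_Ioi] at hx
      rw [(hder2 x hx).deriv]
      linarith [hd2 x hx]
  obtain ⟨ξ, hξ, he⟩ := exists_mvt_zero (hc.sub (continuousOn_branchingMechanism 0 0 hlevy)) hder
    one_pos
  have h1 := hmono (Set.mem_Ioi.2 hξ.1) (Set.mem_Ioi.2 one_pos) hξ.2.le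
  have hB0 : B 0 = 0 := branchingMechanism_zero _ _ _
  have hexp := branchingMechanism_expansion 0 0 hlevy one_pos (s := 1) le_rfl
  change Ψ 1 - B 1 - (Ψ 0 - B 0) = _ at he
  simp only [h0, hB0, mul_one] at he h1
  simp only [sub_self, mul_zero, branchingMechanism_zero, one_mul, add_zero, zero_add,
    mul_one, one_pow] at hexp
  have hJ : ∫ x, Real.exp (-x) * (Real.exp x - 1 - x) ∂Pi ≤ deriv Ψ 1 - Ψ 1 := by
    change mechanismDeriv 0 0 Pi 1 = B 1 + _ at hexp
    linarith
  have hJi : Integrable (fun x => Real.exp (-x) * (Real.exp x - 1 - x)) Pi := by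
    have := integrable_expTail hlevy one_pos (s := 1) le_rfl
    simpa using this
  rw [← ofReal_integral_eq_lintegral_ofReal hlevy.integrable_min (ae_of_all _ fun y => by positivity)]
  refine ENNReal.ofReal_le_ofReal ?_
  calc ∫ y, min 1 (y ^ 2) ∂Pi ≤ ∫ y, 5 * (Real.exp (-y) * (Real.exp y - 1 - y)) ∂Pi := by
        refine integral_mono_ae hlevy.integrable_min (hJi.const_mul 5) ?_
        filter_upwards [hlevy.ae_pos] with y hy
        exact min_le_expTail hy
    _ = 5 * ∫ y, Real.exp (-y) * (Real.exp y - 1 - y) ∂Pi := integral_const_mul _ _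
    _ ≤ 5 * (deriv Ψ 1 - Ψ 1) := by gcongr

theorem isLevyMeasure_levyOf [IsFiniteMeasure σ] (hc : ContinuousOn Ψ (Set.Ici 0)) (h0 : Ψ 0 = 0)
    (han : AnalyticOnNhd ℝ Ψ (Set.Ioi 0))
    (hL : ∀ x, 0 < x → Integrable (fun y => Real.exp (-((x - 1) * y))) σ ∧
      deriv (deriv Ψ) x = ∫ y, Real.exp (-((x - 1) * y)) ∂σ) :
    IsLevyMeasure (levyOf σ (Set.Ioi 0)) := by
  refine ⟨levyOf_Iic σ le_rfl, ?_⟩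
  refine lt_of_le_of_lt ?_ (ENNReal.ofReal_lt_top (r := 5 * (deriv Ψ 1 - Ψ 1)))
  have hU : Set.Ioi (0 : ℝ) = ⋃ n : ℕ, Set.Ioc (0 : ℝ) n := by
    ext y
    simp only [Set.mem_Ioi, Set.mem_iUnion, Set.mem_Ioc, exists_and_left, iff_self_and]
    exact fun _ => exists_nat_ge y
  have hmono : Monotone fun n : ℕ => Set.Ioc (0 : ℝ) n := fun n m hnm =>
    Set.Ioc_subset_Ioc_right (by exact_mod_cast hnm)
  rw [lintegral_min_levyOf, ← withDensity_apply _ measurableSet_Ioi, hU, hmono.measure_iUnion]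
  refine iSup_le fun n => ?_
  rw [withDensity_apply _ measurableSet_Ioc, ← lintegral_min_levyOf]
  exact lintegral_min_levyOf_le hc h0 han hL n

/-- The atom of `σ` at `0` gives the quadratic term, the rest the Lévy measure, so that second
derivatives agree. The difference is then linear, with slope `b`, and vanishes at `0` by continuity.
-/
theorem exists_branchingMechanism [IsFiniteMeasure σ] (hc : ContinuousOn Ψ (Set.Ici 0))
    (h0 : Ψ 0 = 0) (han : AnalyticOnNhd ℝ Ψ (Set.Ioi 0)) (hσ : σ (Set.Iio 0) = 0)
    (hL : ∀ x, 0 < x → Integrable (fun y => Real.exp (-((x - 1) * y))) σ ∧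
      deriv (deriv Ψ) x = ∫ y, Real.exp (-((x - 1) * y)) ∂σ) :
    ∃ (b a : ℝ) (Pi : Measure ℝ), 0 ≤ a ∧ IsLevyMeasure Pi ∧
      ∀ x, 0 ≤ x → Ψ x = branchingMechanism b a Pi x := by
  have hlevy := isLevyMeasure_levyOf hc h0 han hL
  set Pi := levyOf σ (Set.Ioi 0) with hPi
  set a := σ.real {0} / 2 with ha
  have hd2 : ∀ x, 0 < x → deriv (deriv Ψ) x = mechanismDeriv2 a Pi x := fun x hx => by
    rw [(hL x hx).2, mechanismDeriv2, hPi, integral_sq_levyOf σ measurableSet_Ioi le_rfl, ha,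
      mul_div_cancel₀ _ two_ne_zero]
    have e1 : ∫ y, Real.exp (-((x - 1) * y)) ∂σ = ∫ y in Set.Ici 0, Real.exp (-((x - 1) * y)) ∂σ := by
      rw [Measure.restrict_eq_self_of_ae_mem]
      rw [ae_iff]
      convert hσ using 2
      ext y
      simp
    have e2 : Set.Ici (0 : ℝ) = {0} ∪ Set.Ioi 0 := by
      rw [Set.union_comm, Set.Ioi_union_left]
    rw [e1, e2, setIntegral_union (by simp) measurableSet_Ioi (hL x hx).1.integrableOn
      (hL x hx).1.integrableOn, integral_singleton]
    simp
  have hder : ∀ x, 0 < x → HasDerivAt (fun x => Ψ x - branchingMechanism 0 a Pi x)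
      (deriv Ψ x - mechanismDeriv 0 a Pi x) x := fun x hx =>
    (han x hx).differentiableAt.hasDerivAt.sub (hasDerivAt_branchingMechanism 0 a hlevy hx)
  have hder2 : ∀ x, 0 < x → HasDerivAt (fun x => deriv Ψ x - mechanismDeriv 0 a Pi x) 0 x :=
    fun x hx => ((han.deriv x hx).differentiableAt.hasDerivAt.sub
      (hasDerivAt_mechanismDeriv 0 a hlevy hx)).congr_deriv (by rw [hd2 x hx, sub_self])
  obtain ⟨b, hb⟩ := isOpen_Ioi.exists_is_const_of_deriv_eq_zero isPreconnected_Ioi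
    (s := Set.Ioi (0 : ℝ)) (f := fun x => deriv Ψ x - mechanismDeriv 0 a Pi x)
    (fun x hx => (hder2 x hx).differentiableAt.differentiableWithinAt) fun x hx => (hder2 x hx).deriv
  refine ⟨b, a, Pi, by positivity, hlevy, fun x hx => ?_⟩
  rcases hx.eq_or_lt with rfl | hx
  · rw [h0, branchingMechanism_zero]
  · obtain ⟨ξ, hξ, he⟩ := exists_mvt_zero
      (hc.sub (continuousOn_branchingMechanism 0 a hlevy)) hder hx
    rw [hb ξ hξ.1] at he
    change Ψ x - branchingMechanism 0 a Pi x - (Ψ 0 - branchingMechanism 0 a Pi 0) = _ at he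
    rw [h0, branchingMechanism_zero] at he
    have e : branchingMechanism b a Pi x = b * x + branchingMechanism 0 a Pi x := by
      rw [branchingMechanism, branchingMechanism]
      ring
    rw [e]
    linarith

end

/-! ### From consistent families to branching mechanisms -/

namespace ConsistentPairs

variable {Q : ℝ≥0 → PMF ℕ} {K : ℝ≥0 → ProbabilityMeasure ℝ} {b a : ℝ} {Pi : Measure ℝ}

theorem exists_branchingMechanism (h : ConsistentPairs Q K) :
    ∃ (b a : ℝ) (Pi : Measure ℝ), 0 ≤ a ∧ IsLevyMeasure Pi ∧
      (∀ y ∈ Set.Icc (0 : ℝ) 1, mech (Q 1) y = branchingMechanism b a Pi y) ∧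
      ∀ l, 1 < l → Set.EqOn (branchingMechanism b a Pi) (rescaledMech Q l)
        (Set.Ico 0 (2 / rootProb Q l)) := by
  obtain ⟨Ψ, h1, h2, h3⟩ := h.exists_mechanism
  obtain ⟨σ, hfin, hσ, hL⟩ := h.exists_laplace_deriv2 h1 h3
  have h0 : Ψ 0 = 0 := by rw [h2 ⟨le_rfl, zero_le_one⟩, mech_zero]
  have hc : ContinuousOn Ψ (Set.Ici 0) := by
    intro x hx
    rcases (Set.mem_Ici.1 hx).eq_or_lt with rfl | hx
    · refine ContinuousWithinAt.mono_of_mem_nhdsWithin ?_ (Icc_mem_nhdsGE one_pos)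
      exact (continuousOn_mech (Q 1)).congr h2 0 ⟨le_rfl, zero_le_one⟩
    · exact (h3 x hx).continuousAt.continuousWithinAt
  obtain ⟨b, a, Pi, ha, hPi, he⟩ := _root_.exists_branchingMechanism hc h0 h3 hσ hL
  refine ⟨b, a, Pi, ha, hPi, fun y hy => ?_, fun l hl x hx => ?_⟩
  · rw [← h2 hy, he y hy.1]
  · rw [← he x hx.1, h1 l hl hx]

/-- For `α < 1` pick `y > 1` with `ψ'(y) = 1 / α` and the level `l = ψ(y) / q(0)`. Reducing from `l`
to `1` merges geometric numbers of lifetimes with parameter exactly `α`. -/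
theorem isGeometricallyDivisible (h : ConsistentPairs Q K) (ha : 0 ≤ a) (hPi : IsLevyMeasure Pi)
    (h1 : ∀ y ∈ Set.Icc (0 : ℝ) 1, mech (Q 1) y = branchingMechanism b a Pi y)
    (h2 : ∀ l, 1 < l → Set.EqOn (branchingMechanism b a Pi) (rescaledMech Q l)
      (Set.Ico 0 (2 / rootProb Q l))) {α : ℝ} (hα : α ∈ Set.Ioc (0 : ℝ) 1) {x : ℝ} (hx : 1 < x)
    (hαx : 1 / α ≤ mechanismDeriv b a Pi x) : IsGeometricallyDivisible (K 1) α := by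
  refine hα.2.eq_or_lt.elim (fun hα1 => ?_) fun hα1 => ?_
  · rw [hα1]
    exact (geomRel_one (K 1)).isGeometricallyDivisible ⟨one_pos, le_rfl⟩
  have hq := h.toReal_zero_pos one_pos
  have hd1 : mechanismDeriv b a Pi 1 = 1 := by
    have e1 := hasDerivAt_mech (Q 1) (y := 1) ⟨by norm_num, by norm_num⟩
    rw [← e1.deriv, deriv_mech_one (h.1.1 1 one_pos).2] at e1
    exact (e1.eq_of_eqOn_Icc (hasDerivAt_branchingMechanism b a hPi one_pos) h1
      ⟨zero_le_one, le_rfl⟩).symm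
  have hαinv : 1 < 1 / α := (one_lt_div hα.1).2 hα1
  obtain ⟨y, hy, hyα⟩ : ∃ y, 1 < y ∧ mechanismDeriv b a Pi y = 1 / α := by
    obtain ⟨y, hy, he⟩ := intermediate_value_Icc hx.le
      (f := mechanismDeriv b a Pi) (fun r hr => (hasDerivAt_mechanismDeriv b a hPi
        (one_pos.trans_le hr.1)).continuousAt.continuousWithinAt) ⟨hd1.le.trans hαinv.le, hαx⟩
    refine ⟨y, lt_of_le_of_ne hy.1 fun h1y => ?_, he⟩
    rw [← h1y, hd1] at he
    exact hαinv.ne he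
  have hmono : StrictMonoOn (branchingMechanism b a Pi) (Set.Ici 1) := by
    refine strictMonoOn_of_deriv_pos (convex_Ici 1)
      ((continuousOn_branchingMechanism b a hPi).mono (Set.Ici_subset_Ici.2 zero_le_one))
      fun r hr => ?_
    rw [interior_Ici] at hr
    have hr0 : (0 : ℝ) < r := one_pos.trans hr
    rw [deriv_branchingMechanism b a hPi hr0]
    have := monotoneOn_mechanismDeriv b ha hPi (Set.mem_Ioi.2 one_pos) (Set.mem_Ioi.2 hr0)
      (le_of_lt hr)
    linarith
  have hB1 : branchingMechanism b a Pi 1 = (Q 1 0).toReal := by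
    rw [← h1 1 ⟨zero_le_one, le_rfl⟩, mech_one]
  have hBy := hmono (Set.mem_Ici.2 le_rfl) (Set.mem_Ici.2 hy.le) hy
  rw [hB1] at hBy
  have hlr : 1 < branchingMechanism b a Pi y / (Q 1 0).toReal := (one_lt_div hq).2 hBy
  set l : ℝ≥0 := ⟨branchingMechanism b a Pi y / (Q 1 0).toReal, by linarith⟩ with hldef
  have hl : 1 < l := hlr
  have hlq : (l : ℝ) * (Q 1 0).toReal = branchingMechanism b a Pi y := div_mul_cancel₀ _ hq.ne'
  have hmem := h.inv_mem hl
  -- Both points are at least `1`, where `ψ` is strictly increasing, and `ψ` equals `l q(0)` at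
  -- both.
  have hθ : 1 / rootProb Q l = y := by
    refine hmono.injOn (Set.mem_Ici.2 (h.one_lt_inv hl).le) (Set.mem_Ici.2 hy.le) ?_
    rw [h2 l hl ⟨hmem.1.le, hmem.2⟩, h.rescaledMech_inv hl, hlq]
  have hev : branchingMechanism b a Pi =ᶠ[𝓝 (1 / rootProb Q l)] rescaledMech Q l := by
    filter_upwards [Ioo_mem_nhds hmem.1 hmem.2] with z hz
    exact h2 l hl ⟨hz.1.le, hz.2⟩
  have hdl := h.deriv_rescaledMech_inv hl
  rw [← hev.deriv_eq, hθ, deriv_branchingMechanism b a hPi (one_pos.trans hy), hyα] at hdl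
  have hαl : rootDeriv Q l = α := by
    rw [← one_div_one_div (rootDeriv Q l), ← hdl, one_div_one_div]
  have := (h.reduction hl).2
  rw [hαl] at this
  exact this.isGeometricallyDivisible hα

theorem isDivisibleFor (h : ConsistentPairs Q K) (ha : 0 ≤ a) (hPi : IsLevyMeasure Pi)
    (h1 : ∀ y ∈ Set.Icc (0 : ℝ) 1, mech (Q 1) y = branchingMechanism b a Pi y)
    (h2 : ∀ l, 1 < l → Set.EqOn (branchingMechanism b a Pi) (rescaledMech Q l)
      (Set.Ico 0 (2 / rootProb Q l))) : IsDivisibleFor (K 1) (branchingMechanism b a Pi) := by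
  have key : ∀ α ∈ Set.Ioc (0 : ℝ) 1,
      (∀ᶠ x in atTop, 1 / α ≤ deriv (branchingMechanism b a Pi) x) →
      IsGeometricallyDivisible (K 1) α := by
    intro α hα hev
    obtain ⟨x, hx, hx1⟩ := (hev.and (eventually_gt_atTop (1 : ℝ))).exists
    rw [deriv_branchingMechanism b a hPi (one_pos.trans hx1)] at hx
    exact h.isGeometricallyDivisible ha hPi h1 h2 hα hx1 hx
  refine ⟨fun m hm α hα hmα => key α hα ?_, fun htop α hα => key α hα (htop.eventually_ge_atTop _)⟩
  have hm0 : 0 < m := by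
    have hd1 : 0 < mechanismDeriv b a Pi 1 := by
      have e1 := hasDerivAt_mech (Q 1) (y := 1) ⟨by norm_num, by norm_num⟩
      rw [← e1.deriv, deriv_mech_one (h.1.1 1 one_pos).2] at e1
      rw [← e1.eq_of_eqOn_Icc (hasDerivAt_branchingMechanism b a hPi one_pos) h1
        ⟨zero_le_one, le_rfl⟩]
      exact one_pos
    refine hd1.trans_le (ge_of_tendsto hm ?_)
    filter_upwards [eventually_ge_atTop (1 : ℝ)] with r hr
    have hr0 : 0 < r := one_pos.trans_le hr
    rw [deriv_branchingMechanism b a hPi hr0]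
    exact monotoneOn_mechanismDeriv b ha hPi (Set.mem_Ioi.2 one_pos) (Set.mem_Ioi.2 hr0) hr
  exact (hm.eventually_const_lt ((one_div_lt hα.1 hm0).2 hmα)).mono fun x hx => hx.le

end ConsistentPairs

theorem genFun_eq_iff_mech_eq {q : PMF ℕ} {ψ : ℝ → ℝ} :
    (∀ s ∈ Set.Icc (0 : ℝ) 1, genFun q s = s + ψ (1 - s)) ↔
      ∀ y ∈ Set.Icc (0 : ℝ) 1, mech q y = ψ y := by
  constructor
  · intro h y hy
    have := h (1 - y) ⟨by linarith [hy.2], by linarith [hy.1]⟩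
    rw [mech, this, sub_sub_cancel]
    ring
  · intro h s hs
    have := h (1 - s) ⟨by linarith [hs.2], by linarith [hs.1]⟩
    rw [mech, sub_sub_cancel] at this
    linarith

theorem theorem2 (q : PMF ℕ) (κ : ProbabilityMeasure ℝ)
    (hq : IsOffspringLaw q) (hκ : IsLifetimeLaw κ) :
    -- the equivalence
    ((∃ (Q : ℝ≥0 → PMF ℕ) (K : ℝ≥0 → ProbabilityMeasure ℝ),
        Q 1 = q ∧ K 1 = κ ∧ ConsistentPairs Q K) ↔
      ∃ (b a : ℝ) (Pi : Measure ℝ), 0 ≤ a ∧ IsLevyMeasure Pi ∧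
        (∀ s ∈ Set.Icc (0 : ℝ) 1, genFun q s = s + branchingMechanism b a Pi (1 - s)) ∧
        (∀ m : ℝ, Tendsto (deriv (branchingMechanism b a Pi)) atTop (𝓝 m) →
          ∀ α ∈ Set.Ioc (0 : ℝ) 1, 1 / m < α → IsGeometricallyDivisible κ α) ∧
        (Tendsto (deriv (branchingMechanism b a Pi)) atTop atTop →
          ∀ α ∈ Set.Ioc (0 : ℝ) 1, IsGeometricallyDivisible κ α)) ∧
    -- existence of consistent bushes
    (∀ (Q : ℝ≥0 → PMF ℕ) (K : ℝ≥0 → ProbabilityMeasure ℝ),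
      Q 1 = q → K 1 = κ → ConsistentPairs Q K →
      ∀ β : ℝ≥0, 0 < β → ∃ b : ℝ≥0 → ℝ≥0, b 1 = β ∧ ExistConsistentBushes Q K b) ∧
    -- uniqueness and dependence of the families on `(q, κ, β)`
    (∀ (Q Q' : ℝ≥0 → PMF ℕ) (K K' : ℝ≥0 → ProbabilityMeasure ℝ) (b b' : ℝ≥0 → ℝ≥0),
      Q 1 = q → Q' 1 = q → K 1 = κ → 0 < b 1 → 0 < b' 1 →
      ConsistentTriplets Q K b → ConsistentTriplets Q' K' b' →
      (∀ l, 0 < l ∨ 0 < b 0 → Q l = Q' l) ∧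
      (K' 1 = κ → ∀ l, 0 < l ∨ 0 < b 0 → K l = K' l) ∧
      (b 1 = b' 1 → ∀ l, b l = b' l)) := by
  refine ⟨⟨?_, ?_⟩, ?_, ?_⟩
  · rintro ⟨Q, K, rfl, rfl, h⟩
    obtain ⟨b, a, Pi, ha, hPi, h1, h2⟩ := h.exists_branchingMechanism
    have hdiv := h.isDivisibleFor ha hPi h1 h2
    exact ⟨b, a, Pi, ha, hPi, genFun_eq_iff_mech_eq.2 h1, hdiv.1, hdiv.2⟩
  · rintro ⟨b, a, Pi, ha, hPi, hgen, hd1, hd2⟩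
    exact exists_consistentPairs hq hκ fun s hs =>
      exists_preimage_pair hq hκ ha hPi (genFun_eq_iff_mech_eq.1 hgen) ⟨hd1, hd2⟩ hs
  · intro Q K _ _ h β _
    exact ⟨bushParam Q β, bushParam_one β, h.existConsistentBushes β⟩
  · intro Q Q' K K' b b' hQ hQ' hK hb hb' h h'
    have hqq : Q 1 = Q' 1 := hQ.trans hQ'.symm
    exact ⟨fun l hl => h.offspring_eq h' hb hb' hqq hl,
      fun hK' l hl => h.lifetime_eq h' hb hb' hqq (hK.trans hK'.symm) hl,
      fun hbb l => h.param_unique h' hb hqq hbb l⟩
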